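/- **Notation.** For $[a,b]\subset\mathbb R$ let $\mathcal E^k_{[a,b]}$ be the set of functions that are constant on each of the $2^k$ open intervals $\left(a+(i-1)\frac{b-a}{2^k},\,a+i\frac{b-a}{2^k}\right)$, $1\le i\le 2^k$ (values at the end points are ignored), and $\mathcal E^k=\mathcal E^k_{[0,1]}$. Let $r_n(t)=\operatorname{sgn}\sin(2^{n+1}\pi t)$ $(n\ge 0)$ be the Rademacher functions and let $h_1^{(k)}$ be the Haar function equal to $2^{k/2}$ on $(0,2^{-k-1})$, to $-2^{k/2}$ on $(2^{-k-1},2^{-k})$ and to $0$ elsewhere. For $L\ge 2$ let $(\kappa^{(L)}_{ij})_{1\le i,j\le L}$ be the orthogonal matrix with $\kappa^{(L)}_{ij}=L^{-1/2}$ if $i=1$ or $j=L$, and $\kappa^{(L)}_{ij}=\delta_{j,i-1}-\frac1{L-1}\left(1+L^{-1/2}\right)$ otherwise. **Construction.** (1) Let $M_k$ be the $2$-periodic function equal to $\frac{2^{k/2}}{8i}$ on $\left[\frac{i-1}{2^k},\frac i{2^k}\right)$ for $1\le |i|\le 2^k-1$ and to $0$ on $[-2^{-k},0)$ and on $[1-2^{-k},1)$.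 For each $k\ge1$ let $f_k^0,\dots,f_k^{2^k-1}$ be $4$-periodic functions that are orthonormal in $L^2_{[-2,2]}$, have integral $0$ over $[-2,2]$, vanish on $[-2,-1)$, satisfy $f_k^i(x)=M_k(x-i2^{-k})$ on $[-1,1]$, and belong to $\mathcal E^{k+1}_{[1,2]}$. (2) For $0\le i\le 3$ put $g_1^i(x)=2f_2^i(8x-2)$ on $[0,\frac12]$ and $g_1^i=r_{9+i}$ on $(\frac12,1]$. For $n\ge1$ let $k_n$ be the smallest natural number with $g_n^i\in\mathcal E^{k_n}$ for all $0\le i<2^{2n}$, where for $n\ge2$ and $0\le i<2^{2n}$ one puts $g_n^i(x)=\widehat g_n^{\,i}(2^{k_{n-1}+2n^2+2}x)$ and $\widehat g_n^{\,i}$ is the $1$-periodic function equal to $n^{-1}2^{n^2}f_{2n}^i\left(2^{2n^2+2}(x-2^{-2n^2})\right)$ on $[0,2^{-2n^2}]$, to $n^{-1}2^{s/2}f_{2n}^i\left(2^{s+2}(x-2^{-s})\right)$ on $(2^{-s},2^{-s+1}]$ for $2\le s\le 2n^2$, and to $r_{k_{n-1}+4+i}$ on $(\frac12,1]$ (values at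 integers being immaterial). (3) Put $m_0=0$, $m_1=2^{k_1+2}-6$ and $m_n=m_{n-1}+2^{k_n+2}-2^{k_{n-1}+2}-2^{2n}-2$ for $n\ge 2$. Let $\psi_1=1$ on $[0,1]$ and, for each $n\ge 1$, let $\psi_\nu$, $m_{n-1}<\nu\le m_n$, be orthonormal functions in $\mathcal E^{k_n+2}$ that are orthogonal in $L^2_{[0,1]}$ to all $g_n^i$, to $r_{k_n}$, to $h_1^{(k_n+1)}$ and, if $n\ge2$, to $\mathcal E^{k_{n-1}+2}$. (4) For $m_{n-1}<\nu\le m_n$ put $p_\nu=2^{2(k_n+1)}$ and $q_\nu=\sum_{v<\nu}(p_v-1)$, and $$\phi^\nu_j=\kappa^{(p_\nu)}_{1j}\psi_\nu+\sum_{i=2}^{p_\nu}\kappa^{(p_\nu)}_{ij}\,h_1^{(k_{q_\nu+i-1}+1)},\qquad 1\le j\le p_\nu .$$ Let $\xi_1,\xi_2,\dots$ be the functions $\phi^1_1,\dots,\phi^1_{p_1},\phi^2_1,\dots,\phi^2_{p_2},\dots$ in this order. (5) For $n\ge1$ and $1\le j\le 2^{2n}+1$ put $\Upsilon^n_j=\kappa^{(2^{2n}+1)}_{1j}\xi_n+\sum_{i=2}^{2^{2n}+1}\kappa^{(2^{2n}+1)}_{ij}g_n^{i-2}$.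 Let $\mu_0=0$, $\mu_m=\mu_{m-1}+2^{2m}+1$, and let $\Upsilon_{\mu_{m-1}+j}=\Upsilon^m_j$ for $m\ge 1$, $1\le j\le 2^{2m}+1$. (6) Let $l_0$ be a non-negative integer, and let $\nu_0\ge1$ and $n_1,n_2,\dots$ be integers such that, with $\nu_j=\nu_{j-1}+2^{n_j}-1$ for $j\ge 1$, one has $n_j\ge k_{\nu_{j-1}}+l_0$ and $\Upsilon_j\in\mathcal E^{k_{\nu_{j-1}}}$ for all $j\ge1$, and, for every $m\ge1$, $\Upsilon_j\in\mathcal E^{k_{\nu_{\mu_{m-1}}}}$ for all $\mu_{m-1}<j\le\mu_m$. Let $\chi_1,\chi_2,\dots$ be the functions $r_{k_1},\dots,r_{k_{\nu_0}}$ (block $0$), followed for $j=1,2,\dots$ by block $j$, which consists of the $2^{n_j}$ functions $\Upsilon_j,\ r_{k_{\nu_{j-1}+1}},\dots,r_{k_{\nu_j}}$. Thus block $j$ ends with $\chi_{\nu_j+j}$. **Theorem.** For every $l_0$ the choices in this construction can be made. For every admissible choice, $\{\chi_k\}_{k=1}^\infty$ is a complete orthonormal system in $L^2_{[0,1]}$,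 and for every real sequence $\{a_k\}_{k=1}^\infty\notin\ell^2$ the block partial sums $$S_j(x)=\sum_{k=1}^{\nu_j+j}a_k\chi_k(x),\qquad j\in\mathbb N,$$ diverge (have no finite limit as $j\to\infty$) for almost every $x\in[0,1]$. -/

import Mathlib

noncomputable section

namespace DivONS

open MeasureTheory Filter Topology

/-! All sequences `k n`, `ψ ν`, `ξ l`, `Υ k`, `χ k`, `a k`, … are indexed by `1, 2, 3, …`; the value
at `0` plays no role, except for `m 0`, `μ 0`, `ν 0`, which are the initial values of recursions. -/

/-- The space `E^k_[a,b]`: functions that are constant on each open interval of the partition of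
`[a,b]` into `2^k` equal parts. The values at the end points of these intervals are ignored. -/
def dyadicStep (a b : ℝ) (k : ℕ) : Set (ℝ → ℝ) :=
  {f | ∃ c : ℕ → ℝ, ∀ i : ℕ, 1 ≤ i → i ≤ 2 ^ k →
    ∀ x ∈ Set.Ioo (a + ((i : ℝ) - 1) * ((b - a) / 2 ^ k)) (a + (i : ℝ) * ((b - a) / 2 ^ k)),
      f x = c i}

/-- The Rademacher functions `r_n(t) = sgn (sin (2^(n+1) π t))`, `n = 0, 1, …`. -/
def rademacher (n : ℕ) (t : ℝ) : ℝ :=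
  Real.sign (Real.sin (2 ^ (n + 1) * Real.pi * t))

/-- The first Haar function `h_1^(k)` of the generation `k`. -/
def haarFirst (k : ℕ) (t : ℝ) : ℝ :=
  if 0 < t ∧ t < 1 / 2 ^ (k + 1) then √(2 ^ k)
  else if 1 / 2 ^ (k + 1) < t ∧ t < 2 / 2 ^ (k + 1) then -√(2 ^ k)
  else 0

/-- The Menshov function `M_k`: it is `2`-periodic; on the cell `[(i-1)/2^k, i/2^k)` of `[-1,1)`,
where `-2^k + 1 ≤ i ≤ 2^k`, it equals `2^(k/2) / (8 i)`, except that it vanishes on the cells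
`i = 0` and `i = 2^k`. -/
def menshov (k : ℕ) (x : ℝ) : ℝ :=
  let y : ℝ := 2 * Int.fract ((x + 1) / 2) - 1
  let i : ℤ := ⌊2 ^ k * y⌋ + 1
  if i = 0 ∨ i = 2 ^ k then 0 else √(2 ^ k) / (8 * (i : ℝ))

/-- `f 0, …, f (2^k - 1)` are mean zero and orthonormal on `[-2,2]`, vanish on `[-2,-1)`, are the
translates `M_k(x - i 2^(-k))` of the Menshov function on `[-1,1]`, belong to `E^(k+1)` on `[1,2]`,
and are extended to the line with period `4`. -/
structure IsMenshovSystem (k : ℕ) (f : ℕ → ℝ → ℝ) : Prop where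
  periodic : ∀ i < 2 ^ k, Function.Periodic (f i) 4
  eq_zero : ∀ i < 2 ^ k, ∀ x ∈ Set.Ico (-2 : ℝ) (-1), f i x = 0
  eq_menshov : ∀ i < 2 ^ k, ∀ x ∈ Set.Icc (-1 : ℝ) 1, f i x = menshov k (x - (i : ℝ) / 2 ^ k)
  step : ∀ i < 2 ^ k, f i ∈ dyadicStep 1 2 (k + 1)
  mean_zero : ∀ i < 2 ^ k, ∫ x in (-2 : ℝ)..2, f i x = 0
  orthonormal : ∀ i < 2 ^ k, ∀ j < 2 ^ k,
    ∫ x in (-2 : ℝ)..2, f i x * f j x = if i = j then 1 else 0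

/-- The functions `g_1^i`, `0 ≤ i ≤ 3`, on `[0,1]`. -/
def gFirst (f : ℕ → ℕ → ℝ → ℝ) (i : ℕ) (x : ℝ) : ℝ :=
  if x ≤ 1 / 2 then 2 * f 2 i (8 * x - 2) else rademacher (9 + i) x

/-- The functions `ĝ_n^i` on `[0,1]`, `n ≥ 2`; the parameter `kp` stands for `k_(n-1)`. -/
def gHat (f : ℕ → ℕ → ℝ → ℝ) (n kp i : ℕ) (x : ℝ) : ℝ :=
  (Set.Icc (0 : ℝ) (1 / 2 ^ (2 * n ^ 2))).indicator
      (fun y => 1 / (n : ℝ) * 2 ^ (n ^ 2) *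
        f (2 * n) i (2 ^ (2 * n ^ 2 + 2) * (y - 1 / 2 ^ (2 * n ^ 2)))) x
  + ∑ s ∈ Finset.Icc 2 (2 * n ^ 2),
      (Set.Ioc (1 / 2 ^ s : ℝ) (2 / 2 ^ s)).indicator
        (fun y => 1 / (n : ℝ) * √(2 ^ s) * f (2 * n) i (2 ^ (s + 2) * (y - 1 / 2 ^ s))) x
  + (Set.Ioc (1 / 2 : ℝ) 1).indicator (rademacher (kp + 4 + i)) x

/-- The functions `g_n^i` in terms of `kp = k_(n-1)`: for `n ≥ 2`, `ĝ_n^i` is extended with period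
`1` and dilated by the factor `2^(k_(n-1) + 2n² + 2)`. -/
def gStep (f : ℕ → ℕ → ℝ → ℝ) (n kp i : ℕ) (x : ℝ) : ℝ :=
  if n = 1 then gFirst f i x
  else gHat f n kp i (Int.fract (2 ^ (kp + 2 * n ^ 2 + 2) * x))

/-- `k_n` is the smallest natural number such that all `g_n^i`, `0 ≤ i < 2^(2n)`, belong to
`E^(k_n)_[0,1]`. -/
def kSeq (f : ℕ → ℕ → ℝ → ℝ) : ℕ → ℕ
  | 0 => 0
  | n + 1 => sInf {K | ∀ i < 2 ^ (2 * (n + 1)), gStep f (n + 1) (kSeq f n) i ∈ dyadicStep 0 1 K}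

/-- The functions `g_n^i`, `n ≥ 1`, `0 ≤ i < 2^(2n)`. -/
def gFun (f : ℕ → ℕ → ℝ → ℝ) (n i : ℕ) : ℝ → ℝ :=
  gStep f n (kSeq f (n - 1)) i

/-- `m_n - m_(n-1)` is the dimension of the orthogonal complement of the `2^(2n) + 2` functions
`g_n^i`, `r_(k_n)`, `h_1^(k_n + 1)` in `E^(k_n + 2)` if `n = 1`, and in the orthogonal complement
of `E^(k_(n-1) + 2)` in `E^(k_n + 2)` if `n ≥ 2`. -/
def mSeq (k : ℕ → ℕ) : ℕ → ℕ
  | 0 => 0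
  | n + 1 => mSeq k n + (2 ^ (k (n + 1) + 2) - (if n = 0 then 0 else 2 ^ (k n + 2))
      - (2 ^ (2 * (n + 1)) + 2))

/-- The requirements on the functions `ψ_ν` that complete the first auxiliary system. -/
structure IsComplement (k : ℕ → ℕ) (g : ℕ → ℕ → ℝ → ℝ) (ψ : ℕ → ℝ → ℝ) : Prop where
  first : ∀ t ∈ Set.Icc (0 : ℝ) 1, ψ 1 t = 1
  step : ∀ n ≥ 1, ∀ ν ∈ Finset.Ioc (mSeq k (n - 1)) (mSeq k n), ψ ν ∈ dyadicStep 0 1 (k n + 2)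
  orth_prev : ∀ n ≥ 2, ∀ ν ∈ Finset.Ioc (mSeq k (n - 1)) (mSeq k n),
    ∀ u ∈ dyadicStep 0 1 (k (n - 1) + 2), ∫ x in (0 : ℝ)..1, ψ ν x * u x = 0
  orth_g : ∀ n ≥ 1, ∀ ν ∈ Finset.Ioc (mSeq k (n - 1)) (mSeq k n), ∀ i < 2 ^ (2 * n),
    ∫ x in (0 : ℝ)..1, ψ ν x * g n i x = 0
  orth_rademacher : ∀ n ≥ 1, ∀ ν ∈ Finset.Ioc (mSeq k (n - 1)) (mSeq k n),
    ∫ x in (0 : ℝ)..1, ψ ν x * rademacher (k n) x = 0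
  orth_haar : ∀ n ≥ 1, ∀ ν ∈ Finset.Ioc (mSeq k (n - 1)) (mSeq k n),
    ∫ x in (0 : ℝ)..1, ψ ν x * haarFirst (k n + 1) x = 0
  orthonormal : ∀ n ≥ 1, ∀ ν ∈ Finset.Ioc (mSeq k (n - 1)) (mSeq k n),
    ∀ ν' ∈ Finset.Ioc (mSeq k (n - 1)) (mSeq k n),
      ∫ x in (0 : ℝ)..1, ψ ν x * ψ ν' x = if ν = ν' then 1 else 0

/-- For `s 0 ≤ s 1 ≤ …` unbounded: the number `n` with `s (n-1) < l ≤ s n`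
(and `n = 0` if `l ≤ s 0`). -/
def blockOf (s : ℕ → ℕ) (l : ℕ) : ℕ := sInf {n | l ≤ s n}

/-- The entry `(i,j)`, `1 ≤ i, j ≤ L`, of the orthogonal matrix `K_N` of order `L = N + 1`. -/
def kappa (L i j : ℕ) : ℝ :=
  if i = 1 ∨ j = L then 1 / √(L : ℝ)
  else (if j + 1 = i then 1 else 0) - 1 / ((L : ℝ) - 1) * (1 + 1 / √(L : ℝ))

/-- The order `p = 2^(2(k_n + 1))` of the matrix applied to `ψ_ν`, where `m_(n-1) < ν ≤ m_n`. -/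
def pOf (k : ℕ → ℕ) (ν : ℕ) : ℕ := 2 ^ (2 * (k (blockOf (mSeq k) ν) + 1))

/-- The number of the functions `h_1^(k_l + 1)` that are used up by `ψ_1, …, ψ_(ν-1)`. -/
def qOf (k : ℕ → ℕ) (ν : ℕ) : ℕ := ∑ v ∈ Finset.Ico 1 ν, (pOf k v - 1)

/-- The functions `φ_j^ν`, `1 ≤ j ≤ pOf k ν`. -/
def phi (k : ℕ → ℕ) (ψ : ℕ → ℝ → ℝ) (ν j : ℕ) (x : ℝ) : ℝ :=
  kappa (pOf k ν) 1 j * ψ ν x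
    + ∑ i ∈ Finset.Icc 2 (pOf k ν), kappa (pOf k ν) i j * haarFirst (k (qOf k ν + i - 1) + 1) x

/-- The number of all the functions `φ_j^v` with `v ≤ ν`. -/
def rhoOf (k : ℕ → ℕ) (ν : ℕ) : ℕ := ∑ v ∈ Finset.Icc 1 ν, pOf k v

/-- The functions `ξ_l`, `l ≥ 1`: the blocks `φ_1^ν, …, φ_p^ν` (`ν = 1, 2, …`) in a row. -/
def xi (k : ℕ → ℕ) (ψ : ℕ → ℝ → ℝ) (l : ℕ) : ℝ → ℝ :=
  phi k ψ (blockOf (rhoOf k) l) (l - rhoOf k (blockOf (rhoOf k) l - 1))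

/-- The functions `Υ_j^n`, `1 ≤ j ≤ 2^(2n) + 1`. -/
def upsilonBlock (k : ℕ → ℕ) (g : ℕ → ℕ → ℝ → ℝ) (ψ : ℕ → ℝ → ℝ) (n j : ℕ) (x : ℝ) : ℝ :=
  kappa (2 ^ (2 * n) + 1) 1 j * xi k ψ n x
    + ∑ i ∈ Finset.Icc 2 (2 ^ (2 * n) + 1), kappa (2 ^ (2 * n) + 1) i j * g n (i - 2) x

/-- `μ_m = ∑_(i=1)^m (2^(2i) + 1)`. -/
def muSeq : ℕ → ℕ
  | 0 => 0
  | m + 1 => muSeq m + 2 ^ (2 * (m + 1)) + 1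

/-- The functions `Υ_k`, `k ≥ 1`: the blocks `Υ_1^m, …, Υ_(2^(2m)+1)^m` (`m = 1, 2, …`) in a row. -/
def upsilon (k : ℕ → ℕ) (g : ℕ → ℕ → ℝ → ℝ) (ψ : ℕ → ℝ → ℝ) (l : ℕ) : ℝ → ℝ :=
  upsilonBlock k g ψ (blockOf muSeq l) (l - muSeq (blockOf muSeq l - 1))

/-- The functions `χ_j^(i)`: for `j = 0` these are `r_(k_i)`; for `j ≥ 1` they are `Υ_j` (`i = 1`)
and `r_(k_(ν_(j-1) + i - 1))` (`i ≥ 2`). -/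
def chiBlock (k : ℕ → ℕ) (Y : ℕ → ℝ → ℝ) (ν : ℕ → ℕ) (j i : ℕ) : ℝ → ℝ :=
  if j = 0 then rademacher (k i)
  else if i = 1 then Y j
  else rademacher (k (ν (j - 1) + i - 1))

/-- The functions `χ_l`, `l ≥ 1`: the blocks `χ_0^(1), …, χ_0^(ν_0)` and
`χ_j^(1), …, χ_j^(2^(n_j))`, `j = 1, 2, …`, in a row. The last function of the block `j` has the
number `ν_j + j`. -/
def chiSeq (k : ℕ → ℕ) (Y : ℕ → ℝ → ℝ) (ν : ℕ → ℕ) (l : ℕ) : ℝ → ℝ :=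
  let j := blockOf (fun j => ν j + j) l
  chiBlock k Y ν j (if j = 0 then l else l - (ν (j - 1) + (j - 1)))

/-- The requirements on `ν_j` and on the block lengths `2^(n_j)`. The number of Rademacher
functions in the blocks `0, …, j` is `ν_j`. -/
structure IsBlocking (l₀ : ℕ) (k : ℕ → ℕ) (Y : ℕ → ℝ → ℝ) (ν N : ℕ → ℕ) : Prop where
  pos : 1 ≤ ν 0
  succ : ∀ j ≥ 1, ν j = ν (j - 1) + (2 ^ N j - 1)
  large : ∀ j ≥ 1, k (ν (j - 1)) + l₀ ≤ N j
  step : ∀ j, Y (j + 1) ∈ dyadicStep 0 1 (k (ν j))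
  step_block : ∀ m ≥ 1, ∀ j ∈ Finset.Ioc (muSeq (m - 1)) (muSeq m),
    Y j ∈ dyadicStep 0 1 (k (ν (muSeq (m - 1))))

/-- The free choices in the construction of `χ`: the functions `f_k^i`, the functions `ψ_ν`, and
the integers `ν_j`, `n_j`. -/
structure Choices where
  f : ℕ → ℕ → ℝ → ℝ
  ψ : ℕ → ℝ → ℝ
  ν : ℕ → ℕ
  N : ℕ → ℕ

/-- The sequence `k_n` of the construction. -/
def Choices.k (D : Choices) : ℕ → ℕ := kSeq D.f

/-- The system `Υ` of the construction. -/
def Choices.Υ (D : Choices) : ℕ → ℝ → ℝ := upsilon D.k (gFun D.f) D.ψ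

/-- The system `χ` of the construction. -/
def Choices.χ (D : Choices) : ℕ → ℝ → ℝ := chiSeq D.k D.Υ D.ν

/-- The choices are admissible for the construction with the parameter `l₀`. -/
structure Choices.Admissible (D : Choices) (l₀ : ℕ) : Prop where
  menshov : ∀ k ≥ 1, IsMenshovSystem k (D.f k)
  complement : IsComplement D.k (gFun D.f) D.ψ
  blocking : IsBlocking l₀ D.k D.Υ D.ν D.N

/-- The partial sum `S_j` of `∑ a_l χ_l` that ends with the block `j`. -/
def Choices.blockSum (D : Choices) (a : ℕ → ℝ) (j : ℕ) (x : ℝ) : ℝ :=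
  ∑ l ∈ Finset.Icc 1 (D.ν j + j), a l * D.χ l x

/-- `φ_1, φ_2, …` is a complete orthonormal system in `L²[0,1]`. -/
structure IsCompleteONS (φ : ℕ → ℝ → ℝ) : Prop where
  memLp : ∀ l ≥ 1, MemLp (φ l) 2 (volume.restrict (Set.Icc (0 : ℝ) 1))
  orthonormal : ∀ l ≥ 1, ∀ l' ≥ 1,
    ∫ x in Set.Icc (0 : ℝ) 1, φ l x * φ l' x = if l = l' then 1 else 0
  complete : ∀ u : ℝ → ℝ, MemLp u 2 (volume.restrict (Set.Icc (0 : ℝ) 1)) →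
    (∀ l ≥ 1, ∫ x in Set.Icc (0 : ℝ) 1, u x * φ l x = 0) →
      ∀ᵐ x ∂volume.restrict (Set.Icc (0 : ℝ) 1), u x = 0

end DivONS

end

/-! Completeness rests on separation of scales. The functions r_{k_n}, h_1^{(k_n+1)}, g_n^i and ψ_ν
of generation n are steps of level k_n+2 and, for n ≥ 2, are orthogonal to all steps of level
k_{n-1}+2. Their number is exactly what is missing for a basis, so the generations 1, …, n form an
orthonormal basis of E^{k_n+2}. Passing to ξ, Υ and χ only applies orthogonal matrices to disjoint
finite groups and reorders (`kappa_col`, `kappa_row`, `concat`). A function orthogonal to χ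
therefore has integral 0 over every dyadic interval of the levels k_n+2 (`cells_eq_zero`) and
vanishes almost everywhere by Lebesgue differentiation.

For the divergence, let c_m be the coefficient of ξ_m in the m-th rotated block and B_m the sum of
squares of the coefficients of the g_m^i; the energy of the block is c_m² + B_m.

Suppose that the sum of c_m² diverges along blocks with B_m bounded by a multiple of c_m². The
coefficients of such a block have a sum of the full order allowed by their energy. Cutting the block
off at the singularity of Menshov's kernel 1/(p-i) keeps only one sign of the kernel and produces a
logarithmic gain, which pays for the factor 1/n in g_n^i. The copies of height 2^{s/2} on (2^{-s},
2^{1-s}] allow height to be traded against measure: partial sums reach max(1,|c_m|)/32 on a set of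
measure at least a constant times min(1,c_m²) (`integral_bigSum`). These sets are independent, so
almost every point lies in infinitely many of them, while ξ_m tends to 0 almost everywhere and does
not interfere (`tendsto_xi`). The accompanying Rademacher functions are odd about the midpoint of
any short dyadic interval on which the large sum is constant, so they can spoil it on at most half
of that interval. By the density theorem the partial sums cannot be nearly Cauchy on a set of
positive measure (`ae_diverges_of_dominant`).

Suppose now that divergence fails on a set that is not null. Some dyadic interval is almost filled
by points where the sums oscillate by less than 1 after a fixed index. The increments are tested
there against W, the Rademacher part plus the g-part restricted to the halves on which the g_m^i are
Rademacher functions themselves. W has controlled fourth moment and correlates fully with the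
increments, so the sum of all B_m and of the squared Rademacher coefficients is bounded
(`correlation_le`, `coef_bound`). Each c_m² is either dominated by B_m or belongs to the case above,
where it must be summable. Hence a is in ℓ² (`ae_diverges`).

The choices exist because the translates of the Menshov function on [-1,1] form a contraction by
Hilbert's inequality, so the defect of their Gram matrix is itself a Gram matrix, realized on (1,2]
(`exists_isMenshovSystem`). The ψ_ν come from extending an orthonormal system to a basis, and the
ν_j from taking the blocks long enough. -/

noncomputable section

namespace DivONS

open MeasureTheory Filter Topology

/-! ### Dyadic step functions -/

/-- `x` and `y` lie in the same open dyadic interval of level `K` of the line. -/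
def LineCell (K : ℕ) (x y : ℝ) : Prop :=
  ∃ z : ℤ, (z : ℝ) < 2 ^ K * x ∧ 2 ^ K * x < z + 1 ∧ (z : ℝ) < 2 ^ K * y ∧ 2 ^ K * y < z + 1

/-- `x` and `y` lie in the same open dyadic interval of level `K` of `[0,1]`. -/
def SameCell (K : ℕ) (x y : ℝ) : Prop :=
  ∃ i : ℕ, i < 2 ^ K ∧
    (i : ℝ) < 2 ^ K * x ∧ 2 ^ K * x < i + 1 ∧ (i : ℝ) < 2 ^ K * y ∧ 2 ^ K * y < i + 1

/-- Functions on the line that are constant on the open dyadic intervals of level `K`. -/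
def LineStep (K : ℕ) (u : ℝ → ℝ) : Prop := ∀ x y, LineCell K x y → u x = u y

theorem SameCell.lineCell {K : ℕ} {x y : ℝ} (h : SameCell K x y) : LineCell K x y := by
  obtain ⟨i, _, h1, h2, h3, h4⟩ := h
  exact ⟨i, by simpa using h1, by simpa using h2, by simpa using h3, by simpa using h4⟩

/-- A description by pairs of points, without constants to choose, makes closure under pointwise
operations immediate. The values at midpoints serve as constants in the converse. -/
theorem mem_dyadicStep_iff {K : ℕ} {u : ℝ → ℝ} :
    u ∈ dyadicStep 0 1 K ↔ ∀ x y, SameCell K x y → u x = u y := by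
  have h2 : (0 : ℝ) < 2 ^ K := by positivity
  constructor
  · rintro ⟨c, hc⟩ x y ⟨i, hi, h3, h4, h5, h6⟩
    have key : ∀ w : ℝ, (i : ℝ) < 2 ^ K * w → 2 ^ K * w < i + 1 → u w = c (i + 1) := by
      intro w hw1 hw2
      apply hc (i + 1) (by omega) (by omega)
      constructor
      · push_cast
        rw [show (0 : ℝ) + ((i : ℝ) + 1 - 1) * ((1 - 0) / 2 ^ K) = i / 2 ^ K by ring,
          div_lt_iff₀ h2]
        linarith
      · push_cast
        rw [show (0 : ℝ) + ((i : ℝ) + 1) * ((1 - 0) / 2 ^ K) = (i + 1) / 2 ^ K by ring,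
          lt_div_iff₀ h2]
        linarith
    rw [key x h3 h4, key y h5 h6]
  · intro h
    -- In `dyadicStep` the intervals are numbered from 1, so the midpoint of the i-th one is (i -
    -- 1/2)/2^K.
    refine ⟨fun i => u (((i : ℝ) - 1 / 2) / 2 ^ K), fun i hi1 hi2 x hx => ?_⟩
    obtain ⟨j, rfl⟩ : ∃ j, i = j + 1 := ⟨i - 1, by omega⟩
    have hx1 := hx.1
    have hx2 := hx.2
    push_cast at hx1 hx2
    rw [show (0 : ℝ) + ((j : ℝ) + 1 - 1) * ((1 - 0) / 2 ^ K) = j / 2 ^ K by ring,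
      div_lt_iff₀ h2] at hx1
    rw [show (0 : ℝ) + ((j : ℝ) + 1) * ((1 - 0) / 2 ^ K) = (j + 1) / 2 ^ K by ring,
      lt_div_iff₀ h2] at hx2
    apply h
    refine ⟨j, by omega, by linarith, by linarith, ?_, ?_⟩
    · rw [mul_div_cancel₀ _ h2.ne']; push_cast; linarith
    · rw [mul_div_cancel₀ _ h2.ne']; push_cast; linarith

theorem LineStep.mem {K : ℕ} {u : ℝ → ℝ} (h : LineStep K u) : u ∈ dyadicStep 0 1 K :=
  mem_dyadicStep_iff.2 fun x y hxy => h x y hxy.lineCell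

theorem LineCell.of_succ {K : ℕ} {x y : ℝ} (h : LineCell (K + 1) x y) : LineCell K x y := by
  obtain ⟨z, h1, h2, h3, h4⟩ := h
  have e1 : (2 : ℤ) * (z / 2) ≤ z := by omega
  have e2 : z + 1 ≤ 2 * (z / 2) + 2 := by omega
  have e1' : (2 : ℝ) * ((z / 2 : ℤ) : ℝ) ≤ z := by exact_mod_cast e1
  have e2' : (z : ℝ) + 1 ≤ 2 * ((z / 2 : ℤ) : ℝ) + 2 := by exact_mod_cast e2
  rw [pow_succ] at h1 h2 h3 h4
  exact ⟨z / 2, by linarith, by linarith, by linarith, by linarith⟩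

theorem LineCell.mono {K K' : ℕ} (hK : K ≤ K') {x y : ℝ} (h : LineCell K' x y) :
    LineCell K x y := by
  induction K', hK using Nat.le_induction with
  | base => exact h
  | succ n _ ih => exact ih h.of_succ

theorem SameCell.mono {K K' : ℕ} (hK : K ≤ K') {x y : ℝ} (h : SameCell K' x y) :
    SameCell K x y := by
  induction K', hK using Nat.le_induction with
  | base => exact h
  | succ n _ ih =>
    apply ih
    obtain ⟨i, hi, h1, h2, h3, h4⟩ := h
    have e1 : 2 * (i / 2) ≤ i := by omega
    have e2 : i + 1 ≤ 2 * (i / 2) + 2 := by omega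
    have e1' : (2 : ℝ) * ((i / 2 : ℕ) : ℝ) ≤ i := by exact_mod_cast e1
    have e2' : (i : ℝ) + 1 ≤ 2 * ((i / 2 : ℕ) : ℝ) + 2 := by exact_mod_cast e2
    rw [pow_succ] at h1 h2 h3 h4
    exact ⟨i / 2, by rw [pow_succ] at hi; omega, by linarith, by linarith, by linarith,
      by linarith⟩

theorem LineStep.mono {K K' : ℕ} (hK : K ≤ K') {u : ℝ → ℝ} (h : LineStep K u) :
    LineStep K' u := fun x y hxy => h x y (hxy.mono hK)

theorem dyadicStep_mono {K K' : ℕ} (hK : K ≤ K') : dyadicStep 0 1 K ⊆ dyadicStep 0 1 K' := by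
  intro u hu
  rw [mem_dyadicStep_iff] at hu ⊢
  exact fun x y hxy => hu x y (hxy.mono hK)

theorem LineCell.affine {K a : ℕ} {x y : ℝ} (d : ℤ) (h : LineCell (K + a) x y) :
    LineCell K (2 ^ a * x + d) (2 ^ a * y + d) := by
  obtain ⟨z, h1, h2, h3, h4⟩ := h
  rw [pow_add] at h1 h2 h3 h4
  refine ⟨z + 2 ^ K * d, ?_, ?_, ?_, ?_⟩ <;> push_cast <;> nlinarith

theorem LineStep.affine {K a : ℕ} {u : ℝ → ℝ} (h : LineStep K u) (d : ℤ) :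
    LineStep (K + a) (fun x => u (2 ^ a * x + d)) := fun _ _ hxy => h _ _ (hxy.affine d)

theorem LineCell.zero_floor {x y : ℝ} (h : LineCell 0 x y) : ⌊x⌋ = ⌊y⌋ := by
  obtain ⟨z, h1, h2, h3, h4⟩ := h
  simp only [pow_zero, one_mul] at h1 h2 h3 h4
  rw [Int.floor_eq_iff.2 ⟨h1.le, h2⟩, Int.floor_eq_iff.2 ⟨h3.le, h4⟩]

/-- An open dyadic interval of any level lies between two consecutive integers, so both points lose
the same integer part. -/
theorem LineCell.fract {K : ℕ} {x y : ℝ} (h : LineCell K x y) :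
    LineCell K (Int.fract x) (Int.fract y) := by
  have h0 := (h.mono (Nat.zero_le K)).zero_floor
  have := LineCell.affine (K := K) (a := 0) (-⌊x⌋) h
  simp only [pow_zero, one_mul, Int.cast_neg] at this
  rw [Int.fract, Int.fract, ← h0]
  simpa [sub_eq_add_neg] using this

theorem LineStep.fract {K : ℕ} {u : ℝ → ℝ} (h : LineStep K u) :
    LineStep K (fun x => u (Int.fract x)) := fun _ _ hxy => h _ _ hxy.fract

theorem LineCell.lt_iff {K : ℕ} {x y : ℝ} (h : LineCell K x y) (d : ℤ) :
    (x < d / 2 ^ K ↔ y < d / 2 ^ K) ∧ (x ≤ d / 2 ^ K ↔ y ≤ d / 2 ^ K) := by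
  obtain ⟨z, h1, h2, h3, h4⟩ := h
  have h0 : (0 : ℝ) < 2 ^ K := by positivity
  simp only [lt_div_iff₀' h0, le_div_iff₀' h0]
  rcases lt_or_ge z d with hz | hz
  · have : (z : ℝ) + 1 ≤ d := by exact_mod_cast hz
    constructor <;> constructor <;> intro _ <;> linarith
  · have : (d : ℝ) ≤ z := by exact_mod_cast hz
    constructor <;> constructor <;> intro _ <;> linarith

/-- `x` is not a dyadic rational. -/
def Nondyadic (x : ℝ) : Prop := ∀ (K : ℕ) (z : ℤ), 2 ^ K * x ≠ z

theorem ae_nondyadic : ∀ᵐ x : ℝ, Nondyadic x := by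
  simp only [Nondyadic, ae_all_iff]
  intro K z
  have : {x : ℝ | ¬ (2 ^ K * x ≠ z)} ⊆ {(z : ℝ) / 2 ^ K} := by
    intro x hx
    simp only [ne_eq, not_not, Set.mem_ofPred_eq] at hx
    rw [Set.mem_singleton_iff, ← hx]; field_simp
  exact measure_mono_null this (by simp)

theorem Nondyadic.exists_cell {x : ℝ} (hx : Nondyadic x) (h0 : 0 ≤ x) (h1 : x ≤ 1) (K : ℕ) :
    ∃ i : ℕ, i < 2 ^ K ∧ (i : ℝ) < 2 ^ K * x ∧ 2 ^ K * x < i + 1 := by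
  have h2 : (0 : ℝ) < 2 ^ K := by positivity
  have hp : 0 ≤ 2 ^ K * x := by positivity
  have h3 : 2 ^ K * x < 2 ^ K := by
    have := hx K (2 ^ K)
    push_cast at this
    exact lt_of_le_of_ne (by nlinarith) this
  refine ⟨⌊2 ^ K * x⌋₊, ?_, ?_, Nat.lt_floor_add_one _⟩
  · rw [Nat.floor_lt hp]; push_cast; exact h3
  · exact lt_of_le_of_ne (Nat.floor_le hp) (fun h => hx K ⌊2 ^ K * x⌋₊ (by rw [← h]; simp))

/-- The midpoint of the dyadic interval number `i` of level `K`. -/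
def mid (K i : ℕ) : ℝ := ((i : ℝ) + 1 / 2) / 2 ^ K

theorem sameCell_mid {K i : ℕ} (hi : i < 2 ^ K) {x : ℝ} (h1 : (i : ℝ) < 2 ^ K * x)
    (h2 : 2 ^ K * x < i + 1) : SameCell K x (mid K i) := by
  have h0 : (0 : ℝ) < 2 ^ K := by positivity
  refine ⟨i, hi, h1, h2, ?_, ?_⟩ <;> rw [mid, mul_div_cancel₀ _ h0.ne'] <;> linarith

theorem eqOn_cell {K i : ℕ} (hi : i < 2 ^ K) {u : ℝ → ℝ} (hu : u ∈ dyadicStep 0 1 K) :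
    Set.EqOn u (fun _ => u (mid K i)) (Set.Ioo ((i : ℝ) / 2 ^ K) (((i + 1 : ℕ) : ℝ) / 2 ^ K)) := by
  intro x hx
  have h0 : (0 : ℝ) < 2 ^ K := by positivity
  have h1 := hx.1
  have h2 := hx.2
  rw [div_lt_iff₀' h0] at h1
  rw [lt_div_iff₀' h0] at h2
  push_cast at h2
  exact mem_dyadicStep_iff.1 hu _ _ (sameCell_mid hi h1 h2)

/-! ### Integration over dyadic intervals. -/

theorem cell_le (K i : ℕ) : (i : ℝ) / 2 ^ K ≤ ((i + 1 : ℕ) : ℝ) / 2 ^ K := by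
  gcongr; simp

theorem intervalIntegrable_cell {K i : ℕ} (hi : i < 2 ^ K) {u : ℝ → ℝ}
    (hu : u ∈ dyadicStep 0 1 K) :
    IntervalIntegrable u volume ((i : ℝ) / 2 ^ K) (((i + 1 : ℕ) : ℝ) / 2 ^ K) := by
  refine IntervalIntegrable.congr_uIoo
    (f := fun _ => u (mid K i)) (intervalIntegrable_const) ?_
  rw [Set.uIoo_of_le (cell_le K i)]
  exact (eqOn_cell hi hu).symm

theorem intervalIntegrable_of_cells {K : ℕ} {v : ℝ → ℝ}
    (h : ∀ i : ℕ, i < 2 ^ K → IntervalIntegrable v volume ((i : ℝ) / 2 ^ K) (((i + 1 : ℕ) : ℝ) / 2 ^ K)) :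
    IntervalIntegrable v volume 0 1 := by
  have := IntervalIntegrable.trans_iterate (f := v) (μ := volume)
    (a := fun i : ℕ => (i : ℝ) / 2 ^ K) (n := 2 ^ K) h
  simpa using this

theorem intervalIntegrable_step {K : ℕ} {u : ℝ → ℝ} (hu : u ∈ dyadicStep 0 1 K) :
    IntervalIntegrable u volume 0 1 :=
  intervalIntegrable_of_cells fun _ hi => intervalIntegrable_cell hi hu

theorem integral_eq_sum_cells (K : ℕ) {v : ℝ → ℝ}
    (h : ∀ i : ℕ, i < 2 ^ K → IntervalIntegrable v volume ((i : ℝ) / 2 ^ K) (((i + 1 : ℕ) : ℝ) / 2 ^ K)) :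
    ∫ x in (0 : ℝ)..1, v x
      = ∑ i ∈ Finset.range (2 ^ K), ∫ x in ((i : ℝ) / 2 ^ K)..(((i + 1 : ℕ) : ℝ) / 2 ^ K), v x := by
  have := intervalIntegral.sum_integral_adjacent_intervals (f := v) (μ := volume)
    (a := fun i : ℕ => (i : ℝ) / 2 ^ K) (n := 2 ^ K) h
  rw [this]; simp

theorem cell_subset {K i : ℕ} (hi : i < 2 ^ K) :
    Set.uIcc ((i : ℝ) / 2 ^ K) (((i + 1 : ℕ) : ℝ) / 2 ^ K) ⊆ Set.uIcc (0 : ℝ) 1 := by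
  rw [Set.uIcc_of_le (cell_le K i), Set.uIcc_of_le zero_le_one]
  apply Set.Icc_subset_Icc (by positivity)
  rw [div_le_one (by positivity)]
  exact_mod_cast hi

/-- Here v is merely integrable: the formula serves both independence, with v periodic, and
completeness, with v an arbitrary square integrable function. -/
theorem integral_step_mul {K : ℕ} {u v : ℝ → ℝ} (hu : u ∈ dyadicStep 0 1 K)
    (hv : IntervalIntegrable v volume 0 1) :
    IntervalIntegrable (fun x => u x * v x) volume 0 1 ∧
    ∫ x in (0 : ℝ)..1, u x * v x = ∑ i ∈ Finset.range (2 ^ K), u (mid K i) *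
      ∫ x in ((i : ℝ) / 2 ^ K)..(((i + 1 : ℕ) : ℝ) / 2 ^ K), v x := by
  have key : ∀ i : ℕ, i < 2 ^ K → Set.EqOn (fun x => u x * v x) (fun x => u (mid K i) * v x)
      (Set.Ioo ((i : ℝ) / 2 ^ K) (((i + 1 : ℕ) : ℝ) / 2 ^ K)) := fun i hi x hx => by
    have := eqOn_cell hi hu hx
    simp only at this ⊢
    rw [this]
  have h_int : ∀ i : ℕ, i < 2 ^ K → IntervalIntegrable (fun x => u x * v x) volume ((i : ℝ) / 2 ^ K)
      (((i + 1 : ℕ) : ℝ) / 2 ^ K) := fun i hi => by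
    refine IntervalIntegrable.congr_uIoo (f := fun x => u (mid K i) * v x)
      ((hv.mono_set (cell_subset hi)).const_mul _) ?_
    rw [Set.uIoo_of_le (cell_le K i)]
    exact (key i hi).symm
  refine ⟨intervalIntegrable_of_cells h_int, ?_⟩
  rw [integral_eq_sum_cells K h_int]
  refine Finset.sum_congr rfl fun i hi => ?_
  rw [intervalIntegral.integral_congr_Ioo_of_le (cell_le K i) (key i (Finset.mem_range.1 hi)),
    intervalIntegral.integral_const_mul]

theorem integral_step {K : ℕ} {u : ℝ → ℝ} (hu : u ∈ dyadicStep 0 1 K) :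
    ∫ x in (0 : ℝ)..1, u x = ∑ i ∈ Finset.range (2 ^ K), u (mid K i) * (1 / 2 ^ K) := by
  have := (integral_step_mul hu (v := fun _ => 1) intervalIntegrable_const).2
  simp only [mul_one] at this
  rw [this]
  refine Finset.sum_congr rfl fun i _ => ?_
  rw [intervalIntegral.integral_const]
  push_cast
  simp only [smul_eq_mul]
  ring

/-- Periodicity makes the integrals over all 2^K cells equal, and they add up to the integral over
[0,1]. -/
theorem integral_cell_periodic {K : ℕ} {v : ℝ → ℝ} (hv : IntervalIntegrable v volume 0 1)
    (hp : Function.Periodic v (1 / 2 ^ K)) (i : ℕ) :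
    ∫ x in ((i : ℝ) / 2 ^ K)..(((i + 1 : ℕ) : ℝ) / 2 ^ K), v x
      = (1 / 2 ^ K) * ∫ x in (0 : ℝ)..1, v x := by
  have h1 : ∀ j : ℕ, ∫ x in ((j : ℝ) / 2 ^ K)..(((j + 1 : ℕ) : ℝ) / 2 ^ K), v x
      = ∫ x in (0 : ℝ)..(0 + 1 / 2 ^ K), v x := fun j => by
    rw [show (((j + 1 : ℕ) : ℝ) / 2 ^ K) = (j : ℝ) / 2 ^ K + 1 / 2 ^ K by push_cast; ring]
    exact hp.intervalIntegral_add_eq _ _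
  rw [integral_eq_sum_cells K fun i hi => hv.mono_set (cell_subset hi),
    Finset.sum_congr rfl fun j _ => h1 j, h1 i]
  simp

/-- A step function of level `K` and a function of period `2^(-K)` are independent. -/
theorem integral_step_mul_periodic {K : ℕ} {u v : ℝ → ℝ} (hu : u ∈ dyadicStep 0 1 K)
    (hv : IntervalIntegrable v volume 0 1) (hp : Function.Periodic v (1 / 2 ^ K)) :
    ∫ x in (0 : ℝ)..1, u x * v x = (∫ x in (0 : ℝ)..1, u x) * ∫ x in (0 : ℝ)..1, v x := by
  rw [(integral_step_mul hu hv).2, integral_step hu, Finset.sum_mul]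
  refine Finset.sum_congr rfl fun i _ => ?_
  rw [integral_cell_periodic hv hp]
  ring

/-! ### Algebra of step functions -/

theorem step_const (K : ℕ) (c : ℝ) : (fun _ => c) ∈ dyadicStep 0 1 K :=
  mem_dyadicStep_iff.2 fun _ _ _ => rfl

theorem step_comp₂ {K : ℕ} {u v : ℝ → ℝ} (F : ℝ → ℝ → ℝ) (hu : u ∈ dyadicStep 0 1 K)
    (hv : v ∈ dyadicStep 0 1 K) : (fun x => F (u x) (v x)) ∈ dyadicStep 0 1 K :=
  mem_dyadicStep_iff.2 fun x y h => by
    simp only [mem_dyadicStep_iff.1 hu x y h, mem_dyadicStep_iff.1 hv x y h]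

theorem step_comp {K : ℕ} {u : ℝ → ℝ} (F : ℝ → ℝ) (hu : u ∈ dyadicStep 0 1 K) :
    (fun x => F (u x)) ∈ dyadicStep 0 1 K := step_comp₂ (fun a _ => F a) hu hu

theorem step_add {K : ℕ} {u v : ℝ → ℝ} (hu : u ∈ dyadicStep 0 1 K)
    (hv : v ∈ dyadicStep 0 1 K) : (fun x => u x + v x) ∈ dyadicStep 0 1 K :=
  step_comp₂ (· + ·) hu hv

theorem step_mul {K : ℕ} {u v : ℝ → ℝ} (hu : u ∈ dyadicStep 0 1 K)
    (hv : v ∈ dyadicStep 0 1 K) : (fun x => u x * v x) ∈ dyadicStep 0 1 K :=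
  step_comp₂ (· * ·) hu hv

theorem step_const_mul {K : ℕ} {u : ℝ → ℝ} (c : ℝ) (hu : u ∈ dyadicStep 0 1 K) :
    (fun x => c * u x) ∈ dyadicStep 0 1 K := step_comp (c * ·) hu

theorem step_sum {ι : Type*} {K : ℕ} {s : Finset ι} {u : ι → ℝ → ℝ}
    (hu : ∀ i ∈ s, u i ∈ dyadicStep 0 1 K) : (fun x => ∑ i ∈ s, u i x) ∈ dyadicStep 0 1 K :=
  mem_dyadicStep_iff.2 fun x y h =>
    Finset.sum_congr rfl fun i hi => mem_dyadicStep_iff.1 (hu i hi) x y h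

theorem step_prod {ι : Type*} {K : ℕ} {s : Finset ι} {u : ι → ℝ → ℝ}
    (hu : ∀ i ∈ s, u i ∈ dyadicStep 0 1 K) : (fun x => ∏ i ∈ s, u i x) ∈ dyadicStep 0 1 K :=
  mem_dyadicStep_iff.2 fun x y h =>
    Finset.prod_congr rfl fun i hi => mem_dyadicStep_iff.1 (hu i hi) x y h

/-- A step function of some level. -/
def IsStep (u : ℝ → ℝ) : Prop := ∃ K, u ∈ dyadicStep 0 1 K

theorem IsStep.comp₂ {u v : ℝ → ℝ} (F : ℝ → ℝ → ℝ) (hu : IsStep u) (hv : IsStep v) :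
    IsStep (fun x => F (u x) (v x)) := by
  obtain ⟨K, hK⟩ := hu
  obtain ⟨K', hK'⟩ := hv
  exact ⟨max K K', step_comp₂ F (dyadicStep_mono (le_max_left _ _) hK)
    (dyadicStep_mono (le_max_right _ _) hK')⟩

theorem IsStep.const (c : ℝ) : IsStep (fun _ => c) := ⟨0, step_const 0 c⟩

theorem IsStep.add {u v : ℝ → ℝ} (hu : IsStep u) (hv : IsStep v) :
    IsStep (fun x => u x + v x) := hu.comp₂ (· + ·) hv

theorem IsStep.mul {u v : ℝ → ℝ} (hu : IsStep u) (hv : IsStep v) :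
    IsStep (fun x => u x * v x) := hu.comp₂ (· * ·) hv

theorem IsStep.const_mul {u : ℝ → ℝ} (c : ℝ) (hu : IsStep u) :
    IsStep (fun x => c * u x) := hu.comp₂ (fun a _ => c * a) hu

theorem IsStep.sum {ι : Type*} {s : Finset ι} {u : ι → ℝ → ℝ} (hu : ∀ i ∈ s, IsStep (u i)) :
    IsStep (fun x => ∑ i ∈ s, u i x) := by
  classical
  induction s using Finset.induction_on with
  | empty => simpa using IsStep.const 0
  | insert a s ha ih =>
    simp only [Finset.sum_insert ha]
    exact (hu a (by simp)).add (ih fun i hi => hu i (by simp [hi]))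

theorem IsStep.intervalIntegrable {u : ℝ → ℝ} (hu : IsStep u) :
    IntervalIntegrable u volume 0 1 := by
  obtain ⟨K, hK⟩ := hu
  exact intervalIntegrable_step hK

/-- The scalar product of `L²[0,1]`. -/
def ip (u v : ℝ → ℝ) : ℝ := ∫ x in (0 : ℝ)..1, u x * v x

theorem ip_comm (u v : ℝ → ℝ) : ip u v = ip v u := by
  simp only [ip, mul_comm]

theorem ip_sum_left {ι : Type*} {s : Finset ι} {u : ι → ℝ → ℝ} {v : ℝ → ℝ} (c : ι → ℝ)
    (hu : ∀ i ∈ s, IsStep (u i)) (hv : IsStep v) :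
    ip (fun x => ∑ i ∈ s, c i * u i x) v = ∑ i ∈ s, c i * ip (u i) v := by
  simp only [ip, Finset.sum_mul]
  rw [intervalIntegral.integral_finsetSum]
  · refine Finset.sum_congr rfl fun i _ => ?_
    simp only [mul_assoc]
    exact intervalIntegral.integral_const_mul _ _
  · intro i hi
    exact (((hu i hi).const_mul (c i)).mul hv).intervalIntegrable

theorem ip_sum_right {ι : Type*} {s : Finset ι} {u : ι → ℝ → ℝ} {v : ℝ → ℝ} (c : ι → ℝ)
    (hu : ∀ i ∈ s, IsStep (u i)) (hv : IsStep v) :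
    ip v (fun x => ∑ i ∈ s, c i * u i x) = ∑ i ∈ s, c i * ip v (u i) := by
  rw [ip_comm, ip_sum_left c hu hv]
  simp only [ip_comm v]

theorem ip_sum_sum {ι κ : Type*} {s : Finset ι} {t : Finset κ} {u : ι → ℝ → ℝ} {v : κ → ℝ → ℝ}
    (c : ι → ℝ) (d : κ → ℝ) (hu : ∀ i ∈ s, IsStep (u i)) (hv : ∀ i ∈ t, IsStep (v i)) :
    ip (fun x => ∑ i ∈ s, c i * u i x) (fun x => ∑ j ∈ t, d j * v j x)
      = ∑ i ∈ s, ∑ j ∈ t, c i * d j * ip (u i) (v j) := by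
  rw [ip_sum_left c hu (IsStep.sum fun j hj => (hv j hj).const_mul _)]
  refine Finset.sum_congr rfl fun i hi => ?_
  rw [ip_sum_right d hv (hu i hi), Finset.mul_sum]
  refine Finset.sum_congr rfl fun j _ => by ring

theorem ip_self_sum {ι : Type*} [DecidableEq ι] {s : Finset ι} {u : ι → ℝ → ℝ} (c : ι → ℝ)
    (hu : ∀ i ∈ s, IsStep (u i))
    (ho : ∀ i ∈ s, ∀ j ∈ s, ip (u i) (u j) = if i = j then 1 else 0) :
    ip (fun x => ∑ i ∈ s, c i * u i x) (fun x => ∑ i ∈ s, c i * u i x) = ∑ i ∈ s, c i ^ 2 := by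
  rw [ip_sum_sum c c hu hu]
  refine Finset.sum_congr rfl fun i hi => ?_
  rw [Finset.sum_congr rfl fun j hj => by rw [ho i hi j hj]]
  simp [hi, sq]

theorem ip_eq_sum {K : ℕ} {u v : ℝ → ℝ} (hu : u ∈ dyadicStep 0 1 K) (hv : v ∈ dyadicStep 0 1 K) :
    ip u v = ∑ i ∈ Finset.range (2 ^ K), u (mid K i) * v (mid K i) * (1 / 2 ^ K) :=
  integral_step (step_mul hu hv)

/-- A periodic function of mean zero is orthogonal to the step functions of its scale. -/
theorem ip_eq_zero_of_periodic {K : ℕ} {u v : ℝ → ℝ} (hu : u ∈ dyadicStep 0 1 K)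
    (hv : IntervalIntegrable v volume 0 1) (hp : Function.Periodic v (1 / 2 ^ K))
    (h0 : ∫ x in (0 : ℝ)..1, v x = 0) : ip u v = 0 := by
  rw [ip, integral_step_mul_periodic hu hv hp, h0, mul_zero]

theorem periodic_mono {K K' : ℕ} (h : K ≤ K') {v : ℝ → ℝ} (hp : Function.Periodic v (1 / 2 ^ K')) :
    Function.Periodic v (1 / 2 ^ K) := by
  obtain ⟨d, rfl⟩ := Nat.exists_eq_add_of_le h
  have := hp.nat_mul (2 ^ d)
  have e : ((2 ^ d : ℕ) : ℝ) * (1 / 2 ^ (K + d)) = 1 / 2 ^ K := by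
    push_cast
    rw [pow_add]
    field_simp
  rwa [e] at this

end DivONS

end

noncomputable section

namespace DivONS

open MeasureTheory Filter Topology

/-! ### Rademacher functions -/

theorem rademacher_of_cell {n : ℕ} {t : ℝ} {z : ℤ} (h1 : (z : ℝ) < 2 ^ (n + 1) * t)
    (h2 : 2 ^ (n + 1) * t < z + 1) : rademacher n t = (-1) ^ z := by
  have hpos : 0 < Real.sin ((2 ^ (n + 1) * t - z) * Real.pi) := by
    apply Real.sin_pos_of_pos_of_lt_pi
    · have := Real.pi_pos
      apply mul_pos (by linarith) this
    · have := Real.pi_pos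
      nlinarith
  have e : 2 ^ (n + 1) * Real.pi * t = (2 ^ (n + 1) * t - z) * Real.pi + z * Real.pi := by ring
  rw [rademacher, e, Real.sin_add_int_mul_pi]
  rcases Int.even_or_odd z with h | h
  · rw [h.neg_one_zpow, one_mul, Real.sign_of_pos hpos]
  · rw [h.neg_one_zpow, Real.sign_of_neg (by linarith)]

theorem lineStep_rademacher (n : ℕ) : LineStep (n + 1) (rademacher n) := by
  rintro x y ⟨z, h1, h2, h3, h4⟩
  rw [rademacher_of_cell h1 h2, rademacher_of_cell h3 h4]

theorem periodic_rademacher (n : ℕ) : Function.Periodic (rademacher n) (1 / 2 ^ n) := by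
  intro t
  rw [rademacher, rademacher,
    show (2 : ℝ) ^ (n + 1) * Real.pi * (t + 1 / 2 ^ n) = 2 ^ (n + 1) * Real.pi * t + 2 * Real.pi by
      rw [pow_succ]; field_simp, Real.sin_add_two_pi]

theorem rademacher_neg (n : ℕ) (t : ℝ) : rademacher n (-t) = -rademacher n t := by
  rw [rademacher, rademacher, mul_neg, Real.sin_neg, Real.sign_neg]

theorem rademacher_one_sub (n : ℕ) (t : ℝ) : rademacher n (1 - t) = -rademacher n t := by
  have : Function.Periodic (rademacher n) 1 := by
    have := periodic_mono (Nat.zero_le n) (periodic_rademacher n)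
    simpa using this
  rw [sub_eq_neg_add, this, rademacher_neg]

theorem Nondyadic.exists_lineCell {x : ℝ} (hx : Nondyadic x) (K : ℕ) :
    ∃ z : ℤ, (z : ℝ) < 2 ^ K * x ∧ 2 ^ K * x < z + 1 :=
  ⟨⌊2 ^ K * x⌋, lt_of_le_of_ne (Int.floor_le _) (fun h => hx K _ h.symm), Int.lt_floor_add_one _⟩

theorem rademacher_sq {n : ℕ} {t : ℝ} (ht : Nondyadic t) : rademacher n t * rademacher n t = 1 := by
  obtain ⟨z, h1, h2⟩ := ht.exists_lineCell (n + 1)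
  rw [rademacher_of_cell h1 h2]
  rcases Int.even_or_odd z with h | h <;> simp [h.neg_one_zpow]

theorem step_rademacher (n : ℕ) : rademacher n ∈ dyadicStep 0 1 (n + 1) :=
  (lineStep_rademacher n).mem

theorem isStep_rademacher (n : ℕ) : IsStep (rademacher n) := ⟨_, step_rademacher n⟩

theorem integral_reflect (u : ℝ → ℝ) :
    ∫ x in (0 : ℝ)..1, u (1 - x) = ∫ x in (0 : ℝ)..1, u x := by
  rw [intervalIntegral.integral_comp_sub_left]; simp

/-- The function is odd about the point 1/2. -/
theorem integral_rademacher (n : ℕ) : ∫ x in (0 : ℝ)..1, rademacher n x = 0 := by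
  have := integral_reflect (rademacher n)
  simp only [rademacher_one_sub, intervalIntegral.integral_neg] at this
  linarith

theorem integral_congr_nondyadic {u v : ℝ → ℝ}
    (h : ∀ x, Nondyadic x → 0 < x → x ≤ 1 → u x = v x) :
    ∫ x in (0 : ℝ)..1, u x = ∫ x in (0 : ℝ)..1, v x := by
  apply intervalIntegral.integral_congr_ae
  filter_upwards [ae_nondyadic] with x hx hx'
  rw [Set.uIoc_of_le zero_le_one] at hx'
  exact h x hx hx'.1 hx'.2

theorem ip_rademacher_step {K n : ℕ} (h : K ≤ n) {u : ℝ → ℝ} (hu : u ∈ dyadicStep 0 1 K) :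
    ip u (rademacher n) = 0 :=
  ip_eq_zero_of_periodic (dyadicStep_mono h hu) (isStep_rademacher n).intervalIntegrable
    (periodic_rademacher n) (integral_rademacher n)

theorem ip_rademacher (a b : ℕ) : ip (rademacher a) (rademacher b) = if a = b then 1 else 0 := by
  rcases lt_trichotomy a b with h | h | h
  · rw [if_neg h.ne, ip_rademacher_step h (step_rademacher a)]
  · subst h
    rw [if_pos rfl, ip, integral_congr_nondyadic (v := fun _ => 1) fun x hx _ _ => rademacher_sq hx]
    simp
  · rw [if_neg h.ne', ip_comm, ip_rademacher_step h (step_rademacher b)]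

/-! ### The first Haar functions -/

theorem LineCell.le_iff {K s : ℕ} (hs : s ≤ K) {x y : ℝ} (h : LineCell K x y) (d : ℤ) :
    x ≤ d / 2 ^ s ↔ y ≤ d / 2 ^ s := ((h.mono hs).lt_iff d).2

theorem lineStep_initial (k : ℕ) : LineStep k (fun x => if x ≤ 1 / 2 ^ k then (1 : ℝ) else 0) := by
  intro x y h
  have := h.le_iff le_rfl 1
  push_cast at this
  simp only [this]

/-- Writing the Haar function as a step function of level k times r_k reduces its orthogonality to
E^k to that of r_k. -/
theorem haarFirst_eq {k : ℕ} {x : ℝ} (hx : Nondyadic x) (h0 : 0 < x) :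
    haarFirst k x = (√(2 ^ k) * if x ≤ 1 / 2 ^ k then (1 : ℝ) else 0) * rademacher k x := by
  have hk : (0 : ℝ) < 2 ^ (k + 1) := by positivity
  have e : (2 : ℝ) / 2 ^ (k + 1) = 1 / 2 ^ k := by rw [pow_succ]; field_simp
  have n1 := hx (k + 1) 1
  have n2 := hx k 1
  push_cast at n1 n2
  rw [haarFirst, e]
  by_cases h1 : x < 1 / 2 ^ (k + 1)
  · rw [if_pos ⟨h0, h1⟩]
    have h3 : x ≤ 1 / 2 ^ k := h1.le.trans (by gcongr <;> simp)
    rw [if_pos h3]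
    rw [lt_div_iff₀' hk] at h1
    rw [rademacher_of_cell (z := 0) (by push_cast; positivity) (by push_cast; linarith)]
    simp
  · rw [if_neg (fun h => h1 h.2)]
    have h1' : 1 / 2 ^ (k + 1) < x := by
      rw [not_lt] at h1
      refine lt_of_le_of_ne h1 fun h => n1 ?_
      rw [← h]; field_simp
    by_cases h2 : x < 1 / 2 ^ k
    · rw [if_pos ⟨h1', h2⟩, if_pos h2.le]
      rw [← e, lt_div_iff₀' hk] at h2
      rw [div_lt_iff₀' hk] at h1'
      rw [rademacher_of_cell (z := 1) (by push_cast; linarith) (by push_cast; linarith)]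
      simp
    · have h2' : ¬ x ≤ 1 / 2 ^ k := by
        intro h
        have h' := lt_of_le_of_ne h (fun h => n2 (by rw [h]; field_simp))
        exact h2 h'
      rw [if_neg (fun h => h2 h.2), if_neg h2']
      simp

theorem lineStep_haarFirst (k : ℕ) : LineStep (k + 1) (haarFirst k) := by
  intro x y h
  have e1 := h.lt_iff 0
  have e2 := h.lt_iff 1
  have e3 := h.lt_iff 2
  push_cast at e1 e2 e3
  rw [zero_div] at e1
  have e1' : 0 < x ↔ 0 < y := by rw [← not_le, e1.2, not_le]
  have e2' : 1 / 2 ^ (k + 1) < x ↔ 1 / 2 ^ (k + 1) < y := by rw [← not_le, e2.2, not_le]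
  simp only [haarFirst, e1', e2', e2.1, e3.1]

theorem step_haarFirst (k : ℕ) : haarFirst k ∈ dyadicStep 0 1 (k + 1) :=
  (lineStep_haarFirst k).mem

theorem isStep_haarFirst (k : ℕ) : IsStep (haarFirst k) := ⟨_, step_haarFirst k⟩

theorem ip_haarFirst_step {k : ℕ} {u : ℝ → ℝ} (hu : u ∈ dyadicStep 0 1 k) :
    ip u (haarFirst k) = 0 := by
  have : ip u (haarFirst k)
      = ip (fun x => u x * (√(2 ^ k) * if x ≤ 1 / 2 ^ k then (1 : ℝ) else 0)) (rademacher k) := by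
    refine integral_congr_nondyadic fun x hx h0 _ => ?_
    rw [haarFirst_eq hx h0]; ring
  rw [this]
  exact ip_rademacher_step le_rfl (step_mul hu (step_const_mul _ (lineStep_initial k).mem))

theorem ip_haarFirst_self (k : ℕ) : ip (haarFirst k) (haarFirst k) = 1 := by
  have h1 : ip (haarFirst k) (haarFirst k)
      = ∫ x in (0 : ℝ)..1, 2 ^ k * if x ≤ 1 / 2 ^ k then (1 : ℝ) else 0 := by
    refine integral_congr_nondyadic fun x hx h0 _ => ?_
    have hs : √((2 : ℝ) ^ k) * √(2 ^ k) = 2 ^ k := Real.mul_self_sqrt (by positivity)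
    have hr := rademacher_sq (n := k) hx
    rw [haarFirst_eq hx h0]
    split_ifs
    · linear_combination (√((2 : ℝ) ^ k) * √(2 ^ k)) * hr + hs
    · simp
  rw [h1, integral_step (step_const_mul _ (lineStep_initial k).mem),
    Finset.sum_eq_single 0]
  · have : mid k 0 ≤ 1 / 2 ^ k := by rw [mid]; gcongr; norm_num
    rw [if_pos this]; field_simp
  · intro i _ hi
    have : ¬ mid k i ≤ 1 / 2 ^ k := by
      rw [mid, not_le]
      have : (1 : ℝ) ≤ i := by exact_mod_cast Nat.one_le_iff_ne_zero.2 hi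
      gcongr
      linarith
    rw [if_neg this]; simp
  · simp

theorem haarFirst_eq_zero {k : ℕ} {x : ℝ} (hx : 1 / 2 ^ k ≤ x) : haarFirst k x = 0 := by
  have e : (2 : ℝ) / 2 ^ (k + 1) = 1 / 2 ^ k := by rw [pow_succ]; field_simp
  have e' : (1 : ℝ) / 2 ^ (k + 1) ≤ 1 / 2 ^ k := by gcongr <;> simp
  rw [haarFirst, if_neg (by rintro ⟨_, h⟩; linarith), if_neg (by rintro ⟨_, h⟩; linarith)]

/-! ### Menshov's functions -/

/-- Reduction modulo the period 2 is pulled out of the floor. The value is thus seen to depend only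
on the cell of level k and on the number of removed periods. -/
theorem menshov_eq_floor (k : ℕ) (x : ℝ) :
    menshov k x = if ⌊2 ^ k * x⌋ - 2 ^ (k + 1) * ⌊(x + 1) / 2⌋ + 1 = 0 ∨
        ⌊2 ^ k * x⌋ - 2 ^ (k + 1) * ⌊(x + 1) / 2⌋ + 1 = 2 ^ k then 0
      else √(2 ^ k) / (8 * ((⌊2 ^ k * x⌋ - 2 ^ (k + 1) * ⌊(x + 1) / 2⌋ + 1 : ℤ) : ℝ)) := by
  have e : ⌊(2 : ℝ) ^ k * (2 * Int.fract ((x + 1) / 2) - 1)⌋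
      = ⌊2 ^ k * x⌋ - 2 ^ (k + 1) * ⌊(x + 1) / 2⌋ := by
    rw [← Int.floor_sub_intCast]
    congr 1
    rw [Int.fract]
    push_cast
    ring
  simp only [menshov, e]

theorem lineStep_menshov (k : ℕ) : LineStep k (menshov k) := by
  intro x y h
  have h0 := h.mono (Nat.zero_le k)
  have e1 : ⌊(x + 1) / 2⌋ = ⌊(y + 1) / 2⌋ := by
    obtain ⟨z, h1, h2, h3, h4⟩ := h0
    simp only [pow_zero, one_mul] at h1 h2 h3 h4
    have a1 : 2 * ((z + 1) / 2) ≤ z + 1 := by omega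
    have a2 : z + 2 ≤ 2 * ((z + 1) / 2) + 2 := by omega
    have a1' : (2 : ℝ) * (((z + 1) / 2 : ℤ) : ℝ) ≤ z + 1 := by exact_mod_cast a1
    have a2' : (z : ℝ) + 2 ≤ 2 * (((z + 1) / 2 : ℤ) : ℝ) + 2 := by exact_mod_cast a2
    have f : ∀ w : ℝ, (z : ℝ) < w → w < z + 1 → ⌊(w + 1) / 2⌋ = (z + 1) / 2 := fun w w1 w2 => by
      rw [Int.floor_eq_iff]
      constructor <;> linarith
    rw [f x h1 h2, f y h3 h4]
  have e2 : ⌊2 ^ k * x⌋ = ⌊2 ^ k * y⌋ := by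
    obtain ⟨z, h1, h2, h3, h4⟩ := h
    rw [Int.floor_eq_iff.2 ⟨h1.le, h2⟩, Int.floor_eq_iff.2 ⟨h3.le, h4⟩]
  rw [menshov_eq_floor, menshov_eq_floor, e1, e2]

theorem lineStep_menshov_translate (k i : ℕ) :
    LineStep k (fun x => menshov k (x - (i : ℝ) / 2 ^ k)) := by
  intro x y h
  apply lineStep_menshov k
  obtain ⟨z, h1, h2, h3, h4⟩ := h
  have e : ∀ w : ℝ, 2 ^ k * (w - (i : ℝ) / 2 ^ k) = 2 ^ k * w - i := fun w => by field_simp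
  refine ⟨z - i, ?_, ?_, ?_, ?_⟩ <;> rw [e] <;> push_cast <;> linarith

/-- On a fixed cell of (0,1) the translates take, as i varies, the values of the Hilbert kernel with
pole at i = p + 1. The last cell is excluded because there the translate i = 0 meets the cell 2^k,
where M_k was set to 0. -/
theorem menshov_translate_eq {k i p : ℕ} (hi : i < 2 ^ k) (hp : p < 2 ^ k) {y : ℝ}
    (h1 : (p : ℝ) < 2 ^ k * y) (h2 : 2 ^ k * y < p + 1) (hp' : p + 1 < 2 ^ k) :
    menshov k (y - (i : ℝ) / 2 ^ k)
      = if p + 1 = i then 0 else √(2 ^ k) / (8 * ((p : ℝ) + 1 - i)) := by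
  have h0 : (0 : ℝ) < 2 ^ k := by positivity
  have hi' : (i : ℝ) + 1 ≤ 2 ^ k := by exact_mod_cast hi
  have hp1 : (p : ℝ) + 1 ≤ 2 ^ k := by exact_mod_cast hp
  have e : 2 ^ k * (y - (i : ℝ) / 2 ^ k) = 2 ^ k * y - i := by field_simp
  have f1 : ⌊2 ^ k * (y - (i : ℝ) / 2 ^ k)⌋ = (p : ℤ) - i := by
    rw [e, Int.floor_eq_iff]; push_cast; constructor <;> linarith
  have f2 : ⌊((y - (i : ℝ) / 2 ^ k) + 1) / 2⌋ = 0 := by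
    rw [Int.floor_eq_iff]
    push_cast
    have y0 : 0 < y := by
      by_contra hy
      have : 2 ^ k * y ≤ 0 := by nlinarith
      have : (0 : ℝ) ≤ p := by positivity
      linarith
    have y1 : y < 1 := by nlinarith
    have i1 : (i : ℝ) / 2 ^ k < 1 := by rw [div_lt_one h0]; linarith
    have i0 : 0 ≤ (i : ℝ) / 2 ^ k := by positivity
    constructor <;> linarith
  rw [menshov_eq_floor, f1, f2]
  have hc : ((p : ℤ) - i - 2 ^ (k + 1) * 0 + 1 = 0 ∨ (p : ℤ) - i - 2 ^ (k + 1) * 0 + 1 = 2 ^ k)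
      ↔ p + 1 = i := by
    have : ((2 : ℕ) ^ k : ℤ) = 2 ^ k := by norm_cast
    have hp2 : (p : ℤ) + 1 < 2 ^ k := by exact_mod_cast hp'
    constructor
    · rintro (h | h) <;> omega
    · intro h; left; omega
  simp only [hc]
  split_ifs
  · rfl
  · push_cast; congr 1; ring

variable {k : ℕ} {f : ℕ → ℝ → ℝ}

/-- Periodicity reduces everything to [-2,2), where the four unit intervals are checked separately.
Only (1,2) needs level k+1; on (-1,1) level k would do. -/
theorem IsMenshovSystem.lineStep (hf : IsMenshovSystem k f) {i : ℕ} (hi : i < 2 ^ k) :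
    LineStep (k + 1) (f i) := by
  have main : ∀ x y, LineCell (k + 1) x y → -2 ≤ x → x < 2 → f i x = f i y := by
    intro x y h hx1 hx2
    obtain ⟨z, h1, h2, h3, h4⟩ := h.mono (Nat.zero_le _)
    simp only [pow_zero, one_mul] at h1 h2 h3 h4
    have hz1 : -3 < z := by
      have : (-3 : ℝ) < z := by linarith
      exact_mod_cast this
    have hz2 : z < 2 := by
      have : (z : ℝ) < 2 := by linarith
      exact_mod_cast this
    have hM : -1 ≤ x → x ≤ 1 → -1 ≤ y → y ≤ 1 → f i x = f i y := fun a b c d => by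
      rw [hf.eq_menshov i hi x ⟨a, b⟩, hf.eq_menshov i hi y ⟨c, d⟩]
      exact lineStep_menshov_translate k i x y (h.mono (Nat.le_succ k))
    obtain rfl | rfl | rfl | rfl : z = -2 ∨ z = -1 ∨ z = 0 ∨ z = 1 := by omega
    · push_cast at h1 h2 h3 h4
      rw [hf.eq_zero i hi x ⟨by linarith, by linarith⟩, hf.eq_zero i hi y ⟨by linarith, by linarith⟩]
    · push_cast at h1 h2 h3 h4
      exact hM (by linarith) (by linarith) (by linarith) (by linarith)
    · push_cast at h1 h2 h3 h4
      exact hM (by linarith) (by linarith) (by linarith) (by linarith)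
    · push_cast at h1 h2 h3 h4
      obtain ⟨c, hc⟩ := hf.step i hi
      obtain ⟨w, w1, w2, w3, w4⟩ := h
      have h0 : (0 : ℝ) < 2 ^ (k + 1) := by positivity
      have e0 : ((2 : ℤ) ^ (k + 1) : ℤ) = ((2 ^ (k + 1) : ℕ) : ℤ) := by push_cast; rfl
      have wl : (2 : ℤ) ^ (k + 1) ≤ w := by
        have : ((2 : ℤ) ^ (k + 1) : ℤ) < w + 1 := by
          have : (2 : ℝ) ^ (k + 1) < w + 1 := by nlinarith
          exact_mod_cast this
        omega
      have wu : w < 2 * (2 : ℤ) ^ (k + 1) := by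
        have : (w : ℝ) < 2 * 2 ^ (k + 1) := by nlinarith
        exact_mod_cast this
      obtain ⟨j, hj⟩ := Int.eq_ofNat_of_zero_le (sub_nonneg.2 wl)
      have hw : (w : ℝ) = 2 ^ (k + 1) + j := by
        have : w = 2 ^ (k + 1) + (j : ℤ) := by omega
        rw [this]; push_cast; ring
      have key : ∀ v : ℝ, (w : ℝ) < 2 ^ (k + 1) * v → 2 ^ (k + 1) * v < w + 1 →
          f i v = c (j + 1) := by
        intro v v1 v2
        apply hc (j + 1) (by omega) (by omega)
        rw [hw] at v1 v2
        push_cast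
        constructor
        · rw [show (1 : ℝ) + ((j : ℝ) + 1 - 1) * ((2 - 1) / 2 ^ (k + 1))
            = (2 ^ (k + 1) + j) / 2 ^ (k + 1) by field_simp; ring, div_lt_iff₀' h0]
          exact v1
        · rw [show (1 : ℝ) + ((j : ℝ) + 1) * ((2 - 1) / 2 ^ (k + 1))
            = (2 ^ (k + 1) + j + 1) / 2 ^ (k + 1) by field_simp; ring, lt_div_iff₀' h0]
          exact v2
      rw [key x w1 w2, key y w3 w4]
  intro x y h
  -- The number of periods to remove in order to bring x into [-2,2). The shift is an integer, so y
  -- stays in the same cell as x.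
  set q : ℤ := ⌊(x + 2) / 4⌋ with hq
  have hp : ∀ w : ℝ, f i w = f i (w + ((-4 * q : ℤ) : ℝ)) := fun w => by
    have := (hf.periodic i hi).sub_int_mul_eq (x := w) q
    rw [← this]
    congr 1
    push_cast; ring
  rw [hp x, hp y]
  have h' := LineCell.affine (K := k + 1) (a := 0) (-4 * q) h
  simp only [pow_zero, one_mul] at h'
  have l1 := Int.floor_le ((x + 2) / 4)
  have l2 := Int.lt_floor_add_one ((x + 2) / 4)
  rw [← hq] at l1 l2
  apply main _ _ h' <;> push_cast <;> linarith

end DivONS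

end

noncomputable section

namespace DivONS

open MeasureTheory Filter Topology

/-! ### The functions `g` -/

theorem IsMenshovSystem.integral_shift {k : ℕ} {f : ℕ → ℝ → ℝ} (hf : IsMenshovSystem k f)
    {i : ℕ} (hi : i < 2 ^ k) (t : ℝ) : ∫ x in t..t + 4, f i x = 0 := by
  rw [(hf.periodic i hi).intervalIntegral_add_eq t (-2)]
  norm_num
  exact hf.mean_zero i hi

theorem IsMenshovSystem.integral_mul_shift {k : ℕ} {f : ℕ → ℝ → ℝ} (hf : IsMenshovSystem k f)
    {i j : ℕ} (hi : i < 2 ^ k) (hj : j < 2 ^ k) (t : ℝ) :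
    ∫ x in t..t + 4, f i x * f j x = if i = j then 1 else 0 := by
  have : Function.Periodic (fun x => f i x * f j x) 4 := fun x => by
    simp only [hf.periodic i hi x, hf.periodic j hj x]
  rw [this.intervalIntegral_add_eq t (-2)]
  norm_num
  exact hf.orthonormal i hi j hj

theorem pow_half_le {a b : ℕ} (h : a ≤ b) : (1 : ℝ) / 2 ^ b ≤ 1 / 2 ^ a := by
  gcongr; norm_num

theorem two_div_pow_succ (s : ℕ) : (2 : ℝ) / 2 ^ (s + 1) = 1 / 2 ^ s := by
  rw [pow_succ]; field_simp

theorem two_div_pow {s : ℕ} (hs : 1 ≤ s) : (2 : ℝ) / 2 ^ s = 1 / 2 ^ (s - 1) := by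
  obtain ⟨t, rfl⟩ : ∃ t, s = t + 1 := ⟨s - 1, by omega⟩
  rw [two_div_pow_succ, Nat.add_sub_cancel]

theorem gHat_of_zero_piece (f : ℕ → ℕ → ℝ → ℝ) {n kp i : ℕ} (hn : 1 ≤ n) {x : ℝ}
    (h0 : 0 < x) (h1 : x < 1 / 2 ^ (2 * n ^ 2)) :
    gHat f n kp i x = 1 / (n : ℝ) * 2 ^ (n ^ 2) *
        f (2 * n) i (2 ^ (2 * n ^ 2 + 2) * (x - 1 / 2 ^ (2 * n ^ 2))) := by
  have hn2 : 1 ≤ n ^ 2 := Nat.one_le_pow _ _ hn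
  rw [gHat, Set.indicator_of_mem (by exact ⟨h0.le, h1.le⟩), Finset.sum_eq_zero,
    Set.indicator_of_notMem]
  · ring
  · rintro ⟨h, _⟩
    have := pow_half_le (a := 1) (b := 2 * n ^ 2) (by omega)
    norm_num at this h
    norm_num at h1
    linarith
  · intro s hs
    rw [Finset.mem_Icc] at hs
    rw [Set.indicator_of_notMem]
    rintro ⟨h, _⟩
    have := pow_half_le hs.2
    linarith

theorem gHat_of_piece (f : ℕ → ℕ → ℝ → ℝ) {n kp i s : ℕ} (hs : 2 ≤ s) (hs' : s ≤ 2 * n ^ 2) {x : ℝ}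
    (h0 : 1 / 2 ^ s < x) (h1 : x < 2 / 2 ^ s) :
    gHat f n kp i x = 1 / (n : ℝ) * √(2 ^ s) * f (2 * n) i (2 ^ (s + 2) * (x - 1 / 2 ^ s)) := by
  rw [gHat, Set.indicator_of_notMem, Finset.sum_eq_single s, Set.indicator_of_mem,
    Set.indicator_of_notMem]
  · ring
  · rintro ⟨h, _⟩
    rw [two_div_pow (by omega)] at h1
    have := pow_half_le (a := 1) (b := s - 1) (by omega)
    norm_num at this h
    norm_num at h1
    linarith
  · exact ⟨h0, h1.le⟩
  · intro t ht hts
    rw [Finset.mem_Icc] at ht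
    rw [Set.indicator_of_notMem]
    rintro ⟨h, h'⟩
    rcases lt_or_gt_of_ne hts with h2 | h2
    · rw [two_div_pow (by omega)] at h1
      have := pow_half_le (a := t) (b := s - 1) (by omega)
      linarith
    · rw [two_div_pow (by omega)] at h'
      have := pow_half_le (a := s) (b := t - 1) (by omega)
      linarith
  · intro h
    exact absurd (Finset.mem_Icc.2 ⟨hs, hs'⟩) h
  · rintro ⟨_, h⟩
    have := pow_half_le hs'
    linarith

theorem gHat_of_last_piece (f : ℕ → ℕ → ℝ → ℝ) {n kp i : ℕ} (hn : 1 ≤ n) {x : ℝ}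
    (h0 : 1 / 2 < x) (h1 : x ≤ 1) : gHat f n kp i x = rademacher (kp + 4 + i) x := by
  have hn2 : 1 ≤ n ^ 2 := Nat.one_le_pow _ _ hn
  rw [gHat, Set.indicator_of_notMem, Finset.sum_eq_zero, Set.indicator_of_mem]
  · ring
  · exact ⟨h0, h1⟩
  · intro s hs
    rw [Finset.mem_Icc] at hs
    rw [Set.indicator_of_notMem]
    rintro ⟨_, h⟩
    rw [two_div_pow (by omega)] at h
    have := pow_half_le (a := 1) (b := s - 1) (by omega)
    norm_num at this h
    linarith
  · rintro ⟨_, h⟩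
    have := pow_half_le (a := 1) (b := 2 * n ^ 2) (by omega)
    norm_num at this h
    linarith

theorem LineCell.mem_Ioc_iff {K s : ℕ} (hs : s ≤ K) {x y : ℝ} (h : LineCell K x y) (d e : ℤ) :
    x ∈ Set.Ioc ((d : ℝ) / 2 ^ s) (e / 2 ^ s) ↔ y ∈ Set.Ioc ((d : ℝ) / 2 ^ s) (e / 2 ^ s) := by
  rw [Set.mem_Ioc, Set.mem_Ioc, ← not_le, ← not_le, h.le_iff hs d, h.le_iff hs e]

theorem indicator_congr_of_iff {s : Set ℝ} {u : ℝ → ℝ} {x y : ℝ} (h : x ∈ s ↔ y ∈ s)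
    (hu : u x = u y) : s.indicator u x = s.indicator u y := by
  classical
  simp only [Set.indicator_apply, h, hu]

theorem lineStep_gHat {f : ℕ → ℕ → ℝ → ℝ} (hf : ∀ k ≥ 1, IsMenshovSystem k (f k)) {n kp i : ℕ}
    (hn : 1 ≤ n) (hi : i < 2 ^ (2 * n)) :
    LineStep (2 * n ^ 2 + 2 * n + kp + i + 5) (gHat f n kp i) := by
  have hstep := (hf (2 * n) (by omega)).lineStep hi
  have hpiece : ∀ s : ℕ, s ≤ 2 * n ^ 2 → ∀ x y : ℝ,
      LineCell (2 * n ^ 2 + 2 * n + kp + i + 5) x y →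
      f (2 * n) i (2 ^ (s + 2) * (x - 1 / 2 ^ s)) = f (2 * n) i (2 ^ (s + 2) * (y - 1 / 2 ^ s)) := by
    intro s hs x y h
    -- The translation by 2^{-s} becomes the integer shift 4 after dilation, so the dyadic grid is
    -- preserved.
    have e : ∀ w : ℝ, 2 ^ (s + 2) * (w - 1 / 2 ^ s) = 2 ^ (s + 2) * w + ((-4 : ℤ) : ℝ) := fun w => by
      rw [pow_add]; push_cast; field_simp; ring
    rw [e, e]
    exact hstep.affine (a := s + 2) (-4) x y (h.mono (by omega))
  intro x y h
  rw [gHat, gHat]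
  congr 1
  congr 1
  · apply indicator_congr_of_iff
    · have h1 := h.le_iff (s := 2 * n ^ 2) (by omega) 1
      have h2 := h.lt_iff 0
      push_cast at h1 h2
      rw [zero_div] at h2
      rw [Set.mem_Icc, Set.mem_Icc, h1, ← not_lt, h2.1, not_lt]
    · rw [hpiece (2 * n ^ 2) le_rfl x y h]
  · refine Finset.sum_congr rfl fun s hs => ?_
    rw [Finset.mem_Icc] at hs
    apply indicator_congr_of_iff
    · have := h.mem_Ioc_iff (s := s) (by omega) 1 2
      push_cast at this
      exact this
    · rw [hpiece s hs.2 x y h]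
  · apply indicator_congr_of_iff
    · have := h.mem_Ioc_iff (s := 1) (by omega) 1 2
      push_cast at this
      norm_num at this ⊢
      exact this
    · exact lineStep_rademacher _ x y (h.mono (by omega))

/-- The dilated function has period 2^{-K}, and on the first cell the fractional part disappears, so
a linear substitution computes the integral. -/
theorem integral_dilate {Q K : ℕ} {F : ℝ → ℝ} (hF : LineStep Q F) :
    ∫ x in (0 : ℝ)..1, F (Int.fract (2 ^ K * x)) = ∫ x in (0 : ℝ)..1, F x := by
  have hK : (0 : ℝ) < 2 ^ K := by positivity
  have hs : LineStep (Q + K) (fun x => F (Int.fract (2 ^ K * x))) := by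
    have := hF.fract.affine (a := K) 0
    simpa using this
  have hp : Function.Periodic (fun x => F (Int.fract (2 ^ K * x))) (1 / 2 ^ K) := fun x => by
    simp only [mul_add, mul_one_div_cancel hK.ne', Int.fract_add_one]
  have h1 := integral_cell_periodic (intervalIntegrable_step hs.mem) hp 0
  have h2 : ∫ x in (((0 : ℕ) : ℝ) / 2 ^ K)..(((0 + 1 : ℕ) : ℝ) / 2 ^ K), F (Int.fract (2 ^ K * x))
      = ∫ x in (((0 : ℕ) : ℝ) / 2 ^ K)..(((0 + 1 : ℕ) : ℝ) / 2 ^ K), F (2 ^ K * x) := by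
    apply intervalIntegral.integral_congr_Ioo_of_le (cell_le K 0)
    intro x hx
    have hx1 := hx.1
    have hx2 := hx.2
    rw [div_lt_iff₀' hK] at hx1
    rw [lt_div_iff₀' hK] at hx2
    push_cast at hx1 hx2
    have : Int.fract (2 ^ K * x) = 2 ^ K * x := Int.fract_eq_self.2 ⟨hx1.le, by linarith⟩
    simp only [this]
  rw [h2, intervalIntegral.integral_comp_mul_left _ hK.ne'] at h1
  have h3 : (2 : ℝ) ^ K * (((0 + 1 : ℕ) : ℝ) / 2 ^ K) = 1 := by push_cast; field_simp
  rw [h3] at h1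
  simp only [Nat.cast_zero, zero_div, mul_zero, smul_eq_mul] at h1
  field_simp at h1
  exact h1.symm

/-! ### Mean values and scalar products of the functions ĝ and g. -/

theorem uIcc_subset_unit {a b : ℝ} (ha : 0 ≤ a) (hab : a ≤ b) (hb : b ≤ 1) :
    Set.uIcc a b ⊆ Set.uIcc (0 : ℝ) 1 := by
  rw [Set.uIcc_of_le hab, Set.uIcc_of_le zero_le_one]
  exact Set.Icc_subset_Icc ha hb

theorem integral_pieces {v : ℝ → ℝ} (hv : IntervalIntegrable v volume 0 1) {S : ℕ} (hS : 1 ≤ S) :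
    ∫ x in (0 : ℝ)..1, v x = (∫ x in (0 : ℝ)..1 / 2 ^ S, v x)
      + (∑ s ∈ Finset.Icc 2 S, ∫ x in (1 / 2 ^ s : ℝ)..2 / 2 ^ s, v x)
      + ∫ x in (1 / 2 : ℝ)..1, v x := by
  have hi : ∀ a b : ℝ, 0 ≤ a → a ≤ b → b ≤ 1 → IntervalIntegrable v volume a b :=
    fun a b ha hab hb => hv.mono_set (uIcc_subset_unit ha hab hb)
  have h1 : ∀ T : ℕ, (1 : ℝ) / 2 ^ T ≤ 1 := fun T => by
    simpa using pow_half_le (Nat.zero_le T)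
  induction S, hS using Nat.le_induction with
  | base =>
    norm_num
    rw [intervalIntegral.integral_add_adjacent_intervals] <;> apply hi <;> norm_num
  | succ n hn ih =>
    rw [ih, ← Finset.insert_Icc_right_eq_Icc_add_one (by omega), Finset.sum_insert (by simp),
      two_div_pow_succ]
    have := intervalIntegral.integral_add_adjacent_intervals
      (hi 0 (1 / 2 ^ (n + 1)) le_rfl (by positivity) (h1 _))
      (hi (1 / 2 ^ (n + 1)) (1 / 2 ^ n) (by positivity) (pow_half_le (Nat.le_succ n)) (h1 _))
    rw [← this]
    ring

theorem integral_affine_piece (F : ℝ → ℝ) (s : ℕ) (a b : ℝ) :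
    ∫ x in a..b, F (2 ^ (s + 2) * (x - 1 / 2 ^ s))
      = 1 / 2 ^ (s + 2) * ∫ x in (2 ^ (s + 2) * a - 4)..(2 ^ (s + 2) * b - 4), F x := by
  have e : ∀ w : ℝ, (2 : ℝ) ^ (s + 2) * (w - 1 / 2 ^ s) = 2 ^ (s + 2) * w - 4 := fun w => by
    rw [pow_add]; field_simp; ring
  simp only [e]
  rw [intervalIntegral.integral_comp_mul_sub _ (by positivity)]
  simp

theorem lineStep_upper_half : LineStep 1 (fun x : ℝ => if 1 / 2 < x then (1 : ℝ) else 0) := by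
  intro x y h
  have := h.le_iff le_rfl 1
  push_cast at this
  rw [pow_one] at this
  simp only [← not_le, this]

theorem integral_upper_half_mul {v : ℝ → ℝ} (hv : IntervalIntegrable v volume 0 1)
    (hp : Function.Periodic v (1 / 2 ^ 1)) :
    ∫ x in (1 / 2 : ℝ)..1, v x = 1 / 2 * ∫ x in (0 : ℝ)..1, v x := by
  have h := integral_cell_periodic hv hp 1
  norm_num at h ⊢
  exact h

theorem integral_upper_half_rademacher {a : ℕ} (ha : 1 ≤ a) :
    ∫ x in (1 / 2 : ℝ)..1, rademacher a x = 0 := by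
  rw [integral_upper_half_mul (isStep_rademacher a).intervalIntegrable
    (periodic_mono ha (periodic_rademacher a)), integral_rademacher, mul_zero]

theorem integral_upper_half_rademacher_mul {a b : ℕ} (ha : 1 ≤ a) (hb : 1 ≤ b) :
    ∫ x in (1 / 2 : ℝ)..1, rademacher a x * rademacher b x = if a = b then 1 / 2 else 0 := by
  have hp : Function.Periodic (fun x => rademacher a x * rademacher b x) (1 / 2 ^ 1) := fun x => by
    simp only [periodic_mono ha (periodic_rademacher a) x,
      periodic_mono hb (periodic_rademacher b) x]
  rw [integral_upper_half_mul ((isStep_rademacher a).mul (isStep_rademacher b)).intervalIntegrable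
    hp]
  have := ip_rademacher a b
  rw [ip] at this
  rw [this]
  split_ifs <;> simp

theorem integral_gHat {f : ℕ → ℕ → ℝ → ℝ} (hf : ∀ k ≥ 1, IsMenshovSystem k (f k))
    {n kp i : ℕ} (hn : 1 ≤ n) (hi : i < 2 ^ (2 * n)) :
    ∫ x in (0 : ℝ)..1, gHat f n kp i x = 0 := by
  have hn2 : 1 ≤ n ^ 2 := Nat.one_le_pow _ _ hn
  have hM := hf (2 * n) (by omega)
  rw [integral_pieces (intervalIntegrable_step (lineStep_gHat hf hn hi).mem)
    (S := 2 * n ^ 2) (by omega)]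
  rw [intervalIntegral.integral_congr_Ioo_of_le (by positivity)
    (fun x hx => gHat_of_zero_piece f hn hx.1 hx.2)]
  rw [intervalIntegral.integral_const_mul, integral_affine_piece (f (2 * n) i)]
  -- Each piece is stretched onto an interval of length 4, which is a full period of f.
  have e1 : (2 : ℝ) ^ (2 * n ^ 2 + 2) * (1 / 2 ^ (2 * n ^ 2)) - 4
      = (2 ^ (2 * n ^ 2 + 2) * 0 - 4) + 4 := by rw [pow_add]; field_simp; ring
  rw [e1, hM.integral_shift hi, Finset.sum_eq_zero, intervalIntegral.integral_congr_Ioo_of_le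
    (by norm_num) (fun x hx => gHat_of_last_piece f hn hx.1 hx.2.le),
    integral_upper_half_rademacher (by omega)]
  · ring
  · intro s hs
    rw [Finset.mem_Icc] at hs
    rw [intervalIntegral.integral_congr_Ioo_of_le (by gcongr; norm_num)
      (fun x hx => gHat_of_piece f hs.1 hs.2 hx.1 hx.2),
      intervalIntegral.integral_const_mul, integral_affine_piece (f (2 * n) i)]
    have e2 : (2 : ℝ) ^ (s + 2) * (2 / 2 ^ s) - 4 = (2 ^ (s + 2) * (1 / 2 ^ s) - 4) + 4 := by
      rw [pow_add]; field_simp; ring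
    rw [e2, hM.integral_shift hi]
    ring

/-- Each of the 2n² pieces to the left of 1/2 contributes δ_ij/(4n²): the squared height 2^s/n² is
multiplied by the length factor 2^{-s-2}. They add up to δ_ij/2, and the Rademacher functions on
(1/2,1] supply the other half. -/
theorem integral_gHat_mul {f : ℕ → ℕ → ℝ → ℝ} (hf : ∀ k ≥ 1, IsMenshovSystem k (f k))
    {n kp i j : ℕ} (hn : 1 ≤ n) (hi : i < 2 ^ (2 * n))
    (hj : j < 2 ^ (2 * n)) :
    ∫ x in (0 : ℝ)..1, gHat f n kp i x * gHat f n kp j x = if i = j then 1 else 0 := by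
  have hn2 : 1 ≤ n ^ 2 := Nat.one_le_pow _ _ hn
  have hn0 : (n : ℝ) ≠ 0 := by positivity
  have hM := hf (2 * n) (by omega)
  have hstep : IsStep (fun x => gHat f n kp i x * gHat f n kp j x) :=
    IsStep.mul ⟨_, (lineStep_gHat hf hn hi).mem⟩ ⟨_, (lineStep_gHat hf hn hj).mem⟩
  rw [integral_pieces hstep.intervalIntegrable (S := 2 * n ^ 2) (by omega)]
  have first : ∫ x in (0 : ℝ)..1 / 2 ^ (2 * n ^ 2), gHat f n kp i x * gHat f n kp j x
      = (1 / (4 * (n : ℝ) ^ 2)) * if i = j then 1 else 0 := by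
    have e1 : (2 : ℝ) ^ (2 * n ^ 2 + 2) * (1 / 2 ^ (2 * n ^ 2)) - 4
      = (2 ^ (2 * n ^ 2 + 2) * 0 - 4) + 4 := by rw [pow_add]; field_simp; ring
    have : Set.EqOn (fun x => gHat f n kp i x * gHat f n kp j x)
        (fun x => (1 / (n : ℝ) ^ 2 * 2 ^ (2 * n ^ 2)) *
          (fun y => f (2 * n) i y * f (2 * n) j y) (2 ^ (2 * n ^ 2 + 2) *
            (x - 1 / 2 ^ (2 * n ^ 2)))) (Set.Ioo 0 (1 / 2 ^ (2 * n ^ 2))) := fun x hx => by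
      simp only
      rw [gHat_of_zero_piece f hn hx.1 hx.2, gHat_of_zero_piece f hn hx.1 hx.2, two_mul (n ^ 2),
        pow_add]
      ring
    rw [intervalIntegral.integral_congr_Ioo_of_le (by positivity) this,
      intervalIntegral.integral_const_mul,
      integral_affine_piece (fun y => f (2 * n) i y * f (2 * n) j y), e1,
      hM.integral_mul_shift hi hj, pow_add 2 _ 2]
    split_ifs
    · field_simp
      norm_num
    · simp
  have mids : ∀ s ∈ Finset.Icc 2 (2 * n ^ 2),
      ∫ x in (1 / 2 ^ s : ℝ)..2 / 2 ^ s, gHat f n kp i x * gHat f n kp j x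
      = (1 / (4 * (n : ℝ) ^ 2)) * if i = j then 1 else 0 := by
    intro s hs
    rw [Finset.mem_Icc] at hs
    have e2 : (2 : ℝ) ^ (s + 2) * (2 / 2 ^ s) - 4 = (2 ^ (s + 2) * (1 / 2 ^ s) - 4) + 4 := by
      rw [pow_add]; field_simp; ring
    have : Set.EqOn (fun x => gHat f n kp i x * gHat f n kp j x)
        (fun x => (1 / (n : ℝ) ^ 2 * 2 ^ s) *
          (fun y => f (2 * n) i y * f (2 * n) j y) (2 ^ (s + 2) *
            (x - 1 / 2 ^ s))) (Set.Ioo (1 / 2 ^ s) (2 / 2 ^ s)) := fun x hx => by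
      have hs0 : √((2 : ℝ) ^ s) * √(2 ^ s) = 2 ^ s := Real.mul_self_sqrt (by positivity)
      simp only
      rw [gHat_of_piece f hs.1 hs.2 hx.1 hx.2, gHat_of_piece f hs.1 hs.2 hx.1 hx.2]
      linear_combination (1 / (n : ℝ) ^ 2 * f (2 * n) i (2 ^ (s + 2) * (x - 1 / 2 ^ s)) *
        f (2 * n) j (2 ^ (s + 2) * (x - 1 / 2 ^ s))) * hs0
    rw [intervalIntegral.integral_congr_Ioo_of_le (by gcongr; norm_num) this,
      intervalIntegral.integral_const_mul,
      integral_affine_piece (fun y => f (2 * n) i y * f (2 * n) j y), e2,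
      hM.integral_mul_shift hi hj, pow_add 2 _ 2]
    split_ifs
    · field_simp
      norm_num
    · simp
  have last : ∫ x in (1 / 2 : ℝ)..1, gHat f n kp i x * gHat f n kp j x
      = (1 / 2) * if i = j then 1 else 0 := by
    have : Set.EqOn (fun x => gHat f n kp i x * gHat f n kp j x)
        (fun x => rademacher (kp + 4 + i) x * rademacher (kp + 4 + j) x) (Set.Ioo (1 / 2) 1) :=
      fun x hx => by
        simp only
        rw [gHat_of_last_piece f hn hx.1 hx.2.le, gHat_of_last_piece f hn hx.1 hx.2.le]
    rw [intervalIntegral.integral_congr_Ioo_of_le (by norm_num) this,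
      integral_upper_half_rademacher_mul (by omega) (by omega)]
    simp only [Nat.add_left_cancel_iff]
    split_ifs <;> simp
  rw [first, last, Finset.sum_congr rfl mids, Finset.sum_const, Nat.card_Icc, nsmul_eq_mul]
  split_ifs
  · have : ((2 * n ^ 2 + 1 - 2 : ℕ) : ℝ) = 2 * (n : ℝ) ^ 2 - 1 := by
      rw [Nat.cast_sub (by omega)]; push_cast; ring
    rw [this]
    field_simp
    ring
  · simp

theorem lineStep_gFirst {f : ℕ → ℕ → ℝ → ℝ} (hf : ∀ k ≥ 1, IsMenshovSystem k (f k))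
    {i : ℕ} (hi : i < 2 ^ 2) : LineStep (i + 10) (gFirst f i) := by
  intro x y h
  have h1 := h.le_iff (s := 1) (by omega) 1
  push_cast at h1
  rw [pow_one] at h1
  have h2 : f 2 i (8 * x - 2) = f 2 i (8 * y - 2) := by
    have := ((hf 2 (by omega)).lineStep hi).affine (a := 3) (-2) x y (h.mono (by omega))
    simp only at this
    norm_num [← sub_eq_add_neg] at this
    exact this
  simp only [gFirst, h1, h2]
  rw [lineStep_rademacher (9 + i) x y (h.mono (by omega))]

theorem integral_gFirst {f : ℕ → ℕ → ℝ → ℝ} (hf : ∀ k ≥ 1, IsMenshovSystem k (f k))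
    {i : ℕ} (hi : i < 2 ^ 2) : ∫ x in (0 : ℝ)..1, gFirst f i x = 0 := by
  have hv := intervalIntegrable_step (lineStep_gFirst hf hi).mem
  rw [← intervalIntegral.integral_add_adjacent_intervals (b := 1 / 2)
    (hv.mono_set (uIcc_subset_unit le_rfl (by norm_num) (by norm_num)))
    (hv.mono_set (uIcc_subset_unit (by norm_num) (by norm_num) (by norm_num))),
    intervalIntegral.integral_congr_Ioo_of_le (a := 0) (g := fun x => 2 * f 2 i (8 * x - 2))
      (by norm_num) (fun x hx => by simp only [gFirst, if_pos hx.2.le]),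
    intervalIntegral.integral_congr_Ioo_of_le (a := 1 / 2) (g := rademacher (9 + i)) (by norm_num)
      (fun x hx => by simp only [gFirst, if_neg (not_le.2 hx.1)]),
    integral_upper_half_rademacher (by omega), intervalIntegral.integral_const_mul,
    intervalIntegral.integral_comp_mul_sub _ (by norm_num)]
  norm_num
  exact (hf 2 (by omega)).mean_zero i hi

theorem integral_gFirst_mul {f : ℕ → ℕ → ℝ → ℝ} (hf : ∀ k ≥ 1, IsMenshovSystem k (f k))
    {i j : ℕ} (hi : i < 2 ^ 2) (hj : j < 2 ^ 2) :
    ∫ x in (0 : ℝ)..1, gFirst f i x * gFirst f j x = if i = j then 1 else 0 := by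
  have hv := (IsStep.mul ⟨_, (lineStep_gFirst hf hi).mem⟩
    ⟨_, (lineStep_gFirst hf hj).mem⟩).intervalIntegrable
  rw [← intervalIntegral.integral_add_adjacent_intervals (b := 1 / 2)
    (hv.mono_set (uIcc_subset_unit le_rfl (by norm_num) (by norm_num)))
    (hv.mono_set (uIcc_subset_unit (by norm_num) (by norm_num) (by norm_num))),
    intervalIntegral.integral_congr_Ioo_of_le (a := 0)
      (g := fun x => 4 * (fun y => f 2 i y * f 2 j y) (8 * x - 2)) (by norm_num)
      (fun x hx => by simp only [gFirst, if_pos hx.2.le]; ring),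
    intervalIntegral.integral_congr_Ioo_of_le (a := 1 / 2)
      (g := fun x => rademacher (9 + i) x * rademacher (9 + j) x) (by norm_num)
      (fun x hx => by simp only [gFirst, if_neg (not_le.2 hx.1)]),
    integral_upper_half_rademacher_mul (by omega) (by omega), intervalIntegral.integral_const_mul,
    intervalIntegral.integral_comp_mul_sub (fun y => f 2 i y * f 2 j y) (by norm_num)]
  norm_num
  rw [(hf 2 (by omega)).orthonormal i hi j hj]
  split_ifs <;> norm_num

/-- The bound on the level does not depend on i, so one level serves all g_n^i and the set that
defines k_n is nonempty. -/
theorem lineStep_gStep {f : ℕ → ℕ → ℝ → ℝ} (hf : ∀ k ≥ 1, IsMenshovSystem k (f k))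
    {n kp i : ℕ} (hn : 1 ≤ n) (hi : i < 2 ^ (2 * n)) :
    ∃ Q, LineStep Q (gStep f n kp i) ∧ Q ≤ 4 * n ^ 2 + 2 * n + 2 * kp + 2 ^ (2 * n) + 20 := by
  rcases eq_or_ne n 1 with rfl | h1
  · refine ⟨i + 10, ?_, by omega⟩
    have := lineStep_gFirst hf (i := i) (by simpa using hi)
    intro x y h
    simp only [gStep, if_true]
    exact this x y h
  · refine ⟨(2 * n ^ 2 + 2 * n + kp + i + 5) + (kp + 2 * n ^ 2 + 2), ?_, by omega⟩
    have := (lineStep_gHat hf (kp := kp) hn hi).fract.affine (a := kp + 2 * n ^ 2 + 2) 0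
    intro x y h
    simp only [gStep, if_neg h1]
    have := this x y h
    simpa using this

theorem integral_gStep {f : ℕ → ℕ → ℝ → ℝ} (hf : ∀ k ≥ 1, IsMenshovSystem k (f k))
    {n kp i : ℕ} (hn : 1 ≤ n) (hi : i < 2 ^ (2 * n)) :
    ∫ x in (0 : ℝ)..1, gStep f n kp i x = 0 := by
  rcases eq_or_ne n 1 with rfl | h1
  · simp only [gStep, if_true]
    exact integral_gFirst hf (by simpa using hi)
  · simp only [gStep, if_neg h1]
    rw [integral_dilate (lineStep_gHat hf hn hi), integral_gHat hf hn hi]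

theorem ip_gStep {f : ℕ → ℕ → ℝ → ℝ} (hf : ∀ k ≥ 1, IsMenshovSystem k (f k))
    {n kp i j : ℕ} (hn : 1 ≤ n) (hi : i < 2 ^ (2 * n)) (hj : j < 2 ^ (2 * n)) :
    ip (gStep f n kp i) (gStep f n kp j) = if i = j then 1 else 0 := by
  rcases eq_or_ne n 1 with rfl | h1
  · simp only [ip, gStep, if_true]
    exact integral_gFirst_mul hf (by simpa using hi) (by simpa using hj)
  · simp only [ip, gStep, if_neg h1]
    have h : LineStep (2 * n ^ 2 + 2 * n + kp + (i + j) + 5)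
        (fun x => gHat f n kp i x * gHat f n kp j x) := fun x y h => by
      simp only
      rw [lineStep_gHat hf (kp := kp) hn hi x y (h.mono (by omega)),
        lineStep_gHat hf (kp := kp) hn hj x y (h.mono (by omega))]
    rw [integral_dilate h, integral_gHat_mul hf hn hi hj]

theorem periodic_gStep {f : ℕ → ℕ → ℝ → ℝ} {n kp i : ℕ} (hn : 2 ≤ n) :
    Function.Periodic (gStep f n kp i) (1 / 2 ^ (kp + 2 * n ^ 2 + 2)) := fun x => by
  have hK : (0 : ℝ) < 2 ^ (kp + 2 * n ^ 2 + 2) := by positivity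
  simp only [gStep, if_neg (show n ≠ 1 by omega), mul_add, mul_one_div_cancel hK.ne',
    Int.fract_add_one]

/-! ### The levels k_n. -/

theorem step_gFun {f : ℕ → ℕ → ℝ → ℝ} (hf : ∀ k ≥ 1, IsMenshovSystem k (f k))
    {n i : ℕ} (hn : 1 ≤ n) (hi : i < 2 ^ (2 * n)) :
    gFun f n i ∈ dyadicStep 0 1 (kSeq f n) := by
  obtain ⟨m, rfl⟩ : ∃ m, n = m + 1 := ⟨n - 1, by omega⟩
  -- Without nonemptiness the infimum would be the default value 0 and would say nothing.
  have hne : {K | ∀ i < 2 ^ (2 * (m + 1)), gStep f (m + 1) (kSeq f m) i ∈ dyadicStep 0 1 K}.Nonempty :=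
    ⟨_, fun i hi => by
      obtain ⟨Q, h, hQ⟩ := lineStep_gStep hf (kp := kSeq f m) hn hi
      exact dyadicStep_mono hQ h.mem⟩
  have := Nat.sInf_mem hne i hi
  rw [kSeq]
  exact this

theorem isStep_gFun {f : ℕ → ℕ → ℝ → ℝ} (hf : ∀ k ≥ 1, IsMenshovSystem k (f k))
    {n i : ℕ} (hn : 1 ≤ n) (hi : i < 2 ^ (2 * n)) : IsStep (gFun f n i) :=
  ⟨_, step_gFun hf hn hi⟩

theorem ip_gFun {f : ℕ → ℕ → ℝ → ℝ} (hf : ∀ k ≥ 1, IsMenshovSystem k (f k))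
    {n i j : ℕ} (hn : 1 ≤ n) (hi : i < 2 ^ (2 * n)) (hj : j < 2 ^ (2 * n)) :
    ip (gFun f n i) (gFun f n j) = if i = j then 1 else 0 := ip_gStep hf hn hi hj

theorem integral_gFun {f : ℕ → ℕ → ℝ → ℝ} (hf : ∀ k ≥ 1, IsMenshovSystem k (f k))
    {n i : ℕ} (hn : 1 ≤ n) (hi : i < 2 ^ (2 * n)) :
    ∫ x in (0 : ℝ)..1, gFun f n i x = 0 := integral_gStep hf hn hi

theorem ip_step_gFun {f : ℕ → ℕ → ℝ → ℝ} (hf : ∀ k ≥ 1, IsMenshovSystem k (f k))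
    {n i : ℕ} (hn : 2 ≤ n) (hi : i < 2 ^ (2 * n)) {u : ℝ → ℝ}
    (hu : u ∈ dyadicStep 0 1 (kSeq f (n - 1) + 2 * n ^ 2 + 2)) : ip u (gFun f n i) = 0 :=
  ip_eq_zero_of_periodic hu (isStep_gFun hf (by omega) hi).intervalIntegrable (periodic_gStep hn)
    (integral_gFun hf (by omega) hi)

/-- Otherwise g_n^0 would be a step function at the scale of its own period; having mean 0 it would
be orthogonal to itself, against its unit norm. -/
theorem kSeq_lt {f : ℕ → ℕ → ℝ → ℝ} (hf : ∀ k ≥ 1, IsMenshovSystem k (f k))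
    {n : ℕ} (hn : 2 ≤ n) : kSeq f (n - 1) + 2 * n ^ 2 + 2 < kSeq f n := by
  by_contra h
  have hi : 0 < 2 ^ (2 * n) := by positivity
  have h1 := ip_step_gFun hf hn hi (dyadicStep_mono (not_lt.1 h) (step_gFun hf (by omega) hi))
  rw [ip_gFun hf (by omega) hi hi] at h1
  simp at h1

/-- At level 0 the function g_1^0 would be constant, which mean 0 and norm 1 exclude. -/
theorem kSeq_one_pos {f : ℕ → ℕ → ℝ → ℝ} (hf : ∀ k ≥ 1, IsMenshovSystem k (f k)) : 1 ≤ kSeq f 1 := by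
  by_contra h
  have hi : 0 < 2 ^ (2 * 1) := by positivity
  have h0 : kSeq f 1 = 0 := by omega
  have hs := step_gFun hf (n := 1) le_rfl hi
  rw [h0] at hs
  have h1 := ip_gFun hf (n := 1) le_rfl hi hi
  have h2 := integral_gFun hf (n := 1) le_rfl hi
  rw [integral_step hs] at h2
  rw [ip_eq_sum hs hs] at h1
  simp at h1 h2
  rw [h2] at h1
  simp at h1

theorem kSeq_strictMono {f : ℕ → ℕ → ℝ → ℝ} (hf : ∀ k ≥ 1, IsMenshovSystem k (f k)) : StrictMono (kSeq f) := by
  apply strictMono_nat_of_lt_succ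
  intro n
  rcases Nat.eq_zero_or_pos n with rfl | h
  · have := kSeq_one_pos hf
    rw [show kSeq f 0 = 0 from rfl]
    exact this
  · have := kSeq_lt hf (n := n + 1) (by omega)
    rw [Nat.add_sub_cancel] at this
    omega

/-- This keeps the natural subtractions in the definition of m_n from being truncated. The
strictness leaves room for at least one ψ_ν in each generation. -/
theorem two_pow_kSeq {f : ℕ → ℕ → ℝ → ℝ} (hf : ∀ k ≥ 1, IsMenshovSystem k (f k))
    {n : ℕ} (hn : 1 ≤ n) :
    2 ^ (2 * n) + 2 + (if n = 1 then 0 else 2 ^ (kSeq f (n - 1) + 2)) < 2 ^ (kSeq f n + 2) := by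
  rcases eq_or_ne n 1 with rfl | h1
  · have : 2 ^ 3 ≤ 2 ^ (kSeq f 1 + 2) :=
      Nat.pow_le_pow_right (by norm_num) (by have := kSeq_one_pos hf; omega)
    simp
    omega
  · rw [if_neg h1]
    have h := kSeq_lt hf (n := n) (by omega)
    have h2 : n ≤ n ^ 2 := by nlinarith
    have e1 : 2 ^ (2 * n + 1) ≤ 2 ^ (kSeq f n) := Nat.pow_le_pow_right (by norm_num) (by omega)
    have e2 : 2 ^ (kSeq f (n - 1) + 2) ≤ 2 ^ (kSeq f n) :=
      Nat.pow_le_pow_right (by norm_num) (by omega)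
    have e3 : 2 ^ 1 ≤ 2 ^ (2 * n) := Nat.pow_le_pow_right (by norm_num) (by omega)
    rw [pow_succ] at e1
    rw [pow_add _ (kSeq f n)]
    omega

end DivONS

end

noncomputable section

namespace DivONS

open MeasureTheory Filter Topology

/-! ### Blocks of indices -/

theorem blockOf_le {s : ℕ → ℕ} {l n : ℕ} (h : l ≤ s n) : blockOf s l ≤ n :=
  Nat.sInf_le h

theorem blockOf_eq {s : ℕ → ℕ} (hs : Monotone s) {n l : ℕ} (h1 : s (n - 1) < l)
    (h2 : l ≤ s n) : blockOf s l = n := by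
  refine le_antisymm (blockOf_le h2) ?_
  by_contra h
  have hm : l ≤ s (blockOf s l) := Nat.sInf_mem (s := {n | l ≤ s n}) ⟨n, h2⟩
  have := hs (show blockOf s l ≤ n - 1 by omega)
  omega

theorem le_blockOf {s : ℕ → ℕ} (hs : StrictMono s) (l : ℕ) : l ≤ s (blockOf s l) :=
  Nat.sInf_mem (s := {n | l ≤ s n}) ⟨l, hs.le_apply⟩

theorem lt_of_blockOf_pos {s : ℕ → ℕ} {l : ℕ} (h : 1 ≤ blockOf s l) :
    s (blockOf s l - 1) < l := by
  by_contra h'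
  have := blockOf_le (not_lt.1 h')
  omega

theorem blockOf_pos {s : ℕ → ℕ} (hs : StrictMono s) {l : ℕ} (h : s 0 < l) : 1 ≤ blockOf s l := by
  by_contra h'
  have h0 : blockOf s l = 0 := by omega
  have := le_blockOf hs l
  rw [h0] at this
  omega

theorem blockOf_mono {s : ℕ → ℕ} (hs : StrictMono s) : Monotone (blockOf s) := fun _ b hab =>
  blockOf_le (hab.trans (le_blockOf hs b))

theorem tendsto_blockOf {s : ℕ → ℕ} (hs : StrictMono s) : Tendsto (blockOf s) atTop atTop := by
  refine tendsto_atTop_mono' atTop (f₁ := blockOf s) (Eventually.of_forall fun _ => le_rfl) ?_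
  refine (blockOf_mono hs).tendsto_atTop_atTop fun n => ⟨s n + 1, ?_⟩
  by_contra h
  have h1 := le_blockOf hs (s n + 1)
  have h2 := hs.monotone (show blockOf s (s n + 1) ≤ n by omega)
  omega

theorem sum_blocks {M : Type*} [AddCommMonoid M] {s : ℕ → ℕ} (hs : Monotone s) (h0 : s 0 = 0)
    (F : ℕ → M) (n : ℕ) : ∑ l ∈ Finset.Icc 1 (s n), F l
      = ∑ m ∈ Finset.Icc 1 n, ∑ t ∈ Finset.Icc 1 (s m - s (m - 1)), F (s (m - 1) + t) := by
  induction n with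
  | zero => simp [h0]
  | succ n ih =>
    rw [← Finset.insert_Icc_right_eq_Icc_add_one (by omega), Finset.sum_insert (by simp), ← ih,
      Nat.add_sub_cancel]
    have hle := hs (Nat.le_succ n)
    rw [Nat.succ_eq_add_one] at hle
    have e : Finset.Icc 1 (s (n + 1)) = Finset.Icc 1 (s n) ∪
        (Finset.Icc 1 (s (n + 1) - s n)).map (addLeftEmbedding (s n)) := by
      ext l
      simp only [Finset.mem_union, Finset.mem_map, Finset.mem_Icc, addLeftEmbedding_apply]
      constructor
      · intro h
        by_cases h' : l ≤ s n
        · exact Or.inl ⟨h.1, h'⟩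
        · exact Or.inr ⟨l - s n, by omega, by omega⟩
      · rintro (h | ⟨a, h, rfl⟩) <;> omega
    rw [e, Finset.sum_union, Finset.sum_map, add_comm]
    · rfl
    · rw [Finset.disjoint_left]
      intro l h1 h2
      simp only [Finset.mem_map, Finset.mem_Icc, addLeftEmbedding_apply] at h1 h2
      obtain ⟨a, h, rfl⟩ := h2
      omega

/-! ### The orthogonal matrices -/

/-- These are the three relations behind orthonormality of the columns, for two copies of the last
column, for the last with another, and for two others. With σ = L^{-1/2} and c = (1+σ)/(L-1), the
last says that the correction σ² - 2c + (L-1)c² to the unit matrix vanishes. -/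
theorem kappa_identity {L : ℝ} (hL : 1 < L) :
    L * (1 / √L) ^ 2 = 1 ∧ (L - 1) * (1 / (L - 1) * (1 + 1 / √L)) = 1 + 1 / √L ∧
    (1 / √L) ^ 2 + (L - 1) * (1 / (L - 1) * (1 + 1 / √L)) ^ 2
      - 2 * (1 / (L - 1) * (1 + 1 / √L)) = 0 := by
  have h0 : (0 : ℝ) < L := by linarith
  have h1 : L - 1 ≠ 0 := by linarith
  have a : L * (1 / √L) ^ 2 = 1 := by
    rw [div_pow, Real.sq_sqrt h0.le]; field_simp
  have b : (L - 1) * (1 / (L - 1) * (1 + 1 / √L)) = 1 + 1 / √L := by field_simp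
  refine ⟨a, b, ?_⟩
  set σ := 1 / √L
  set c := 1 / (L - 1) * (1 + σ)
  apply mul_left_cancel₀ h1
  linear_combination a + (L - 1) * c * b + (σ - 1) * b

/-- The entry of the matrix in the lower left part. -/
theorem kappa_of_ne {L i j : ℕ} (hi : i ≠ 1) (hj : j ≠ L) :
    kappa L i j = (if j + 1 = i then 1 else 0) - 1 / ((L : ℝ) - 1) * (1 + 1 / √(L : ℝ)) := by
  rw [kappa, if_neg (by tauto)]

theorem kappa_first (L j : ℕ) : kappa L 1 j = 1 / √(L : ℝ) := by simp [kappa]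

theorem kappa_last (L i : ℕ) : kappa L i L = 1 / √(L : ℝ) := by simp [kappa]

theorem sum_delta_sub (s : Finset ℕ) (a b : ℕ) (ha : a ∈ s) (hb : b ∈ s) (c : ℝ) :
    ∑ i ∈ s, ((if a = i then (1 : ℝ) else 0) - c) * ((if b = i then (1 : ℝ) else 0) - c)
      = (if a = b then 1 else 0) - 2 * c + s.card * c ^ 2 := by
  have : ∀ i ∈ s, ((if a = i then (1 : ℝ) else 0) - c) * ((if b = i then (1 : ℝ) else 0) - c)
      = (if a = i then (if b = i then (1 : ℝ) else 0) else 0) - c * (if a = i then (1 : ℝ) else 0)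
        - c * (if b = i then (1 : ℝ) else 0) + c ^ 2 := by
    intro i _
    split_ifs <;> ring
  rw [Finset.sum_congr rfl this]
  simp only [Finset.sum_add_distrib, Finset.sum_sub_distrib, ← Finset.mul_sum,
    Finset.sum_ite_eq, ha, hb, if_true, Finset.sum_const, nsmul_eq_mul]
  have e : (if b = a then (1 : ℝ) else 0) = if a = b then 1 else 0 := by simp only [eq_comm]
  rw [e]
  ring

theorem sum_delta_sub_one (s : Finset ℕ) (a : ℕ) (ha : a ∈ s) (c : ℝ) :
    ∑ i ∈ s, ((if a = i then (1 : ℝ) else 0) - c) = 1 - s.card * c := by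
  simp [Finset.sum_sub_distrib, ha]

theorem kappa_col {L j j' : ℕ} (hL : 2 ≤ L) (hj : j ∈ Finset.Icc 1 L) (hj' : j' ∈ Finset.Icc 1 L) :
    ∑ i ∈ Finset.Icc 1 L, kappa L i j * kappa L i j' = if j = j' then 1 else 0 := by
  have hL' : (1 : ℝ) < L := by exact_mod_cast hL
  obtain ⟨ka, kb, kc⟩ := kappa_identity hL'
  rw [Finset.mem_Icc] at hj hj'
  have hcard : ((Finset.Icc 2 L).card : ℝ) = L - 1 := by
    rw [Nat.card_Icc, Nat.cast_sub (by omega)]; push_cast; ring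
  rw [← Finset.insert_Icc_add_one_left_eq_Icc (by omega : 1 ≤ L), Finset.sum_insert (by simp),
    kappa_first, kappa_first]
  norm_num only
  by_cases h1 : j = L <;> by_cases h2 : j' = L
  · subst h1; subst h2
    simp only [kappa_last, Finset.sum_const, nsmul_eq_mul, hcard, if_true]
    linear_combination ka
  · subst h1
    rw [Finset.sum_congr rfl fun i hi => by
      rw [kappa_last, kappa_of_ne (by rw [Finset.mem_Icc] at hi; omega) h2], ← Finset.mul_sum,
      sum_delta_sub_one _ _ (by rw [Finset.mem_Icc]; omega), hcard, if_neg (Ne.symm h2)]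
    linear_combination (-(1 / √(j : ℝ))) * kb
  · subst h2
    rw [Finset.sum_congr rfl fun i hi => by
      rw [kappa_last, kappa_of_ne (by rw [Finset.mem_Icc] at hi; omega) h1], ← Finset.sum_mul,
      sum_delta_sub_one _ _ (by rw [Finset.mem_Icc]; omega), hcard, if_neg h1]
    linear_combination (-(1 / √(j' : ℝ))) * kb
  · rw [Finset.sum_congr rfl fun i hi => by
      rw [kappa_of_ne (by rw [Finset.mem_Icc] at hi; omega) h1,
        kappa_of_ne (by rw [Finset.mem_Icc] at hi; omega) h2],
      sum_delta_sub _ _ _ (by rw [Finset.mem_Icc]; omega) (by rw [Finset.mem_Icc]; omega), hcard]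
    have e : (if j + 1 = j' + 1 then (1 : ℝ) else 0) = if j = j' then 1 else 0 := by simp
    rw [e]
    linear_combination kc

theorem sum_Icc_one_eq_range (F : ℕ → ℝ) (L : ℕ) :
    ∑ i ∈ Finset.Icc 1 L, F i = ∑ i ∈ Finset.range L, F (i + 1) := by
  rw [← Finset.Ico_add_one_right_eq_Icc, Finset.sum_Ico_eq_sum_range, Nat.add_sub_cancel]
  exact Finset.sum_congr rfl fun i _ => by rw [add_comm]

/-- For a square matrix a left inverse is a right inverse, so orthonormal columns force orthonormal
rows. -/
theorem kappa_row {L i i' : ℕ} (hL : 2 ≤ L) (hi : i ∈ Finset.Icc 1 L) (hi' : i' ∈ Finset.Icc 1 L) :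
    ∑ j ∈ Finset.Icc 1 L, kappa L i j * kappa L i' j = if i = i' then 1 else 0 := by
  have hmul : (Matrix.of fun a b : Fin L => kappa L (b + 1) (a + 1)) *
      (Matrix.of fun a b : Fin L => kappa L (a + 1) (b + 1)) = 1 := by
    ext a b
    rw [Matrix.mul_apply, Matrix.one_apply]
    have := kappa_col hL (j := a + 1) (j' := b + 1) (by rw [Finset.mem_Icc]; omega)
      (by rw [Finset.mem_Icc]; omega)
    rw [sum_Icc_one_eq_range] at this
    simp only [Matrix.of_apply]
    rw [Fin.sum_univ_eq_sum_range (fun c => kappa L (c + 1) (a + 1) * kappa L (c + 1) (b + 1)) L]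
    simp only [add_left_inj, Fin.val_inj] at this
    exact this
  have hmul' := mul_eq_one_comm.1 hmul
  rw [Finset.mem_Icc] at hi hi'
  have := congrFun (congrFun hmul' ⟨i - 1, by omega⟩) ⟨i' - 1, by omega⟩
  rw [Matrix.mul_apply, Matrix.one_apply] at this
  simp only [Matrix.of_apply] at this
  rw [Fin.sum_univ_eq_sum_range
    (fun c => kappa L (i - 1 + 1) (c + 1) * kappa L (i' - 1 + 1) (c + 1)) L] at this
  rw [sum_Icc_one_eq_range]
  rw [show i - 1 + 1 = i by omega, show i' - 1 + 1 = i' by omega] at this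
  rw [this]
  have e : ((⟨i - 1, by omega⟩ : Fin L) = ⟨i' - 1, by omega⟩) ↔ i = i' := by
    rw [Fin.mk.injEq]; omega
  simp only [e]

/-- The functions `∑ i, κ_ij e_i`. -/
def rot (L : ℕ) (e : ℕ → ℝ → ℝ) (j : ℕ) (x : ℝ) : ℝ := ∑ i ∈ Finset.Icc 1 L, kappa L i j * e i x

theorem rot_inverse {L : ℕ} (hL : 2 ≤ L) (e : ℕ → ℝ → ℝ) {i : ℕ} (hi : i ∈ Finset.Icc 1 L) (x : ℝ) :
    ∑ j ∈ Finset.Icc 1 L, kappa L i j * rot L e j x = e i x := by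
  simp only [rot, Finset.mul_sum]
  rw [Finset.sum_comm]
  rw [Finset.sum_congr rfl fun i' hi' => by
    rw [Finset.sum_congr rfl fun j _ => (mul_assoc _ _ _).symm, ← Finset.sum_mul,
      kappa_row hL hi hi']]
  simp only [ite_mul, one_mul, zero_mul, Finset.sum_ite_eq, hi, if_true]

/-- The blocks `rot (L n) (e n) 1, …, rot (L n) (e n) (L n)`, `n = 1, 2, …`, in a row, where
`s n = L 1 + … + L n`. -/
def concat (s L : ℕ → ℕ) (e : ℕ → ℕ → ℝ → ℝ) (l : ℕ) : ℝ → ℝ :=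
  rot (L (blockOf s l)) (e (blockOf s l)) (l - s (blockOf s l - 1))

/-- The block lengths `L n` belong to the end points `s n`. -/
structure IsBlockLength (s L : ℕ → ℕ) : Prop where
  zero : s 0 = 0
  succ : ∀ n ≥ 1, s n = s (n - 1) + L n
  two_le : ∀ n ≥ 1, 2 ≤ L n

theorem IsBlockLength.strictMono {s L : ℕ → ℕ} (h : IsBlockLength s L) : StrictMono s := by
  apply strictMono_nat_of_lt_succ
  intro n
  have h1 := h.succ (n + 1) (by omega)
  have h2 := h.two_le (n + 1) (by omega)
  rw [Nat.add_sub_cancel] at h1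
  omega

theorem IsBlockLength.cases {s L : ℕ → ℕ} (h : IsBlockLength s L) {l : ℕ} (hl : 1 ≤ l) :
    1 ≤ blockOf s l ∧ l - s (blockOf s l - 1) ∈ Finset.Icc 1 (L (blockOf s l)) ∧
      l = s (blockOf s l - 1) + (l - s (blockOf s l - 1)) := by
  have h1 := blockOf_pos h.strictMono (l := l) (by rw [h.zero]; omega)
  have h2 := lt_of_blockOf_pos h1
  have h3 := le_blockOf h.strictMono l
  have h4 := h.succ _ h1
  rw [Finset.mem_Icc]
  refine ⟨h1, ⟨by omega, by omega⟩, by omega⟩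

theorem IsBlockLength.blockOf_add {s L : ℕ → ℕ} (h : IsBlockLength s L) {n t : ℕ} (hn : 1 ≤ n)
    (ht : t ∈ Finset.Icc 1 (L n)) : blockOf s (s (n - 1) + t) = n := by
  rw [Finset.mem_Icc] at ht
  exact blockOf_eq h.strictMono.monotone (by omega) (by rw [h.succ n hn]; omega)

theorem IsBlockLength.concat_add {s L : ℕ → ℕ} (h : IsBlockLength s L) (e : ℕ → ℕ → ℝ → ℝ)
    {n t : ℕ} (hn : 1 ≤ n) (ht : t ∈ Finset.Icc 1 (L n)) :
    concat s L e (s (n - 1) + t) = rot (L n) (e n) t := by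
  rw [concat, h.blockOf_add hn ht, Nat.add_sub_cancel_left]

theorem isStep_rot {L : ℕ} {e : ℕ → ℝ → ℝ} (he : ∀ i ∈ Finset.Icc 1 L, IsStep (e i)) (j : ℕ) :
    IsStep (rot L e j) := IsStep.sum fun i hi => (he i hi).const_mul _

section

variable {s L : ℕ → ℕ} {e : ℕ → ℕ → ℝ → ℝ} 

theorem isStep_concat (h : IsBlockLength s L)
    (he : ∀ n ≥ 1, ∀ i ∈ Finset.Icc 1 (L n), IsStep (e n i)) {l : ℕ} (hl : 1 ≤ l) :
    IsStep (concat s L e l) := isStep_rot (he _ (h.cases hl).1) _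

theorem ip_concat_eq_zero (h : IsBlockLength s L)
    (he : ∀ n ≥ 1, ∀ i ∈ Finset.Icc 1 (L n), IsStep (e n i)) {w : ℝ → ℝ} (hw : IsStep w)
    (h0 : ∀ n ≥ 1, ∀ i ∈ Finset.Icc 1 (L n), ip (e n i) w = 0) {l : ℕ} (hl : 1 ≤ l) :
    ip (concat s L e l) w = 0 := by
  have h1 := (h.cases hl).1
  have := ip_sum_left (fun i => kappa (L (blockOf s l)) i (l - s (blockOf s l - 1))) (he _ h1) hw
  refine Eq.trans this (Finset.sum_eq_zero fun i hi => ?_)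
  rw [h0 _ h1 i hi, mul_zero]

theorem ip_concat (h : IsBlockLength s L)
    (he : ∀ n ≥ 1, ∀ i ∈ Finset.Icc 1 (L n), IsStep (e n i))
    (ho : ∀ n ≥ 1, ∀ i ∈ Finset.Icc 1 (L n), ∀ n' ≥ 1, ∀ i' ∈ Finset.Icc 1 (L n'),
      ip (e n i) (e n' i') = if n = n' ∧ i = i' then 1 else 0) {l l' : ℕ} (hl : 1 ≤ l)
    (hl' : 1 ≤ l') : ip (concat s L e l) (concat s L e l') = if l = l' then 1 else 0 := by
  obtain ⟨a1, a2, a3⟩ := h.cases hl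
  obtain ⟨b1, b2, b3⟩ := h.cases hl'
  have key := ip_sum_sum (fun i => kappa (L (blockOf s l)) i (l - s (blockOf s l - 1)))
    (fun i => kappa (L (blockOf s l')) i (l' - s (blockOf s l' - 1))) (he _ a1) (he _ b1)
  refine Eq.trans key ?_
  by_cases hb : blockOf s l = blockOf s l'
  · rw [← hb] at b2 b3 ⊢
    have : ∀ i ∈ Finset.Icc 1 (L (blockOf s l)), ∀ i' ∈ Finset.Icc 1 (L (blockOf s l)),
        ip (e (blockOf s l) i) (e (blockOf s l) i') = if i = i' then 1 else 0 := fun i hi i' hi' => by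
      rw [ho _ a1 i hi _ a1 i' hi']; simp
    rw [Finset.sum_congr rfl fun i hi => Finset.sum_congr rfl fun i' hi' => by rw [this i hi i' hi']]
    simp only [mul_ite, mul_one, mul_zero, Finset.sum_ite_eq]
    rw [Finset.sum_congr rfl fun i hi => by rw [if_pos hi]]
    rw [kappa_col (h.two_le _ a1) a2 b2]
    have : l - s (blockOf s l - 1) = l' - s (blockOf s l - 1) ↔ l = l' := by omega
    simp only [this]
  · rw [if_neg (fun h => hb (by rw [h]))]
    refine Finset.sum_eq_zero fun i hi => Finset.sum_eq_zero fun i' hi' => ?_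
    rw [ho _ a1 i hi _ b1 i' hi', if_neg (fun h => hb h.1), mul_zero]

/-- A function orthogonal to all the rotated functions is orthogonal to the original ones. -/
theorem integral_eq_zero_of_concat (h : IsBlockLength s L)
    (he : ∀ n ≥ 1, ∀ i ∈ Finset.Icc 1 (L n), IsStep (e n i)) {u : ℝ → ℝ}
    (hu : IntervalIntegrable u volume 0 1)
    (h0 : ∀ l ≥ 1, ∫ x in (0 : ℝ)..1, concat s L e l x * u x = 0) {n i : ℕ} (hn : 1 ≤ n)
    (hi : i ∈ Finset.Icc 1 (L n)) : ∫ x in (0 : ℝ)..1, e n i x * u x = 0 := by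
  have e1 : ∀ x, e n i x * u x = ∑ j ∈ Finset.Icc 1 (L n),
      kappa (L n) i j * (rot (L n) (e n) j x * u x) := fun x => by
    rw [← rot_inverse (h.two_le n hn) (e n) hi x, Finset.sum_mul]
    exact Finset.sum_congr rfl fun j _ => mul_assoc _ _ _
  simp only [e1]
  rw [intervalIntegral.integral_finsetSum]
  · refine Finset.sum_eq_zero fun j hj => ?_
    have := h0 (s (n - 1) + j) (by rw [Finset.mem_Icc] at hj; omega)
    rw [h.concat_add e hn hj] at this
    rw [intervalIntegral.integral_const_mul, this, mul_zero]
  · intro j _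
    obtain ⟨K, hK⟩ := isStep_rot (he n hn) j
    exact (integral_step_mul hK hu).1.const_mul _

end

end DivONS

end

noncomputable section

namespace DivONS

open MeasureTheory Filter Topology

/-! ### Orthogonality of the generating functions -/

section

variable {f : ℕ → ℕ → ℝ → ℝ}

/-- The gap of two levels matters because h_1^{(k_l+1)} is a step function of level k_l+2 and must
still lie below the later generations. -/
theorem kSeq_add_two_le (hf : ∀ k ≥ 1, IsMenshovSystem k (f k)) {l n : ℕ} (hl : 1 ≤ l)
    (h : l < n) : kSeq f l + 2 ≤ kSeq f n := by
  have h1 := kSeq_lt hf (n := n) (by omega)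
  have h2 := (kSeq_strictMono hf).monotone (show l ≤ n - 1 by omega)
  omega

theorem kSeq_mono (hf : ∀ k ≥ 1, IsMenshovSystem k (f k)) {l n : ℕ} (h : l ≤ n) :
    kSeq f l ≤ kSeq f n := (kSeq_strictMono hf).monotone h

theorem ip_r_r (hf : ∀ k ≥ 1, IsMenshovSystem k (f k)) (l l' : ℕ) :
    ip (rademacher (kSeq f l)) (rademacher (kSeq f l')) = if l = l' then 1 else 0 := by
  rw [ip_rademacher]
  simp only [(kSeq_strictMono hf).injective.eq_iff]

theorem ip_h_h (hf : ∀ k ≥ 1, IsMenshovSystem k (f k)) (l l' : ℕ) :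
    ip (haarFirst (kSeq f l + 1)) (haarFirst (kSeq f l' + 1)) = if l = l' then 1 else 0 := by
  have key : ∀ a b, a < b → ip (haarFirst (kSeq f a + 1)) (haarFirst (kSeq f b + 1)) = 0 :=
    fun a b h => ip_haarFirst_step (dyadicStep_mono
      (by have := kSeq_strictMono hf h; omega) (step_haarFirst _))
  rcases lt_trichotomy l l' with h | h | h
  · rw [key _ _ h, if_neg h.ne]
  · rw [h, ip_haarFirst_self, if_pos rfl]
  · rw [ip_comm, key _ _ h, if_neg h.ne']

/-- The function of higher frequency is orthogonal to the step space containing the other one. At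
equal index the Haar function, of generation k_l+1, is the finer of the two. -/
theorem ip_r_h (hf : ∀ k ≥ 1, IsMenshovSystem k (f k)) {l l' : ℕ} (hl' : 1 ≤ l') :
    ip (rademacher (kSeq f l)) (haarFirst (kSeq f l' + 1)) = 0 := by
  rcases le_or_gt l l' with h | h
  · exact ip_haarFirst_step (dyadicStep_mono (by have := kSeq_mono hf h; omega) (step_rademacher _))
  · rw [ip_comm]
    exact ip_rademacher_step (kSeq_add_two_le hf hl' h) (step_haarFirst _)

theorem ip_g_g (hf : ∀ k ≥ 1, IsMenshovSystem k (f k)) {n i n' i' : ℕ} (hn : 1 ≤ n)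
    (hi : i < 2 ^ (2 * n)) (hn' : 1 ≤ n') (hi' : i' < 2 ^ (2 * n')) :
    ip (gFun f n i) (gFun f n' i') = if n = n' ∧ i = i' then 1 else 0 := by
  have key : ∀ a b i i', 1 ≤ a → i < 2 ^ (2 * a) → i' < 2 ^ (2 * b) → a < b →
      ip (gFun f a i) (gFun f b i') = 0 := fun a b i i' ha hi hi' h =>
    ip_step_gFun hf (by omega) hi' (dyadicStep_mono
      (by have := kSeq_mono hf (show a ≤ b - 1 by omega); omega) (step_gFun hf ha hi))
  rcases lt_trichotomy n n' with h | h | h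
  · rw [key _ _ _ _ hn hi hi' h, if_neg (fun h' => h.ne h'.1)]
  · subst h
    rw [ip_gFun hf hn hi hi']; simp
  · rw [ip_comm, key _ _ _ _ hn' hi' hi h, if_neg (fun h' => h.ne' h'.1)]

theorem ip_g_r (hf : ∀ k ≥ 1, IsMenshovSystem k (f k)) {n i l : ℕ} (hn : 1 ≤ n)
    (hi : i < 2 ^ (2 * n)) (hl : 1 ≤ l) : ip (gFun f n i) (rademacher (kSeq f l)) = 0 := by
  rcases le_or_gt n l with h | h
  · exact ip_rademacher_step (kSeq_mono hf h) (step_gFun hf hn hi)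
  · rw [ip_comm]
    exact ip_step_gFun hf (by omega) hi (dyadicStep_mono
      (by have := kSeq_mono hf (show l ≤ n - 1 by omega); omega) (step_rademacher _))

theorem ip_g_h (hf : ∀ k ≥ 1, IsMenshovSystem k (f k)) {n i l : ℕ} (hn : 1 ≤ n)
    (hi : i < 2 ^ (2 * n)) (hl : 1 ≤ l) : ip (gFun f n i) (haarFirst (kSeq f l + 1)) = 0 := by
  rcases le_or_gt n l with h | h
  · exact ip_haarFirst_step (dyadicStep_mono (by have := kSeq_mono hf h; omega) (step_gFun hf hn hi))
  · rw [ip_comm]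
    exact ip_step_gFun hf (by omega) hi (dyadicStep_mono
      (by have := kSeq_mono hf (show l ≤ n - 1 by omega); omega) (step_haarFirst _))

/-- The recursion of m_n is put in additive form, free of truncated subtraction, for use in
dimension counts. -/
theorem mSeq_succ_eq (hf : ∀ k ≥ 1, IsMenshovSystem k (f k)) {n : ℕ} (hn : 1 ≤ n) :
    mSeq (kSeq f) n + (if n = 1 then 0 else 2 ^ (kSeq f (n - 1) + 2)) + (2 ^ (2 * n) + 2)
      = mSeq (kSeq f) (n - 1) + 2 ^ (kSeq f n + 2) := by
  obtain ⟨m, rfl⟩ : ∃ m, n = m + 1 := ⟨n - 1, by omega⟩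
  have := two_pow_kSeq hf hn
  rw [mSeq, Nat.add_sub_cancel] at *
  have e : (if m = 0 then 0 else 2 ^ (kSeq f m + 2)) = if m + 1 = 1 then 0
    else 2 ^ (kSeq f m + 2) := by simp
  rw [e]
  omega

theorem mSeq_strictMono (hf : ∀ k ≥ 1, IsMenshovSystem k (f k)) : StrictMono (mSeq (kSeq f)) := by
  apply strictMono_nat_of_lt_succ
  intro n
  have h1 := mSeq_succ_eq hf (n := n + 1) (by omega)
  have h2 := two_pow_kSeq hf (n := n + 1) (by omega)
  rw [Nat.add_sub_cancel] at *
  omega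

/-- The generation of `ψ ν`. -/
theorem psi_block (hf : ∀ k ≥ 1, IsMenshovSystem k (f k)) {ν : ℕ} (hν : 1 ≤ ν) :
    1 ≤ blockOf (mSeq (kSeq f)) ν ∧ ν ∈ Finset.Ioc (mSeq (kSeq f) (blockOf (mSeq (kSeq f)) ν - 1))
      (mSeq (kSeq f) (blockOf (mSeq (kSeq f)) ν)) := by
  have h1 := blockOf_pos (mSeq_strictMono hf) (l := ν) hν
  exact ⟨h1, Finset.mem_Ioc.2 ⟨lt_of_blockOf_pos h1, le_blockOf (mSeq_strictMono hf) ν⟩⟩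

variable {ψ : ℕ → ℝ → ℝ}

theorem isStep_psi (hf : ∀ k ≥ 1, IsMenshovSystem k (f k))
    (hψ : IsComplement (kSeq f) (gFun f) ψ) {ν : ℕ} (hν : 1 ≤ ν) : IsStep (ψ ν) :=
  ⟨_, hψ.step _ (psi_block hf hν).1 _ (psi_block hf hν).2⟩

theorem ip_psi_psi (hf : ∀ k ≥ 1, IsMenshovSystem k (f k))
    (hψ : IsComplement (kSeq f) (gFun f) ψ) {ν ν' : ℕ} (hν : 1 ≤ ν) (hν' : 1 ≤ ν') :
    ip (ψ ν) (ψ ν') = if ν = ν' then 1 else 0 := by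
  have key : ∀ a b, 1 ≤ a → 1 ≤ b → blockOf (mSeq (kSeq f)) a < blockOf (mSeq (kSeq f)) b →
      ip (ψ a) (ψ b) = 0 := fun a b ha hb h => by
    obtain ⟨a1, a2⟩ := psi_block hf ha
    obtain ⟨b1, b2⟩ := psi_block hf hb
    rw [ip_comm]
    exact hψ.orth_prev _ (by omega) _ b2 _ (dyadicStep_mono
      (by have := kSeq_mono hf (show blockOf (mSeq (kSeq f)) a ≤ blockOf (mSeq (kSeq f)) b - 1
            by omega)
          omega) (hψ.step _ a1 _ a2))
  rcases lt_trichotomy (blockOf (mSeq (kSeq f)) ν) (blockOf (mSeq (kSeq f)) ν') with h | h | h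
  · rw [key _ _ hν hν' h, if_neg (by rintro rfl; exact lt_irrefl _ h)]
  · obtain ⟨a1, a2⟩ := psi_block hf hν
    obtain ⟨b1, b2⟩ := psi_block hf hν'
    rw [← h] at b2
    exact hψ.orthonormal _ a1 _ a2 _ b2
  · rw [ip_comm, key _ _ hν' hν h, if_neg (by rintro rfl; exact lt_irrefl _ h)]

theorem ip_psi_g (hf : ∀ k ≥ 1, IsMenshovSystem k (f k))
    (hψ : IsComplement (kSeq f) (gFun f) ψ) {ν n i : ℕ} (hν : 1 ≤ ν) (hn : 1 ≤ n)
    (hi : i < 2 ^ (2 * n)) : ip (ψ ν) (gFun f n i) = 0 := by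
  obtain ⟨a1, a2⟩ := psi_block hf hν
  rcases lt_trichotomy n (blockOf (mSeq (kSeq f)) ν) with h | h | h
  · exact hψ.orth_prev _ (by omega) _ a2 _ (dyadicStep_mono
      (by have := kSeq_mono hf (show n ≤ blockOf (mSeq (kSeq f)) ν - 1 by omega)
          omega) (step_gFun hf hn hi))
  · rw [h] at hi ⊢
    exact hψ.orth_g _ a1 _ a2 _ hi
  · exact ip_step_gFun hf (by omega) hi (dyadicStep_mono
      (by have := kSeq_mono hf (show blockOf (mSeq (kSeq f)) ν ≤ n - 1 by omega)
          omega) (hψ.step _ a1 _ a2))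

theorem ip_psi_r (hf : ∀ k ≥ 1, IsMenshovSystem k (f k))
    (hψ : IsComplement (kSeq f) (gFun f) ψ) {ν l : ℕ} (hν : 1 ≤ ν) (hl : 1 ≤ l) :
    ip (ψ ν) (rademacher (kSeq f l)) = 0 := by
  obtain ⟨a1, a2⟩ := psi_block hf hν
  rcases lt_trichotomy l (blockOf (mSeq (kSeq f)) ν) with h | h | h
  · exact hψ.orth_prev _ (by omega) _ a2 _ (dyadicStep_mono
      (by have := kSeq_mono hf (show l ≤ blockOf (mSeq (kSeq f)) ν - 1 by omega)
          omega) (step_rademacher _))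
  · rw [h]
    exact hψ.orth_rademacher _ a1 _ a2
  · exact ip_rademacher_step (kSeq_add_two_le hf a1 h) (hψ.step _ a1 _ a2)

theorem ip_psi_h (hf : ∀ k ≥ 1, IsMenshovSystem k (f k))
    (hψ : IsComplement (kSeq f) (gFun f) ψ) {ν l : ℕ} (hν : 1 ≤ ν) (hl : 1 ≤ l) :
    ip (ψ ν) (haarFirst (kSeq f l + 1)) = 0 := by
  obtain ⟨a1, a2⟩ := psi_block hf hν
  rcases lt_trichotomy l (blockOf (mSeq (kSeq f)) ν) with h | h | h
  · exact hψ.orth_prev _ (by omega) _ a2 _ (dyadicStep_mono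
      (by have := kSeq_mono hf (show l ≤ blockOf (mSeq (kSeq f)) ν - 1 by omega)
          omega) (step_haarFirst _))
  · rw [h]
    exact hψ.orth_haar _ a1 _ a2
  · exact ip_haarFirst_step (dyadicStep_mono
      (by have := kSeq_add_two_le hf a1 h; omega) (hψ.step _ a1 _ a2))

end

/-! ### The functions `ξ` -/

/-- The functions that are combined into the block `ν` of `ξ`. -/
def xiArg (k : ℕ → ℕ) (ψ : ℕ → ℝ → ℝ) (ν i : ℕ) : ℝ → ℝ :=
  if i = 1 then ψ ν else haarFirst (k (qOf k ν + i - 1) + 1)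

theorem two_le_pOf (k : ℕ → ℕ) (ν : ℕ) : 2 ≤ pOf k ν :=
  Nat.pow_le_pow_right (n := 2) (by norm_num)
    (show 1 ≤ 2 * (k (blockOf (mSeq k) ν) + 1) by omega)

theorem phi_eq_rot (k : ℕ → ℕ) (ψ : ℕ → ℝ → ℝ) (ν j : ℕ) :
    phi k ψ ν j = rot (pOf k ν) (xiArg k ψ ν) j := by
  ext x
  rw [phi, rot, ← Finset.insert_Icc_add_one_left_eq_Icc
    (show 1 ≤ pOf k ν by have := two_le_pOf k ν; omega), Finset.sum_insert (by simp)]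
  congr 1
  refine Finset.sum_congr rfl fun i hi => ?_
  rw [Finset.mem_Icc] at hi
  rw [xiArg, if_neg (by omega)]

theorem xi_eq_concat (k : ℕ → ℕ) (ψ : ℕ → ℝ → ℝ) (l : ℕ) :
    xi k ψ l = concat (rhoOf k) (pOf k) (xiArg k ψ) l := phi_eq_rot _ _ _ _

theorem isBlockLength_rhoOf (k : ℕ → ℕ) : IsBlockLength (rhoOf k) (pOf k) where
  zero := by simp [rhoOf]
  succ n hn := by
    obtain ⟨m, rfl⟩ : ∃ m, n = m + 1 := ⟨n - 1, by omega⟩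
    rw [rhoOf, rhoOf, ← Finset.insert_Icc_right_eq_Icc_add_one (by omega),
      Finset.sum_insert (by simp), Nat.add_sub_cancel]
    ring
  two_le n _ := two_le_pOf k n

theorem qOf_succ (k : ℕ → ℕ) {ν : ℕ} (hν : 1 ≤ ν) : qOf k (ν + 1) = qOf k ν + (pOf k ν - 1) := by
  rw [qOf, qOf, Finset.sum_Ico_succ_top hν]

theorem qOf_mono (k : ℕ → ℕ) : Monotone (qOf k) := fun _ _ h =>
  Finset.sum_le_sum_of_subset (Finset.Ico_subset_Ico_right h)

theorem le_qOf (k : ℕ → ℕ) {ν : ℕ} (hν : 1 ≤ ν) : ν ≤ qOf k ν + 1 := by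
  induction ν, hν using Nat.le_induction with
  | base => omega
  | succ n hn ih =>
    rw [qOf_succ k hn]
    have := two_le_pOf k n
    omega

section

variable {f : ℕ → ℕ → ℝ → ℝ} {ψ : ℕ → ℝ → ℝ}

theorem isStep_xiArg (hf : ∀ k ≥ 1, IsMenshovSystem k (f k))
    (hψ : IsComplement (kSeq f) (gFun f) ψ) {ν : ℕ} (hν : 1 ≤ ν) (i : ℕ) :
    IsStep (xiArg (kSeq f) ψ ν i) := by
  rw [xiArg]
  split_ifs
  · exact isStep_psi hf hψ hν
  · exact isStep_haarFirst _

theorem isStep_xi (hf : ∀ k ≥ 1, IsMenshovSystem k (f k))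
    (hψ : IsComplement (kSeq f) (gFun f) ψ) {l : ℕ} (hl : 1 ≤ l) : IsStep (xi (kSeq f) ψ l) := by
  rw [xi_eq_concat]
  exact isStep_concat (isBlockLength_rhoOf _) (fun n hn i _ => isStep_xiArg hf hψ hn i) hl

theorem ip_xi_eq_zero (hf : ∀ k ≥ 1, IsMenshovSystem k (f k))
    (hψ : IsComplement (kSeq f) (gFun f) ψ) {w : ℝ → ℝ} (hw : IsStep w)
    (h1 : ∀ ν ≥ 1, ip (ψ ν) w = 0) (h2 : ∀ l ≥ 1, ip (haarFirst (kSeq f l + 1)) w = 0)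
    {l : ℕ} (hl : 1 ≤ l) : ip (xi (kSeq f) ψ l) w = 0 := by
  rw [xi_eq_concat]
  refine ip_concat_eq_zero (isBlockLength_rhoOf _) (fun n hn i _ => isStep_xiArg hf hψ hn i) hw
    (fun n hn i hi => ?_) hl
  rw [Finset.mem_Icc] at hi
  rw [xiArg]
  split_ifs
  · exact h1 n hn
  · exact h2 _ (by omega)

theorem ip_xi_g (hf : ∀ k ≥ 1, IsMenshovSystem k (f k))
    (hψ : IsComplement (kSeq f) (gFun f) ψ) {l n i : ℕ} (hl : 1 ≤ l) (hn : 1 ≤ n)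
    (hi : i < 2 ^ (2 * n)) : ip (xi (kSeq f) ψ l) (gFun f n i) = 0 :=
  ip_xi_eq_zero hf hψ (isStep_gFun hf hn hi) (fun _ hν => ip_psi_g hf hψ hν hn hi)
    (fun l hl => by rw [ip_comm]; exact ip_g_h hf hn hi hl) hl

theorem ip_xi_r (hf : ∀ k ≥ 1, IsMenshovSystem k (f k))
    (hψ : IsComplement (kSeq f) (gFun f) ψ) {l l' : ℕ} (hl : 1 ≤ l) (hl' : 1 ≤ l') :
    ip (xi (kSeq f) ψ l) (rademacher (kSeq f l')) = 0 :=
  ip_xi_eq_zero hf hψ (isStep_rademacher _) (fun _ hν => ip_psi_r hf hψ hν hl')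
    (fun l hl => by rw [ip_comm]; exact ip_r_h hf hl) hl

theorem ip_xi_xi (hf : ∀ k ≥ 1, IsMenshovSystem k (f k))
    (hψ : IsComplement (kSeq f) (gFun f) ψ) {l l' : ℕ} (hl : 1 ≤ l) (hl' : 1 ≤ l') :
    ip (xi (kSeq f) ψ l) (xi (kSeq f) ψ l') = if l = l' then 1 else 0 := by
  rw [xi_eq_concat, xi_eq_concat]
  refine ip_concat (isBlockLength_rhoOf _) (fun n hn i _ => isStep_xiArg hf hψ hn i)
    (fun n hn i hi n' hn' i' hi' => ?_) hl hl'
  rw [Finset.mem_Icc] at hi hi'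
  rw [xiArg, xiArg]
  split_ifs with a b c d e
  · rw [ip_psi_psi hf hψ hn hn', if_pos c.1]
  · rw [ip_psi_psi hf hψ hn hn', if_neg (by intro h; exact c ⟨h, by omega⟩)]
  · omega
  · exact ip_psi_h hf hψ hn (by omega)
  · omega
  · rw [ip_comm]; exact ip_psi_h hf hψ hn' (by omega)
  · rw [ip_h_h hf, if_pos]
    rename_i hh
    rw [hh.1, hh.2]
  · rw [ip_h_h hf, if_neg]
    rename_i hh
    intro h
    -- The Haar functions used by ψ_m have the numbers from q_m + 1 to q_{m+1}. These ranges are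
    -- consecutive, so no Haar function is used twice.
    have key : ∀ m m' j j' : ℕ, 1 ≤ m → 1 ≤ m' → j ≤ pOf (kSeq f) m → 2 ≤ j' → m < m' →
        qOf (kSeq f) m + j - 1 < qOf (kSeq f) m' + j' - 1 := fun m m' j j' hm hm' hj hj' hmm => by
      have h1 := qOf_succ (kSeq f) hm
      have h2 := qOf_mono (kSeq f) (show m + 1 ≤ m' by omega)
      omega
    rcases lt_trichotomy n n' with h' | h' | h'
    · have := key n n' i i' hn hn' hi.2 (by omega) h'
      omega
    · subst h'
      exact hh ⟨rfl, by omega⟩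
    · have := key n' n i' i hn' hn hi'.2 (by omega) h'
      omega

end

/-! ### The functions `Υ` -/

/-- The functions that are combined into the block `n` of `Υ`. -/
def upsArg (k : ℕ → ℕ) (g : ℕ → ℕ → ℝ → ℝ) (ψ : ℕ → ℝ → ℝ) (n i : ℕ) : ℝ → ℝ :=
  if i = 1 then xi k ψ n else g n (i - 2)

theorem upsilonBlock_eq_rot (k : ℕ → ℕ) (g : ℕ → ℕ → ℝ → ℝ) (ψ : ℕ → ℝ → ℝ) (n j : ℕ) :
    upsilonBlock k g ψ n j = rot (2 ^ (2 * n) + 1) (upsArg k g ψ n) j := by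
  ext x
  rw [upsilonBlock, rot, ← Finset.insert_Icc_add_one_left_eq_Icc
    (Nat.le_add_left 1 (2 ^ (2 * n))), Finset.sum_insert (by simp)]
  congr 1
  refine Finset.sum_congr rfl fun i hi => ?_
  rw [Finset.mem_Icc] at hi
  rw [upsArg, if_neg (by omega)]

theorem upsilon_eq_concat (k : ℕ → ℕ) (g : ℕ → ℕ → ℝ → ℝ) (ψ : ℕ → ℝ → ℝ) (l : ℕ) :
    upsilon k g ψ l = concat muSeq (fun n => 2 ^ (2 * n) + 1) (upsArg k g ψ) l :=
  upsilonBlock_eq_rot _ _ _ _ _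

theorem isBlockLength_muSeq : IsBlockLength muSeq (fun n => 2 ^ (2 * n) + 1) where
  zero := rfl
  succ n hn := by
    obtain ⟨m, rfl⟩ : ∃ m, n = m + 1 := ⟨n - 1, by omega⟩
    rw [muSeq, Nat.add_sub_cancel, add_assoc]
  two_le n _ := by
    have : 1 ≤ 2 ^ (2 * n) := Nat.one_le_two_pow
    omega

section

variable {f : ℕ → ℕ → ℝ → ℝ} {ψ : ℕ → ℝ → ℝ}

theorem isStep_upsArg (hf : ∀ k ≥ 1, IsMenshovSystem k (f k))
    (hψ : IsComplement (kSeq f) (gFun f) ψ) {n i : ℕ} (hn : 1 ≤ n)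
    (hi : i ∈ Finset.Icc 1 (2 ^ (2 * n) + 1)) : IsStep (upsArg (kSeq f) (gFun f) ψ n i) := by
  rw [Finset.mem_Icc] at hi
  rw [upsArg]
  split_ifs
  · exact isStep_xi hf hψ hn
  · exact isStep_gFun hf hn (by omega)

theorem isStep_upsilon (hf : ∀ k ≥ 1, IsMenshovSystem k (f k))
    (hψ : IsComplement (kSeq f) (gFun f) ψ) {l : ℕ} (hl : 1 ≤ l) :
    IsStep (upsilon (kSeq f) (gFun f) ψ l) := by
  rw [upsilon_eq_concat]
  exact isStep_concat isBlockLength_muSeq (fun n hn i hi => isStep_upsArg hf hψ hn hi) hl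

theorem ip_upsilon_r (hf : ∀ k ≥ 1, IsMenshovSystem k (f k))
    (hψ : IsComplement (kSeq f) (gFun f) ψ) {l l' : ℕ} (hl : 1 ≤ l) (hl' : 1 ≤ l') :
    ip (upsilon (kSeq f) (gFun f) ψ l) (rademacher (kSeq f l')) = 0 := by
  rw [upsilon_eq_concat]
  refine ip_concat_eq_zero isBlockLength_muSeq (fun n hn i hi => isStep_upsArg hf hψ hn hi)
    (isStep_rademacher _) (fun n hn i hi => ?_) hl
  rw [Finset.mem_Icc] at hi
  rw [upsArg]
  split_ifs
  · exact ip_xi_r hf hψ hn hl'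
  · exact ip_g_r hf hn (by omega) hl'

theorem ip_upsilon_upsilon (hf : ∀ k ≥ 1, IsMenshovSystem k (f k))
    (hψ : IsComplement (kSeq f) (gFun f) ψ) {l l' : ℕ} (hl : 1 ≤ l) (hl' : 1 ≤ l') :
    ip (upsilon (kSeq f) (gFun f) ψ l) (upsilon (kSeq f) (gFun f) ψ l')
      = if l = l' then 1 else 0 := by
  rw [upsilon_eq_concat, upsilon_eq_concat]
  refine ip_concat isBlockLength_muSeq (fun n hn i hi => isStep_upsArg hf hψ hn hi)
    (fun n hn i hi n' hn' i' hi' => ?_) hl hl'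
  rw [Finset.mem_Icc] at hi hi'
  rw [upsArg, upsArg]
  by_cases a : i = 1 <;> by_cases b : i' = 1
  · rw [if_pos a, if_pos b, ip_xi_xi hf hψ hn hn']
    simp [a, b]
  · rw [if_pos a, if_neg b, ip_xi_g hf hψ hn hn' (by omega), if_neg (by omega)]
  · rw [if_neg a, if_pos b, ip_comm, ip_xi_g hf hψ hn' hn (by omega), if_neg (by omega)]
  · rw [if_neg a, if_neg b, ip_g_g hf hn (by omega) hn' (by omega)]
    have : (i - 2 = i' - 2) ↔ i = i' := by omega
    simp only [this]

end

/-! ### The system `χ` -/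

section

variable {k : ℕ → ℕ} {Y : ℕ → ℝ → ℝ} {ν : ℕ → ℕ}

theorem strictMono_add_id (hν : StrictMono ν) : StrictMono (fun j => ν j + j) :=
  fun _ _ h => Nat.add_lt_add (hν h) h

/-- The position of `r_(k_t)` in the sequence `χ`. -/
def radPos (ν : ℕ → ℕ) (t : ℕ) : ℕ := t + blockOf ν t

/-- The position of `Υ_i` in the sequence `χ`. -/
def upsPos (ν : ℕ → ℕ) (i : ℕ) : ℕ := ν (i - 1) + i

theorem radPos_strictMono (hν : StrictMono ν) : StrictMono (radPos ν) := fun _ _ h =>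
  Nat.add_lt_add_of_lt_of_le h (blockOf_mono hν h.le)

theorem upsPos_strictMono (hν : StrictMono ν) : StrictMono (upsPos ν) := fun a b h =>
  Nat.add_lt_add_of_le_of_lt (hν.monotone (by omega)) h

theorem radPos_ne_upsPos (hν : StrictMono ν) (t : ℕ) {i : ℕ} (hi : 1 ≤ i) :
    radPos ν t ≠ upsPos ν i := by
  rw [radPos, upsPos]
  rcases le_or_gt t (ν (i - 1)) with h | h
  · have := blockOf_le h
    omega
  · have h1 := blockOf_mono hν h.le
    have : i ≤ blockOf ν t := by
      by_contra h'
      have h2 := le_blockOf hν t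
      have h3 := hν.monotone (show blockOf ν t ≤ i - 1 by omega)
      omega
    omega

theorem chiSeq_radPos (hν : StrictMono ν) {t : ℕ} (ht : 1 ≤ t) :
    chiSeq k Y ν (radPos ν t) = rademacher (k t) := by
  have h1 := le_blockOf hν t
  rcases Nat.eq_zero_or_pos (blockOf ν t) with h0 | h0
  · have hb : blockOf (fun j => ν j + j) (radPos ν t) = 0 := by
      rw [h0] at h1
      have := blockOf_le (s := fun j => ν j + j) (l := radPos ν t) (n := 0)
        (by simp only [radPos, h0]; omega)
      omega
    simp only [chiSeq, hb, if_true, chiBlock]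
    rw [radPos, h0, add_zero]
  · have h2 := lt_of_blockOf_pos h0
    have hb : blockOf (fun j => ν j + j) (radPos ν t) = blockOf ν t := by
      refine blockOf_eq (strictMono_add_id hν).monotone ?_ ?_
      · simp only [radPos]; omega
      · simp only [radPos]; omega
    simp only [chiSeq, hb, chiBlock, if_neg (show blockOf ν t ≠ 0 by omega)]
    rw [radPos, if_neg (by omega)]
    congr 2
    omega

theorem chiSeq_upsPos (hν : StrictMono ν) {i : ℕ} (hi : 1 ≤ i) :
    chiSeq k Y ν (upsPos ν i) = Y i := by
  have h1 := hν (show i - 1 < i by omega)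
  have hb : blockOf (fun j => ν j + j) (upsPos ν i) = i := by
    refine blockOf_eq (strictMono_add_id hν).monotone ?_ ?_
    · simp only [upsPos]; omega
    · simp only [upsPos]; omega
  simp only [chiSeq, hb, chiBlock, if_neg (show i ≠ 0 by omega)]
  rw [upsPos, if_pos (by omega)]

theorem pos_cases (hν : StrictMono ν) {l : ℕ} (hl : 1 ≤ l) :
    (∃ t ≥ 1, l = radPos ν t) ∨ ∃ i ≥ 1, l = upsPos ν i := by
  have hs := strictMono_add_id hν
  have h1 : l ≤ ν _ + _ := le_blockOf hs l
  set j := blockOf (fun j => ν j + j) l with hj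
  rcases Nat.eq_zero_or_pos j with h0 | h0
  · left
    rw [h0] at h1
    refine ⟨l, hl, ?_⟩
    have := blockOf_le (s := ν) (l := l) (n := 0) (by omega)
    rw [radPos]; omega
  · have h2 : ν (j - 1) + (j - 1) < l := lt_of_blockOf_pos (s := fun j => ν j + j) h0
    rcases eq_or_ne l (upsPos ν j) with h | h
    · exact Or.inr ⟨j, h0, h⟩
    · left
      rw [upsPos] at h
      refine ⟨l - j, by omega, ?_⟩
      rw [radPos, blockOf_eq hν.monotone (n := j) (by omega) (by omega)]
      omega

/-- The two position maps are increasing, have disjoint ranges and together exhaust the positive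
integers. This is what splits a block partial sum into a Rademacher part and an Υ part. -/
theorem sum_positions {M : Type*} [AddCommMonoid M] (hν : StrictMono ν) (F : ℕ → M) (j : ℕ) :
    ∑ l ∈ Finset.Icc 1 (ν j + j), F l
      = ∑ t ∈ Finset.Icc 1 (ν j), F (radPos ν t) + ∑ i ∈ Finset.Icc 1 j, F (upsPos ν i) := by
  have e : Finset.Icc 1 (ν j + j) = (Finset.Icc 1 (ν j)).map ⟨_, (radPos_strictMono hν).injective⟩ ∪
      (Finset.Icc 1 j).map ⟨_, (upsPos_strictMono hν).injective⟩ := by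
    ext l
    simp only [Finset.mem_union, Finset.mem_map, Finset.mem_Icc, Function.Embedding.coeFn_mk]
    constructor
    · intro h
      rcases pos_cases hν h.1 with ⟨t, ht, rfl⟩ | ⟨i, hi, rfl⟩
      · refine Or.inl ⟨t, ⟨ht, ?_⟩, rfl⟩
        by_contra h'
        have h2 := h.2
        rw [radPos] at h2
        have : j ≤ blockOf ν t := by
          by_contra h3
          have h4 := le_blockOf hν t
          have h5 := hν.monotone (show blockOf ν t ≤ j by omega)
          omega
        omega
      · refine Or.inr ⟨i, ⟨hi, ?_⟩, rfl⟩
        by_contra h'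
        have h2 := h.2
        rw [upsPos] at h2
        have h5 := hν.monotone (show j ≤ i - 1 by omega)
        omega
    · rintro (⟨t, ht, rfl⟩ | ⟨i, hi, rfl⟩)
      · rw [radPos]
        have := blockOf_le ht.2
        omega
      · rw [upsPos]
        have h5 := hν.monotone (show i - 1 ≤ j by omega)
        omega
  rw [e, Finset.sum_union, Finset.sum_map, Finset.sum_map]
  · rfl
  · rw [Finset.disjoint_left]
    intro l h1 h2
    simp only [Finset.mem_map, Finset.mem_Icc, Function.Embedding.coeFn_mk] at h1 h2
    obtain ⟨t, _, rfl⟩ := h1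
    obtain ⟨i, hi, h⟩ := h2
    exact radPos_ne_upsPos hν t hi.1 h.symm

end

theorem IsBlocking.strictMono {l₀ : ℕ} {k ν N : ℕ → ℕ} {Y : ℕ → ℝ → ℝ}
    (h : IsBlocking l₀ k Y ν N) (hk : StrictMono k) : StrictMono ν := by
  have hpos : ∀ j, 1 ≤ ν j := by
    intro j
    induction j with
    | zero => exact h.pos
    | succ j ih =>
      have := h.succ (j + 1) (by omega)
      rw [Nat.add_sub_cancel] at this
      omega
  apply strictMono_nat_of_lt_succ
  intro j
  have h1 := h.succ (j + 1) (by omega)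
  have h2 := h.large (j + 1) (by omega)
  rw [Nat.add_sub_cancel] at h1 h2
  -- Together with ν j ≥ 1 this gives N (j+1) ≥ 1, so the block adds at least one Rademacher
  -- function.
  have h3 : ν j ≤ k (ν j) := hk.le_apply
  have h4 : 2 ^ 1 ≤ 2 ^ N (j + 1) :=
    Nat.pow_le_pow_right (by norm_num) (by have := hpos j; omega)
  omega

theorem ip_chi {l₀ : ℕ} {D : Choices} (hD : D.Admissible l₀) {l l' : ℕ} (hl : 1 ≤ l)
    (hl' : 1 ≤ l') : ip (D.χ l) (D.χ l') = if l = l' then 1 else 0 := by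
  have hf := hD.menshov
  have hν := hD.blocking.strictMono (kSeq_strictMono hf)
  rcases pos_cases hν hl with ⟨t, ht, rfl⟩ | ⟨i, hi, rfl⟩ <;>
    rcases pos_cases hν hl' with ⟨t', ht', rfl⟩ | ⟨i', hi', rfl⟩
  · rw [Choices.χ, chiSeq_radPos hν ht, chiSeq_radPos hν ht']
    simp only [(radPos_strictMono hν).injective.eq_iff]
    exact ip_r_r hf _ _
  · rw [Choices.χ, chiSeq_radPos hν ht, chiSeq_upsPos hν hi', ip_comm,
      if_neg (radPos_ne_upsPos hν t hi')]
    exact ip_upsilon_r hf hD.complement hi' ht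
  · rw [Choices.χ, chiSeq_upsPos hν hi, chiSeq_radPos hν ht',
      if_neg (radPos_ne_upsPos hν t' hi).symm]
    exact ip_upsilon_r hf hD.complement hi ht'
  · rw [Choices.χ, chiSeq_upsPos hν hi, chiSeq_upsPos hν hi']
    simp only [(upsPos_strictMono hν).injective.eq_iff]
    exact ip_upsilon_upsilon hf hD.complement hi hi'

theorem isStep_chi {l₀ : ℕ} {D : Choices} (hD : D.Admissible l₀) {l : ℕ} (hl : 1 ≤ l) :
    IsStep (D.χ l) := by
  have hf := hD.menshov
  have hν := hD.blocking.strictMono (kSeq_strictMono hf)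
  rcases pos_cases hν hl with ⟨t, ht, rfl⟩ | ⟨i, hi, rfl⟩
  · rw [Choices.χ, chiSeq_radPos hν ht]
    exact isStep_rademacher _
  · rw [Choices.χ, chiSeq_upsPos hν hi]
    exact isStep_upsilon hf hD.complement hi

end DivONS

end

noncomputable section

namespace DivONS

open MeasureTheory Filter Topology

/-! ### Step functions as vectors -/

/-- The vector of the normalized values of a step function. -/
def toVec (K : ℕ) (u : ℝ → ℝ) : EuclideanSpace ℝ (Fin (2 ^ K)) :=
  WithLp.toLp 2 fun i => u (mid K i) / √(2 ^ K)

/-- The step function with given normalized values. -/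
def ofVec (K : ℕ) (v : EuclideanSpace ℝ (Fin (2 ^ K))) (x : ℝ) : ℝ :=
  if h : ⌊2 ^ K * x⌋₊ < 2 ^ K then √(2 ^ K) * v ⟨⌊2 ^ K * x⌋₊, h⟩ else 0

/-- The normalization by √(2^K) makes `toVec` an isometry on step functions of level K, so that
finite-dimensional linear algebra applies to them. -/
theorem inner_toVec {K : ℕ} {u v : ℝ → ℝ} (hu : u ∈ dyadicStep 0 1 K)
    (hv : v ∈ dyadicStep 0 1 K) : inner ℝ (toVec K u) (toVec K v) = ip u v := by
  rw [ip_eq_sum hu hv, PiLp.inner_apply,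
    ← Fin.sum_univ_eq_sum_range (fun i => u (mid K i) * v (mid K i) * (1 / 2 ^ K))]
  refine Finset.sum_congr rfl fun i _ => ?_
  simp only [toVec, RCLike.inner_apply, conj_trivial]
  have : √((2 : ℝ) ^ K) * √(2 ^ K) = 2 ^ K := Real.mul_self_sqrt (by positivity)
  rw [div_mul_div_comm, this]
  ring

theorem ofVec_of_cell {K i : ℕ} (hi : i < 2 ^ K) (v : EuclideanSpace ℝ (Fin (2 ^ K))) {x : ℝ}
    (h1 : (i : ℝ) < 2 ^ K * x) (h2 : 2 ^ K * x < i + 1) : ofVec K v x = √(2 ^ K) * v ⟨i, hi⟩ := by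
  have hfl : ⌊2 ^ K * x⌋₊ = i := by
    rw [Nat.floor_eq_iff (by have : (0 : ℝ) ≤ i := by positivity
                             linarith)]
    exact ⟨h1.le, h2⟩
  rw [ofVec]
  simp only [hfl, hi, dif_pos]

theorem step_ofVec (K : ℕ) (v : EuclideanSpace ℝ (Fin (2 ^ K))) :
    ofVec K v ∈ dyadicStep 0 1 K := by
  rw [mem_dyadicStep_iff]
  rintro x y ⟨i, hi, h1, h2, h3, h4⟩
  rw [ofVec_of_cell hi v h1 h2, ofVec_of_cell hi v h3 h4]

theorem mid_mem (K i : ℕ) : (i : ℝ) < 2 ^ K * mid K i ∧ 2 ^ K * mid K i < i + 1 := by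
  have h0 : (0 : ℝ) < 2 ^ K := by positivity
  constructor <;> rw [mid, mul_div_cancel₀ _ h0.ne'] <;> linarith

theorem toVec_ofVec (K : ℕ) (v : EuclideanSpace ℝ (Fin (2 ^ K))) : toVec K (ofVec K v) = v := by
  ext i
  have h0 : √((2 : ℝ) ^ K) ≠ 0 := by positivity
  simp only [toVec]
  rw [ofVec_of_cell i.2 v (mid_mem K i).1 (mid_mem K i).2]
  field_simp

/-- The normalized indicator function of the dyadic interval number `i` of level `K`. -/
def cellFn (K : ℕ) (i : Fin (2 ^ K)) : ℝ → ℝ := ofVec K (EuclideanSpace.single i 1)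

theorem ip_cellFn (K : ℕ) (i j : Fin (2 ^ K)) :
    ip (cellFn K i) (cellFn K j) = if i = j then 1 else 0 := by
  rw [cellFn, cellFn, ← inner_toVec (step_ofVec _ _) (step_ofVec _ _), toVec_ofVec, toVec_ofVec]
  rw [EuclideanSpace.inner_single_left]
  simp

/-! ### One generation of functions -/

/-- The dimension of the space spanned by the earlier generations. -/
def prevDim (k : ℕ → ℕ) (n : ℕ) : ℕ := if n = 1 then 0 else 2 ^ (k (n - 1) + 2)

/-- An orthonormal system in `E^(k_n + 2)`: a basis of `E^(k_(n-1) + 2)` if `n ≥ 2`, the functions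
`g_n^i`, and `r_(k_n)`, `h_1^(k_n + 1)`. -/
def known (f : ℕ → ℕ → ℝ → ℝ) (n : ℕ) :
    Fin (prevDim (kSeq f) n) ⊕ Fin (2 ^ (2 * n)) ⊕ Fin 2 → ℝ → ℝ
  | .inl i => if h : (i : ℕ) < 2 ^ (kSeq f (n - 1) + 2) then cellFn (kSeq f (n - 1) + 2) ⟨i, h⟩ else 0
  | .inr (.inl i) => gFun f n i
  | .inr (.inr i) => if i = 0 then rademacher (kSeq f n) else haarFirst (kSeq f n + 1)

theorem prevDim_lt {k : ℕ → ℕ} {n : ℕ} (i : Fin (prevDim k n)) :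
    2 ≤ n ∨ n = 0 := by
  by_contra h
  have hn : n = 1 := by omega
  have := i.2
  simp [prevDim, hn] at this

theorem known_inl (f : ℕ → ℕ → ℝ → ℝ) {n : ℕ} (i : Fin (prevDim (kSeq f) n)) :
    ∃ h : (i : ℕ) < 2 ^ (kSeq f (n - 1) + 2),
      known f n (.inl i) = cellFn (kSeq f (n - 1) + 2) ⟨i, h⟩ := by
  have h1 := prevDim_lt i
  have h2 : (i : ℕ) < 2 ^ (kSeq f (n - 1) + 2) := by
    refine i.2.trans_eq ?_
    rw [prevDim, if_neg (by omega)]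
  exact ⟨h2, by simp only [known, h2, dif_pos]⟩

theorem step_known {f : ℕ → ℕ → ℝ → ℝ} (hf : ∀ k ≥ 1, IsMenshovSystem k (f k)) {n : ℕ}
    (hn : 1 ≤ n) (a : Fin (prevDim (kSeq f) n) ⊕ Fin (2 ^ (2 * n)) ⊕ Fin 2) :
    known f n a ∈ dyadicStep 0 1 (kSeq f n + 2) := by
  rcases a with i | i | i
  · obtain ⟨h, e⟩ := known_inl f i
    rw [e]
    refine dyadicStep_mono ?_ (step_ofVec _ _)
    have := kSeq_mono hf (show n - 1 ≤ n by omega)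
    omega
  · exact dyadicStep_mono (by omega) (step_gFun hf hn i.2)
  · simp only [known]
    split_ifs
    · exact dyadicStep_mono (by omega) (step_rademacher _)
    · exact step_haarFirst _

theorem ip_known {f : ℕ → ℕ → ℝ → ℝ} (hf : ∀ k ≥ 1, IsMenshovSystem k (f k)) {n : ℕ}
    (hn : 1 ≤ n) (a b : Fin (prevDim (kSeq f) n) ⊕ Fin (2 ^ (2 * n)) ⊕ Fin 2) :
    ip (known f n a) (known f n b) = if a = b then 1 else 0 := by
  have hcg : ∀ (i : Fin (prevDim (kSeq f) n)) (b : Fin (2 ^ (2 * n)) ⊕ Fin 2),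
      ip (known f n (.inl i)) (known f n (.inr b)) = 0 := by
    intro i b
    obtain ⟨h, e⟩ := known_inl f i
    have hn2 : 2 ≤ n := by have := prevDim_lt i; omega
    have hk := kSeq_lt hf hn2
    rw [e]
    rcases b with j | j
    · exact ip_step_gFun hf hn2 j.2 (dyadicStep_mono (by omega) (step_ofVec _ _))
    · simp only [known]
      split_ifs
      · exact ip_rademacher_step (by omega) (step_ofVec _ _)
      · exact ip_haarFirst_step (dyadicStep_mono (by omega) (step_ofVec _ _))
  have hgr : ∀ (i : Fin (2 ^ (2 * n))) (j : Fin 2),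
      ip (known f n (.inr (.inl i))) (known f n (.inr (.inr j))) = 0 := by
    intro i j
    simp only [known]
    split_ifs
    · exact ip_g_r hf hn i.2 hn
    · exact ip_g_h hf hn i.2 hn
  rcases a with i | i | i <;> rcases b with j | j | j
  · obtain ⟨h, e⟩ := known_inl f i
    obtain ⟨h', e'⟩ := known_inl f j
    rw [e, e', ip_cellFn]
    simp [Fin.ext_iff]
  · rw [hcg]; simp
  · rw [hcg]; simp
  · rw [ip_comm, hcg]; simp
  · simp only [known]
    rw [ip_gFun hf hn i.2 j.2]; simp [Fin.ext_iff]
  · rw [hgr]; simp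
  · rw [ip_comm, hcg]; simp
  · rw [ip_comm, hgr]; simp
  · simp only [known]
    fin_cases i <;> fin_cases j
    · simp [ip_rademacher]
    · simpa using ip_r_h hf hn
    · rw [ip_comm]
      simpa using ip_r_h hf hn
    · simp [ip_haarFirst_self]

/-- The numbers m_n were chosen for this count: the known functions and the new ψ_ν are as many as
the dimension of E^{k_n+2}. -/
theorem card_generation {f : ℕ → ℕ → ℝ → ℝ} (hf : ∀ k ≥ 1, IsMenshovSystem k (f k)) {n : ℕ}
    (hn : 1 ≤ n) :
    Fintype.card ((Fin (prevDim (kSeq f) n) ⊕ Fin (2 ^ (2 * n)) ⊕ Fin 2) ⊕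
      Fin (mSeq (kSeq f) n - mSeq (kSeq f) (n - 1))) = 2 ^ (kSeq f n + 2) := by
  have h1 := mSeq_succ_eq hf hn
  have h2 := (mSeq_strictMono hf).monotone (show n - 1 ≤ n by omega)
  rw [Fintype.card_sum, Fintype.card_sum, Fintype.card_sum, Fintype.card_fin, Fintype.card_fin,
    Fintype.card_fin, Fintype.card_fin, prevDim]
  omega

/-! ### Completeness -/

/-- By the dimension count the orthonormal family F is a basis of E^{k_n+2}. The vector of the
integrals of u over the cells is orthogonal to each of its members, hence zero. -/
theorem cells_eq_zero_of_known {f : ℕ → ℕ → ℝ → ℝ} (hf : ∀ k ≥ 1, IsMenshovSystem k (f k))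
    {ψ : ℕ → ℝ → ℝ} (hψ : IsComplement (kSeq f) (gFun f) ψ) {u : ℝ → ℝ}
    (hu : IntervalIntegrable u volume 0 1) {n : ℕ} (hn : 1 ≤ n)
    (hk : ∀ a, ∫ x in (0 : ℝ)..1, known f n a x * u x = 0)
    (hp : ∀ ν ≥ 1, ∫ x in (0 : ℝ)..1, ψ ν x * u x = 0) :
    ∀ i : ℕ, i < 2 ^ (kSeq f n + 2) → ∫ x in ((i : ℝ) / 2 ^ (kSeq f n + 2))..(((i + 1 : ℕ) : ℝ) /
      2 ^ (kSeq f n + 2)), u x = 0 := by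
  set K := kSeq f n + 2 with hK
  set M := mSeq (kSeq f) n - mSeq (kSeq f) (n - 1) with hM
  have hmem : ∀ j : Fin M, mSeq (kSeq f) (n - 1) + 1 + j ∈
      Finset.Ioc (mSeq (kSeq f) (n - 1)) (mSeq (kSeq f) n) := fun j => by
    rw [Finset.mem_Ioc]; omega
  let F : (Fin (prevDim (kSeq f) n) ⊕ Fin (2 ^ (2 * n)) ⊕ Fin 2) ⊕ Fin M → ℝ → ℝ :=
    Sum.elim (known f n) (fun j => ψ (mSeq (kSeq f) (n - 1) + 1 + j))
  have hFs : ∀ a, F a ∈ dyadicStep 0 1 K := by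
    rintro (a | j)
    · exact step_known hf hn a
    · exact hψ.step n hn _ (hmem j)
  have hkp : ∀ (a : Fin (prevDim (kSeq f) n) ⊕ Fin (2 ^ (2 * n)) ⊕ Fin 2) (j : Fin M),
      ip (ψ (mSeq (kSeq f) (n - 1) + 1 + j)) (known f n a) = 0 := by
    rintro (i | i | i) j
    · obtain ⟨h, e⟩ := known_inl f i
      rw [e]
      exact hψ.orth_prev n (by have := prevDim_lt i; omega) _ (hmem j) _ (step_ofVec _ _)
    · exact hψ.orth_g n hn _ (hmem j) _ i.2
    · simp only [known]
      split_ifs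
      · exact hψ.orth_rademacher n hn _ (hmem j)
      · exact hψ.orth_haar n hn _ (hmem j)
  have hFo : ∀ a b, ip (F a) (F b) = if a = b then 1 else 0 := by
    rintro (a | j) (b | j')
    · simp only [F, Sum.elim_inl]
      rw [ip_known hf hn]; simp
    · simp only [F, Sum.elim_inl, Sum.elim_inr]
      rw [ip_comm, hkp]; simp
    · simp only [F, Sum.elim_inl, Sum.elim_inr]
      rw [hkp]; simp
    · simp only [F, Sum.elim_inr]
      refine (hψ.orthonormal n hn _ (hmem j) _ (hmem j')).trans ?_
      simp [Fin.ext_iff]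
  have hFu : ∀ a, ∫ x in (0 : ℝ)..1, F a x * u x = 0 := by
    rintro (a | j)
    · exact hk a
    · exact hp _ (by omega)
  have horth : Orthonormal ℝ (fun a => toVec K (F a)) := by
    rw [orthonormal_iff_ite]
    intro a b
    rw [inner_toVec (hFs a) (hFs b), hFo]
  obtain ⟨b, hb⟩ := Orthonormal.exists_orthonormalBasis_extension_of_card_eq (𝕜 := ℝ)
    (E := EuclideanSpace ℝ (Fin (2 ^ K)))
    (ι := (Fin (prevDim (kSeq f) n) ⊕ Fin (2 ^ (2 * n)) ⊕ Fin 2) ⊕ Fin M)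
    (by rw [finrank_euclideanSpace_fin, card_generation hf hn]) (v := fun a => toVec K (F a))
    (s := Set.univ) (horth.comp _ Subtype.val_injective)
  -- Up to the factor √(2^K), the inner product of the value vector of F a with U is the integral of
  -- F a * u.
  let U : EuclideanSpace ℝ (Fin (2 ^ K)) := WithLp.toLp 2 fun i =>
    ∫ x in ((i : ℝ) / 2 ^ K)..(((i + 1 : ℕ) : ℝ) / 2 ^ K), u x
  have hU : U = 0 := by
    apply b.repr.injective
    ext a
    rw [b.repr_apply_apply, hb a (Set.mem_univ _), map_zero, PiLp.inner_apply, PiLp.zero_apply]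
    have h1 := (integral_step_mul (hFs a) hu).2
    rw [hFu a, ← Fin.sum_univ_eq_sum_range (fun i => F a (mid K i) *
      ∫ x in ((i : ℝ) / 2 ^ K)..(((i + 1 : ℕ) : ℝ) / 2 ^ K), u x)] at h1
    have h2 := mul_eq_zero_of_right (1 / √((2 : ℝ) ^ K)) h1.symm
    rw [Finset.mul_sum] at h2
    refine Eq.trans (Finset.sum_congr rfl fun i _ => ?_) h2
    simp only [toVec, U, RCLike.inner_apply, conj_trivial]
    ring
  intro i hi
  have := congrArg (fun w : EuclideanSpace ℝ (Fin (2 ^ K)) => w ⟨i, hi⟩) hU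
  simpa [U] using this

/-- Induction on the generation: orthogonality to the basis of the previous step space is the
vanishing of the integrals over the coarser cells, and for n = 1 that part of the family is empty.
-/
theorem cells_eq_zero {f : ℕ → ℕ → ℝ → ℝ} (hf : ∀ k ≥ 1, IsMenshovSystem k (f k)) {ψ : ℕ → ℝ → ℝ}
    (hψ : IsComplement (kSeq f) (gFun f) ψ) {u : ℝ → ℝ} (hu : IntervalIntegrable u volume 0 1)
    (hr : ∀ l ≥ 1, ∫ x in (0 : ℝ)..1, rademacher (kSeq f l) x * u x = 0)
    (hh : ∀ l ≥ 1, ∫ x in (0 : ℝ)..1, haarFirst (kSeq f l + 1) x * u x = 0)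
    (hg : ∀ n ≥ 1, ∀ i < 2 ^ (2 * n), ∫ x in (0 : ℝ)..1, gFun f n i x * u x = 0)
    (hp : ∀ ν ≥ 1, ∫ x in (0 : ℝ)..1, ψ ν x * u x = 0) {n : ℕ} (hn : 1 ≤ n) :
    ∀ i : ℕ, i < 2 ^ (kSeq f n + 2) → ∫ x in ((i : ℝ) / 2 ^ (kSeq f n + 2))..(((i + 1 : ℕ) : ℝ) /
      2 ^ (kSeq f n + 2)), u x = 0 := by
  have key : ∀ m ≥ 1, ∀ b : Fin (2 ^ (2 * m)) ⊕ Fin 2,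
      ∫ x in (0 : ℝ)..1, known f m (.inr b) x * u x = 0 := by
    rintro m hm (i | i)
    · exact hg m hm i i.2
    · simp only [known]
      split_ifs
      · exact hr m hm
      · exact hh m hm
  induction n, hn using Nat.le_induction with
  | base =>
    refine cells_eq_zero_of_known hf hψ hu le_rfl ?_ hp
    rintro (i | b)
    · have := prevDim_lt i
      omega
    · exact key 1 le_rfl b
  | succ n hn ih =>
    refine cells_eq_zero_of_known hf hψ hu (by omega) ?_ hp
    rintro (i | b)
    · obtain ⟨h, e⟩ := known_inl f i
      rw [e, cellFn, (integral_step_mul (step_ofVec _ _) hu).2]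
      refine Finset.sum_eq_zero fun j hj => ?_
      rw [Finset.mem_range, Nat.add_sub_cancel] at hj
      exact mul_eq_zero_of_right _ (ih j hj)
    · exact key _ (by omega) b

/-- Dyadic intervals are presented as balls so that the differentiation theorems for doubling
measures apply to them, although their centres move. -/
theorem closedBall_mid (K i : ℕ) :
    Metric.closedBall (mid K i) (1 / 2 ^ (K + 1))
      = Set.Icc ((i : ℝ) / 2 ^ K) (((i + 1 : ℕ) : ℝ) / 2 ^ K) := by
  rw [Real.closedBall_eq_Icc, mid]
  have h0 : (2 : ℝ) ^ K ≠ 0 := by positivity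
  congr 1
  · rw [pow_succ]; field_simp; ring
  · rw [pow_succ]; push_cast; field_simp; ring

theorem tendsto_cell_radius {K : ℕ → ℕ} (hK : Tendsto K atTop atTop) :
    Tendsto (fun n => (1 : ℝ) / 2 ^ (K n + 1)) atTop (𝓝[>] 0) := by
  rw [tendsto_nhdsWithin_iff]
  refine ⟨?_, Eventually.of_forall fun n => Set.mem_Ioi.2 (by positivity)⟩
  have h1 : Tendsto (fun m : ℕ => ((1 : ℝ) / 2) ^ m) atTop (𝓝 0) :=
    tendsto_pow_atTop_nhds_zero_of_lt_one (by norm_num) (by norm_num)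
  have h2 := h1.comp (tendsto_atTop_mono (fun n => Nat.le_succ (K n)) hK)
  refine h2.congr fun n => ?_
  simp [one_div]

theorem mem_cell_of_lt {K i : ℕ} {x : ℝ} (h1 : (i : ℝ) < 2 ^ K * x) (h2 : 2 ^ K * x < i + 1) :
    x ∈ Set.Icc ((i : ℝ) / 2 ^ K) (((i + 1 : ℕ) : ℝ) / 2 ^ K) := by
  have h0 : (0 : ℝ) < 2 ^ K := by positivity
  refine ⟨(div_le_iff₀' h0).2 h1.le, (le_div_iff₀' h0).2 ?_⟩
  push_cast
  exact h2.le

/-- Lebesgue differentiation along the dyadic intervals that contain a point: all these averages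
vanish and they converge to u(x). -/
theorem ae_eq_zero_of_cells {u : ℝ → ℝ} (hu : IntervalIntegrable u volume 0 1) {K : ℕ → ℕ}
    (hK : Tendsto K atTop atTop)
    (h : ∀ n, ∀ i : ℕ, i < 2 ^ K n →
      ∫ x in ((i : ℝ) / 2 ^ K n)..(((i + 1 : ℕ) : ℝ) / 2 ^ K n), u x = 0) :
    ∀ᵐ x ∂volume.restrict (Set.Icc (0 : ℝ) 1), u x = 0 := by
  have h_int : IntegrableOn u (Set.Icc 0 1) := by
    rwa [integrableOn_Icc_iff_integrableOn_Ioc,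
      ← intervalIntegrable_iff_integrableOn_Ioc_of_le zero_le_one]
  have hw : LocallyIntegrable ((Set.Icc (0 : ℝ) 1).indicator u) volume :=
    (h_int.integrable_indicator measurableSet_Icc).locallyIntegrable
  rw [ae_restrict_iff' measurableSet_Icc]
  filter_upwards [IsUnifLocDoublingMeasure.ae_tendsto_average volume hw 1, ae_nondyadic]
    with x hx hnd hx01
  choose i hi h1 h2 using fun n => hnd.exists_cell hx01.1 hx01.2 (K n)
  have hlim := hx (fun n => mid (K n) (i n)) (fun n => (1 : ℝ) / 2 ^ (K n + 1))
    (tendsto_cell_radius hK) (Eventually.of_forall fun n => by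
      rw [one_mul, closedBall_mid]
      exact mem_cell_of_lt (h1 n) (h2 n))
  have hz : ∀ n, ⨍ y in Metric.closedBall (mid (K n) (i n)) (1 / 2 ^ (K n + 1)),
      (Set.Icc (0 : ℝ) 1).indicator u y = 0 := by
    intro n
    rw [closedBall_mid, setAverage_eq, integral_Icc_eq_integral_Ioc,
      ← intervalIntegral.integral_of_le (cell_le _ _), intervalIntegral.integral_congr
        (g := u) (fun y hy => Set.indicator_of_mem ?_ u), h n (i n) (hi n), smul_zero]
    have := cell_subset (hi n) hy
    rwa [Set.uIcc_of_le zero_le_one] at this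
  simp only [hz] at hlim
  have := tendsto_nhds_unique hlim tendsto_const_nhds
  rw [Set.indicator_of_mem hx01] at this
  exact this

theorem IsStep.memLp {u : ℝ → ℝ} (hu : IsStep u) :
    MemLp u 2 (volume.restrict (Set.Icc (0 : ℝ) 1)) := by
  have hi : ∀ v : ℝ → ℝ, IsStep v → Integrable v (volume.restrict (Set.Icc (0 : ℝ) 1)) :=
    fun v hv => by
      have := hv.intervalIntegrable
      rwa [intervalIntegrable_iff_integrableOn_Ioc_of_le zero_le_one,
        ← integrableOn_Icc_iff_integrableOn_Ioc] at this
  rw [memLp_two_iff_integrable_sq (hi u hu).aestronglyMeasurable]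
  exact hi _ (hu.comp₂ (fun a _ => a ^ 2) hu)

theorem setIntegral_unit (v : ℝ → ℝ) :
    ∫ x in Set.Icc (0 : ℝ) 1, v x = ∫ x in (0 : ℝ)..1, v x := by
  rw [integral_Icc_eq_integral_Ioc, intervalIntegral.integral_of_le zero_le_one]

theorem isCompleteONS_chi {l₀ : ℕ} {D : Choices} (hD : D.Admissible l₀) : IsCompleteONS D.χ where
  memLp l hl := (isStep_chi hD hl).memLp
  orthonormal l hl l' hl' := by
    rw [setIntegral_unit]
    exact ip_chi hD hl hl'
  complete u hu h0 := by
    have hf := hD.menshov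
    have hψ := hD.complement
    have hν := hD.blocking.strictMono (kSeq_strictMono hf)
    have hui : IntervalIntegrable u volume 0 1 := by
      rw [intervalIntegrable_iff_integrableOn_Ioc_of_le zero_le_one,
        ← integrableOn_Icc_iff_integrableOn_Ioc]
      exact hu.integrable (by norm_num)
    have h1 : ∀ l ≥ 1, ∫ x in (0 : ℝ)..1, D.χ l x * u x = 0 := fun l hl => by
      have := h0 l hl
      rw [setIntegral_unit] at this
      simpa only [mul_comm] using this
    have hr : ∀ l ≥ 1, ∫ x in (0 : ℝ)..1, rademacher (kSeq D.f l) x * u x = 0 := fun l hl => by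
      have := h1 (radPos D.ν l) (by rw [radPos]; omega)
      rwa [Choices.χ, chiSeq_radPos hν hl] at this
    have hU : ∀ l ≥ 1, ∫ x in (0 : ℝ)..1, D.Υ l x * u x = 0 := fun l hl => by
      have := h1 (upsPos D.ν l) (by rw [upsPos]; omega)
      rwa [Choices.χ, chiSeq_upsPos hν hl] at this
    have hA : ∀ n ≥ 1, ∀ i ∈ Finset.Icc 1 (2 ^ (2 * n) + 1),
        ∫ x in (0 : ℝ)..1, upsArg (kSeq D.f) (gFun D.f) D.ψ n i x * u x = 0 := fun n hn i hi =>
      integral_eq_zero_of_concat isBlockLength_muSeq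
        (fun n hn i hi => isStep_upsArg hf hψ hn hi) hui
        (fun l hl => by rw [← upsilon_eq_concat]; exact hU l hl) hn hi
    have hxi : ∀ n ≥ 1, ∫ x in (0 : ℝ)..1, xi (kSeq D.f) D.ψ n x * u x = 0 := fun n hn => by
      simpa [upsArg] using hA n hn 1 (by simp)
    have hB : ∀ n ≥ 1, ∀ i ∈ Finset.Icc 1 (pOf (kSeq D.f) n),
        ∫ x in (0 : ℝ)..1, xiArg (kSeq D.f) D.ψ n i x * u x = 0 := fun n hn i hi =>
      integral_eq_zero_of_concat (isBlockLength_rhoOf _)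
        (fun n hn i _ => isStep_xiArg hf hψ hn i) hui
        (fun l hl => by rw [← xi_eq_concat]; exact hxi l hl) hn hi
    refine ae_eq_zero_of_cells hui (K := fun n => kSeq D.f (n + 1) + 2)
      (tendsto_atTop_mono (fun n => ?_) tendsto_id) (fun n =>
        cells_eq_zero hf hψ hui hr ?_ ?_ ?_ (by omega))
    · have : n + 1 ≤ kSeq D.f (n + 1) := (kSeq_strictMono hf).le_apply
      exact (Nat.le_succ n).trans (this.trans (Nat.le_add_right _ _))
    · intro l hl
      -- To recover the l-th Haar function, locate the ν with q_ν < l ≤ q_{ν+1}. It is then the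
      -- argument number l - q_ν + 1 of the block ν of ξ.
      have hm : StrictMono (fun ν => qOf (kSeq D.f) (ν + 1)) := by
        apply strictMono_nat_of_lt_succ
        intro ν
        have h1 := qOf_succ (kSeq D.f) (ν := ν + 1) (by omega)
        have h2 := two_le_pOf (kSeq D.f) (ν + 1)
        omega
      have a1 := blockOf_pos hm (l := l) (by simp [qOf]; omega)
      have a2 := lt_of_blockOf_pos a1
      have a3 := le_blockOf hm l
      set ν := blockOf (fun ν => qOf (kSeq D.f) (ν + 1)) l
      have a4 := qOf_succ (kSeq D.f) a1
      rw [show ν - 1 + 1 = ν by omega] at a2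
      have := hB ν a1 (l - qOf (kSeq D.f) ν + 1) (by rw [Finset.mem_Icc]; omega)
      rw [xiArg, if_neg (by omega)] at this
      rwa [show qOf (kSeq D.f) ν + (l - qOf (kSeq D.f) ν + 1) - 1 = l by omega] at this
    · intro n hn i hi
      have := hA n hn (i + 2) (by rw [Finset.mem_Icc]; omega)
      rw [upsArg, if_neg (by omega)] at this
      simpa using this
    · intro ν hν
      have := hB ν hν 1 (by rw [Finset.mem_Icc]; have := two_le_pOf (kSeq D.f) ν; omega)
      simpa [xiArg] using this

end DivONS

end

noncomputable section

namespace DivONS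

open MeasureTheory Filter Topology

/-! ### Menshov's estimate -/

/-- The harmonic sum `1 + 1/2 + … + 1/n`. -/
def harm (n : ℕ) : ℝ := ∑ i ∈ Finset.range n, 1 / ((i : ℝ) + 1)

theorem harm_succ (n : ℕ) : harm (n + 1) = harm n + 1 / ((n : ℝ) + 1) := Finset.sum_range_succ _ _

theorem harm_mono : Monotone harm := monotone_nat_of_le_succ fun n => by
  rw [harm_succ]
  have : (0 : ℝ) ≤ 1 / ((n : ℝ) + 1) := by positivity
  linarith

theorem harm_nonneg (n : ℕ) : 0 ≤ harm n := Finset.sum_nonneg fun _ _ => by positivity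

/-- The terms between 2^k and 2^{k+1} add up to at least 1/2. -/
theorem harm_two_pow (k : ℕ) : 1 + (k : ℝ) / 2 ≤ harm (2 ^ k) := by
  induction k with
  | zero => simp [harm]
  | succ k ih =>
    have h : harm (2 ^ (k + 1)) = harm (2 ^ k)
        + ∑ i ∈ Finset.range (2 ^ k), 1 / (((2 ^ k + i : ℕ) : ℝ) + 1) := by
      rw [harm, harm, pow_succ, mul_two, Finset.sum_range_add]
    have h2 : ∑ i ∈ Finset.range (2 ^ k), (1 : ℝ) / (2 ^ k * 2)
        ≤ ∑ i ∈ Finset.range (2 ^ k), 1 / (((2 ^ k + i : ℕ) : ℝ) + 1) := by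
      refine Finset.sum_le_sum fun i hi => ?_
      have : ((i : ℕ) : ℝ) + 1 ≤ 2 ^ k := by exact_mod_cast Finset.mem_range.1 hi
      push_cast
      gcongr
      linarith
    rw [Finset.sum_const, Finset.card_range, nsmul_eq_mul] at h2
    have h3 : ((2 ^ k : ℕ) : ℝ) * (1 / (2 ^ k * 2)) = 1 / 2 := by push_cast; field_simp
    rw [h3] at h2
    push_cast
    linarith

theorem harm_le_sqrt (n : ℕ) : harm n ≤ 2 * √(n : ℝ) := by
  induction n with
  | zero => simp [harm]
  | succ n ih =>
    rw [harm_succ]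
    push_cast
    have h1 : √((n : ℝ) + 1) * √((n : ℝ) + 1) = n + 1 := Real.mul_self_sqrt (by positivity)
    have h2 : √(n : ℝ) * √(n : ℝ) = n := Real.mul_self_sqrt (by positivity)
    have h3 : 0 ≤ √(n : ℝ) := Real.sqrt_nonneg _
    have h4 : 1 ≤ √((n : ℝ) + 1) := by rw [Real.one_le_sqrt]; linarith [Nat.cast_nonneg (α := ℝ) n]
    have h5 : √(n : ℝ) ≤ √((n : ℝ) + 1) := Real.sqrt_le_sqrt (by linarith)
    have h6 : 1 / ((n : ℝ) + 1) ≤ 2 * (√((n : ℝ) + 1) - √(n : ℝ)) := by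
      rw [div_le_iff₀ (by positivity)]
      generalize √((n : ℝ) + 1) = a at *
      generalize √(n : ℝ) = b at *
      have e1 : (a - b) * (a + b) = 1 := by linear_combination h1 - h2
      rw [← h1]
      nlinarith [mul_nonneg (sub_nonneg.2 h5) (show 0 ≤ 2 * (a * a) - (a + b) by nlinarith)]
    linarith

/-- The term 1/(i+1) is missing from harm j for exactly i+1 values of j, so each term contributes 1
in total. -/
theorem sum_harm_sub (n : ℕ) : ∑ j ∈ Finset.range n, (harm n - harm j) = n := by
  induction n with
  | zero => simp
  | succ n ih =>
    rw [Finset.sum_range_succ, harm_succ]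
    have : ∑ j ∈ Finset.range n, (harm n + 1 / ((n : ℝ) + 1) - harm j)
        = ∑ j ∈ Finset.range n, (harm n - harm j) + n * (1 / ((n : ℝ) + 1)) := by
      rw [Finset.sum_congr rfl fun j _ => (by ring : harm n + 1 / ((n : ℝ) + 1) - harm j
        = (harm n - harm j) + 1 / ((n : ℝ) + 1)), Finset.sum_add_distrib, Finset.sum_const,
        Finset.card_range, nsmul_eq_mul]
    rw [this, ih]
    push_cast
    field_simp
    ring

theorem sum_harm_sub_sq (n : ℕ) : ∑ j ∈ Finset.range n, (harm n - harm j) ^ 2 ≤ 2 * n := by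
  induction n with
  | zero => simp
  | succ n ih =>
    rw [Finset.sum_range_succ, harm_succ]
    have : ∑ j ∈ Finset.range n, (harm n + 1 / ((n : ℝ) + 1) - harm j) ^ 2
        = ∑ j ∈ Finset.range n, (harm n - harm j) ^ 2
          + 2 * (1 / ((n : ℝ) + 1)) * ∑ j ∈ Finset.range n, (harm n - harm j)
          + n * (1 / ((n : ℝ) + 1)) ^ 2 := by
      rw [Finset.sum_congr rfl fun j _ => (by ring : (harm n + 1 / ((n : ℝ) + 1) - harm j) ^ 2
        = (harm n - harm j) ^ 2 + 2 * (1 / ((n : ℝ) + 1)) * (harm n - harm j)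
          + (1 / ((n : ℝ) + 1)) ^ 2), Finset.sum_add_distrib, Finset.sum_add_distrib,
        ← Finset.mul_sum, Finset.sum_const, Finset.card_range, nsmul_eq_mul]
    rw [this, sum_harm_sub]
    have h0 : (0 : ℝ) < (n : ℝ) + 1 := by positivity
    have e : 2 * (1 / ((n : ℝ) + 1)) * n + n * (1 / ((n : ℝ) + 1)) ^ 2
        + (harm n + 1 / ((n : ℝ) + 1) - harm n) ^ 2 ≤ 2 := by
      have : 2 * (1 / ((n : ℝ) + 1)) * n + n * (1 / ((n : ℝ) + 1)) ^ 2
        + (harm n + 1 / ((n : ℝ) + 1) - harm n) ^ 2 = 2 - 1 / ((n : ℝ) + 1) := by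
        field_simp; ring
      rw [this]
      have : (0 : ℝ) ≤ 1 / ((n : ℝ) + 1) := by positivity
      linarith
    push_cast
    linarith

/-- In the double sum e i meets the reciprocals of 1, …, n-1-i. -/
theorem sum_convolution (e : ℕ → ℝ) (n : ℕ) :
    ∑ p ∈ Finset.range n, ∑ i ∈ Finset.range p, e i / ((p : ℝ) - i)
      = ∑ i ∈ Finset.range n, e i * harm (n - 1 - i) := by
  induction n with
  | zero => simp
  | succ n ih =>
    rw [Finset.sum_range_succ, ih, Finset.sum_range_succ, ← Finset.sum_add_distrib]
    have h0 : harm (n + 1 - 1 - n) = 0 := by simp [harm]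
    rw [h0, mul_zero, add_zero]
    refine Finset.sum_congr rfl fun i hi => ?_
    rw [Finset.mem_range] at hi
    obtain ⟨d, rfl⟩ : ∃ d, n = i + 1 + d := ⟨n - (i + 1), by omega⟩
    rw [show i + 1 + d + 1 - 1 - i = d + 1 by omega, show i + 1 + d - 1 - i = d by omega, harm_succ]
    push_cast
    rw [show (i : ℝ) + 1 + d - i = d + 1 by ring]
    ring

theorem sum_inv_sub (p : ℕ) : ∑ i ∈ Finset.range p, 1 / ((p : ℝ) - i) = harm p := by
  rw [harm, ← Finset.sum_range_reflect]
  refine Finset.sum_congr rfl fun i hi => ?_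
  rw [Finset.mem_range] at hi
  obtain ⟨d, rfl⟩ : ∃ d, p = i + 1 + d := ⟨p - (i + 1), by omega⟩
  rw [show i + 1 + d - 1 - i = d by omega]
  push_cast
  congr 1
  ring

theorem sum_inv_sub_ne {n p : ℕ} (hp : p < n) :
    ∑ i ∈ Finset.range n, (if p = i then 0 else 1 / ((p : ℝ) - i)) = harm p - harm (n - 1 - p) := by
  obtain ⟨d, rfl⟩ : ∃ d, n = p + 1 + d := ⟨n - (p + 1), by omega⟩
  rw [Finset.sum_range_add, Finset.sum_range_succ, if_pos rfl, add_zero, ← sum_inv_sub p,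
    show p + 1 + d - 1 - p = d by omega, sub_eq_add_neg, harm, ← Finset.sum_neg_distrib]
  congr 1
  · refine Finset.sum_congr rfl fun i hi => ?_
    rw [Finset.mem_range] at hi
    rw [if_neg (by omega)]
  · refine Finset.sum_congr rfl fun i _ => ?_
    rw [if_neg (by omega)]
    push_cast
    rw [show (p : ℝ) - (p + 1 + i) = -(i + 1) by ring, div_neg]

theorem sq_sum_le_card {s : Finset ℕ} (e : ℕ → ℝ) :
    (∑ i ∈ s, e i) ^ 2 ≤ s.card * ∑ i ∈ s, e i ^ 2 := sq_sum_le_card_mul_sum_sq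

/-- Schur's test: Cauchy–Schwarz with the weights 1/(p-i), whose row and column sums are at most
harm n. -/
theorem sum_convolution_sq_le (e : ℕ → ℝ) (n : ℕ) :
    ∑ p ∈ Finset.range n, (∑ i ∈ Finset.range p, e i / ((p : ℝ) - i)) ^ 2
      ≤ harm n ^ 2 * ∑ i ∈ Finset.range n, e i ^ 2 := by
  have h1 : ∀ p ∈ Finset.range n, (∑ i ∈ Finset.range p, e i / ((p : ℝ) - i)) ^ 2
      ≤ harm n * ∑ i ∈ Finset.range p, e i ^ 2 / ((p : ℝ) - i) := by
    intro p hp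
    rw [Finset.mem_range] at hp
    have hpos : ∀ i ∈ Finset.range p, (0 : ℝ) < (p : ℝ) - i := fun i hi => by
      have : (i : ℝ) < p := by exact_mod_cast Finset.mem_range.1 hi
      linarith
    have h2 : (∑ i ∈ Finset.range p, e i / ((p : ℝ) - i)) ^ 2
        ≤ (∑ i ∈ Finset.range p, 1 / ((p : ℝ) - i)) *
          ∑ i ∈ Finset.range p, e i ^ 2 / ((p : ℝ) - i) := by
      refine Finset.sum_sq_le_sum_mul_sum_of_sq_le_mul _ (fun i hi => ?_) (fun i hi => ?_)
        (fun i hi => ?_)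
      · have := hpos i hi; positivity
      · have := hpos i hi; positivity
      · exact le_of_eq (by rw [div_pow, div_mul_div_comm, one_mul, sq ((p : ℝ) - i)])
    rw [sum_inv_sub] at h2
    refine h2.trans (mul_le_mul_of_nonneg_right (harm_mono hp.le) (Finset.sum_nonneg fun i hi => ?_))
    have := hpos i hi
    positivity
  refine (Finset.sum_le_sum h1).trans ?_
  rw [← Finset.mul_sum, sum_convolution (fun i => e i ^ 2), sq, mul_assoc]
  refine mul_le_mul_of_nonneg_left ?_ (harm_nonneg n)
  rw [Finset.mul_sum]
  refine Finset.sum_le_sum fun i _ => ?_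
  rw [mul_comm]
  exact mul_le_mul_of_nonneg_right (harm_mono (by omega)) (sq_nonneg _)

/-- The partial sum that ends at the singularity of the translates, up to normalization. -/
def peak (N : ℕ) (c : ℝ) (e : ℕ → ℝ) (p : ℕ) : ℝ :=
  ∑ i ∈ Finset.range p, e i / ((p : ℝ) - i)
    - c * (∑ i ∈ Finset.range p, e i) * (harm p - harm (N - 1 - p))

theorem abs_partial_sum_le {N : ℕ} {e : ℕ → ℝ} {A : ℝ} (hA : 0 ≤ A)
    (he : ∑ i ∈ Finset.range N, e i ^ 2 ≤ A ^ 2) {p : ℕ} (hp : p ≤ N) :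
    |∑ i ∈ Finset.range p, e i| ≤ √(N : ℝ) * A := by
  apply abs_le_of_sq_le_sq _ (by positivity)
  refine (sq_sum_le_card e).trans ?_
  rw [mul_pow, Real.sq_sqrt (by positivity), Finset.card_range]
  have h1 : ∑ i ∈ Finset.range p, e i ^ 2 ≤ A ^ 2 := le_trans
    (Finset.sum_le_sum_of_subset_of_nonneg (Finset.range_subset_range.2 hp)
      fun _ _ _ => sq_nonneg _) he
  have h2 : (p : ℝ) ≤ N := by exact_mod_cast hp
  have h3 : 0 ≤ ∑ i ∈ Finset.range p, e i ^ 2 := Finset.sum_nonneg fun _ _ => sq_nonneg _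
  have : (0 : ℝ) ≤ N := by positivity
  nlinarith

/-- The main term is the harmonic weight of each coefficient. Replacing harm (N-1-i) by harm N costs
2√N A, by Cauchy–Schwarz and `sum_harm_sub_sq`. The rank-one part of the rotation costs 4√N A, by
`sum_harm_sub` and c N ≤ 2. -/
theorem sum_peak_ge {N : ℕ} (hN : 1 ≤ N) {c A : ℝ} {e : ℕ → ℝ} (hc0 : 0 ≤ c)
    (hc : c * N ≤ 2) (hA : 0 ≤ A) (he : ∑ i ∈ Finset.range N, e i ^ 2 ≤ A ^ 2) :
    harm N * ∑ i ∈ Finset.range N, e i - 6 * √(N : ℝ) * A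
      ≤ ∑ p ∈ Finset.range N, peak N c e p := by
  have hN0 : (0 : ℝ) < N := by exact_mod_cast hN
  have hs : 0 < √(N : ℝ) := Real.sqrt_pos.2 hN0
  simp only [peak, Finset.sum_sub_distrib]
  rw [sum_convolution]
  have h1 : harm N * ∑ i ∈ Finset.range N, e i - 2 * √(N : ℝ) * A
      ≤ ∑ i ∈ Finset.range N, e i * harm (N - 1 - i) := by
    have e1 : ∑ i ∈ Finset.range N, e i * harm (N - 1 - i) = harm N * ∑ i ∈ Finset.range N, e i
        - ∑ i ∈ Finset.range N, e i * (harm N - harm (N - 1 - i)) := by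
      rw [Finset.mul_sum, ← Finset.sum_sub_distrib]
      exact Finset.sum_congr rfl fun i _ => by ring
    have e2 : ∑ i ∈ Finset.range N, (harm N - harm (N - 1 - i)) ^ 2 ≤ 2 * N := by
      rw [Finset.sum_range_reflect (fun j => (harm N - harm j) ^ 2)]
      exact sum_harm_sub_sq N
    have e3 : |∑ i ∈ Finset.range N, e i * (harm N - harm (N - 1 - i))| ≤ 2 * √(N : ℝ) * A := by
      apply abs_le_of_sq_le_sq _ (by positivity)
      refine (Finset.sum_mul_sq_le_sq_mul_sq _ _ _).trans ?_
      rw [mul_pow, mul_pow, Real.sq_sqrt hN0.le]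
      have := Finset.sum_nonneg (s := Finset.range N)
        (f := fun i => (harm N - harm (N - 1 - i)) ^ 2) fun _ _ => sq_nonneg _
      have := sq_nonneg A
      nlinarith [mul_le_mul he e2 (by assumption) (sq_nonneg A)]
    rw [e1]
    have := (abs_le.1 e3).2
    linarith
  have h2 : ∑ p ∈ Finset.range N, c * (∑ i ∈ Finset.range p, e i) * (harm p - harm (N - 1 - p))
      ≤ 4 * √(N : ℝ) * A := by
    have e1 : ∀ p ∈ Finset.range N,
        c * (∑ i ∈ Finset.range p, e i) * (harm p - harm (N - 1 - p))
        ≤ c * (√(N : ℝ) * A) * ((harm N - harm p) + (harm N - harm (N - 1 - p))) := by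
      intro p hp
      rw [Finset.mem_range] at hp
      have a1 := harm_mono hp.le
      have a2 := harm_mono (show N - 1 - p ≤ N by omega)
      refine (le_abs_self _).trans ?_
      rw [abs_mul, abs_mul, abs_of_nonneg hc0]
      gcongr
      · exact abs_partial_sum_le hA he hp.le
      · rw [abs_le]
        constructor <;> linarith
    refine (Finset.sum_le_sum e1).trans ?_
    rw [← Finset.mul_sum, Finset.sum_add_distrib, sum_harm_sub,
      Finset.sum_range_reflect (fun j => harm N - harm j), sum_harm_sub]
    have : 0 ≤ √(N : ℝ) * A := by positivity
    nlinarith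
  linarith

/-- The square of the difference is at most twice the sum of the squares: 2 comes from the
convolution and 2(cN)² ≤ 8 from the rank-one part. -/
theorem sum_peak_sq_le {N : ℕ} (hN : 1 ≤ N) {c A : ℝ} {e : ℕ → ℝ} (hc0 : 0 ≤ c)
    (hc : c * N ≤ 2) (hA : 0 ≤ A) (he : ∑ i ∈ Finset.range N, e i ^ 2 ≤ A ^ 2) :
    ∑ p ∈ Finset.range N, peak N c e p ^ 2 ≤ 10 * (harm N * A) ^ 2 := by
  have hN0 : (0 : ℝ) < N := by exact_mod_cast hN
  have hH := harm_nonneg N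
  have e1 : ∀ p ∈ Finset.range N, peak N c e p ^ 2
      ≤ 2 * (∑ i ∈ Finset.range p, e i / ((p : ℝ) - i)) ^ 2 + 2 * (c ^ 2 * N * (harm N * A) ^ 2) := by
    intro p hp
    rw [Finset.mem_range] at hp
    have a1 := harm_mono hp.le
    have a2 := harm_mono (show N - 1 - p ≤ N by omega)
    have a3 := harm_nonneg p
    have a4 := harm_nonneg (N - 1 - p)
    have a5 : (c * (∑ i ∈ Finset.range p, e i) * (harm p - harm (N - 1 - p))) ^ 2
        ≤ c ^ 2 * N * (harm N * A) ^ 2 := by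
      have : c ^ 2 * N * (harm N * A) ^ 2 = (c * (√(N : ℝ) * A) * harm N) ^ 2 := by
        rw [mul_pow, mul_pow, mul_pow, mul_pow, Real.sq_sqrt hN0.le]; ring
      rw [this, ← sq_abs]
      gcongr
      rw [abs_mul, abs_mul, abs_of_nonneg hc0]
      gcongr
      · exact abs_partial_sum_le hA he hp.le
      · rw [abs_le]
        constructor <;> linarith
    rw [peak]
    nlinarith [sq_nonneg (∑ i ∈ Finset.range p, e i / ((p : ℝ) - i)
      + c * (∑ i ∈ Finset.range p, e i) * (harm p - harm (N - 1 - p)))]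
  refine (Finset.sum_le_sum e1).trans ?_
  rw [Finset.sum_add_distrib, ← Finset.mul_sum, Finset.sum_const, Finset.card_range, nsmul_eq_mul]
  have h1 := sum_convolution_sq_le e N
  have h2 : harm N ^ 2 * ∑ i ∈ Finset.range N, e i ^ 2 ≤ (harm N * A) ^ 2 := by
    rw [mul_pow]
    exact mul_le_mul_of_nonneg_left he (sq_nonneg _)
  have h3 : (c * N) ^ 2 ≤ 4 := by nlinarith [mul_nonneg hc0 hN0.le]
  have h4 : (N : ℝ) * (2 * (c ^ 2 * N * (harm N * A) ^ 2)) = 2 * ((c * N) ^ 2 * (harm N * A) ^ 2) := by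
    ring
  rw [h4]
  nlinarith [sq_nonneg (harm N * A)]

/-- A fixed proportion of the partial sums is large. -/
theorem card_large_peak {N : ℕ} (hN : 1 ≤ N) {c A C γ : ℝ} {e : ℕ → ℝ} (hc0 : 0 ≤ c)
    (hc : c * N ≤ 2) (hA : 0 ≤ A) (he : ∑ i ∈ Finset.range N, e i ^ 2 ≤ A ^ 2) (hγ : 0 < γ)
    (hAC : A ≤ C * γ) (hsum : γ * √(N : ℝ) - A ≤ ∑ i ∈ Finset.range N, e i)
    (hH : 16 * C ≤ harm N) :
    (N : ℝ) ≤ 160 * C ^ 2 *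
      ((Finset.range N).filter fun p => harm N * γ / (4 * √(N : ℝ)) ≤ peak N c e p).card := by
  have hN0 : (0 : ℝ) < N := by exact_mod_cast hN
  have hs : 0 < √(N : ℝ) := Real.sqrt_pos.2 hN0
  have hs2 : √(N : ℝ) * √(N : ℝ) = N := Real.mul_self_sqrt hN0.le
  have hHn : 0 < harm N := lt_of_lt_of_le (by simp [harm]) (harm_mono hN)
  set R := (Finset.range N).filter fun p => harm N * γ / (4 * √(N : ℝ)) ≤ peak N c e p with hR
  have h1 := sum_peak_ge hN hc0 hc hA he
  have h2 := sum_peak_sq_le hN hc0 hc hA he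
  have hHs := harm_le_sqrt N
  -- The errors total 8√N A, the harmonic sum being at most 2√N, and 16A ≤ 16Cγ ≤ harm N * γ turns
  -- them into half of the main term.
  have h3 : √(N : ℝ) * (harm N * γ) / 2 ≤ ∑ p ∈ Finset.range N, peak N c e p := by
    refine le_trans ?_ h1
    have a1 : harm N * (γ * √(N : ℝ) - A) ≤ harm N * ∑ i ∈ Finset.range N, e i :=
      mul_le_mul_of_nonneg_left hsum hHn.le
    have a2 : harm N * A ≤ 2 * √(N : ℝ) * A := mul_le_mul_of_nonneg_right hHs hA
    have a3 : 16 * A ≤ harm N * γ := by nlinarith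
    nlinarith
  -- The indices below the threshold contribute at most N times the threshold, a quarter of √N
  -- harm(N) γ. The remaining quarter must come from R; Cauchy–Schwarz with the second moment then
  -- bounds the size of R from below.
  have h4 : ∑ p ∈ Finset.range N, peak N c e p
      ≤ ∑ p ∈ R, peak N c e p + √(N : ℝ) * (harm N * γ) / 4 := by
    rw [← Finset.sum_filter_add_sum_filter_not (Finset.range N)
      (fun p => harm N * γ / (4 * √(N : ℝ)) ≤ peak N c e p)]
    gcongr
    have : ∀ p ∈ (Finset.range N).filter fun p => ¬ harm N * γ / (4 * √(N : ℝ)) ≤ peak N c e p,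
        peak N c e p ≤ harm N * γ / (4 * √(N : ℝ)) := fun p hp =>
      (not_le.1 (Finset.mem_filter.1 hp).2).le
    refine (Finset.sum_le_card_nsmul _ _ _ this).trans ?_
    rw [nsmul_eq_mul]
    have hcard : (((Finset.range N).filter
        fun p => ¬ harm N * γ / (4 * √(N : ℝ)) ≤ peak N c e p).card : ℝ) ≤ N := by
      have := Finset.card_filter_le (Finset.range N)
        (fun p => ¬ harm N * γ / (4 * √(N : ℝ)) ≤ peak N c e p)
      rw [Finset.card_range] at this
      exact_mod_cast this
    have hq : 0 ≤ harm N * γ / (4 * √(N : ℝ)) := by positivity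
    refine (mul_le_mul_of_nonneg_right hcard hq).trans ?_
    apply le_of_eq
    rw [mul_div_assoc', div_eq_div_iff (by positivity) (by norm_num)]
    linear_combination (-(4 * (harm N * γ))) * hs2
  have h5 : √(N : ℝ) * (harm N * γ) / 4 ≤ ∑ p ∈ R, peak N c e p := by linarith
  have h6 : (∑ p ∈ R, peak N c e p) ^ 2 ≤ R.card * (10 * (harm N * A) ^ 2) :=
    (sq_sum_le_card _).trans (mul_le_mul_of_nonneg_left (le_trans
      (Finset.sum_le_sum_of_subset_of_nonneg (Finset.filter_subset _ _) fun _ _ _ => sq_nonneg _) h2)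
      (by positivity))
  have h7 : (√(N : ℝ) * (harm N * γ) / 4) ^ 2 ≤ R.card * (10 * (harm N * A) ^ 2) :=
    le_trans (pow_le_pow_left₀ (by positivity) h5 2) h6
  have h8 : (harm N * A) ^ 2 ≤ C ^ 2 * (harm N * γ) ^ 2 := by
    rw [← mul_pow]
    apply pow_le_pow_left₀ (by positivity)
    nlinarith
  have h9 : (N : ℝ) * (harm N * γ) ^ 2 ≤ (160 * C ^ 2 * R.card) * (harm N * γ) ^ 2 := by
    have : (√(N : ℝ) * (harm N * γ) / 4) ^ 2 = N * (harm N * γ) ^ 2 / 16 := by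
      rw [div_pow, mul_pow, Real.sq_sqrt hN0.le]; norm_num
    rw [this] at h7
    nlinarith [mul_le_mul_of_nonneg_left h8 (show (0 : ℝ) ≤ 10 * R.card by positivity)]
  exact le_of_mul_le_mul_right h9 (by positivity)

end DivONS

end

noncomputable section

namespace DivONS

open MeasureTheory Filter Topology

/-! ### Large partial sums of a rotated block -/

/-- The partial sum of length `t` of `∑ α_j Υ_j`, without the first row of the matrix, where the
functions `g_n^i` take the values `v i`. -/
def rotPartial (N : ℕ) (α v : ℕ → ℝ) (t : ℕ) : ℝ :=
  ∑ s ∈ Finset.Icc 1 t, α s * ∑ i ∈ Finset.Icc 2 (N + 1), kappa (N + 1) i s * v (i - 2)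

theorem rotPartial_neg (N : ℕ) (α v : ℕ → ℝ) (t : ℕ) :
    rotPartial N (fun s => -α s) v t = -rotPartial N α v t := by
  simp only [rotPartial, neg_mul, Finset.sum_neg_distrib]

/-- The off-diagonal entry of the rotation, up to the sign. -/
def kappaOff (N : ℕ) : ℝ := 1 / (N : ℝ) * (1 + 1 / √((N : ℝ) + 1))

theorem kappaOff_nonneg (N : ℕ) : 0 ≤ kappaOff N := by rw [kappaOff]; positivity

theorem kappaOff_mul_le {N : ℕ} (hN : 1 ≤ N) : kappaOff N * N ≤ 2 := by
  have hN0 : (0 : ℝ) < N := by exact_mod_cast hN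
  have h1 : (1 : ℝ) ≤ √((N : ℝ) + 1) := by rw [Real.one_le_sqrt]; linarith
  have h2 : 1 / √((N : ℝ) + 1) ≤ 1 := by rw [div_le_one (by linarith)]; exact h1
  have : kappaOff N * N = 1 + 1 / √((N : ℝ) + 1) := by rw [kappaOff]; field_simp
  linarith

theorem sum_Icc_two_eq_range (F : ℕ → ℝ) (N : ℕ) :
    ∑ i ∈ Finset.Icc 2 (N + 1), F i = ∑ i ∈ Finset.range N, F (i + 2) := by
  induction N with
  | zero => simp
  | succ N ih => rw [Finset.sum_Icc_succ_top (by omega), ih, Finset.sum_range_succ]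

/-- The condition t ≤ N excludes the last, constant column; in the others the matrix is a shifted
unit matrix minus a constant. -/
theorem rotPartial_eq {N t : ℕ} (ht : t ≤ N) (α v : ℕ → ℝ) :
    rotPartial N α v t = ∑ i ∈ Finset.range t, α (i + 1) * v i
      - kappaOff N * (∑ i ∈ Finset.range t, α (i + 1)) * ∑ i ∈ Finset.range N, v i := by
  rw [rotPartial, sum_Icc_one_eq_range, mul_right_comm, Finset.mul_sum (Finset.range t),
    ← Finset.sum_sub_distrib]
  refine Finset.sum_congr rfl fun s hs => ?_
  rw [Finset.mem_range] at hs
  rw [sum_Icc_two_eq_range]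
  have h1 : ∀ i ∈ Finset.range N, kappa (N + 1) (i + 2) (s + 1) * v (i + 2 - 2)
      = (if s = i then v i else 0) - kappaOff N * v i := fun i _ => by
    rw [kappa_of_ne (by omega) (by omega), kappaOff, Nat.add_sub_cancel]
    push_cast
    rw [add_sub_cancel_right]
    split_ifs <;> ring
  rw [Finset.sum_congr rfl h1, Finset.sum_sub_distrib, Finset.sum_ite_eq,
    if_pos (Finset.mem_range.2 (by omega)), ← Finset.mul_sum]
  ring

/-- The sum is stopped exactly at the singularity of the kernel, so only the positive values
1/(p-i), i < p, are retained. -/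
theorem rotPartial_eq_peak {N p : ℕ} (hp : p < N) {α v : ℕ → ℝ} {w : ℝ}
    (hv : ∀ i < N, v i = w * if p = i then 0 else 1 / ((p : ℝ) - i)) :
    rotPartial N α v p = w * peak N (kappaOff N) (fun i => α (i + 1)) p := by
  have h1 : ∑ i ∈ Finset.range N, v i = w * (harm p - harm (N - 1 - p)) := by
    rw [← sum_inv_sub_ne hp, Finset.mul_sum]
    exact Finset.sum_congr rfl fun i hi => hv i (Finset.mem_range.1 hi)
  have h2 : ∑ i ∈ Finset.range p, α (i + 1) * v i
      = w * ∑ i ∈ Finset.range p, α (i + 1) / ((p : ℝ) - i) := by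
    rw [Finset.mul_sum]
    refine Finset.sum_congr rfl fun i hi => ?_
    rw [Finset.mem_range] at hi
    rw [hv i (hi.trans hp), if_neg (by omega)]
    ring
  rw [rotPartial_eq hp.le, h1, h2, peak]
  ring

/-- At level s+2+2n the piece (2^{-s}, 2^{1-s}] begins at the cell number 4·2^{2n}, and its first
quarter is the copy of (0,1). The pole of the kernel on the cell p is at p + 1. -/
theorem gHat_of_menshov_cell {f : ℕ → ℕ → ℝ → ℝ} (hf : ∀ k ≥ 1, IsMenshovSystem k (f k))
    {n kp s p i : ℕ} (hn : 1 ≤ n) (hs : 2 ≤ s) (hs' : s ≤ 2 * n ^ 2) (hp : p + 1 < 2 ^ (2 * n))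
    (hi : i < 2 ^ (2 * n)) {z : ℝ}
    (h1 : (4 * 2 ^ (2 * n) + p : ℝ) < 2 ^ (s + 2 + 2 * n) * z)
    (h2 : 2 ^ (s + 2 + 2 * n) * z < 4 * 2 ^ (2 * n) + p + 1) :
    gHat f n kp i z = (1 / (n : ℝ) * √(2 ^ s) * (√(2 ^ (2 * n)) / 8)) *
      if p + 1 = i then 0 else 1 / (((p + 1 : ℕ) : ℝ) - i) := by
  have hN : (0 : ℝ) < 2 ^ (2 * n) := by positivity
  have hS : (0 : ℝ) < 2 ^ s := by positivity
  have hp' : ((p : ℕ) : ℝ) + 1 ≤ 2 ^ (2 * n) := by exact_mod_cast hp.le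
  have hp0 : (0 : ℝ) ≤ p := by positivity
  rw [pow_add, pow_add] at h1 h2
  have e : (2 : ℝ) ^ (s + 2) * (z - 1 / 2 ^ s) = 2 ^ s * 4 * z - 4 := by
    rw [pow_add]; field_simp; ring
  set y : ℝ := 2 ^ s * 4 * z - 4 with hy
  have y1 : (p : ℝ) < 2 ^ (2 * n) * y := by rw [hy]; nlinarith
  have y2 : 2 ^ (2 * n) * y < p + 1 := by rw [hy]; nlinarith
  have y0 : 0 < y := by
    by_contra h
    have := mul_nonpos_of_nonneg_of_nonpos hN.le (not_lt.1 h)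
    linarith
  have y3 : y < 1 := by
    by_contra h
    have := mul_le_mul_of_nonneg_left (not_lt.1 h) hN.le
    linarith
  rw [gHat_of_piece f hs hs' (by rw [div_lt_iff₀ hS]; nlinarith) (by rw [lt_div_iff₀ hS]; nlinarith), e,
    (hf (2 * n) (by omega)).eq_menshov i hi y ⟨by linarith, y3.le⟩,
    menshov_translate_eq hi (by omega) y1 y2 hp]
  split_ifs
  · simp
  · push_cast
    have : (8 * ((p : ℝ) + 1 - i)) = 8 * ((p : ℝ) + 1 - i) := rfl
    rw [div_mul_eq_div_div]
    ring

/-- The indicator of the event that some partial sum is at least `θ`. -/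
def exceeds (N : ℕ) (α : ℕ → ℝ) (θ : ℝ) (v : ℕ → ℝ) : ℝ :=
  open Classical in if ∃ t ≤ N, θ ≤ |rotPartial N α v t| then 1 else 0

theorem exceeds_nonneg (N : ℕ) (α : ℕ → ℝ) (θ : ℝ) (v : ℕ → ℝ) : 0 ≤ exceeds N α θ v := by
  rw [exceeds]; split_ifs <;> norm_num

theorem exceeds_le_one (N : ℕ) (α : ℕ → ℝ) (θ : ℝ) (v : ℕ → ℝ) : exceeds N α θ v ≤ 1 := by
  rw [exceeds]; split_ifs <;> norm_num

theorem exceeds_congr {N : ℕ} {α : ℕ → ℝ} {θ : ℝ} {v v' : ℕ → ℝ} (h : ∀ i < N, v i = v' i) :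
    exceeds N α θ v = exceeds N α θ v' := by
  have : ∀ t, rotPartial N α v t = rotPartial N α v' t := fun t =>
    Finset.sum_congr rfl fun s _ => by
      congr 1
      refine Finset.sum_congr rfl fun i hi => ?_
      rw [Finset.mem_Icc] at hi
      rw [h _ (by omega)]
  simp only [exceeds, this]

theorem exceeds_neg (N : ℕ) (α : ℕ → ℝ) (θ : ℝ) (v : ℕ → ℝ) :
    exceeds N (fun s => -α s) θ v = exceeds N α θ v := by
  simp only [exceeds, rotPartial_neg, abs_neg]

theorem exceeds_anti {N : ℕ} {α : ℕ → ℝ} {θ θ' : ℝ} (h : θ ≤ θ') (v : ℕ → ℝ) :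
    exceeds N α θ' v ≤ exceeds N α θ v := by
  by_cases h1 : ∃ t ≤ N, θ' ≤ |rotPartial N α v t|
  · obtain ⟨t, ht, h2⟩ := h1
    rw [exceeds, exceeds, if_pos ⟨t, ht, h2⟩, if_pos ⟨t, ht, h.trans h2⟩]
  · rw [exceeds, if_neg h1]
    exact exceeds_nonneg _ _ _ _

/-- On a fixed proportion of the 2^{2n} Menshov cells of the s-th piece some partial sum is large,
so the exceptional set has measure of order 2^{-s}. -/
theorem integral_exceeds_gHat {f : ℕ → ℕ → ℝ → ℝ} (hf : ∀ k ≥ 1, IsMenshovSystem k (f k))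
    {n kp s : ℕ} (hn : 1 ≤ n) (hs : 2 ≤ s) (hs' : s ≤ 2 * n ^ 2) {α : ℕ → ℝ} {A C γ : ℝ}
    (hA : 0 ≤ A) (hα : ∑ t ∈ Finset.Icc 1 (2 ^ (2 * n) + 1), α t ^ 2 = A ^ 2)
    (hγ : ∑ t ∈ Finset.Icc 1 (2 ^ (2 * n) + 1), α t = γ * √((2 : ℝ) ^ (2 * n) + 1))
    (hγ0 : 0 < γ) (hAC : A ≤ C * γ) (hH : 16 * C ≤ harm (2 ^ (2 * n))) :
    1 ≤ 160 * C ^ 2 * (2 ^ (s + 2) *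
      ∫ z in (0 : ℝ)..1, exceeds (2 ^ (2 * n)) α (√(2 ^ s) * γ / 32) fun i => gHat f n kp i z) := by
  set N := 2 ^ (2 * n) with hNdef
  have hN1 : 1 ≤ N := Nat.one_le_two_pow
  have hNr : ((N : ℕ) : ℝ) = 2 ^ (2 * n) := by rw [hNdef]; push_cast; rfl
  have hN0 : (0 : ℝ) < N := by exact_mod_cast hN1
  set e : ℕ → ℝ := fun i => α (i + 1) with he
  set F : ℝ → ℝ := fun z => exceeds N α (√(2 ^ s) * γ / 32) fun i => gHat f n kp i z with hF
  rw [sum_Icc_one_eq_range, Finset.sum_range_succ] at hα hγ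
  have hstep : IsStep F := by
    refine ⟨2 * n ^ 2 + 2 * n + kp + N + 5, LineStep.mem fun x y hxy => exceeds_congr fun i hi => ?_⟩
    exact (lineStep_gHat hf hn hi).mono (by omega) x y hxy
  -- The coefficient attached to the last column is dropped from the sum at the cost of one A.
  have hαN : |α (N + 1)| ≤ A := by
    apply abs_le_of_sq_le_sq _ hA
    have : 0 ≤ ∑ i ∈ Finset.range N, α (i + 1) ^ 2 := Finset.sum_nonneg fun _ _ => sq_nonneg _
    linarith
  have hsum : γ * √(N : ℝ) - A ≤ ∑ i ∈ Finset.range N, e i := by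
    have h1 : √(N : ℝ) ≤ √((2 : ℝ) ^ (2 * n) + 1) := Real.sqrt_le_sqrt (by rw [hNr]; linarith)
    have := (abs_le.1 hαN).2
    have : ∑ i ∈ Finset.range N, e i = γ * √((2 : ℝ) ^ (2 * n) + 1) - α (N + 1) := by linarith
    nlinarith
  have hsq : ∑ i ∈ Finset.range N, e i ^ 2 ≤ A ^ 2 := by
    have := sq_nonneg (α (N + 1))
    linarith
  have hcard := card_large_peak hN1 (kappaOff_nonneg N) (kappaOff_mul_le hN1) hA hsq hγ0 hAC hsum hH
  set R := (Finset.range N).filter fun p => harm N * γ / (4 * √(N : ℝ)) ≤ peak N (kappaOff N) e p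
    with hR
  have hHpos : 0 < harm N := lt_of_lt_of_le (by simp [harm]) (harm_mono hN1)
  -- The pole p is realized on the cell p - 1, so p = 0 has to be excluded; its peak is an empty sum
  -- and lies below the threshold.
  have hRpos : ∀ p ∈ R, 1 ≤ p ∧ p < N := fun p hp => by
    rw [hR, Finset.mem_filter, Finset.mem_range] at hp
    refine ⟨Nat.one_le_iff_ne_zero.2 fun h0 => ?_, hp.1⟩
    have h1 := hp.2
    rw [h0, peak] at h1
    simp only [Finset.range_zero, Finset.sum_empty, mul_zero, zero_mul, sub_zero] at h1
    have : 0 < harm N * γ / (4 * √(N : ℝ)) := by positivity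
    linarith
  have hone : ∀ p ∈ R, ∀ z : ℝ, ((4 * N + (p - 1) : ℕ) : ℝ) < 2 ^ (s + 2 + 2 * n) * z →
      2 ^ (s + 2 + 2 * n) * z < (4 * N + (p - 1) : ℕ) + 1 → F z = 1 := by
    intro p hp z h1 h2
    obtain ⟨hp1, hpN⟩ := hRpos p hp
    obtain ⟨q, rfl⟩ : ∃ q, p = q + 1 := ⟨p - 1, by omega⟩
    rw [Nat.add_sub_cancel] at h1 h2
    push_cast at h1 h2
    rw [hNr] at h1 h2
    have hv : ∀ i < N, gHat f n kp i z = (1 / (n : ℝ) * √(2 ^ s) * (√(2 ^ (2 * n)) / 8)) *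
        if q + 1 = i then 0 else 1 / (((q + 1 : ℕ) : ℝ) - i) := fun i hi =>
      gHat_of_menshov_cell hf hn hs hs' hpN hi h1 h2
    rw [hF]
    simp only [exceeds]
    refine if_pos ⟨q + 1, hpN.le, ?_⟩
    rw [rotPartial_eq_peak hpN hv]
    have h3 : harm N * γ / (4 * √(N : ℝ)) ≤ peak N (kappaOff N) e (q + 1) := (Finset.mem_filter.1 hp).2
    refine le_trans ?_ (le_abs_self _)
    have hn0 : (0 : ℝ) < n := by exact_mod_cast hn
    have h4 : (n : ℝ) ≤ harm N := by
      have := harm_two_pow (2 * n)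
      push_cast at this
      rw [hNdef]
      linarith
    have hsN : 0 < √((2 : ℝ) ^ (2 * n)) := by positivity
    have hsS : 0 < √((2 : ℝ) ^ s) := by positivity
    -- The logarithmic growth harm N ≥ n cancels the factor 1/n in the definition of ĝ_n.
    calc √(2 ^ s) * γ / 32 = (1 / (n : ℝ) * √(2 ^ s) * (√(2 ^ (2 * n)) / 8)) *
          (n * γ / (4 * √((2 : ℝ) ^ (2 * n)))) := by field_simp; norm_num
      _ ≤ (1 / (n : ℝ) * √(2 ^ s) * (√(2 ^ (2 * n)) / 8)) *
          (harm N * γ / (4 * √((2 : ℝ) ^ (2 * n)))) := by gcongr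
      _ ≤ _ := by
          rw [hNr] at h3
          gcongr
  have h_int : (R.card : ℝ) * (1 / 2 ^ (s + 2 + 2 * n)) ≤ ∫ z in (0 : ℝ)..1, F z := by
    rw [integral_eq_sum_cells (s + 2 + 2 * n)
      fun i hi => hstep.intervalIntegrable.mono_set (cell_subset hi)]
    have hinj : Set.InjOn (fun p => 4 * N + (p - 1)) (R : Set ℕ) := fun p hp q hq h => by
      have := (hRpos p hp).1
      have := (hRpos q hq).1
      simp only at h
      omega
    have hsub : R.image (fun p => 4 * N + (p - 1)) ⊆ Finset.range (2 ^ (s + 2 + 2 * n)) := by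
      intro q hq
      obtain ⟨p, hp, rfl⟩ := Finset.mem_image.1 hq
      have := (hRpos p hp).2
      rw [Finset.mem_range, pow_add, ← hNdef]
      have := Nat.mul_le_mul_right N
        (Nat.pow_le_pow_right (n := 2) (by norm_num) (show 4 ≤ s + 2 by omega))
      omega
    refine le_trans ?_ (Finset.sum_le_sum_of_subset_of_nonneg hsub fun i _ _ =>
      intervalIntegral.integral_nonneg (cell_le _ _) fun z _ => exceeds_nonneg _ _ _ _)
    rw [Finset.sum_image hinj, ← nsmul_eq_mul, ← Finset.sum_const]
    refine Finset.sum_le_sum fun p hp => ?_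
    have hc : Set.EqOn F (fun _ => 1) (Set.Ioo (((4 * N + (p - 1) : ℕ) : ℝ) / 2 ^ (s + 2 + 2 * n))
        (((4 * N + (p - 1) + 1 : ℕ) : ℝ) / 2 ^ (s + 2 + 2 * n))) := fun z hz => by
      refine hone p hp z ?_ ?_
      · have := hz.1
        rwa [div_lt_iff₀' (by positivity)] at this
      · have := hz.2
        rw [lt_div_iff₀' (by positivity)] at this
        push_cast at this ⊢
        exact this
    rw [intervalIntegral.integral_congr_Ioo_of_le (cell_le _ _) hc]
    simp only [intervalIntegral.integral_const, smul_eq_mul, mul_one]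
    push_cast
    apply le_of_eq
    ring
  have h5 : (R.card : ℝ) = 2 ^ (s + 2) * N * (R.card * (1 / 2 ^ (s + 2 + 2 * n))) := by
    rw [pow_add _ _ (2 * n), hNr]
    field_simp
  have h6 : (N : ℝ) * 1 ≤ N * (160 * C ^ 2 * (2 ^ (s + 2) * ∫ z in (0 : ℝ)..1, F z)) := by
    rw [mul_one]
    refine hcard.trans ?_
    rw [h5]
    have : 160 * C ^ 2 * (2 ^ (s + 2) * N * (R.card * (1 / 2 ^ (s + 2 + 2 * n))))
        ≤ 160 * C ^ 2 * (2 ^ (s + 2) * N * ∫ z in (0 : ℝ)..1, F z) := by gcongr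
    linarith
  exact le_of_mul_le_mul_left h6 hN0

/-- The set where some partial sum of the block `n` is large, as an indicator function. -/
def bigSum (f : ℕ → ℕ → ℝ → ℝ) (n : ℕ) (α : ℕ → ℝ) (θ x : ℝ) : ℝ :=
  exceeds (2 ^ (2 * n)) α θ fun i => gFun f n i x

theorem step_bigSum {f : ℕ → ℕ → ℝ → ℝ} (hf : ∀ k ≥ 1, IsMenshovSystem k (f k)) {n : ℕ} (hn : 1 ≤ n)
    (α : ℕ → ℝ) (θ : ℝ) : bigSum f n α θ ∈ dyadicStep 0 1 (kSeq f n) := by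
  rw [mem_dyadicStep_iff]
  exact fun x y hxy => exceeds_congr fun i hi => mem_dyadicStep_iff.1 (step_gFun hf hn hi) x y hxy

theorem periodic_bigSum {f : ℕ → ℕ → ℝ → ℝ} {n : ℕ} (hn : 2 ≤ n) (α : ℕ → ℝ) (θ : ℝ) :
    Function.Periodic (bigSum f n α θ) (1 / 2 ^ (kSeq f (n - 1) + 2 * n ^ 2 + 2)) := fun x =>
  exceeds_congr fun _ _ => periodic_gStep hn x

/-- The height √(2^s)|γ| must reach max(1,|γ|), while the measure obtained is of order 2^{-s}. The
least admissible s makes 2^{-s} comparable to min(1,γ²). -/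
theorem integral_bigSum {f : ℕ → ℕ → ℝ → ℝ} (hf : ∀ k ≥ 1, IsMenshovSystem k (f k))
    {n : ℕ} (hn : 2 ≤ n) {α : ℕ → ℝ} {C γ θ : ℝ} (hθ : 32 * θ ≤ max 1 |γ|)
    (hγ : ∑ t ∈ Finset.Icc 1 (2 ^ (2 * n) + 1), α t = γ * √((2 : ℝ) ^ (2 * n) + 1))
    (hα : ∑ t ∈ Finset.Icc 1 (2 ^ (2 * n) + 1), α t ^ 2 ≤ C ^ 2 * γ ^ 2) (hC : 0 ≤ C)
    (hγ0 : 1 ≤ 2 ^ (2 * n ^ 2) * γ ^ 2) (hH : 16 * C ≤ harm (2 ^ (2 * n))) :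
    min 1 (γ ^ 2) ≤ 2560 * C ^ 2 * ∫ x in (0 : ℝ)..1, bigSum f n α θ x := by
  have hγne : γ ≠ 0 := by
    rintro rfl
    norm_num at hγ0
  have hγsq : 0 < γ ^ 2 := by positivity
  -- The least s ≥ 2 with 2^s γ² ≥ 1. It is at most 2n² by hγ0. Minimality gives 2^s γ² < 2 if s >
  -- 2, and for s = 2 the bound 4 is clear.
  obtain ⟨s, hs, hs', hsγ, hsmin⟩ : ∃ s, 2 ≤ s ∧ s ≤ 2 * n ^ 2 ∧ 1 ≤ 2 ^ s * γ ^ 2 ∧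
      (2 : ℝ) ^ s * min 1 (γ ^ 2) ≤ 4 := by
    classical
    have hex : ∃ s, 2 ≤ s ∧ 1 ≤ 2 ^ s * γ ^ 2 := ⟨2 * n ^ 2, by nlinarith, hγ0⟩
    refine ⟨Nat.find hex, (Nat.find_spec hex).1, Nat.find_min' hex ⟨by nlinarith, hγ0⟩,
      (Nat.find_spec hex).2, ?_⟩
    set s := Nat.find hex with hsdef
    rcases Nat.eq_or_lt_of_le (Nat.find_spec hex).1 with h | h
    · rw [← hsdef] at h
      rw [← h]
      have := min_le_left 1 (γ ^ 2)
      linarith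
    · have h1 := Nat.find_min hex (m := s - 1) (by omega)
      have h2 : (2 : ℝ) ^ (s - 1) * γ ^ 2 < 1 := by
        by_contra h3
        exact h1 ⟨by omega, not_lt.1 h3⟩
      have h4 : (2 : ℝ) ^ s = 2 ^ (s - 1) * 2 := by rw [← pow_succ, Nat.sub_add_cancel (by omega)]
      have := min_le_right 1 (γ ^ 2)
      rw [h4]
      have : (0 : ℝ) < 2 ^ (s - 1) := by positivity
      nlinarith
  have hθ' : θ ≤ √(2 ^ s) * |γ| / 32 := by
    have : 1 ≤ √(2 ^ s) * |γ| := by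
      rw [← Real.sqrt_sq_eq_abs, ← Real.sqrt_mul (by positivity), Real.one_le_sqrt]
      exact hsγ
    have h2 : 1 ≤ √((2 : ℝ) ^ s) := by rw [Real.one_le_sqrt]; exact one_le_pow₀ (by norm_num)
    have h3 : max 1 |γ| ≤ √(2 ^ s) * |γ| := max_le this (le_mul_of_one_le_left (abs_nonneg _) h2)
    linarith
  set A := √(∑ t ∈ Finset.Icc 1 (2 ^ (2 * n) + 1), α t ^ 2) with hAdef
  have hA2 : ∑ t ∈ Finset.Icc 1 (2 ^ (2 * n) + 1), α t ^ 2 = A ^ 2 :=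
    (Real.sq_sqrt (Finset.sum_nonneg fun _ _ => sq_nonneg _)).symm
  have hAC : A ≤ C * |γ| := by
    apply Real.sqrt_le_iff.2 ⟨by positivity, ?_⟩
    rw [mul_pow, sq_abs]
    exact hα
  have key : 1 ≤ 160 * C ^ 2 * (2 ^ (s + 2) * ∫ z in (0 : ℝ)..1,
      exceeds (2 ^ (2 * n)) α (√(2 ^ s) * |γ| / 32) fun i => gHat f n (kSeq f (n - 1)) i z) := by
    rcases lt_or_gt_of_ne hγne with h | h
    · have := integral_exceeds_gHat hf (n := n) (kp := kSeq f (n - 1)) (by omega) hs hs'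
        (α := fun t => -α t) (A := A) (C := C) (γ := |γ|) (Real.sqrt_nonneg _) (by simpa using hA2)
        (by rw [Finset.sum_neg_distrib, hγ, abs_of_neg h]; ring) (by positivity) hAC hH
      simpa only [exceeds_neg] using this
    · exact integral_exceeds_gHat hf (by omega) hs hs' (Real.sqrt_nonneg _) hA2
        (by rw [hγ, abs_of_pos h]) (by positivity) hAC hH
  set F : ℝ → ℝ := fun z =>
    exceeds (2 ^ (2 * n)) α (√(2 ^ s) * |γ| / 32) fun i => gHat f n (kSeq f (n - 1)) i z with hF
  have hstep : LineStep (2 * n ^ 2 + 2 * n + kSeq f (n - 1) + 2 ^ (2 * n) + 5) F :=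
    fun x y hxy => exceeds_congr fun i hi =>
      (lineStep_gHat hf (by omega) hi).mono (by omega) x y hxy
  -- The dilation in the definition of g_n preserves integrals, and lowering the threshold to θ only
  -- enlarges the set.
  have hle : ∫ z in (0 : ℝ)..1, F z ≤ ∫ x in (0 : ℝ)..1, bigSum f n α θ x := by
    rw [← integral_dilate (K := kSeq f (n - 1) + 2 * n ^ 2 + 2) hstep]
    refine intervalIntegral.integral_mono_on zero_le_one ?_
      (intervalIntegrable_step (step_bigSum hf (by omega) α θ)) fun x _ => ?_
    · have := (hstep.fract.affine (a := kSeq f (n - 1) + 2 * n ^ 2 + 2) 0).mem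
      simp only [Int.cast_zero, add_zero] at this
      exact intervalIntegrable_step this
    · refine (exceeds_anti hθ' _).trans (le_of_eq (exceeds_congr fun i _ => ?_))
      rw [gFun, gStep, if_neg (by omega)]
  have hI : 0 ≤ ∫ x in (0 : ℝ)..1, bigSum f n α θ x :=
    intervalIntegral.integral_nonneg zero_le_one fun _ _ => exceeds_nonneg _ _ _ _
  have hm : 0 < min 1 (γ ^ 2) := lt_min one_pos hγsq
  have k1 : 1 ≤ 160 * C ^ 2 * (2 ^ (s + 2) * ∫ x in (0 : ℝ)..1, bigSum f n α θ x) :=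
    key.trans (by gcongr)
  have k2 : min 1 (γ ^ 2) * 1 ≤ min 1 (γ ^ 2) *
      (160 * C ^ 2 * (2 ^ (s + 2) * ∫ x in (0 : ℝ)..1, bigSum f n α θ x)) :=
    mul_le_mul_of_nonneg_left k1 hm.le
  rw [pow_add] at k2
  have k3 := mul_le_mul_of_nonneg_left hsmin
    (show 0 ≤ 640 * C ^ 2 * ∫ x in (0 : ℝ)..1, bigSum f n α θ x by positivity)
  nlinarith

end DivONS

end

noncomputable section

namespace DivONS

open MeasureTheory Filter Topology

/-! ### Independent events, density, symmetry -/

theorem IsStep.integrable {u : ℝ → ℝ} (hu : IsStep u) :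
    Integrable u (volume.restrict (Set.Icc (0 : ℝ) 1)) := by
  have := hu.intervalIntegrable
  rwa [intervalIntegrable_iff_integrableOn_Ioc_of_le zero_le_one,
    ← integrableOn_Icc_iff_integrableOn_Ioc] at this

/-- The functions `ω m` are measurable with respect to consecutive independent `σ`-algebras. -/
structure IsIndepSteps (k : ℕ → ℕ) (ω : ℕ → ℝ → ℝ) : Prop where
  step : ∀ m, ω m ∈ dyadicStep 0 1 (k m)
  periodic : ∀ m ≥ 1, Function.Periodic (ω m) (1 / 2 ^ k (m - 1))

/-- Split off the factor with the largest index a: the others form a step function of level k (a-1),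
whose cell length is a period of ω a. -/
theorem integral_prod_indep {k : ℕ → ℕ} (hk : Monotone k) {ω : ℕ → ℝ → ℝ} (hω : IsIndepSteps k ω)
    (s : Finset ℕ) :
    ∫ x in (0 : ℝ)..1, ∏ m ∈ s, ω m x = ∏ m ∈ s, ∫ x in (0 : ℝ)..1, ω m x := by
  classical
  induction s using Finset.induction_on_max with
  | empty => simp
  | insert a s hs ih =>
    have ha : a ∉ s := fun h => lt_irrefl _ (hs a h)
    simp only [Finset.prod_insert ha]
    rcases s.eq_empty_or_nonempty with rfl | ⟨b, hb⟩
    · simp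
    have h1 : (fun x => ∏ m ∈ s, ω m x) ∈ dyadicStep 0 1 (k (a - 1)) := step_prod fun i hi =>
      dyadicStep_mono (hk (by have := hs i hi; omega)) (hω.step i)
    have ha1 : 1 ≤ a := by have := hs b hb; omega
    rw [← ih, mul_comm, ← integral_step_mul_periodic h1 (intervalIntegrable_step (hω.step a))
      (hω.periodic a ha1)]
    simp only [mul_comm]

/-- The second Borel–Cantelli lemma. The measure of the set where all ω m with M ≤ m < n vanish is
at most the product of the numbers 1 - p m, hence at most exp(-∑ p m), which tends to 0. -/
theorem ae_frequently_of_indep {k : ℕ → ℕ} (hk : Monotone k) {ω : ℕ → ℝ → ℝ}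
    (hω : IsIndepSteps k ω) (h0 : ∀ m x, 0 ≤ ω m x) (h1 : ∀ m x, ω m x ≤ 1)
    (hs : ¬ Summable fun m => ∫ x in (0 : ℝ)..1, ω m x) :
    ∀ᵐ x ∂volume.restrict (Set.Icc (0 : ℝ) 1), ∀ M, ∃ m ≥ M, ω m x ≠ 0 := by
  rw [ae_all_iff]
  intro M
  set p : ℕ → ℝ := fun m => ∫ x in (0 : ℝ)..1, ω m x with hp
  have hp0 : ∀ m, 0 ≤ p m := fun m =>
    intervalIntegral.integral_nonneg zero_le_one fun x _ => h0 m x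
  have hω' : IsIndepSteps k fun m x => 1 - ω m x := by
    refine ⟨fun m => step_comp (1 - ·) (hω.step m), fun m hm x => ?_⟩
    simp only [hω.periodic m hm x]
  have h_int : ∀ m, ∫ x in (0 : ℝ)..1, (1 - ω m x) = 1 - p m := fun m => by
    rw [intervalIntegral.integral_sub (by simp) (intervalIntegrable_step (hω.step m))]
    simp [hp]
  have hlim : Tendsto (fun n => Real.exp (-∑ m ∈ Finset.Ico M n, p m)) atTop (𝓝 0) := by
    rw [Real.tendsto_exp_comp_nhds_zero, tendsto_neg_atBot_iff]
    have h2 := (not_summable_iff_tendsto_nat_atTop_of_nonneg hp0).1 hs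
    refine (tendsto_atTop_add_const_right _ (-∑ m ∈ Finset.range M, p m) h2).congr' ?_
    filter_upwards [eventually_ge_atTop M] with n hn
    rw [Finset.sum_Ico_eq_sub _ hn, sub_eq_add_neg]
  rw [ae_iff]
  set Z := {x : ℝ | ¬ ∃ m ≥ M, ω m x ≠ 0} with hZ
  have hle : ∀ n, (volume.restrict (Set.Icc (0 : ℝ) 1)).real Z
      ≤ Real.exp (-∑ m ∈ Finset.Ico M n, p m) := by
    intro n
    have hF : IsStep fun x => ∏ m ∈ Finset.Ico M n, (1 - ω m x) :=
      ⟨k n, step_prod fun m hm =>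
        dyadicStep_mono (hk (Finset.mem_Ico.1 hm).2.le) (hω'.step m)⟩
    have h2 := mul_meas_ge_le_integral_of_nonneg
      (μ := volume.restrict (Set.Icc (0 : ℝ) 1)) (f := fun x => ∏ m ∈ Finset.Ico M n, (1 - ω m x))
      (Eventually.of_forall fun x => Finset.prod_nonneg fun m _ => by have := h1 m x; linarith)
      hF.integrable 1
    rw [setIntegral_unit, integral_prod_indep hk hω', one_mul] at h2
    have h3 : Z ⊆ {x | 1 ≤ ∏ m ∈ Finset.Ico M n, (1 - ω m x)} := fun x hx => by
      rw [hZ, Set.mem_ofPred_eq] at hx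
      rw [Set.mem_ofPred_eq, Finset.prod_eq_one]
      intro m hm
      have : ω m x = 0 := by
        by_contra h
        exact hx ⟨m, (Finset.mem_Ico.1 hm).1, h⟩
      rw [this, sub_zero]
    refine (measureReal_mono h3).trans (h2.trans ?_)
    rw [← Finset.sum_neg_distrib, Real.exp_sum]
    refine Finset.prod_le_prod (fun m _ => ?_) fun m _ => ?_
    · exact intervalIntegral.integral_nonneg zero_le_one fun x _ => by have := h1 m x; linarith
    · rw [h_int]
      exact Real.one_sub_le_exp_neg _
  have := le_of_tendsto_of_tendsto' tendsto_const_nhds hlim hle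
  have h4 : (volume.restrict (Set.Icc (0 : ℝ) 1)).real Z = 0 := le_antisymm this measureReal_nonneg
  exact (measureReal_eq_zero_iff).1 h4

/-- A set that does not fill arbitrarily small dyadic intervals around almost every point is a null
set. -/
theorem null_of_sparse_cells {S : Set ℝ} (hS : S ⊆ Set.Icc 0 1) {K : ℕ → ℕ}
    (hK : Tendsto K atTop atTop) {q : ENNReal} (hq : q < 1)
    (h : ∀ᵐ x ∂volume.restrict (Set.Icc (0 : ℝ) 1), ∃ᶠ m in atTop, ∀ i : ℕ, i < 2 ^ K m →
      (i : ℝ) < 2 ^ K m * x → 2 ^ K m * x < i + 1 →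
      volume (S ∩ Set.Icc ((i : ℝ) / 2 ^ K m) (((i + 1 : ℕ) : ℝ) / 2 ^ K m))
        ≤ q * volume (Set.Icc ((i : ℝ) / 2 ^ K m) (((i + 1 : ℕ) : ℝ) / 2 ^ K m))) :
    volume S = 0 := by
  rw [← Measure.restrict_eq_zero, ← ae_eq_bot, ← eventually_false_iff_eq_bot]
  have hmem : ∀ᵐ x ∂volume.restrict S, x ∈ Set.Icc (0 : ℝ) 1 :=
    ae_restrict_of_ae_restrict_of_subset hS (ae_restrict_mem measurableSet_Icc)
  -- At almost every point of S the relative measure of S in the dyadic intervals around it tends to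
  -- 1, which contradicts a bound q < 1 valid infinitely often.
  filter_upwards [IsUnifLocDoublingMeasure.ae_tendsto_measure_inter_div volume S 1,
    ae_restrict_of_ae_restrict_of_subset hS h, hmem, ae_restrict_of_ae ae_nondyadic]
    with x hx hfr hx01 hnd
  choose i hi h1 h2 using fun n => hnd.exists_cell hx01.1 hx01.2 (K n)
  have hlim := hx (fun n => mid (K n) (i n)) (fun n => (1 : ℝ) / 2 ^ (K n + 1))
    (tendsto_cell_radius hK) (Eventually.of_forall fun n => by
      rw [one_mul, closedBall_mid]
      exact mem_cell_of_lt (h1 n) (h2 n))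
  have hgt := hlim.eventually (lt_mem_nhds hq)
  obtain ⟨m, hm1, hm2⟩ := (hfr.and_eventually hgt).exists
  have hm3 := hm1 (i m) (hi m) (h1 m) (h2 m)
  rw [closedBall_mid] at hm2
  set I := Set.Icc ((i m : ℝ) / 2 ^ K m) (((i m + 1 : ℕ) : ℝ) / 2 ^ K m) with hI
  exact absurd hm2 (not_lt.2 (ENNReal.div_le_of_le_mul hm3))

/-- The points of the unit interval where `S` oscillates by less than `ε` after the index `J`. -/
def calmSet (S : ℕ → ℝ → ℝ) (ε : ℝ) (J : ℕ) : Set ℝ :=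
  {x | x ∈ Set.Icc (0 : ℝ) 1 ∧ Nondyadic x ∧ ∀ i ≥ J, ∀ j ≥ J, |S i x - S j x| < ε}

theorem ae_not_tendsto_of_null {S : ℕ → ℝ → ℝ} {ε : ℝ} (hε : 0 < ε)
    (h : ∀ J, volume (calmSet S ε J) = 0) :
    ∀ᵐ x ∂volume.restrict (Set.Icc (0 : ℝ) 1),
      ¬ ∃ L : ℝ, Tendsto (fun j : ℕ => S j x) atTop (𝓝 L) := by
  rw [ae_restrict_iff' measurableSet_Icc]
  filter_upwards [ae_nondyadic, ae_all_iff.2 fun J => measure_eq_zero_iff_ae_notMem.1 (h J)]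
    with x hnd hx hx01
  rintro ⟨L, hL⟩
  obtain ⟨J, hJ⟩ := Metric.cauchySeq_iff.1 hL.cauchySeq ε hε
  exact hx J ⟨hx01, hnd, fun i hi j hj => by rw [← Real.dist_eq]; exact hJ i hi j hj⟩

/-! ### Symmetry of Rademacher sums on dyadic intervals. -/

theorem measurable_rademacher (n : ℕ) : Measurable (rademacher n) := by
  have h : Measurable Real.sign := by
    unfold Real.sign
    exact Measurable.ite measurableSet_Iio measurable_const
      (Measurable.ite measurableSet_Ioi measurable_const measurable_const)
  unfold rademacher
  exact h.comp (by fun_prop)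

/-- The point (2i+1)/2^K is twice the midpoint of the i-th cell. A function that is odd and has
period 2^{-K} is odd about every such midpoint. -/
theorem rademacher_cell_reflect {K n : ℕ} (h : K ≤ n) (i : ℕ) (y : ℝ) :
    rademacher n ((2 * i + 1 : ℕ) / 2 ^ K - y) = -rademacher n y := by
  have hp := periodic_mono h (periodic_rademacher n)
  have := hp.nat_mul (2 * i + 1) (-y)
  rw [← rademacher_neg, ← this]
  congr 1
  push_cast
  ring

/-- A symmetric perturbation does not decrease the absolute value of a constant on at least half of
a dyadic interval. -/
theorem volume_symmetric_le {K i : ℕ} {P c : ℝ} (hP : c ≤ |P|) {s : Finset ℕ} {n : ℕ → ℕ} (b : ℕ → ℝ)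
    (hn : ∀ l ∈ s, K ≤ n l) :
    volume {y | y ∈ Set.Icc ((i : ℝ) / 2 ^ K) (((i + 1 : ℕ) : ℝ) / 2 ^ K) ∧
        |P + ∑ l ∈ s, b l * rademacher (n l) y| < c}
      ≤ 2⁻¹ * volume (Set.Icc ((i : ℝ) / 2 ^ K) (((i + 1 : ℕ) : ℝ) / 2 ^ K)) := by
  set Q : ℝ → ℝ := fun y => ∑ l ∈ s, b l * rademacher (n l) y with hQ
  set I := Set.Icc ((i : ℝ) / 2 ^ K) (((i + 1 : ℕ) : ℝ) / 2 ^ K) with hI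
  set B := {y | y ∈ I ∧ |P + Q y| < c} with hB
  set d : ℝ := (2 * i + 1 : ℕ) / 2 ^ K with hd
  have hQd : ∀ y, Q (d - y) = -Q y := fun y => by
    simp only [hQ]
    rw [← Finset.sum_neg_distrib]
    refine Finset.sum_congr rfl fun l hl => ?_
    rw [hd, rademacher_cell_reflect (hn l hl)]
    ring
  have hId : ∀ y, d - y ∈ I ↔ y ∈ I := fun y => by
    rw [hI, hd, Set.mem_Icc, Set.mem_Icc]
    push_cast
    have e : (2 * (i : ℝ) + 1) / 2 ^ K = i / 2 ^ K + (i + 1) / 2 ^ K := by ring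
    rw [e]
    constructor <;> rintro ⟨h1, h2⟩ <;> constructor <;> linarith
  have hQm : Measurable Q := by
    simp only [hQ]
    exact Finset.measurable_sum _ fun l _ => (measurable_rademacher _).const_mul _
  have hBm : MeasurableSet B := by
    rw [hB]
    exact measurableSet_Icc.inter (measurableSet_lt (f := fun y => |P + Q y|)
      (continuous_abs.measurable.comp (hQm.const_add P)) measurable_const)
  have hmp : MeasurePreserving (fun y : ℝ => d - y) volume volume :=
    Measure.measurePreserving_sub_left volume d
  -- If a point and its reflection were both bad, averaging P + Q and P - Q would give |P| < c. So B
  -- and its mirror image are disjoint in the interval and have equal measure.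
  have hdisj : Disjoint B ((fun y : ℝ => d - y) ⁻¹' B) := by
    rw [Set.disjoint_left]
    rintro y ⟨_, h1⟩ ⟨_, h2⟩
    rw [hQd] at h2
    have h3 : |2 * P| ≤ |P + Q y| + |P + -Q y| := by
      have := abs_add_le (P + Q y) (P + -Q y)
      rwa [show P + Q y + (P + -Q y) = 2 * P by ring] at this
    rw [abs_mul, abs_two] at h3
    linarith
  have hsub : B ∪ (fun y : ℝ => d - y) ⁻¹' B ⊆ I := by
    rintro y (hy | hy)
    · exact hy.1
    · exact (hId y).1 hy.1
  rw [mul_comm, ← div_eq_mul_inv, ENNReal.le_div_iff_mul_le (by simp) (by simp), mul_comm]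
  calc 2 * volume B = volume B + volume ((fun y : ℝ => d - y) ⁻¹' B) := by
        rw [hmp.measure_preimage hBm.nullMeasurableSet, two_mul]
    _ = volume (B ∪ (fun y : ℝ => d - y) ⁻¹' B) :=
        (measure_union hdisj (hmp.measurable hBm)).symm
    _ ≤ volume I := measure_mono hsub

/-! ### Pointwise decay of ξ. -/

theorem sq_le_of_step {K : ℕ} {u : ℝ → ℝ} (hu : u ∈ dyadicStep 0 1 K) {x : ℝ} (hx : Nondyadic x)
    (h0 : 0 ≤ x) (h1 : x ≤ 1) : u x ^ 2 ≤ 2 ^ K * ip u u := by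
  obtain ⟨i, hi, hi1, hi2⟩ := hx.exists_cell h0 h1 K
  rw [mem_dyadicStep_iff.1 hu _ _ (sameCell_mid hi hi1 hi2), ip_eq_sum hu hu, Finset.mul_sum]
  have h := Finset.single_le_sum
    (f := fun i => 2 ^ K * (u (mid K i) * u (mid K i) * (1 / 2 ^ K)))
    (fun j _ => by have := mul_self_nonneg (u (mid K j)); positivity) (Finset.mem_range.2 hi)
  refine le_trans (le_of_eq ?_) h
  field_simp

/-- At a fixed x > 0 the Haar functions eventually vanish. The coefficient of ψ_ν is p_ν^{-1/2} =
2^{-(k_n+1)}, whereas |ψ_ν| ≤ 2^{(k_n+2)/2} for a normalized step function of level k_n+2; hence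
ξ_l(x)² ≤ 2^{-k_n} eventually. -/
theorem tendsto_xi {f : ℕ → ℕ → ℝ → ℝ} (hf : ∀ k ≥ 1, IsMenshovSystem k (f k)) {ψ : ℕ → ℝ → ℝ}
    (hψ : IsComplement (kSeq f) (gFun f) ψ) {x : ℝ} (hx : Nondyadic x) (h0 : 0 ≤ x) (h1 : x ≤ 1) :
    Tendsto (fun l => xi (kSeq f) ψ l x) atTop (𝓝 0) := by
  have hxpos : 0 < x := lt_of_le_of_ne h0 fun h => hx 0 0 (by simp [← h])
  have hkt : Tendsto (kSeq f) atTop atTop := (kSeq_strictMono hf).tendsto_atTop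
  have hpow : Tendsto (fun n : ℕ => (1 : ℝ) / 2 ^ n) atTop (𝓝 0) := by
    simpa using tendsto_pow_atTop_nhds_zero_of_lt_one (r := (1 / 2 : ℝ)) (by norm_num) (by norm_num)
  obtain ⟨l₁, hl₁⟩ : ∃ l₁, ∀ l ≥ l₁, haarFirst (kSeq f l + 1) x = 0 := by
    have := (hpow.comp ((tendsto_add_atTop_nat 1).comp hkt)).eventually (gt_mem_nhds hxpos)
    obtain ⟨l₁, h⟩ := eventually_atTop.1 this
    exact ⟨l₁, fun l hl => haarFirst_eq_zero (le_of_lt (by exact h l hl))⟩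
  have hρ := (isBlockLength_rhoOf (kSeq f)).strictMono
  have hν := tendsto_blockOf hρ
  have hn := (tendsto_blockOf (mSeq_strictMono hf)).comp hν
  have hlim : Tendsto (fun l => (1 : ℝ) /
      2 ^ kSeq f (blockOf (mSeq (kSeq f)) (blockOf (rhoOf (kSeq f)) l))) atTop (𝓝 0) :=
    hpow.comp (hkt.comp hn)
  have hsq : Tendsto (fun l => xi (kSeq f) ψ l x ^ 2) atTop (𝓝 0) := by
    refine tendsto_of_tendsto_of_tendsto_of_le_of_le' tendsto_const_nhds hlim
      (Eventually.of_forall fun _ => sq_nonneg _) ?_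
    filter_upwards [hν.eventually_ge_atTop (max l₁ 1)] with l hl
    set ν := blockOf (rhoOf (kSeq f)) l with hνdef
    set n := blockOf (mSeq (kSeq f)) ν with hndef
    have hν1 : 1 ≤ ν := le_trans (le_max_right _ _) hl
    obtain ⟨hn1, hmem⟩ := psi_block hf hν1
    rw [xi, phi, ← hνdef, Finset.sum_eq_zero, add_zero, kappa_first, mul_pow, div_pow, one_pow,
      Real.sq_sqrt (by positivity)]
    · have h2 := sq_le_of_step (hψ.step n hn1 ν hmem) hx h0 h1
      rw [ip_psi_psi hf hψ hν1 hν1, if_pos rfl, mul_one] at h2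
      have h3 : (pOf (kSeq f) ν : ℝ) = 2 ^ (kSeq f n + 2) * 2 ^ kSeq f n := by
        rw [pOf, ← hndef, ← pow_add]
        push_cast
        congr 1
        ring
      rw [h3]
      calc 1 / (2 ^ (kSeq f n + 2) * 2 ^ kSeq f n) * ψ ν x ^ 2
          ≤ 1 / (2 ^ (kSeq f n + 2) * 2 ^ kSeq f n) * 2 ^ (kSeq f n + 2) := by gcongr
        _ = 1 / 2 ^ kSeq f n := by field_simp
    · intro i hi
      rw [Finset.mem_Icc] at hi
      have h2 := le_qOf (kSeq f) hν1
      have h3 := le_trans (le_max_left l₁ 1) hl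
      rw [hl₁ _ (by omega), mul_zero]
  have := hsq.sqrt
  simp only [Real.sqrt_sq_eq_abs, Real.sqrt_zero] at this
  exact (tendsto_zero_iff_abs_tendsto_zero _).2 this

end DivONS

end

noncomputable section

namespace DivONS

open MeasureTheory Filter Topology

/-! ### Blocks of the series and the first divergence criterion -/

/-- The coefficient of the Rademacher function number `t` in `∑ a_l χ_l`. -/
def radCoef (ν : ℕ → ℕ) (a : ℕ → ℝ) (t : ℕ) : ℝ := a (radPos ν t)

/-- The coefficient of `Υ_t^m` in `∑ a_l χ_l`. -/
def upsCoef (ν : ℕ → ℕ) (a : ℕ → ℝ) (m t : ℕ) : ℝ := a (upsPos ν (muSeq (m - 1) + t))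

/-- The coefficient of `ξ_m` in the rotated block `m`. -/
def xiCoef (ν : ℕ → ℕ) (a : ℕ → ℝ) (m : ℕ) : ℝ :=
  (∑ t ∈ Finset.Icc 1 (2 ^ (2 * m) + 1), upsCoef ν a m t) / √((2 : ℝ) ^ (2 * m) + 1)

theorem muSeq_strictMono : StrictMono muSeq := isBlockLength_muSeq.strictMono

theorem upsilon_add (k : ℕ → ℕ) (g : ℕ → ℕ → ℝ → ℝ) (ψ : ℕ → ℝ → ℝ) {m t : ℕ} (hm : 1 ≤ m)
    (ht : t ∈ Finset.Icc 1 (2 ^ (2 * m) + 1)) :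
    upsilon k g ψ (muSeq (m - 1) + t) = upsilonBlock k g ψ m t := by
  rw [upsilon_eq_concat, isBlockLength_muSeq.concat_add _ hm ht, upsilonBlock_eq_rot]

theorem blockSum_eq {D : Choices} (hν : StrictMono D.ν) (a : ℕ → ℝ) (j : ℕ) (x : ℝ) :
    D.blockSum a j x = ∑ t ∈ Finset.Icc 1 (D.ν j), radCoef D.ν a t * rademacher (D.k t) x
      + ∑ i ∈ Finset.Icc 1 j, a (upsPos D.ν i) * D.Υ i x := by
  rw [Choices.blockSum, sum_positions hν]
  congr 1
  · refine Finset.sum_congr rfl fun t ht => ?_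
    rw [Choices.χ, chiSeq_radPos hν (Finset.mem_Icc.1 ht).1, radCoef]
  · refine Finset.sum_congr rfl fun t ht => ?_
    rw [Choices.χ, chiSeq_upsPos hν (Finset.mem_Icc.1 ht).1]

theorem sum_Icc_one_sub {a b : ℕ} (h : a ≤ b) (F : ℕ → ℝ) :
    ∑ i ∈ Finset.Icc 1 b, F i - ∑ i ∈ Finset.Icc 1 a, F i = ∑ i ∈ Finset.Ioc a b, F i := by
  have e : ∀ c, Finset.Icc 1 c = Finset.Ioc 0 c := fun c => by ext; simp [Nat.succ_le_iff]
  rw [e, e, ← Finset.sum_Ioc_consecutive F (Nat.zero_le a) h]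
  ring

theorem sum_Ioc_add (F : ℕ → ℝ) (c t : ℕ) :
    ∑ i ∈ Finset.Ioc c (c + t), F i = ∑ s ∈ Finset.Icc 1 t, F (c + s) := by
  induction t with
  | zero => simp
  | succ t ih => rw [← add_assoc, Finset.sum_Ioc_succ_top (by omega), ih,
      Finset.sum_Icc_succ_top (by omega), add_assoc]

theorem blockSum_sub {D : Choices} (hν : StrictMono D.ν) (a : ℕ → ℝ) {m t : ℕ} (hm : 1 ≤ m)
    (ht : t ≤ 2 ^ (2 * m) + 1) (x : ℝ) :
    D.blockSum a (muSeq (m - 1) + t) x - D.blockSum a (muSeq (m - 1)) x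
      = (∑ s ∈ Finset.Icc 1 t, upsCoef D.ν a m s * upsilonBlock D.k (gFun D.f) D.ψ m s x)
        + ∑ l ∈ Finset.Ioc (D.ν (muSeq (m - 1))) (D.ν (muSeq (m - 1) + t)),
          radCoef D.ν a l * rademacher (D.k l) x := by
  rw [blockSum_eq hν, blockSum_eq hν, add_sub_add_comm, sum_Icc_one_sub (hν.monotone (by omega)),
    sum_Icc_one_sub (by omega), sum_Ioc_add, add_comm]
  congr 1
  refine Finset.sum_congr rfl fun s hs => ?_
  rw [Finset.mem_Icc] at hs
  rw [Choices.Υ, upsilon_add _ _ _ hm (Finset.mem_Icc.2 ⟨hs.1, hs.2.trans ht⟩), upsCoef]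

theorem sum_upsilonBlock (k : ℕ → ℕ) (g : ℕ → ℕ → ℝ → ℝ) (ψ : ℕ → ℝ → ℝ) (α : ℕ → ℝ) (m t : ℕ)
    (x : ℝ) : ∑ s ∈ Finset.Icc 1 t, α s * upsilonBlock k g ψ m s x
      = (∑ s ∈ Finset.Icc 1 t, α s) / √((2 : ℝ) ^ (2 * m) + 1) * xi k ψ m x
        + rotPartial (2 ^ (2 * m)) α (fun i => g m i x) t := by
  rw [rotPartial, div_mul_eq_mul_div, Finset.sum_mul, Finset.sum_div, ← Finset.sum_add_distrib]
  refine Finset.sum_congr rfl fun s _ => ?_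
  rw [upsilonBlock, kappa_first]
  push_cast
  ring

theorem abs_sum_le_of_sq {α : ℕ → ℝ} {L t : ℕ} {C γ : ℝ} (hC : 0 ≤ C)
    (hα : ∑ t ∈ Finset.Icc 1 L, α t ^ 2 ≤ C ^ 2 * γ ^ 2) (ht : t ≤ L) :
    |∑ s ∈ Finset.Icc 1 t, α s| ≤ √(L : ℝ) * (C * |γ|) := by
  apply abs_le_of_sq_le_sq _ (by positivity)
  refine (sq_sum_le_card α).trans ?_
  rw [mul_pow, mul_pow, Real.sq_sqrt (by positivity), sq_abs, Nat.card_Icc, Nat.add_sub_cancel]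
  have h1 : ∑ i ∈ Finset.Icc 1 t, α i ^ 2 ≤ C ^ 2 * γ ^ 2 := le_trans
    (Finset.sum_le_sum_of_subset_of_nonneg (Finset.Icc_subset_Icc_right ht)
      fun _ _ _ => sq_nonneg _) hα
  have h2 : (t : ℝ) ≤ L := by exact_mod_cast ht
  have h3 : 0 ≤ ∑ i ∈ Finset.Icc 1 t, α i ^ 2 := Finset.sum_nonneg fun _ _ => sq_nonneg _
  exact mul_le_mul h2 h1 h3 (by positivity)

theorem Nondyadic.lt_of_mem_cell {K i : ℕ} {y : ℝ} (hy : Nondyadic y)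
    (h : y ∈ Set.Icc ((i : ℝ) / 2 ^ K) (((i + 1 : ℕ) : ℝ) / 2 ^ K)) :
    (i : ℝ) < 2 ^ K * y ∧ 2 ^ K * y < i + 1 := by
  obtain ⟨h1, h2⟩ := h
  rw [div_le_iff₀' (by positivity)] at h1
  rw [le_div_iff₀' (by positivity)] at h2
  have n1 := hy K i
  have n2 := hy K (i + 1)
  push_cast at h2 n1 n2
  exact ⟨lt_of_le_of_ne h1 n1.symm, lt_of_le_of_ne h2 n2⟩

/-- The rotated blocks in which the coefficient of `ξ_m` dominates are responsible for large partial
sums. -/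
theorem ae_frequently_large {f : ℕ → ℕ → ℝ → ℝ} (hf : ∀ k ≥ 1, IsMenshovSystem k (f k))
    (α : ℕ → ℕ → ℝ) (γ : ℕ → ℝ) {C : ℝ} (hC : 0 ≤ C) {G : Set ℕ}
    (hγ : ∀ m, ∑ t ∈ Finset.Icc 1 (2 ^ (2 * m) + 1), α m t = γ m * √((2 : ℝ) ^ (2 * m) + 1))
    (hG : ∀ m ∈ G, ∑ t ∈ Finset.Icc 1 (2 ^ (2 * m) + 1), α m t ^ 2 ≤ C ^ 2 * γ m ^ 2)
    (hs : ¬ Summable (G.indicator fun m => γ m ^ 2)) :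
    ∀ᵐ x ∂volume.restrict (Set.Icc (0 : ℝ) 1), ∀ M, ∃ m ≥ M, 2 ≤ m ∧ m ∈ G ∧
      ∃ t ≤ 2 ^ (2 * m), max 1 |γ m| / 32
        ≤ |rotPartial (2 ^ (2 * m)) (α m) (fun i => gFun f m i x) t| := by
  classical
  -- The blocks to which `integral_bigSum` applies. The discarded blocks of G form a finite set
  -- together with blocks where γ m² < 2^{-2m²}, so divergence of the series survives.
  set G' : Set ℕ := {m | m ∈ G ∧ 2 ≤ m ∧ 1 ≤ 2 ^ (2 * m ^ 2) * γ m ^ 2 ∧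
    16 * C ≤ harm (2 ^ (2 * m))} with hG'
  set ω : ℕ → ℝ → ℝ := fun m x => if m ∈ G' then bigSum f m (α m) (max 1 |γ m| / 32) x else 0 with hω
  have hind : IsIndepSteps (kSeq f) ω := by
    refine ⟨fun m => ?_, fun m _ x => ?_⟩
    · by_cases hm : m ∈ G'
      · simp only [hω, if_pos hm]
        exact step_bigSum hf (le_trans (by norm_num) hm.2.1) _ _
      · simp only [hω, if_neg hm]
        exact step_const _ _
    · by_cases hm : m ∈ G'
      · simp only [hω, if_pos hm]
        exact periodic_mono (by omega) (periodic_bigSum hm.2.1 _ _) x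
      · simp only [hω, if_neg hm]
  have h0 : ∀ m x, 0 ≤ ω m x := fun m x => by
    simp only [hω]
    split_ifs
    · exact exceeds_nonneg _ _ _ _
    · exact le_rfl
  have h1 : ∀ m x, ω m x ≤ 1 := fun m x => by
    simp only [hω]
    split_ifs
    · exact exceeds_le_one _ _ _ _
    · exact zero_le_one
  have hns : ¬ Summable fun m => ∫ x in (0 : ℝ)..1, ω m x := by
    intro hsum
    apply hs
    have hsum' := hsum.mul_left (2560 * C ^ 2)
    have hgeo : Summable fun m : ℕ => ((1 : ℝ) / 2) ^ m := summable_geometric_two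
    refine Summable.of_norm_bounded_eventually_nat (hsum'.add hgeo) ?_
    have hsmall := hsum'.tendsto_atTop_zero.eventually (gt_mem_nhds one_pos)
    filter_upwards [hsmall, eventually_ge_atTop 2, eventually_ge_atTop ⌈16 * C⌉₊] with m hm hm2 hmC
    have hp : 0 ≤ ∫ x in (0 : ℝ)..1, ω m x :=
      intervalIntegral.integral_nonneg zero_le_one fun x _ => h0 m x
    have hq : (0 : ℝ) ≤ (1 / 2) ^ m := by positivity
    by_cases hmG : m ∈ G
    · rw [Set.indicator_of_mem hmG, Real.norm_of_nonneg (sq_nonneg _)]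
      by_cases hbig : 1 ≤ 2 ^ (2 * m ^ 2) * γ m ^ 2
      · have hH : 16 * C ≤ harm (2 ^ (2 * m)) := by
          have e1 := Nat.le_of_ceil_le hmC
          have e2 := harm_two_pow (2 * m)
          push_cast at e2
          linarith
        have hmem : m ∈ G' := ⟨hmG, hm2, hbig, hH⟩
        simp only [hω, if_pos hmem] at hm hp ⊢
        have e3 := integral_bigSum hf hm2 (θ := max 1 |γ m| / 32) (by linarith) (hγ m) (hG m hmG) hC
          hbig hH
        -- The probabilities are assumed summable, so eventually the right-hand side of e3 is below
        -- 1 and the minimum cannot be 1.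
        have e4 : min 1 (γ m ^ 2) = γ m ^ 2 := by
          rcases min_choice 1 (γ m ^ 2) with h | h
          · rw [h] at e3; linarith
          · exact h
        rw [e4] at e3
        linarith
      · have e1 : γ m ^ 2 ≤ (1 / 2) ^ m := by
          rw [not_le] at hbig
          have e2 : (2 : ℝ) ^ m ≤ 2 ^ (2 * m ^ 2) := pow_le_pow_right₀ (by norm_num) (by nlinarith)
          rw [div_pow, one_pow, le_div_iff₀ (by positivity)]
          have := sq_nonneg (γ m)
          nlinarith
        have : 0 ≤ 2560 * C ^ 2 * ∫ x in (0 : ℝ)..1, ω m x := by positivity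
        linarith
    · rw [Set.indicator_of_notMem hmG, norm_zero]
      positivity
  filter_upwards [ae_frequently_of_indep (kSeq_strictMono hf).monotone hind h0 h1 hns] with x hx M
  obtain ⟨m, hm, hne⟩ := hx M
  have hmem : m ∈ G' := by
    by_contra h
    exact hne (if_neg h)
  simp only [hω, if_pos hmem] at hne
  refine ⟨m, hm, hmem.2.1, hmem.1, ?_⟩
  by_contra h
  exact hne (by rw [bigSum, exceeds, if_neg h])

/-- At almost every x infinitely many blocks contain a large partial sum. It is constant on the
dyadic interval of level k_{ν_{μ_{m-1}}} around x, and the Rademacher functions added since the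
start of the group oscillate inside that interval. By symmetry the calm set covers at most half of
it, so its density cannot be 1. -/
theorem ae_diverges_of_dominant {l₀ : ℕ} {D : Choices} (hD : D.Admissible l₀) (a : ℕ → ℝ)
    {C : ℝ} (hC : 0 ≤ C) {G : Set ℕ}
    (hG : ∀ m ∈ G, ∑ t ∈ Finset.Icc 1 (2 ^ (2 * m) + 1), upsCoef D.ν a m t ^ 2
      ≤ C ^ 2 * xiCoef D.ν a m ^ 2)
    (hs : ¬ Summable (G.indicator fun m => xiCoef D.ν a m ^ 2)) :
    ∀ᵐ x ∂volume.restrict (Set.Icc (0 : ℝ) 1),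
      ¬ ∃ L : ℝ, Tendsto (fun j : ℕ => D.blockSum a j x) atTop (𝓝 L) := by
  have hf := hD.menshov
  have hkmono : StrictMono D.k := kSeq_strictMono hf
  have hν : StrictMono D.ν := hD.blocking.strictMono hkmono
  have hγ : ∀ m, ∑ t ∈ Finset.Icc 1 (2 ^ (2 * m) + 1), upsCoef D.ν a m t
      = xiCoef D.ν a m * √((2 : ℝ) ^ (2 * m) + 1) := fun m => by
    rw [xiCoef, div_mul_cancel₀]
    positivity
  refine ae_not_tendsto_of_null (ε := 1 / 64) (by norm_num) fun J => ?_
  have hKt : Tendsto (fun m => D.k (D.ν (muSeq (m - 1)))) atTop atTop :=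
    (((hkmono.comp hν).comp muSeq_strictMono).tendsto_atTop).comp (tendsto_sub_atTop_nat 1)
  refine null_of_sparse_cells (fun x hx => hx.1) hKt (q := 2⁻¹) (by simp) ?_
  filter_upwards [ae_frequently_large hf (upsCoef D.ν a) (xiCoef D.ν a) hC hγ hG hs,
    ae_restrict_of_ae ae_nondyadic, ae_restrict_mem measurableSet_Icc] with x hx hnd hx01
  have hξ := (tendsto_xi hf hD.complement hnd hx01.1 hx01.2).abs.const_mul C
  rw [abs_zero, mul_zero] at hξ
  have hev := (hξ.eventually (gt_mem_nhds (show (0 : ℝ) < 1 / 64 by norm_num))).and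
    (eventually_ge_atTop (J + 1))
  refine ((frequently_atTop.2 hx).and_eventually hev).mono ?_
  rintro m ⟨⟨hm2, hmG, t, ht, hlarge⟩, hξm, hmJ⟩ i hi h1 h2
  set γ := xiCoef D.ν a m with hγdef
  set P := ∑ s ∈ Finset.Icc 1 t, upsCoef D.ν a m s * upsilonBlock D.k (gFun D.f) D.ψ m s x with hP
  -- The ξ-part is at most |γ|/64 for large m, and max(1,|γ|)/32 - |γ|/64 ≥ 1/64. The maximum in the
  -- lower bound is needed for this subtraction when |γ| is large.
  have hPlarge : 1 / 64 ≤ |P| := by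
    rw [hP, sum_upsilonBlock]
    have e1 := abs_sum_le_of_sq hC (hG m hmG) (show t ≤ 2 ^ (2 * m) + 1 by omega)
    set A := ∑ s ∈ Finset.Icc 1 t, upsCoef D.ν a m s with hA
    set R := rotPartial (2 ^ (2 * m)) (upsCoef D.ν a m) (fun i => gFun D.f m i x) t with hR
    push_cast at e1
    have hL : 0 < √((2 : ℝ) ^ (2 * m) + 1) := by positivity
    have e2 : |A / √((2 : ℝ) ^ (2 * m) + 1) * xi D.k D.ψ m x| ≤ |γ| * (1 / 64) := by
      rw [abs_mul, abs_div, abs_of_pos hL]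
      calc |A| / √((2 : ℝ) ^ (2 * m) + 1) * |xi D.k D.ψ m x|
          ≤ (C * |γ|) * |xi D.k D.ψ m x| := by
            gcongr
            rw [div_le_iff₀ hL]
            linarith
        _ = |γ| * (C * |xi D.k D.ψ m x|) := by ring
        _ ≤ _ := by gcongr; exact hξm.le
    have e3 : |R| ≤ |A / √((2 : ℝ) ^ (2 * m) + 1) * xi D.k D.ψ m x + R|
        + |A / √((2 : ℝ) ^ (2 * m) + 1) * xi D.k D.ψ m x| := by
      set X := A / √((2 : ℝ) ^ (2 * m) + 1) * xi D.k D.ψ m x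
      have := abs_add_le (X + R) (-X)
      rwa [abs_neg, show X + R + -X = R by ring] at this
    have e4 := le_max_left 1 |γ|
    have e5 := le_max_right 1 |γ|
    linarith
  refine le_trans (measure_mono ?_)
    (volume_symmetric_le (K := D.k (D.ν (muSeq (m - 1)))) (i := i) hPlarge
      (s := Finset.Ioc (D.ν (muSeq (m - 1))) (D.ν (muSeq (m - 1) + t))) (n := D.k)
      (radCoef D.ν a) (fun l hl => hkmono.monotone (Finset.mem_Ioc.1 hl).1.le))
  rintro y ⟨⟨hy01, hynd, hyosc⟩, hyI⟩
  refine ⟨hyI, ?_⟩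
  obtain ⟨h3, h4⟩ := hynd.lt_of_mem_cell hyI
  have hPy : P = ∑ s ∈ Finset.Icc 1 t,
      upsCoef D.ν a m s * upsilonBlock D.k (gFun D.f) D.ψ m s y := by
    refine Finset.sum_congr rfl fun s hs' => ?_
    congr 1
    rw [Finset.mem_Icc] at hs'
    have e1 := hD.blocking.step_block m (by omega) (muSeq (m - 1) + s) (by
      rw [Finset.mem_Ioc, isBlockLength_muSeq.succ m (by omega)]
      omega)
    rw [Choices.Υ, upsilon_add _ _ _ (by omega) (Finset.mem_Icc.2 ⟨hs'.1, by omega⟩)] at e1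
    exact mem_dyadicStep_iff.1 e1 x y ⟨i, hi, h1, h2, h3, h4⟩
  rw [hPy, ← blockSum_sub hν a (by omega) (by omega) y]
  have := muSeq_strictMono.le_apply (x := m - 1)
  exact hyosc _ (by omega) _ (by omega)

end DivONS

end

noncomputable section

namespace DivONS

open MeasureTheory Filter Topology

/-! ### Moments of sums of independent step functions -/

theorem IsStep.sub {u v : ℝ → ℝ} (hu : IsStep u) (hv : IsStep v) : IsStep (fun x => u x - v x) :=
  hu.comp₂ (· - ·) hv

theorem IsStep.pow {u : ℝ → ℝ} (hu : IsStep u) (n : ℕ) : IsStep (fun x => u x ^ n) :=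
  hu.comp₂ (fun a _ => a ^ n) hu

theorem integral_add_step {u v : ℝ → ℝ} (hu : IsStep u) (hv : IsStep v) :
    ∫ x in (0 : ℝ)..1, (u x + v x) = (∫ x in (0 : ℝ)..1, u x) + ∫ x in (0 : ℝ)..1, v x :=
  intervalIntegral.integral_add hu.intervalIntegrable hv.intervalIntegrable

theorem integral_mono_step {u v : ℝ → ℝ} (hu : IsStep u) (hv : IsStep v) (h : ∀ x, u x ≤ v x) :
    ∫ x in (0 : ℝ)..1, u x ≤ ∫ x in (0 : ℝ)..1, v x :=
  intervalIntegral.integral_mono_on zero_le_one hu.intervalIntegrable hv.intervalIntegrable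
    fun x _ => h x

theorem integral_nonneg_of {u : ℝ → ℝ} (h : ∀ x, 0 ≤ u x) : 0 ≤ ∫ x in (0 : ℝ)..1, u x :=
  intervalIntegral.integral_nonneg zero_le_one fun x _ => h x

theorem sq_integral_mul_le {u v : ℝ → ℝ} (hu : IsStep u) (hv : IsStep v) :
    (∫ x in (0 : ℝ)..1, u x * v x) ^ 2
      ≤ (∫ x in (0 : ℝ)..1, u x ^ 2) * ∫ x in (0 : ℝ)..1, v x ^ 2 := by
  obtain ⟨K, hK⟩ := hu
  obtain ⟨K', hK'⟩ := hv
  have h1 := dyadicStep_mono (le_max_left K K') hK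
  have h2 := dyadicStep_mono (le_max_right K K') hK'
  have := real_inner_mul_inner_self_le (toVec (max K K') u) (toVec (max K K') v)
  rw [inner_toVec h1 h2, inner_toVec h1 h1, inner_toVec h2 h2] at this
  simpa only [ip, sq] using this

/-- A sequence of centred step functions that depend on consecutive groups of binary digits. -/
structure IsAdapted (K : ℕ → ℕ) (Z : ℕ → ℝ → ℝ) : Prop where
  step : ∀ m, Z m ∈ dyadicStep 0 1 (K (m + 1))
  periodic : ∀ m, Function.Periodic (Z m) (1 / 2 ^ K m)
  mean_zero : ∀ m, ∫ x in (0 : ℝ)..1, Z m x = 0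

section Adapted

variable {K : ℕ → ℕ} {P Q Z : ℕ → ℝ → ℝ}

theorem IsAdapted.isStep (hZ : IsAdapted K Z) (m : ℕ) : IsStep (Z m) := ⟨_, hZ.step m⟩

theorem IsAdapted.step_sum (hK : Monotone K) (hZ : IsAdapted K Z) (n : ℕ) :
    (fun x => ∑ m ∈ Finset.range n, Z m x) ∈ dyadicStep 0 1 (K n) :=
  DivONS.step_sum fun m hm => dyadicStep_mono (hK (Finset.mem_range.1 hm)) (hZ.step m)

theorem IsAdapted.integral_mul_eq_zero (hQ : IsAdapted K Q) {u : ℝ → ℝ} {n : ℕ}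
    (hu : u ∈ dyadicStep 0 1 (K n)) : ∫ x in (0 : ℝ)..1, u x * Q n x = 0 := by
  rw [integral_step_mul_periodic hu (hQ.isStep n).intervalIntegrable (hQ.periodic n),
    hQ.mean_zero, mul_zero]

/-- Mixed terms with different indices vanish, because the later factor is periodic with mean 0 at
the scale of the earlier one. -/
theorem IsAdapted.integral_sum_mul_sum (hK : Monotone K) (hP : IsAdapted K P) (hQ : IsAdapted K Q)
    (n : ℕ) : ∫ x in (0 : ℝ)..1, (∑ m ∈ Finset.range n, P m x) * ∑ m ∈ Finset.range n, Q m x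
      = ∑ m ∈ Finset.range n, ∫ x in (0 : ℝ)..1, P m x * Q m x := by
  induction n with
  | zero => simp
  | succ n ih =>
    have hp := hP.step_sum hK n
    have hq := hQ.step_sum hK n
    rw [Finset.sum_range_succ, ← ih]
    simp only [Finset.sum_range_succ]
    set p : ℝ → ℝ := fun x => ∑ m ∈ Finset.range n, P m x with hpdef
    set q : ℝ → ℝ := fun x => ∑ m ∈ Finset.range n, Q m x with hqdef
    have hps : IsStep p := ⟨_, hp⟩
    have hqs : IsStep q := ⟨_, hq⟩
    have hPn := hP.isStep n
    have hQn := hQ.isStep n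
    have e : ∀ x, (p x + P n x) * (q x + Q n x)
        = ((p x * q x + p x * Q n x) + q x * P n x) + P n x * Q n x := fun x => by ring
    have h1 := hQ.integral_mul_eq_zero hp
    have h2 := hP.integral_mul_eq_zero hq
    change ∫ x in (0 : ℝ)..1, (p x + P n x) * (q x + Q n x) = _
    simp only [e]
    rw [integral_add_step (((hps.mul hqs).add (hps.mul hQn)).add (hqs.mul hPn)) (hPn.mul hQn),
      integral_add_step ((hps.mul hqs).add (hps.mul hQn)) (hqs.mul hPn),
      integral_add_step (hps.mul hqs) (hps.mul hQn), h1, h2, add_zero, add_zero]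

theorem integral_mul_of_step {k : ℕ} {u v : ℝ → ℝ} (hu : u ∈ dyadicStep 0 1 k) (hv : IsStep v)
    (hp : Function.Periodic v (1 / 2 ^ k)) :
    ∫ x in (0 : ℝ)..1, u x * v x = (∫ x in (0 : ℝ)..1, u x) * ∫ x in (0 : ℝ)..1, v x :=
  integral_step_mul_periodic hu hv.intervalIntegrable hp

/-- The fourth moment of a sum of two independent centred functions. -/
theorem integral_add_pow_four {k : ℕ} {w z : ℝ → ℝ} (hw : w ∈ dyadicStep 0 1 k) (hz : IsStep z)
    (hp : Function.Periodic z (1 / 2 ^ k)) (hw0 : ∫ x in (0 : ℝ)..1, w x = 0)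
    (hz0 : ∫ x in (0 : ℝ)..1, z x = 0) :
    ∫ x in (0 : ℝ)..1, (w x + z x) ^ 4 = (∫ x in (0 : ℝ)..1, w x ^ 4)
      + 6 * ((∫ x in (0 : ℝ)..1, w x ^ 2) * ∫ x in (0 : ℝ)..1, z x ^ 2)
      + ∫ x in (0 : ℝ)..1, z x ^ 4 := by
  have hws : IsStep w := ⟨_, hw⟩
  have hpp : ∀ n : ℕ, Function.Periodic (fun x => z x ^ n) (1 / 2 ^ k) := fun n x => by
    simp only [hp x]
  have e : ∀ x, (w x + z x) ^ 4 = (((w x ^ 4 + 4 * (w x ^ 3 * z x)) + 6 * (w x ^ 2 * z x ^ 2))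
      + 4 * (w x * z x ^ 3)) + z x ^ 4 := fun x => by ring
  have s1 := hws.pow 4
  have s2 := ((hws.pow 3).mul hz).const_mul 4
  have s3 := ((hws.pow 2).mul (hz.pow 2)).const_mul 6
  have s4 := (hws.mul (hz.pow 3)).const_mul 4
  simp only [e]
  rw [integral_add_step (((s1.add s2).add s3).add s4) (hz.pow 4),
    integral_add_step ((s1.add s2).add s3) s4, integral_add_step (s1.add s2) s3,
    integral_add_step s1 s2, intervalIntegral.integral_const_mul, intervalIntegral.integral_const_mul,
    intervalIntegral.integral_const_mul, integral_mul_of_step (step_comp (· ^ 3) hw) hz hp,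
    integral_mul_of_step (step_comp (· ^ 2) hw) (hz.pow 2) (hpp 2),
    integral_mul_of_step hw (hz.pow 3) (hpp 3), hw0, hz0]
  ring

theorem IsAdapted.integral_sum (hZ : IsAdapted K Z) (n : ℕ) :
    ∫ x in (0 : ℝ)..1, ∑ m ∈ Finset.range n, Z m x = 0 := by
  rw [intervalIntegral.integral_finsetSum fun m _ => (hZ.isStep m).intervalIntegrable]
  exact Finset.sum_eq_zero fun m _ => hZ.mean_zero m

theorem IsAdapted.integral_sum_sq (hK : Monotone K) (hZ : IsAdapted K Z) (n : ℕ) :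
    ∫ x in (0 : ℝ)..1, (∑ m ∈ Finset.range n, Z m x) ^ 2
      = ∑ m ∈ Finset.range n, ∫ x in (0 : ℝ)..1, Z m x ^ 2 := by
  simpa only [sq] using hZ.integral_sum_mul_sum hK hZ n

/-- In the induction the cross term 6 S z of `integral_add_pow_four` fits into the term 2c S z of
c(S+z)², which is why c ≥ 3 suffices. -/
theorem IsAdapted.integral_sum_pow_four (hK : Monotone K) (hZ : IsAdapted K Z) {c : ℝ} (hc : 3 ≤ c)
    (h4 : ∀ m, ∫ x in (0 : ℝ)..1, Z m x ^ 4 ≤ c * (∫ x in (0 : ℝ)..1, Z m x ^ 2) ^ 2) (n : ℕ) :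
    ∫ x in (0 : ℝ)..1, (∑ m ∈ Finset.range n, Z m x) ^ 4
      ≤ c * (∑ m ∈ Finset.range n, ∫ x in (0 : ℝ)..1, Z m x ^ 2) ^ 2 := by
  induction n with
  | zero => simp
  | succ n ih =>
    simp only [Finset.sum_range_succ]
    rw [integral_add_pow_four (hZ.step_sum hK n) (hZ.isStep n) (hZ.periodic n) (hZ.integral_sum n)
      (hZ.mean_zero n), hZ.integral_sum_sq hK]
    have h1 : 0 ≤ ∑ m ∈ Finset.range n, ∫ x in (0 : ℝ)..1, Z m x ^ 2 :=
      Finset.sum_nonneg fun m _ => integral_nonneg_of fun x => sq_nonneg _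
    have h2 : 0 ≤ ∫ x in (0 : ℝ)..1, Z n x ^ 2 := integral_nonneg_of fun x => sq_nonneg _
    have := h4 n
    nlinarith [mul_nonneg h1 h2]

end Adapted

/-- The half of a block of functions `g_n^i` where they are Rademacher functions. -/
def upperSum (q N : ℕ) (β : ℕ → ℝ) (z : ℝ) : ℝ :=
  (if 1 / 2 < z then 1 else 0) * ∑ i ∈ Finset.range N, β i * rademacher (q + i) z

theorem isAdapted_rademacher (q : ℕ) (β : ℕ → ℝ) :
    IsAdapted (fun i => q + i) fun i x => β i * rademacher (q + i) x where
  step i := step_const_mul _ (step_rademacher _)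
  periodic i x := by simp only [periodic_rademacher (q + i) x]
  mean_zero i := by rw [intervalIntegral.integral_const_mul, integral_rademacher, mul_zero]

theorem integral_rademacher_pow {n j : ℕ} (hj : Even j) :
    ∫ x in (0 : ℝ)..1, rademacher n x ^ j = 1 := by
  obtain ⟨i, rfl⟩ := hj
  rw [integral_congr_nondyadic (v := fun _ => 1) fun x hx _ _ => by
    rw [← two_mul, pow_mul, sq, rademacher_sq hx, one_pow]]
  simp

theorem integral_const_mul_rademacher_pow {n j : ℕ} (hj : Even j) (c : ℝ) :
    ∫ x in (0 : ℝ)..1, (c * rademacher n x) ^ j = c ^ j := by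
  simp only [mul_pow]
  rw [intervalIntegral.integral_const_mul, integral_rademacher_pow hj, mul_one]

theorem lineStep_upperSum (q N : ℕ) (β : ℕ → ℝ) : LineStep (q + N + 1) (upperSum q N β) :=
    fun x y h => by
  rw [upperSum, upperSum]
  congr 1
  · exact lineStep_upper_half.mono (by omega) x y h
  refine Finset.sum_congr rfl fun i hi => ?_
  rw [Finset.mem_range] at hi
  rw [(lineStep_rademacher (q + i)).mono (by omega) x y h]

/-- The indicator of (1/2,1] has level 1 and is independent of the Rademacher functions with index
at least 1; its mean is 1/2. -/
theorem integral_upperSum_pow {q : ℕ} (hq : 1 ≤ q) (N : ℕ) (β : ℕ → ℝ) {j : ℕ} (hj : 1 ≤ j) :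
    ∫ z in (0 : ℝ)..1, upperSum q N β z ^ j
      = 1 / 2 * ∫ z in (0 : ℝ)..1, (∑ i ∈ Finset.range N, β i * rademacher (q + i) z) ^ j := by
  have e : ∀ z, upperSum q N β z ^ j = (if 1 / 2 < z then (1 : ℝ) else 0) *
      (∑ i ∈ Finset.range N, β i * rademacher (q + i) z) ^ j := fun z => by
    rw [upperSum, mul_pow]
    split_ifs
    · simp
    · rw [zero_pow (by omega)]
  simp only [e]
  have hu : ∫ z in (0 : ℝ)..1, (if 1 / 2 < z then (1 : ℝ) else 0) = 1 / 2 := by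
    rw [integral_step lineStep_upper_half.mem]
    simp only [mid, pow_one, Finset.sum_range_succ, Finset.sum_range_zero]
    norm_num
  rw [integral_mul_of_step lineStep_upper_half.mem ?_ ?_, hu]
  · exact (IsStep.sum fun i _ => (isStep_rademacher _).const_mul _).pow j
  · intro z
    have h : ∀ i, rademacher (q + i) (z + 1 / 2 ^ 1) = rademacher (q + i) z := fun i =>
      periodic_mono (show 1 ≤ q + i by omega) (periodic_rademacher (q + i)) z
    simp only [h]

theorem integral_upperSum {q : ℕ} (hq : 1 ≤ q) (N : ℕ) (β : ℕ → ℝ) :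
    ∫ z in (0 : ℝ)..1, upperSum q N β z = 0 := by
  have := integral_upperSum_pow hq N β le_rfl
  simpa only [pow_one, (isAdapted_rademacher q β).integral_sum, mul_zero] using this

theorem integral_upperSum_sq {q : ℕ} (hq : 1 ≤ q) (N : ℕ) (β : ℕ → ℝ) :
    ∫ z in (0 : ℝ)..1, upperSum q N β z ^ 2 = 1 / 2 * ∑ i ∈ Finset.range N, β i ^ 2 := by
  have hK : Monotone fun i => q + i := fun i j h => by simpa using h
  rw [integral_upperSum_pow hq N β (by norm_num), (isAdapted_rademacher q β).integral_sum_sq hK]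
  simp only [integral_const_mul_rademacher_pow even_two]

/-- Khinchin's constant 3 doubles under restriction to half of the interval: (1/2)·3S² = 6·(S/2)².
-/
theorem integral_upperSum_pow_four {q : ℕ} (hq : 1 ≤ q) (N : ℕ) (β : ℕ → ℝ) :
    ∫ z in (0 : ℝ)..1, upperSum q N β z ^ 4 ≤ 6 * (∫ z in (0 : ℝ)..1, upperSum q N β z ^ 2) ^ 2 := by
  have hK : Monotone fun i => q + i := fun i j h => by simpa using h
  have h4 : Even 4 := ⟨2, rfl⟩
  have := (isAdapted_rademacher q β).integral_sum_pow_four hK (c := 3) le_rfl (fun m => by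
    rw [integral_const_mul_rademacher_pow h4, integral_const_mul_rademacher_pow even_two]
    nlinarith [sq_nonneg (β m ^ 2)]) N
  rw [integral_upperSum_sq hq, integral_upperSum_pow hq N β (by norm_num)]
  simp only [integral_const_mul_rademacher_pow even_two] at this
  nlinarith

/-! ### The test against the Rademacher part -/

theorem abs_le_of_sq_le' {x y : ℝ} (hy : 0 ≤ y) (h : x ^ 2 ≤ y ^ 2) : |x| ≤ y :=
  abs_le_of_sq_le_sq h hy

/-- If a sum `T = U' + U'' + V` is bounded on most of the set with indicator `u`, while `U''` is small
and `U'` is small compared to `V`, then the correlation of `V` with `W` is bounded. -/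
theorem correlation_le {u U' U'' V W : ℝ → ℝ} {a R : ℝ} (hR : 0 ≤ R) (ha : 0 < a)
    (hu : IsStep u) (hU' : IsStep U') (hU'' : IsStep U'') (hV : IsStep V) (hW : IsStep W)
    (hu01 : ∀ x, u x = 0 ∨ u x = 1) (hua : ∫ x in (0 : ℝ)..1, u x = a)
    (hVW : ∫ x in (0 : ℝ)..1, u x * (V x * W x) = a * R ^ 2)
    (hW2 : ∫ x in (0 : ℝ)..1, u x * W x ^ 2 = a * R ^ 2)
    (hV2 : ∫ x in (0 : ℝ)..1, u x * V x ^ 2 ≤ 2 * a * R ^ 2)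
    (hW4 : ∫ x in (0 : ℝ)..1, u x * W x ^ 4 ≤ 6 * a * R ^ 4)
    (hU'2 : ∫ x in (0 : ℝ)..1, U' x ^ 2 ≤ a / 100 * R ^ 2)
    (hU''2 : ∫ x in (0 : ℝ)..1, U'' x ^ 2 ≤ a / 20000)
    (hT : a * (1 - 1 / 20000)
      ≤ ∫ x in (0 : ℝ)..1, u x * if |U' x + U'' x + V x| ≤ 1 then 1 else 0) : R ≤ 4 := by
  have huu : ∀ x, u x * u x = u x := fun x => by rcases hu01 x with h | h <;> simp [h]
  have hu0 : ∀ x, 0 ≤ u x := fun x => by rcases hu01 x with h | h <;> simp [h]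
  set d : ℝ → ℝ := fun x => if |U' x + U'' x + V x| ≤ 1 then 1 else 0 with hd
  set d' : ℝ → ℝ := fun x => if |U'' x| ≤ 1 then 1 else 0 with hd'
  have hds : IsStep d := ((hU'.add hU'').add hV).comp₂ (fun a _ => if |a| ≤ 1 then 1 else 0) hV
  have hd's : IsStep d' := hU''.comp₂ (fun a _ => if |a| ≤ 1 then 1 else 0) hV
  -- The good set, where T and U'' are both bounded by 1 and hence |U' + V| ≤ 2; β is the indicator
  -- of the rest of the support of u.
  set w : ℝ → ℝ := fun x => u x * (d x * d' x) with hw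
  set β : ℝ → ℝ := fun x => u x - w x with hβ
  have hws : IsStep w := hu.mul (hds.mul hd's)
  have hβs : IsStep β := hu.sub hws
  have hd01 : ∀ x, d x = 0 ∨ d x = 1 := fun x => by simp only [hd]; split_ifs <;> simp
  have hd'01 : ∀ x, d' x = 0 ∨ d' x = 1 := fun x => by simp only [hd']; split_ifs <;> simp
  have hβ01 : ∀ x, β x = 0 ∨ β x = 1 := fun x => by
    simp only [hβ, hw]
    rcases hu01 x with h | h <;> rcases hd01 x with h2 | h2 <;> rcases hd'01 x with h3 | h3 <;>
      simp [h, h2, h3]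
  have hβ0 : ∀ x, 0 ≤ β x := fun x => by rcases hβ01 x with h | h <;> simp [h]
  have hββ : ∀ x, β x * β x = β x := fun x => by rcases hβ01 x with h | h <;> simp [h]
  have hβu : ∀ x, β x * u x = β x := fun x => by
    simp only [hβ, hw]
    linear_combination (1 - d x * d' x) * huu x
  -- Failure of |T| ≤ 1 costs a/20000, and failure of |U''| ≤ 1 costs another a/20000 by Chebyshev's
  -- inequality. The value 9600 makes the fourth-moment bound below a perfect square.
  have hβint : ∫ x in (0 : ℝ)..1, β x ≤ a / 9600 := by
    have h1 : ∫ x in (0 : ℝ)..1, β x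
        ≤ ∫ x in (0 : ℝ)..1, (u x + ((-1) * (u x * d x) + U'' x ^ 2)) := by
      refine integral_mono_step hβs (hu.add (((hu.mul hds).const_mul _).add (hU''.pow 2))) fun x => ?_
      have h2 : u x * d x * (1 - d' x) ≤ U'' x ^ 2 := by
        by_cases h3 : |U'' x| ≤ 1
        · have : d' x = 1 := if_pos h3
          rw [this]
          nlinarith [sq_nonneg (U'' x)]
        · have : d' x = 0 := if_neg h3
          rw [this]
          rw [not_le] at h3
          have h4 : 1 ≤ U'' x ^ 2 := by rw [← sq_abs]; nlinarith
          rcases hu01 x with h | h <;> rcases hd01 x with h2 | h2 <;> simp [h, h2] <;> linarith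
      simp only [hβ, hw]
      linarith
    rw [integral_add_step hu (((hu.mul hds).const_mul _).add (hU''.pow 2)),
      integral_add_step ((hu.mul hds).const_mul _) (hU''.pow 2),
      intervalIntegral.integral_const_mul, hua] at h1
    linarith
  -- the lower bound
  have hlow : |∫ x in (0 : ℝ)..1, U' x * (u x * W x)| ≤ a / 10 * R ^ 2 := by
    apply abs_le_of_sq_le' (by positivity)
    refine (sq_integral_mul_le hU' (hu.mul hW)).trans ?_
    have e : ∀ x, (u x * W x) ^ 2 = u x * W x ^ 2 := fun x => by rw [mul_pow, sq (u x), huu]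
    simp only [e]
    rw [hW2]
    calc (∫ x in (0 : ℝ)..1, U' x ^ 2) * (a * R ^ 2) ≤ (a / 100 * R ^ 2) * (a * R ^ 2) := by gcongr
      _ = (a / 10 * R ^ 2) ^ 2 := by ring
  -- the upper bound on the good set
  have hgood : ∫ x in (0 : ℝ)..1, w x * ((U' x + V x) * W x) ≤ 2 * (a * R) := by
    have h1 : ∫ x in (0 : ℝ)..1, w x * ((U' x + V x) * W x)
        ≤ ∫ x in (0 : ℝ)..1, 2 * (u x * (u x * |W x|)) := by
      refine integral_mono_step (hws.mul ((hU'.add hV).mul hW))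
        ((hu.mul (hu.mul (hW.comp₂ (fun a _ => |a|) hW))).const_mul 2) fun x => ?_
      rw [← mul_assoc (u x), huu]
      have hWx := abs_nonneg (W x)
      by_cases h3 : |U' x + U'' x + V x| ≤ 1 ∧ |U'' x| ≤ 1
      · have e1 : w x = u x := by simp [hw, hd, hd', h3.1, h3.2]
        rw [e1]
        have e2 : |U' x + V x| ≤ 2 := by
          rw [abs_le] at h3 ⊢
          rw [abs_le] at h3
          constructor <;> linarith [h3.1.1, h3.1.2, h3.2.1, h3.2.2]
        have e3 : (U' x + V x) * W x ≤ 2 * |W x| := by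
          refine (le_abs_self _).trans ?_
          rw [abs_mul]
          gcongr
        nlinarith [mul_le_mul_of_nonneg_left e3 (hu0 x)]
      · have e1 : w x = 0 := by
          simp only [hw, hd, hd']
          rw [not_and_or] at h3
          rcases h3 with h3 | h3 <;> simp [h3]
        rw [e1, zero_mul]
        have := hu0 x
        positivity
    rw [intervalIntegral.integral_const_mul] at h1
    have hWs : IsStep fun x => |W x| := hW.comp₂ (fun a _ => |a|) hW
    have h2 := sq_integral_mul_le hu (hu.mul hWs)
    have e : ∀ x, (u x * |W x|) ^ 2 = u x * W x ^ 2 := fun x => by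
      rw [mul_pow, sq_abs, sq (u x), huu]
    have e' : ∀ x, u x ^ 2 = u x := fun x => by rw [sq, huu]
    simp only [e, e'] at h2
    rw [hW2, hua] at h2
    have h3 := abs_le_of_sq_le' (x := ∫ x in (0 : ℝ)..1, u x * (u x * |W x|)) (y := a * R)
      (by positivity) (by linarith)
    have := (abs_le.1 h3).2
    linarith
  -- the upper bound on the bad set
  have hW2β : ∫ x in (0 : ℝ)..1, β x * W x ^ 2 ≤ a / 40 * R ^ 2 := by
    have h1 := sq_integral_mul_le hβs (hu.mul (hW.pow 2))
    have e : ∀ x, (u x * W x ^ 2) ^ 2 = u x * W x ^ 4 := fun x => by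
      rw [mul_pow, sq (u x), huu]; ring
    have e' : ∀ x, β x ^ 2 = β x := fun x => by rw [sq, hββ]
    have e'' : ∀ x, β x * (u x * W x ^ 2) = β x * W x ^ 2 := fun x => by rw [← mul_assoc, hβu]
    simp only [e, e', e''] at h1
    have h2 : (∫ x in (0 : ℝ)..1, β x) * ∫ x in (0 : ℝ)..1, u x * W x ^ 4
        ≤ (a / 9600) * (6 * a * R ^ 4) := by
      refine mul_le_mul hβint hW4 (integral_nonneg_of fun x => ?_) (by positivity)
      have := hu0 x
      positivity
    exact (abs_le.1 (abs_le_of_sq_le' (by positivity) ((h1.trans h2).trans (le_of_eq (by ring))))).2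
  have hUV : ∫ x in (0 : ℝ)..1, (u x * (U' x + V x)) ^ 2 ≤ 5 * a * R ^ 2 := by
    have h1 : ∫ x in (0 : ℝ)..1, (u x * (U' x + V x)) ^ 2
        ≤ ∫ x in (0 : ℝ)..1, (2 * U' x ^ 2 + 2 * (u x * V x ^ 2)) := by
      refine integral_mono_step ((hu.mul (hU'.add hV)).pow 2)
        (((hU'.pow 2).const_mul 2).add ((hu.mul (hV.pow 2)).const_mul 2)) fun x => ?_
      rcases hu01 x with h | h <;> simp only [h] <;>
        nlinarith [sq_nonneg (U' x), sq_nonneg (U' x - V x)]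
    rw [integral_add_step ((hU'.pow 2).const_mul 2) ((hu.mul (hV.pow 2)).const_mul 2),
      intervalIntegral.integral_const_mul, intervalIntegral.integral_const_mul] at h1
    have : 0 ≤ a * R ^ 2 := by positivity
    linarith
  have hbad : ∫ x in (0 : ℝ)..1, β x * ((U' x + V x) * W x) ≤ a * R ^ 2 * (2 / 5) := by
    have h1 := sq_integral_mul_le (hu.mul (hU'.add hV)) (hβs.mul hW)
    have e : ∀ x, u x * (U' x + V x) * (β x * W x) = β x * ((U' x + V x) * W x) := fun x => by
      linear_combination ((U' x + V x) * W x) * hβu x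
    have e' : ∀ x, (β x * W x) ^ 2 = β x * W x ^ 2 := fun x => by rw [mul_pow, sq (β x), hββ]
    simp only [e, e'] at h1
    have h2 : (∫ x in (0 : ℝ)..1, (u x * (U' x + V x)) ^ 2) * ∫ x in (0 : ℝ)..1, β x * W x ^ 2
        ≤ (5 * a * R ^ 2) * (a / 40 * R ^ 2) := by
      refine mul_le_mul hUV hW2β (integral_nonneg_of fun x => ?_) (by positivity)
      have := hβ0 x
      positivity
    refine (abs_le.1 (abs_le_of_sq_le' (by positivity) ((h1.trans h2).trans ?_))).2
    have : 0 ≤ (a * R ^ 2) ^ 2 := by positivity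
    nlinarith
  -- The correlation of U' + V with W, evaluated by the second moments on the left and split into
  -- the good and the bad set on the right.
  have htot : a * R ^ 2 + (∫ x in (0 : ℝ)..1, U' x * (u x * W x))
      = (∫ x in (0 : ℝ)..1, w x * ((U' x + V x) * W x))
        + ∫ x in (0 : ℝ)..1, β x * ((U' x + V x) * W x) := by
    rw [← hVW, ← integral_add_step (hu.mul (hV.mul hW)) (hU'.mul (hu.mul hW)),
      ← integral_add_step (hws.mul ((hU'.add hV).mul hW)) (hβs.mul ((hU'.add hV).mul hW))]
    refine intervalIntegral.integral_congr fun x _ => ?_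
    simp only [hβ]
    ring
  have h5 := (abs_le.1 hlow).1
  by_contra h6
  rw [not_le] at h6
  -- The losses 1/10 and 2/5 leave one half of a R², against at most 2aR from the good set.
  have h7 : a * (R ^ 2 * (1 / 2)) ≤ a * (2 * R) := by linarith
  have h8 := le_of_mul_le_mul_left h7 ha
  nlinarith

end DivONS

end

noncomputable section

namespace DivONS

open MeasureTheory Filter Topology

/-! ### The second divergence criterion -/

/-- The coefficient of `g_m^i` in the rotated block `m`. -/
def gCoef (ν : ℕ → ℕ) (a : ℕ → ℝ) (m i : ℕ) : ℝ :=
  ∑ t ∈ Finset.Icc 1 (2 ^ (2 * m) + 1), kappa (2 ^ (2 * m) + 1) (i + 2) t * upsCoef ν a m t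

theorem sum_sq_kappa {L : ℕ} (hL : 2 ≤ L) (α : ℕ → ℝ) :
    ∑ i ∈ Finset.Icc 1 L, (∑ t ∈ Finset.Icc 1 L, kappa L i t * α t) ^ 2
      = ∑ t ∈ Finset.Icc 1 L, α t ^ 2 := by
  have h1 : ∀ i, (∑ t ∈ Finset.Icc 1 L, kappa L i t * α t) ^ 2
      = ∑ t ∈ Finset.Icc 1 L, ∑ t' ∈ Finset.Icc 1 L, α t * α t' * (kappa L i t * kappa L i t') :=
    fun i => by
      rw [sq, Finset.sum_mul_sum]
      exact Finset.sum_congr rfl fun t _ => Finset.sum_congr rfl fun t' _ => by ring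
  simp only [h1]
  rw [Finset.sum_comm]
  refine Finset.sum_congr rfl fun t ht => ?_
  rw [Finset.sum_comm, Finset.sum_eq_single_of_mem t ht]
  · rw [← Finset.mul_sum, kappa_col hL ht ht, if_pos rfl]
    ring
  · intro t' ht' hne
    rw [← Finset.mul_sum, kappa_col hL ht ht', if_neg hne.symm, mul_zero]

theorem sum_Icc_one_succ_eq (F : ℕ → ℝ) (N : ℕ) :
    ∑ i ∈ Finset.Icc 1 (N + 1), F i = F 1 + ∑ i ∈ Finset.range N, F (i + 2) := by
  rw [sum_Icc_one_eq_range, Finset.sum_range_succ', add_comm]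

/-- The orthogonal matrix preserves the energy of the block; its first row produces the coefficient
of ξ, the other rows those of the g. -/
theorem sum_sq_upsCoef (ν : ℕ → ℕ) (a : ℕ → ℝ) (m : ℕ) :
    ∑ t ∈ Finset.Icc 1 (2 ^ (2 * m) + 1), upsCoef ν a m t ^ 2
      = xiCoef ν a m ^ 2 + ∑ i ∈ Finset.range (2 ^ (2 * m)), gCoef ν a m i ^ 2 := by
  have h : 1 ≤ 2 ^ (2 * m) := Nat.one_le_two_pow
  rw [← sum_sq_kappa (by omega), sum_Icc_one_succ_eq]
  congr 2
  rw [xiCoef, Finset.sum_div]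
  refine Finset.sum_congr rfl fun t _ => ?_
  rw [kappa_first]
  push_cast
  ring

theorem sum_full_block (k ν : ℕ → ℕ) (g : ℕ → ℕ → ℝ → ℝ) (ψ : ℕ → ℝ → ℝ) (a : ℕ → ℝ) (m : ℕ)
    (x : ℝ) :
    ∑ s ∈ Finset.Icc 1 (2 ^ (2 * m) + 1), upsCoef ν a m s * upsilonBlock k g ψ m s x
      = xiCoef ν a m * xi k ψ m x + ∑ i ∈ Finset.range (2 ^ (2 * m)), gCoef ν a m i * g m i x := by
  rw [sum_upsilonBlock, xiCoef]
  congr 1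
  simp only [rotPartial, gCoef, Finset.sum_mul, Finset.mul_sum]
  rw [Finset.sum_comm, sum_Icc_two_eq_range]
  refine Finset.sum_congr rfl fun i _ => Finset.sum_congr rfl fun s _ => ?_
  rw [Nat.add_sub_cancel]
  ring

/-- A linear combination of the functions `g_m^i`. -/
def gSum (f : ℕ → ℕ → ℝ → ℝ) (m : ℕ) (β : ℕ → ℝ) (x : ℝ) : ℝ :=
  ∑ i ∈ Finset.range (2 ^ (2 * m)), β i * gFun f m i x

theorem blockSum_sub_groups {D : Choices} (hν : StrictMono D.ν) (a : ℕ → ℝ) {M₀ M : ℕ} (h : M₀ ≤ M)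
    (x : ℝ) :
    D.blockSum a (muSeq M) x - D.blockSum a (muSeq M₀) x
      = (∑ m ∈ Finset.Ioc M₀ M, xiCoef D.ν a m * xi D.k D.ψ m x)
        + (∑ m ∈ Finset.Ioc M₀ M, gSum D.f m (gCoef D.ν a m) x)
        + ∑ l ∈ Finset.Ioc (D.ν (muSeq M₀)) (D.ν (muSeq M)),
          radCoef D.ν a l * rademacher (D.k l) x := by
  induction M, h using Nat.le_induction with
  | base => simp
  | succ M hM ih =>
    have h1 := blockSum_sub hν a (m := M + 1) (by omega) le_rfl x
    rw [Nat.add_sub_cancel, ← add_assoc, ← muSeq, sum_full_block] at h1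
    have h2 := Finset.sum_Ioc_consecutive (fun l => radCoef D.ν a l * rademacher (D.k l) x)
      (hν.monotone (muSeq_strictMono.monotone hM))
      (hν.monotone (muSeq_strictMono.monotone (Nat.le_succ M)))
    rw [Finset.sum_Ioc_succ_top (by omega), Finset.sum_Ioc_succ_top (by omega), ← h2]
    simp only [gSum] at ih ⊢
    simp only [Nat.succ_eq_add_one]
    linarith

/-- The indicator of the set where the functions `g_m^i` are Rademacher functions. -/
def upperInd (f : ℕ → ℕ → ℝ → ℝ) (m : ℕ) (x : ℝ) : ℝ :=
  if 1 / 2 < Int.fract (2 ^ (kSeq f (m - 1) + 2 * m ^ 2 + 2) * x) then 1 else 0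

theorem upperInd_mul_self (f : ℕ → ℕ → ℝ → ℝ) (m : ℕ) (x : ℝ) :
    upperInd f m x * upperInd f m x = upperInd f m x := by
  rw [upperInd]; split_ifs <;> norm_num

theorem step_upperInd {f : ℕ → ℕ → ℝ → ℝ} (hf : ∀ k ≥ 1, IsMenshovSystem k (f k)) {m : ℕ}
    (hm : 2 ≤ m) : upperInd f m ∈ dyadicStep 0 1 (kSeq f m) := by
  have h := (lineStep_upper_half.fract.affine (a := kSeq f (m - 1) + 2 * m ^ 2 + 2) 0).mem
  simp only [Int.cast_zero, add_zero] at h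
  exact dyadicStep_mono (by have := kSeq_lt hf hm; omega) h

theorem periodic_upperInd (f : ℕ → ℕ → ℝ → ℝ) (m : ℕ) :
    Function.Periodic (upperInd f m) (1 / 2 ^ (kSeq f (m - 1) + 2 * m ^ 2 + 2)) := fun x => by
  have : (2 : ℝ) ^ (kSeq f (m - 1) + 2 * m ^ 2 + 2) *
      (x + 1 / 2 ^ (kSeq f (m - 1) + 2 * m ^ 2 + 2))
      = 2 ^ (kSeq f (m - 1) + 2 * m ^ 2 + 2) * x + 1 := by field_simp
  rw [upperInd, upperInd, this, Int.fract_add_one]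

theorem step_gSum {f : ℕ → ℕ → ℝ → ℝ} (hf : ∀ k ≥ 1, IsMenshovSystem k (f k)) {m : ℕ}
    (hm : 1 ≤ m) (β : ℕ → ℝ) : gSum f m β ∈ dyadicStep 0 1 (kSeq f m) :=
  step_sum fun _ hi => step_const_mul _ (step_gFun hf hm (Finset.mem_range.1 hi))

theorem periodic_gSum {f : ℕ → ℕ → ℝ → ℝ} {m : ℕ} (hm : 2 ≤ m) (β : ℕ → ℝ) :
    Function.Periodic (gSum f m β) (1 / 2 ^ (kSeq f (m - 1) + 2 * m ^ 2 + 2)) := fun x =>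
  Finset.sum_congr rfl fun i _ => by rw [gFun, periodic_gStep hm x]

theorem integral_gSum {f : ℕ → ℕ → ℝ → ℝ} (hf : ∀ k ≥ 1, IsMenshovSystem k (f k)) {m : ℕ}
    (hm : 1 ≤ m) (β : ℕ → ℝ) : ∫ x in (0 : ℝ)..1, gSum f m β x = 0 := by
  simp only [gSum]
  rw [intervalIntegral.integral_finsetSum fun i hi =>
    ((isStep_gFun hf hm (Finset.mem_range.1 hi)).const_mul _).intervalIntegrable]
  refine Finset.sum_eq_zero fun i hi => ?_
  rw [intervalIntegral.integral_const_mul, integral_gFun hf hm (Finset.mem_range.1 hi), mul_zero]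

theorem integral_gSum_sq {f : ℕ → ℕ → ℝ → ℝ} (hf : ∀ k ≥ 1, IsMenshovSystem k (f k)) {m : ℕ}
    (hm : 1 ≤ m) (β : ℕ → ℝ) :
    ∫ x in (0 : ℝ)..1, gSum f m β x ^ 2 = ∑ i ∈ Finset.range (2 ^ (2 * m)), β i ^ 2 := by
  rw [← ip_self_sum β (fun i hi => isStep_gFun hf hm (Finset.mem_range.1 hi)) fun i hi j hj =>
    ip_gFun hf hm (Finset.mem_range.1 hi) (Finset.mem_range.1 hj)]
  simp only [ip, gSum, sq]

theorem upperInd_mul_gSum (f : ℕ → ℕ → ℝ → ℝ) {m : ℕ} (hm : 2 ≤ m) (β : ℕ → ℝ) (x : ℝ) :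
    upperInd f m x * gSum f m β x = upperSum (kSeq f (m - 1) + 4) (2 ^ (2 * m)) β
      (Int.fract (2 ^ (kSeq f (m - 1) + 2 * m ^ 2 + 2) * x)) := by
  rw [upperInd, upperSum]
  split_ifs with h
  · rw [one_mul, one_mul]
    refine Finset.sum_congr rfl fun i _ => ?_
    rw [gFun, gStep, if_neg (by omega), gHat_of_last_piece f (by omega) h (Int.fract_lt_one _).le]
  · simp

theorem integral_upper_pow (f : ℕ → ℕ → ℝ → ℝ) {m : ℕ} (hm : 2 ≤ m) (β : ℕ → ℝ) (j : ℕ) :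
    ∫ x in (0 : ℝ)..1, (upperInd f m x * gSum f m β x) ^ j
      = ∫ z in (0 : ℝ)..1, upperSum (kSeq f (m - 1) + 4) (2 ^ (2 * m)) β z ^ j := by
  simp only [upperInd_mul_gSum f hm]
  refine integral_dilate (Q := kSeq f (m - 1) + 4 + 2 ^ (2 * m) + 1)
    (F := fun z => upperSum (kSeq f (m - 1) + 4) (2 ^ (2 * m)) β z ^ j) fun x y h => ?_
  simp only
  rw [lineStep_upperSum _ _ β x y h]

/-! ### Closure properties of adapted sequences. -/

section Adapted

variable {K : ℕ → ℕ} {P Q : ℕ → ℝ → ℝ}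

theorem IsAdapted.add (hP : IsAdapted K P) (hQ : IsAdapted K Q) :
    IsAdapted K fun m x => P m x + Q m x where
  step m := step_add (hP.step m) (hQ.step m)
  periodic m x := by simp only [hP.periodic m x, hQ.periodic m x]
  mean_zero m := by
    rw [integral_add_step (hP.isStep m) (hQ.isStep m), hP.mean_zero, hQ.mean_zero, add_zero]

theorem IsAdapted.const_mul (hP : IsAdapted K P) (c : ℝ) : IsAdapted K fun m x => c * P m x where
  step m := step_const_mul c (hP.step m)
  periodic m x := by simp only [hP.periodic m x]
  mean_zero m := by rw [intervalIntegral.integral_const_mul, hP.mean_zero, mul_zero]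

theorem isAdapted_restrict (s : Finset ℕ) (hstep : ∀ m ∈ s, P m ∈ dyadicStep 0 1 (K (m + 1)))
    (hper : ∀ m ∈ s, Function.Periodic (P m) (1 / 2 ^ K m))
    (hmean : ∀ m ∈ s, ∫ x in (0 : ℝ)..1, P m x = 0) :
    IsAdapted K fun m x => if m ∈ s then P m x else 0 where
  step m := by
    by_cases h : m ∈ s
    · simp only [if_pos h, hstep m h]
    · simp only [if_neg h, step_const]
  periodic m x := by
    by_cases h : m ∈ s
    · simp only [if_pos h, hper m h x]
    · simp only [if_neg h]
  mean_zero m := by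
    by_cases h : m ∈ s
    · simp only [if_pos h, hmean m h]
    · simp [if_neg h]

theorem sum_restrict {s : Finset ℕ} {n : ℕ} (hs : s ⊆ Finset.range n) (F : ℕ → ℝ) :
    ∑ m ∈ Finset.range n, (if m ∈ s then F m else 0) = ∑ m ∈ s, F m := by
  rw [Finset.sum_ite_mem, Finset.inter_eq_right.2 hs]

end Adapted

theorem integral_add_sq {k : ℕ} {w z : ℝ → ℝ} (hw : w ∈ dyadicStep 0 1 k) (hz : IsStep z)
    (hp : Function.Periodic z (1 / 2 ^ k)) (hz0 : ∫ x in (0 : ℝ)..1, z x = 0) :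
    ∫ x in (0 : ℝ)..1, (w x + z x) ^ 2
      = (∫ x in (0 : ℝ)..1, w x ^ 2) + ∫ x in (0 : ℝ)..1, z x ^ 2 := by
  have hws : IsStep w := ⟨_, hw⟩
  have e : ∀ x, (w x + z x) ^ 2 = (w x ^ 2 + 2 * (w x * z x)) + z x ^ 2 := fun x => by ring
  simp only [e]
  rw [integral_add_step ((hws.pow 2).add ((hws.mul hz).const_mul 2)) (hz.pow 2),
    integral_add_step (hws.pow 2) ((hws.mul hz).const_mul 2), intervalIntegral.integral_const_mul,
    integral_mul_of_step hw hz hp, hz0]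
  ring

/-- If the partial sums between two block ends stay bounded on most of a dyadic interval, then the
coefficients of `g_m^i` and of the Rademacher functions are bounded in `ℓ²`. -/
theorem coef_bound {l₀ : ℕ} {D : Choices} (hD : D.Admissible l₀) (a : ℕ → ℝ) {M₀ M κ : ℕ}
    (hM₀ : 1 ≤ M₀) (hM : M₀ ≤ M) (hκ : κ ≤ D.k M₀) {u : ℝ → ℝ} (hu : u ∈ dyadicStep 0 1 κ)
    (hu01 : ∀ x, u x = 0 ∨ u x = 1) {A : ℝ} (hA : 0 < A) (huA : ∫ x in (0 : ℝ)..1, u x = A)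
    {G : Set ℕ}
    (hG : ∀ m ∉ G, xiCoef D.ν a m ^ 2
      ≤ A / 200 * ∑ i ∈ Finset.range (2 ^ (2 * m)), gCoef D.ν a m i ^ 2)
    (hGs : ∑ m ∈ Finset.Ioc M₀ M, G.indicator (fun m => xiCoef D.ν a m ^ 2) m ≤ A / 20000)
    (hT : A * (1 - 1 / 20000) ≤ ∫ x in (0 : ℝ)..1, u x *
      if |D.blockSum a (muSeq M) x - D.blockSum a (muSeq M₀) x| ≤ 1 then 1 else 0) :
    (∑ m ∈ Finset.Ioc M₀ M, ∑ i ∈ Finset.range (2 ^ (2 * m)), gCoef D.ν a m i ^ 2)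
      + ∑ l ∈ Finset.Ioc (D.ν (muSeq M₀)) (D.ν (muSeq M)), radCoef D.ν a l ^ 2 ≤ 32 := by
  classical
  have hf := hD.menshov
  have hψ := hD.complement
  have hkmono : StrictMono D.k := kSeq_strictMono hf
  have hν : StrictMono D.ν := hD.blocking.strictMono hkmono
  have hνμ : ∀ m, m ≤ D.ν (muSeq m) := fun _ =>
    (hν.comp muSeq_strictMono).le_apply
  set B : ℕ → ℝ := fun m => ∑ i ∈ Finset.range (2 ^ (2 * m)), gCoef D.ν a m i ^ 2 with hB
  have hB0 : ∀ m, 0 ≤ B m := fun m => Finset.sum_nonneg fun _ _ => sq_nonneg _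
  set s := Finset.Ioc M₀ M with hs
  set p := Finset.Ioc (D.ν (muSeq M₀)) (D.ν (muSeq M)) with hp
  -- A common summation range for the g-blocks, indexed by s, and the Rademacher functions, indexed
  -- by p. One index m carries both g_m and r_{k_m}.
  set n := D.ν (muSeq M) + 1 with hn
  have hsn : s ⊆ Finset.range n := fun m hm => by
    rw [hs, Finset.mem_Ioc] at hm
    have := hνμ M
    rw [Finset.mem_range]
    omega
  have hpn : p ⊆ Finset.range n := fun m hm => by
    rw [hp, Finset.mem_Ioc] at hm
    rw [Finset.mem_range]
    omega
  have hsge : ∀ m ∈ s, M₀ < m := fun m hm => (Finset.mem_Ioc.1 hm).1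
  have hpge : ∀ m ∈ p, M₀ < m := fun m hm =>
    lt_of_le_of_lt (hνμ M₀) (Finset.mem_Ioc.1 hm).1
  -- With this shift g_m and r_{k_m} are steps of level K (m+1), and for m > M₀ both have period
  -- 2^{-K m}, so their sum can be one term of an adapted sequence.
  set K : ℕ → ℕ := fun m => D.k (m - 1) + 2 with hK
  have hKm : Monotone K := fun i j hij => by
    have := hkmono.monotone (Nat.sub_le_sub_right hij 1)
    simp only [hK]
    omega
  have hKk : ∀ m, M₀ < m → K m ≤ D.k m := fun m hm =>
    kSeq_add_two_le hf (show 1 ≤ m - 1 by omega) (show m - 1 < m by omega)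
  set X : ℕ → ℝ → ℝ := fun m x => if m ∈ s then gSum D.f m (gCoef D.ν a m) x else 0 with hX
  -- The test function uses g only where it consists of Rademacher functions: this keeps half of the
  -- energy and makes Khinchin's fourth-moment bound available.
  set Y : ℕ → ℝ → ℝ := fun m x =>
    if m ∈ s then upperInd D.f m x * gSum D.f m (gCoef D.ν a m) x else 0 with hY
  set r : ℕ → ℝ → ℝ := fun m x => if m ∈ p then radCoef D.ν a m * rademacher (D.k m) x else 0 with hr
  have hXstep : ∀ m, X m ∈ dyadicStep 0 1 (D.k m) := fun m => by
    by_cases h : m ∈ s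
    · simp only [hX, if_pos h]
      exact step_gSum hf (by have := hsge m h; omega) _
    · simp only [hX, if_neg h]
      exact step_const _ _
  have hYstep : ∀ m, Y m ∈ dyadicStep 0 1 (D.k m) := fun m => by
    by_cases h : m ∈ s
    · simp only [hY, if_pos h]
      have := hsge m h
      exact step_mul (step_upperInd hf (by omega)) (step_gSum hf (by omega) _)
    · simp only [hY, if_neg h]
      exact step_const _ _
  have hrstep : ∀ m, IsStep (r m) := fun m => by
    by_cases h : m ∈ p
    · simp only [hr, if_pos h]
      exact (isStep_rademacher _).const_mul _
    · simp only [hr, if_neg h]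
      exact IsStep.const 0
  have hrper : ∀ m, Function.Periodic (r m) (1 / 2 ^ D.k m) := fun m x => by
    simp only [hr, periodic_rademacher (D.k m) x]
  have hrmean : ∀ m, ∫ x in (0 : ℝ)..1, r m x = 0 := fun m => by
    by_cases h : m ∈ p
    · simp only [hr, if_pos h]
      rw [intervalIntegral.integral_const_mul, integral_rademacher, mul_zero]
    · simp [hr, if_neg h]
  have hXY : ∀ m x, (X m x - Y m x) * Y m x = 0 := fun m x => by
    by_cases h : m ∈ s
    · simp only [hX, hY, if_pos h]
      linear_combination (-(gSum D.f m (gCoef D.ν a m) x ^ 2)) * upperInd_mul_self D.f m x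
    · simp only [hY, if_neg h, mul_zero]
  have hKs : ∀ m, K m ≤ D.k (m - 1) + 2 * m ^ 2 + 2 := fun m => by simp only [hK]; omega
  have hk2 : ∀ m, D.k m ≤ K (m + 1) := fun m => by simp [hK]
  have hXa : IsAdapted K X := isAdapted_restrict s
    (fun m hm => dyadicStep_mono (hk2 m) (step_gSum hf (by have := hsge m hm; omega) _))
    (fun m hm => periodic_mono (hKs m) (periodic_gSum (by have := hsge m hm; omega) _))
    (fun m hm => integral_gSum hf (by have := hsge m hm; omega) _)
  have hYa : IsAdapted K Y := isAdapted_restrict s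
    (fun m hm => dyadicStep_mono (hk2 m) (step_mul
      (step_upperInd hf (by have := hsge m hm; omega))
      (step_gSum hf (by have := hsge m hm; omega) _)))
    (fun m hm x => by
      have := hsge m hm
      simp only [periodic_mono (hKs m) (periodic_upperInd D.f m) x,
        periodic_mono (hKs m) (periodic_gSum (show 2 ≤ m by omega) (gCoef D.ν a m)) x])
    (fun m hm => by
      have := integral_upper_pow D.f (show 2 ≤ m by have := hsge m hm; omega) (gCoef D.ν a m) 1
      simp only [pow_one] at this
      rw [this, integral_upperSum (by omega)])
  have hra : IsAdapted K r := isAdapted_restrict p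
    (fun m _ => dyadicStep_mono (by simp [hK]) (step_const_mul _ (step_rademacher (D.k m))))
    (fun m hm x => by
      simp only [periodic_mono (hKk m (hpge m hm)) (periodic_rademacher (D.k m)) x])
    (fun m _ => by rw [intervalIntegral.integral_const_mul, integral_rademacher, mul_zero])
  have hVa : IsAdapted K fun m x => X m x + r m x := hXa.add hra
  have hZa : IsAdapted K fun m x => Y m x + r m x := hYa.add hra
  have hDa : IsAdapted K fun m x => X m x + (-1) * Y m x := hXa.add (hYa.const_mul (-1))
  -- second moments
  set b : ℕ → ℝ := fun m => if m ∈ p then radCoef D.ν a m ^ 2 else 0 with hb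
  set B' : ℕ → ℝ := fun m => if m ∈ s then B m else 0 with hB'
  have hb0 : ∀ m, 0 ≤ b m := fun m => by simp only [hb]; split_ifs <;> positivity
  have hB'0 : ∀ m, 0 ≤ B' m := fun m => by
    simp only [hB']
    split_ifs
    · exact hB0 m
    · exact le_rfl
  have hX2 : ∀ m, ∫ x in (0 : ℝ)..1, X m x ^ 2 = B' m := fun m => by
    by_cases h : m ∈ s
    · simp only [hX, hB', if_pos h]
      exact integral_gSum_sq hf (by have := hsge m h; omega) _
    · simp [hX, hB', if_neg h]
  have hY2 : ∀ m, ∫ x in (0 : ℝ)..1, Y m x ^ 2 = 1 / 2 * B' m := fun m => by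
    by_cases h : m ∈ s
    · simp only [hY, hB', if_pos h]
      rw [integral_upper_pow D.f (by have := hsge m h; omega), integral_upperSum_sq (by omega)]
    · simp [hY, hB', if_neg h]
  have hY4 : ∀ m, ∫ x in (0 : ℝ)..1, Y m x ^ 4 ≤ 6 * (∫ x in (0 : ℝ)..1, Y m x ^ 2) ^ 2 := fun m => by
    by_cases h : m ∈ s
    · simp only [hY, if_pos h]
      rw [integral_upper_pow D.f (by have := hsge m h; omega),
        integral_upper_pow D.f (by have := hsge m h; omega)]
      exact integral_upperSum_pow_four (by omega) _ _
    · simp [hY, if_neg h]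
  have hr2 : ∀ m, ∫ x in (0 : ℝ)..1, r m x ^ 2 = b m := fun m => by
    by_cases h : m ∈ p
    · simp only [hr, hb, if_pos h]
      exact integral_const_mul_rademacher_pow even_two _
    · simp [hr, hb, if_neg h]
  have hr4 : ∀ m, ∫ x in (0 : ℝ)..1, r m x ^ 4 = b m ^ 2 := fun m => by
    by_cases h : m ∈ p
    · simp only [hr, hb, if_pos h]
      rw [integral_const_mul_rademacher_pow ⟨2, rfl⟩]
      ring
    · simp [hr, hb, if_neg h]
  have hV2 : ∀ m, ∫ x in (0 : ℝ)..1, (X m x + r m x) ^ 2 = B' m + b m := fun m => by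
    rw [integral_add_sq (hXstep m) (hrstep m) (hrper m) (hrmean m), hX2, hr2]
  have hZ2 : ∀ m, ∫ x in (0 : ℝ)..1, (Y m x + r m x) ^ 2 = 1 / 2 * B' m + b m := fun m => by
    rw [integral_add_sq (hYstep m) (hrstep m) (hrper m) (hrmean m), hY2, hr2]
  have hZ4 : ∀ m, ∫ x in (0 : ℝ)..1, (Y m x + r m x) ^ 4
      ≤ 6 * (∫ x in (0 : ℝ)..1, (Y m x + r m x) ^ 2) ^ 2 := fun m => by
    rw [hZ2, integral_add_pow_four (hYstep m) (hrstep m) (hrper m) (hYa.mean_zero m) (hrmean m),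
      hr2, hr4]
    have h1 := hY4 m
    rw [hY2] at h1 ⊢
    nlinarith [hb0 m, hB'0 m, mul_nonneg (hb0 m) (hB'0 m), sq_nonneg (b m)]
  -- X - Y and Y have disjoint supports, and r_{k_m} has mean 0 on the cells where X - Y is
  -- constant. Hence V and W have the correlation ∫ W².
  have hDZ : ∀ m, ∫ x in (0 : ℝ)..1, (X m x + (-1) * Y m x) * (Y m x + r m x) = 0 := fun m => by
    have e : ∀ x, (X m x + (-1) * Y m x) * (Y m x + r m x) = (X m x - Y m x) * r m x := fun x => by
      linear_combination hXY m x
    simp only [e]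
    rw [integral_mul_of_step (step_comp₂ (· - ·) (hXstep m) (hYstep m)) (hrstep m) (hrper m),
      hrmean, mul_zero]
  -- the functions
  set V : ℝ → ℝ := fun x => ∑ m ∈ Finset.range n, (X m x + r m x) with hVdef
  set W : ℝ → ℝ := fun x => ∑ m ∈ Finset.range n, (Y m x + r m x) with hWdef
  set R2 : ℝ := ∑ m ∈ Finset.range n, (1 / 2 * B' m + b m) with hR2
  have hR20 : 0 ≤ R2 := Finset.sum_nonneg fun m _ => by have := hb0 m; have := hB'0 m; positivity
  have hsqR : √R2 ^ 2 = R2 := Real.sq_sqrt hR20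
  have hVs : IsStep V := ⟨_, hVa.step_sum hKm n⟩
  have hWs : IsStep W := ⟨_, hZa.step_sum hKm n⟩
  -- Period 2^{-κ} makes V and W independent of u, so every moment over the support of u is A times
  -- the full moment.
  have hper : ∀ m, Function.Periodic (X m) (1 / 2 ^ κ) ∧ Function.Periodic (Y m) (1 / 2 ^ κ) ∧
      Function.Periodic (r m) (1 / 2 ^ κ) := fun m => by
    have hkap : ∀ m, M₀ < m → κ ≤ K m := fun m hm => by
      have := hkmono.monotone (show M₀ ≤ m - 1 by omega)
      simp only [hK]
      omega
    by_cases hm : M₀ < m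
    · exact ⟨periodic_mono (hkap m hm) (hXa.periodic m), periodic_mono (hkap m hm) (hYa.periodic m),
        periodic_mono (hkap m hm) (hra.periodic m)⟩
    · have h1 : m ∉ s := fun h => hm (hsge m h)
      have h2 : m ∉ p := fun h => hm (hpge m h)
      refine ⟨fun x => ?_, fun x => ?_, fun x => ?_⟩
      · simp only [hX, if_neg h1]
      · simp only [hY, if_neg h1]
      · simp only [hr, if_neg h2]
  have hVp : Function.Periodic V (1 / 2 ^ κ) := fun x =>
    Finset.sum_congr rfl fun m _ => by rw [(hper m).1 x, (hper m).2.2 x]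
  have hWp : Function.Periodic W (1 / 2 ^ κ) := fun x =>
    Finset.sum_congr rfl fun m _ => by rw [(hper m).2.1 x, (hper m).2.2 x]
  have hW2 : ∫ x in (0 : ℝ)..1, W x ^ 2 = R2 := by
    rw [hWdef, hZa.integral_sum_sq hKm]
    exact Finset.sum_congr rfl fun m _ => hZ2 m
  have hVW : ∫ x in (0 : ℝ)..1, V x * W x = R2 := by
    have h1 := hDa.integral_sum_mul_sum hKm hZa n
    rw [Finset.sum_eq_zero fun m _ => hDZ m] at h1
    have e : ∀ x, V x * W x
        = (∑ m ∈ Finset.range n, (X m x + (-1) * Y m x)) * W x + W x ^ 2 := fun x => by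
      have : V x = ∑ m ∈ Finset.range n, (X m x + (-1) * Y m x) + W x := by
        simp only [hVdef, hWdef]
        rw [← Finset.sum_add_distrib]
        exact Finset.sum_congr rfl fun m _ => by ring
      rw [this]
      ring
    simp only [e]
    rw [integral_add_step (IsStep.mul ⟨_, hDa.step_sum hKm n⟩ hWs) (hWs.pow 2), hW2]
    change (∫ x in (0 : ℝ)..1, (∑ m ∈ Finset.range n, (X m x + (-1) * Y m x)) *
      ∑ m ∈ Finset.range n, (Y m x + r m x)) + R2 = R2
    rw [h1, zero_add]
  have hVsq : ∫ x in (0 : ℝ)..1, V x ^ 2 ≤ 2 * R2 := by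
    rw [hVdef, hVa.integral_sum_sq hKm, hR2, Finset.mul_sum]
    refine Finset.sum_le_sum fun m _ => ?_
    rw [hV2]
    have := hb0 m
    linarith
  have hW4 : ∫ x in (0 : ℝ)..1, W x ^ 4 ≤ 6 * R2 ^ 2 := by
    refine (hZa.integral_sum_pow_four hKm (by norm_num) hZ4 n).trans (le_of_eq ?_)
    rw [hR2, Finset.sum_congr rfl fun m _ => hZ2 m]
  have hR2eq : R2 = 1 / 2 * ∑ m ∈ s, B m + ∑ l ∈ p, radCoef D.ν a l ^ 2 := by
    rw [hR2, Finset.sum_add_distrib, ← Finset.mul_sum, sum_restrict hsn, sum_restrict hpn]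
  -- the part with `ξ`
  have hξs : ∀ m ∈ s, IsStep (xi D.k D.ψ m) := fun m hm =>
    isStep_xi hf hψ (by have := hsge m hm; omega)
  have hξo : ∀ m ∈ s, ∀ m' ∈ s, ip (xi D.k D.ψ m) (xi D.k D.ψ m') = if m = m' then 1 else 0 :=
    fun m hm m' hm' => ip_xi_xi hf hψ (by have := hsge m hm; omega) (by have := hsge m' hm'; omega)
  -- The ξ-terms outside G are controlled by the g-energy and play the role of U'. Those in G are
  -- small in norm by hGs and play the role of U''.
  set c' : ℕ → ℝ := fun m => if m ∈ G then 0 else xiCoef D.ν a m with hc'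
  set c'' : ℕ → ℝ := fun m => if m ∈ G then xiCoef D.ν a m else 0 with hc''
  have hU'2 := ip_self_sum c' hξs hξo
  have hU''2 := ip_self_sum c'' hξs hξo
  simp only [ip, ← sq] at hU'2 hU''2
  have hle' : ∑ m ∈ s, c' m ^ 2 ≤ A / 100 * R2 := by
    have h1 : ∑ m ∈ s, c' m ^ 2 ≤ ∑ m ∈ s, A / 200 * B m := by
      refine Finset.sum_le_sum fun m _ => ?_
      have := hB0 m
      simp only [hc']
      split_ifs with h
      · rw [zero_pow (by norm_num)]
        positivity
      · exact hG m h
    rw [← Finset.mul_sum] at h1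
    have h2 : 0 ≤ ∑ l ∈ p, radCoef D.ν a l ^ 2 := Finset.sum_nonneg fun _ _ => sq_nonneg _
    rw [hR2eq]
    nlinarith
  have hle'' : ∑ m ∈ s, c'' m ^ 2 ≤ A / 20000 := by
    refine le_trans (le_of_eq (Finset.sum_congr rfl fun m _ => ?_)) hGs
    simp only [hc'', Set.indicator]
    split_ifs <;> simp
  have hus : IsStep u := ⟨_, hu⟩
  have hTeq : ∀ x, D.blockSum a (muSeq M) x - D.blockSum a (muSeq M₀) x
      = (∑ m ∈ s, c' m * xi D.k D.ψ m x) + (∑ m ∈ s, c'' m * xi D.k D.ψ m x) + V x := fun x => by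
    rw [blockSum_sub_groups hν a hM, ← Finset.sum_add_distrib, hVdef]
    simp only [Finset.sum_add_distrib, hX, hr]
    rw [sum_restrict hsn (fun m => gSum D.f m (gCoef D.ν a m) x), sum_restrict hpn, add_assoc]
    congr 1
    rw [← Finset.sum_add_distrib]
    refine Finset.sum_congr rfl fun m _ => ?_
    simp only [hc', hc'']
    split_ifs <;> ring
  simp only [hTeq] at hT
  have hfin := correlation_le (Real.sqrt_nonneg R2) hA hus
    (IsStep.sum fun m hm => (hξs m hm).const_mul (c' m))
    (IsStep.sum fun m hm => (hξs m hm).const_mul (c'' m)) hVs hWs hu01 huA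
    (by rw [integral_mul_of_step hu (hVs.mul hWs) (fun x => by simp only [hVp x, hWp x]), huA, hVW,
      hsqR])
    (by rw [integral_mul_of_step hu (hWs.pow 2) (fun x => by simp only [hWp x]), huA, hW2, hsqR])
    (by
      rw [integral_mul_of_step hu (hVs.pow 2) (fun x => by simp only [hVp x]), huA, hsqR]
      nlinarith)
    (by
      rw [integral_mul_of_step hu (hWs.pow 4) (fun x => by simp only [hWp x]), huA,
        show √R2 ^ 4 = (√R2 ^ 2) ^ 2 by ring, hsqR]
      nlinarith)
    (by rw [hU'2, hsqR]; exact hle') (by rw [hU''2]; exact hle'') hT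
  have h16 : R2 ≤ 16 := by
    rw [← hsqR]
    nlinarith [Real.sqrt_nonneg R2]
  have h2 : 0 ≤ ∑ l ∈ p, radCoef D.ν a l ^ 2 := Finset.sum_nonneg fun _ _ => sq_nonneg _
  rw [hR2eq] at h16
  linarith

end DivONS

end

noncomputable section

namespace DivONS

open MeasureTheory Filter Topology

/-! ### Divergence -/

/-- The indicator function of a dyadic interval. -/
def cellInd (κ i : ℕ) (x : ℝ) : ℝ := if ⌊(2 : ℝ) ^ κ * x⌋ = i then 1 else 0

theorem cellInd_of_mem {κ i j : ℕ} {x : ℝ} (h1 : (j : ℝ) < 2 ^ κ * x) (h2 : 2 ^ κ * x < j + 1) :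
    cellInd κ i x = if j = i then 1 else 0 := by
  have : ⌊(2 : ℝ) ^ κ * x⌋ = j := by
    rw [Int.floor_eq_iff]
    exact ⟨by exact_mod_cast h1.le, by exact_mod_cast h2⟩
  rw [cellInd, this]
  simp

theorem step_cellInd (κ i : ℕ) : cellInd κ i ∈ dyadicStep 0 1 κ := by
  rw [mem_dyadicStep_iff]
  rintro x y ⟨j, -, h1, h2, h3, h4⟩
  rw [cellInd_of_mem h1 h2, cellInd_of_mem h3 h4]

theorem integral_cellInd {κ i : ℕ} (hi : i < 2 ^ κ) :
    ∫ x in (0 : ℝ)..1, cellInd κ i x = 1 / 2 ^ κ := by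
  rw [integral_step (step_cellInd κ i), Finset.sum_congr rfl fun j _ => by
    rw [cellInd_of_mem (mid_mem κ j).1 (mid_mem κ j).2]]
  simp [Finset.sum_ite_eq', hi]

/-- If no dyadic interval were filled up to the proportion 1 - η, `null_of_sparse_cells` would make
S a null set. -/
theorem exists_full_cell {S : Set ℝ} (hS : S ⊆ Set.Icc 0 1) (h0 : volume S ≠ 0) {η : ℝ}
    (hη : 0 < η) (hη1 : η ≤ 1) : ∃ κ i : ℕ, i < 2 ^ κ ∧
      1 / 2 ^ κ * (1 - η) ≤ (volume.restrict (Set.Icc (0 : ℝ) 1)).real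
        (S ∩ Set.Icc ((i : ℝ) / 2 ^ κ) (((i + 1 : ℕ) : ℝ) / 2 ^ κ)) := by
  by_contra hcon
  push Not at hcon
  refine h0 (null_of_sparse_cells hS (K := id) tendsto_id (q := ENNReal.ofReal (1 - η)) ?_ ?_)
  · rw [ENNReal.ofReal_lt_one]
    linarith
  · refine Eventually.of_forall fun x => Eventually.frequently (Eventually.of_forall
      fun κ i hi _ _ => ?_)
    have h1 := hcon κ i hi
    simp only [id]
    rw [Measure.real, Measure.restrict_apply' measurableSet_Icc,
      Set.inter_eq_left.2 (Set.inter_subset_left.trans hS)] at h1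
    set I := Set.Icc ((i : ℝ) / 2 ^ κ) (((i + 1 : ℕ) : ℝ) / 2 ^ κ) with hI
    have hvol : volume I = ENNReal.ofReal (1 / 2 ^ κ) := by
      rw [hI, Real.volume_Icc]
      congr 1
      push_cast
      ring
    have hfin : volume (S ∩ I) ≠ ⊤ :=
      ne_top_of_le_ne_top (by rw [hvol]; exact ENNReal.ofReal_ne_top)
        (measure_mono Set.inter_subset_right)
    rw [hvol, ← ENNReal.ofReal_mul (by linarith), ENNReal.le_ofReal_iff_toReal_le hfin
      (mul_nonneg (by linarith) (by positivity))]
    linarith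

theorem sum_sq_positions {D : Choices} (hν : StrictMono D.ν) (a : ℕ → ℝ) (M : ℕ) :
    ∑ l ∈ Finset.Icc 1 (D.ν (muSeq M) + muSeq M), a l ^ 2
      = ∑ t ∈ Finset.Icc 1 (D.ν (muSeq M)), radCoef D.ν a t ^ 2
        + ∑ m ∈ Finset.Icc 1 M, (xiCoef D.ν a m ^ 2
          + ∑ i ∈ Finset.range (2 ^ (2 * m)), gCoef D.ν a m i ^ 2) := by
  rw [sum_positions hν, sum_blocks muSeq_strictMono.monotone rfl]
  congr 1
  refine Finset.sum_congr rfl fun m hm => ?_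
  rw [← sum_sq_upsCoef, isBlockLength_muSeq.succ m (Finset.mem_Icc.1 hm).1, Nat.add_sub_cancel_left]
  rfl

theorem exists_tail_le {F : ℕ → ℝ} (hF : Summable F) {ε : ℝ} (hε : 0 < ε) :
    ∃ N, ∀ M₀ ≥ N, ∀ M ≥ M₀, ∑ m ∈ Finset.Ioc M₀ M, F m ≤ ε := by
  obtain ⟨N, hN⟩ := Metric.cauchySeq_iff.1 hF.hasSum.tendsto_sum_nat.cauchySeq ε hε
  refine ⟨N, fun M₀ h₀ M hM => ?_⟩
  have h1 := hN (M + 1) (by omega) (M₀ + 1) (by omega)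
  rw [Real.dist_eq, ← Finset.sum_Ico_eq_sub _ (by omega)] at h1
  have h2 : Finset.Ico (M₀ + 1) (M + 1) = Finset.Ioc M₀ M := by
    ext m
    simp only [Finset.mem_Ico, Finset.mem_Ioc]
    omega
  rw [h2] at h1
  exact (le_abs_self _).trans h1.le

/-- By contradiction: if divergence fails on a set that is not null, an almost full calm dyadic
interval exists, the first criterion makes the dominant c_m² summable, and `coef_bound` beyond a
large index bounds all remaining energy. -/
theorem ae_diverges {l₀ : ℕ} {D : Choices} (hD : D.Admissible l₀) (a : ℕ → ℝ)
    (ha : ¬ Summable fun l => a l ^ 2) :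
    ∀ᵐ x ∂volume.restrict (Set.Icc (0 : ℝ) 1),
      ¬ ∃ L : ℝ, Tendsto (fun j : ℕ => D.blockSum a j x) atTop (𝓝 L) := by
  by_contra hne
  have hkmono : StrictMono D.k := kSeq_strictMono hD.menshov
  have hν : StrictMono D.ν := hD.blocking.strictMono hkmono
  obtain ⟨J, hJ⟩ : ∃ J, volume (calmSet (D.blockSum a) 1 J) ≠ 0 := by
    by_contra hcon
    push Not at hcon
    exact hne (ae_not_tendsto_of_null one_pos hcon)
  obtain ⟨κ, i, hi, hcell⟩ := exists_full_cell (fun x hx => hx.1) hJ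
    (show (0 : ℝ) < 1 / 20000 by norm_num) (by norm_num)
  set A : ℝ := 1 / 2 ^ κ with hA
  have hA0 : 0 < A := by positivity
  have hA1 : A ≤ 1 := by
    rw [hA, div_le_one (by positivity)]
    exact one_le_pow₀ (by norm_num)
  set B : ℕ → ℝ := fun m => ∑ i ∈ Finset.range (2 ^ (2 * m)), gCoef D.ν a m i ^ 2 with hB
  have hB0 : ∀ m, 0 ≤ B m := fun m => Finset.sum_nonneg fun _ _ => sq_nonneg _
  -- The threshold depends on the length A of the calm interval, as `coef_bound` demands.
  set G : Set ℕ := {m | A / 200 * B m < xiCoef D.ν a m ^ 2} with hG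
  have hGsum : Summable (G.indicator fun m => xiCoef D.ν a m ^ 2) := by
    by_contra hcon
    -- On G one has B m ≤ (200/A) c_m², so the energy of the block is at most (1 + 200/A) c_m².
    refine hne (ae_diverges_of_dominant hD a (Real.sqrt_nonneg (1 + 200 / A)) (fun m hm => ?_) hcon)
    rw [sum_sq_upsCoef, Real.sq_sqrt (by positivity)]
    have h1 : A / 200 * B m < xiCoef D.ν a m ^ 2 := hm
    have h2 : B m ≤ 200 / A * xiCoef D.ν a m ^ 2 := by
      rw [div_mul_eq_mul_div, le_div_iff₀ hA0]
      linarith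
    linarith
  have hGnot : ∀ m ∉ G, xiCoef D.ν a m ^ 2 ≤ A / 200 * B m := fun m hm => not_lt.1 hm
  obtain ⟨N, hN⟩ := exists_tail_le hGsum (show 0 < A / 20000 by positivity)
  obtain ⟨M₀, hM1, hMJ, hMκ, hMN⟩ : ∃ M₀, 1 ≤ M₀ ∧ J ≤ M₀ ∧ κ ≤ M₀ ∧ N ≤ M₀ :=
    ⟨1 + J + κ + N, by omega, by omega, by omega, by omega⟩
  have hbound : ∀ M ≥ M₀, (∑ m ∈ Finset.Ioc M₀ M, B m)
      + ∑ l ∈ Finset.Ioc (D.ν (muSeq M₀)) (D.ν (muSeq M)), radCoef D.ν a l ^ 2 ≤ 32 := by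
    intro M hM
    refine coef_bound hD a hM1 hM (hMκ.trans hkmono.le_apply) (step_cellInd κ i)
      (fun x => by rw [cellInd]; split_ifs <;> simp) hA0 (integral_cellInd hi) hGnot
      (hN M₀ hMN M hM) ?_
    refine hcell.trans ?_
    set F : ℝ → ℝ := fun x => cellInd κ i x *
      if |D.blockSum a (muSeq M) x - D.blockSum a (muSeq M₀) x| ≤ 1 then 1 else 0 with hF
    have hchi : ∀ j, IsStep fun x => D.blockSum a j x := fun j =>
      IsStep.sum fun l hl => (isStep_chi hD (Finset.mem_Icc.1 hl).1).const_mul _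
    have hFs : IsStep F := IsStep.mul ⟨_, step_cellInd κ i⟩
      ((hchi (muSeq M)).comp₂ (fun b c => if |b - c| ≤ 1 then 1 else 0) (hchi (muSeq M₀)))
    have h1 := mul_meas_ge_le_integral_of_nonneg (μ := volume.restrict (Set.Icc (0 : ℝ) 1))
      (f := F) (Eventually.of_forall fun x => by
        simp only [hF, cellInd]
        split_ifs <;> simp) hFs.integrable 1
    rw [setIntegral_unit, one_mul] at h1
    refine le_trans (measureReal_mono ?_) h1
    rintro y ⟨⟨_, hnd, hosc⟩, hyI⟩
    obtain ⟨h3, h4⟩ := hnd.lt_of_mem_cell hyI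
    have h5 := muSeq_strictMono.le_apply (x := M)
    have h6 := muSeq_strictMono.le_apply (x := M₀)
    rw [Set.mem_ofPred_eq, hF]
    simp only
    rw [cellInd_of_mem h3 h4, if_pos rfl,
      if_pos (hosc (muSeq M) (by omega) (muSeq M₀) (by omega)).le, mul_one]
  apply ha
  set T : ℕ → ℝ := fun M => ∑ l ∈ Finset.Icc 1 (D.ν (muSeq M) + muSeq M), a l ^ 2 with hT
  -- Off G the coefficient c_m² is at most B m, so the increment is at most twice the bound 32 plus
  -- the tail over G, which is below 1.
  have hTle : ∀ M ≥ M₀, T M ≤ T M₀ + 65 := by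
    intro M hM
    have h1 := hbound M hM
    have h2 := hN M₀ hMN M hM
    have e1 := sum_Icc_one_sub (hν.monotone (muSeq_strictMono.monotone hM))
      (fun t => radCoef D.ν a t ^ 2)
    have e2 := sum_Icc_one_sub hM (fun m => xiCoef D.ν a m ^ 2 + B m)
    have h3 : ∑ m ∈ Finset.Ioc M₀ M, (xiCoef D.ν a m ^ 2 + B m)
        ≤ ∑ m ∈ Finset.Ioc M₀ M, (G.indicator (fun m => xiCoef D.ν a m ^ 2) m + 2 * B m) := by
      refine Finset.sum_le_sum fun m _ => ?_
      have := hB0 m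
      by_cases hm : m ∈ G
      · rw [Set.indicator_of_mem hm]
        linarith
      · rw [Set.indicator_of_notMem hm]
        have := hGnot m hm
        nlinarith
    rw [Finset.sum_add_distrib (f := G.indicator _), ← Finset.mul_sum] at h3
    have h4 : 0 ≤ ∑ l ∈ Finset.Ioc (D.ν (muSeq M₀)) (D.ν (muSeq M)), radCoef D.ν a l ^ 2 :=
      Finset.sum_nonneg fun _ _ => sq_nonneg _
    simp only [hT]
    rw [sum_sq_positions hν, sum_sq_positions hν]
    linarith
  refine summable_of_sum_range_le (c := a 0 ^ 2 + (T M₀ + 65)) (fun l => sq_nonneg _) fun n => ?_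
  have hM : M₀ ≤ max n M₀ := le_max_right _ _
  have hn : n ≤ muSeq (max n M₀) := (le_max_left n M₀).trans muSeq_strictMono.le_apply
  have hsub : Finset.range n ⊆ insert 0 (Finset.Icc 1 (D.ν (muSeq (max n M₀)) + muSeq (max n M₀))) :=
    fun l hl => by
      rw [Finset.mem_range] at hl
      rw [Finset.mem_insert, Finset.mem_Icc]
      omega
  refine (Finset.sum_le_sum_of_subset_of_nonneg hsub fun _ _ _ => sq_nonneg _).trans ?_
  rw [Finset.sum_insert (by simp)]
  have := hTle _ hM
  linarith

end DivONS

end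

noncomputable section

namespace DivONS

open MeasureTheory Filter Topology

/-! ### Hilbert's inequality -/

theorem sum_inv_sq_range_le (n : ℕ) : ∑ i ∈ Finset.range n, ((i : ℝ)⁻¹) ^ 2 ≤ 2 := by
  have h : ∀ n : ℕ, ∑ i ∈ Finset.range (n + 2), ((i : ℝ)⁻¹) ^ 2 ≤ 2 - 1 / ((n : ℝ) + 1) := by
    intro n
    induction n with
    | zero => norm_num [Finset.sum_range_succ]
    | succ n ih =>
      rw [Finset.sum_range_succ]
      push_cast
      have : ((n : ℝ) + 2)⁻¹ ^ 2 ≤ 1 / ((n : ℝ) + 1) - 1 / ((n : ℝ) + 1 + 1) := by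
        rw [inv_pow, div_sub_div _ _ (by positivity) (by positivity), inv_eq_one_div,
          div_le_div_iff₀ (by positivity) (by positivity)]
        nlinarith
      linarith
  have h2 : ∑ i ∈ Finset.range n, ((i : ℝ)⁻¹) ^ 2 ≤ ∑ i ∈ Finset.range (n + 2), ((i : ℝ)⁻¹) ^ 2 :=
    Finset.sum_le_sum_of_subset_of_nonneg (Finset.range_subset_range.2 (by omega))
      fun _ _ _ => sq_nonneg _
  have : (0 : ℝ) ≤ 1 / ((n : ℝ) + 1) := by positivity
  linarith [h n]

theorem sum_inv_sq_image_le {ι : Type*} {s : Finset ι} {φ : ι → ℕ} (hφ : Set.InjOn φ s) :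
    ∑ i ∈ s, ((φ i : ℝ)⁻¹) ^ 2 ≤ 2 := by
  rw [← Finset.sum_image (f := fun n : ℕ => ((n : ℝ)⁻¹) ^ 2) hφ]
  refine le_trans (Finset.sum_le_sum_of_subset_of_nonneg (t := Finset.range
    ((s.image φ).sup id + 1)) (fun n hn => ?_) fun _ _ _ => sq_nonneg _) (sum_inv_sq_range_le _)
  rw [Finset.mem_range, Nat.lt_succ_iff]
  exact Finset.le_sup (f := id) hn

theorem sum_inv_sq_int_le {ι : Type*} {s : Finset ι} {φ : ι → ℤ} (hφ : Set.InjOn φ s) :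
    ∑ i ∈ s, ((φ i : ℝ)⁻¹) ^ 2 ≤ 4 := by
  classical
  have e : ∀ i, ((φ i : ℝ)⁻¹) ^ 2 = (((φ i).natAbs : ℝ)⁻¹) ^ 2 := fun i => by
    rw [Nat.cast_natAbs, inv_pow, inv_pow, Int.cast_abs, sq_abs]
  rw [← Finset.sum_filter_add_sum_filter_not s fun i => 0 ≤ φ i]
  simp only [e]
  have h1 := sum_inv_sq_image_le (s := s.filter fun i => 0 ≤ φ i) (φ := fun i => (φ i).natAbs)
    fun i hi j hj h => by
      rw [Finset.mem_coe, Finset.mem_filter] at hi hj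
      refine hφ hi.1 hj.1 ?_
      simp only at h
      omega
  have h2 := sum_inv_sq_image_le (s := s.filter fun i => ¬ 0 ≤ φ i) (φ := fun i => (φ i).natAbs)
    fun i hi j hj h => by
      rw [Finset.mem_coe, Finset.mem_filter] at hi hj
      refine hφ hi.1 hj.1 ?_
      simp only at h
      omega
  linarith

/-- The symmetric partial sums of `∑ 1/(p - i)`. -/
def hilbertSum (R i : ℕ) : ℝ := ∑ p ∈ Finset.range (2 * R + 1), (((p : ℤ) - R - i : ℤ) : ℝ)⁻¹

theorem hilbertSum_zero (R : ℕ) : hilbertSum R 0 = 0 := by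
  have h : hilbertSum R 0 = -hilbertSum R 0 := by
    conv_lhs => rw [hilbertSum, ← Finset.sum_range_reflect]
    rw [hilbertSum, ← Finset.sum_neg_distrib]
    refine Finset.sum_congr rfl fun p hp => ?_
    rw [Finset.mem_range] at hp
    rw [← inv_neg, ← Int.cast_neg]
    congr 2
    omega
  linarith

theorem hilbertSum_succ (R i : ℕ) : hilbertSum R (i + 1) = hilbertSum R i
    + ((-(R : ℤ) - i - 1 : ℤ) : ℝ)⁻¹ - (((R : ℤ) - i : ℤ) : ℝ)⁻¹ := by
  rw [hilbertSum, Finset.sum_range_succ', hilbertSum, Finset.sum_range_succ]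
  have : ∀ p : ℕ, (((p + 1 : ℕ) : ℤ) - R - (i + 1 : ℕ) : ℤ) = (p : ℤ) - R - i := fun p => by
    push_cast; ring
  simp only [this]
  rw [show (((0 : ℕ) : ℤ) - R - (i + 1 : ℕ) : ℤ) = -(R : ℤ) - i - 1 by push_cast; ring,
    show (((2 * R : ℕ) : ℤ) - R - i : ℤ) = (R : ℤ) - i by push_cast; ring]
  ring

/-- For i = 0 the sum vanishes by antisymmetry, and a shift of i by one changes only the two end
terms, which tend to 0. -/
theorem tendsto_hilbertSum (i : ℕ) : Tendsto (fun R => hilbertSum R i) atTop (𝓝 0) := by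
  induction i with
  | zero => simp only [hilbertSum_zero]; exact tendsto_const_nhds
  | succ i ih =>
    simp only [hilbertSum_succ]
    have h1 : Tendsto (fun R : ℕ => ((-(R : ℤ) - i - 1 : ℤ) : ℝ)⁻¹) atTop (𝓝 0) := by
      refine Tendsto.inv_tendsto_atBot ?_
      push_cast
      refine tendsto_atBot_add_const_right _ _ (tendsto_atBot_add_const_right _ _ ?_)
      exact tendsto_neg_atTop_atBot.comp tendsto_natCast_atTop_atTop
    have h2 : Tendsto (fun R : ℕ => (((R : ℤ) - i : ℤ) : ℝ)⁻¹) atTop (𝓝 0) := by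
      refine Tendsto.inv_tendsto_atTop ?_
      push_cast
      exact tendsto_atTop_add_const_right _ _ tendsto_natCast_atTop_atTop
    simpa using (ih.add h1).sub h2

/-- Partial fractions under the convention that the inverse of 0 is 0; the last summand repairs the
two cases in which a or b is the pole. -/
theorem inv_mul_inv_int {a b : ℤ} (h : a ≠ b) : (a : ℝ)⁻¹ * (b : ℝ)⁻¹
    = ((a - b : ℤ) : ℝ)⁻¹ * ((b : ℝ)⁻¹ - (a : ℝ)⁻¹)
      + (((if a = 0 then 1 else 0) + if b = 0 then 1 else 0) * ((a - b : ℤ) : ℝ)⁻¹ ^ 2) := by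
  have hab : (a : ℝ) - b ≠ 0 := by
    rw [sub_ne_zero]
    exact_mod_cast h
  push_cast
  by_cases ha : a = 0
  · have hb : b ≠ 0 := fun hb => h (by rw [ha, hb])
    have hb' : (b : ℝ) ≠ 0 := by exact_mod_cast hb
    subst ha
    simp only [Int.cast_zero, inv_zero, if_neg hb, if_true]
    field_simp
    ring
  · have ha' : (a : ℝ) ≠ 0 := by exact_mod_cast ha
    by_cases hb : b = 0
    · subst hb
      simp only [Int.cast_zero, inv_zero, if_neg ha, if_true]
      field_simp
      ring
    · have hb' : (b : ℝ) ≠ 0 := by exact_mod_cast hb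
      simp only [if_neg ha, if_neg hb]
      field_simp
      ring

theorem sum_inv_mul_inv {R i j : ℕ} (hi : i ≤ R) (hj : j ≤ R) (h : i ≠ j) :
    ∑ p ∈ Finset.range (2 * R + 1), (((p : ℤ) - R - i : ℤ) : ℝ)⁻¹ * (((p : ℤ) - R - j : ℤ) : ℝ)⁻¹
      = (((j : ℤ) - i : ℤ) : ℝ)⁻¹ * (hilbertSum R j - hilbertSum R i)
        + 2 * (((j : ℤ) - i : ℤ) : ℝ)⁻¹ ^ 2 := by
  have h1 : ∀ p : ℕ, (((p : ℤ) - R - i : ℤ) : ℝ)⁻¹ * (((p : ℤ) - R - j : ℤ) : ℝ)⁻¹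
      = (((j : ℤ) - i : ℤ) : ℝ)⁻¹ *
          ((((p : ℤ) - R - j : ℤ) : ℝ)⁻¹ - (((p : ℤ) - R - i : ℤ) : ℝ)⁻¹)
        + (((if p = R + i then 1 else 0) + if p = R + j then 1 else 0) *
          (((j : ℤ) - i : ℤ) : ℝ)⁻¹ ^ 2) := fun p => by
    rw [inv_mul_inv_int (by omega), show ((p : ℤ) - R - i - (p - R - j) : ℤ) = (j : ℤ) - i by ring]
    have e : ∀ i : ℕ, ((p : ℤ) - R - i = 0) = (p = R + i) := fun i => by
      rw [eq_iff_iff]; omega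
    simp only [e]
  simp only [h1]
  rw [Finset.sum_add_distrib, ← Finset.mul_sum, ← Finset.sum_mul, Finset.sum_sub_distrib,
    Finset.sum_add_distrib, Finset.sum_ite_eq', Finset.sum_ite_eq',
    if_pos (Finset.mem_range.2 (by omega)), if_pos (Finset.mem_range.2 (by omega)),
    ← hilbertSum, ← hilbertSum]
  norm_num

/-- Schur's test for a symmetric nonnegative matrix, from 2 e_i e_j ≤ e_i² + e_j². -/
theorem quadratic_form_le {N : ℕ} (e : ℕ → ℝ) (c : ℕ → ℕ → ℝ) (hc : ∀ i j, 0 ≤ c i j)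
    (hsymm : ∀ i j, c i j = c j i) {A : ℝ}
    (hA : ∀ i ∈ Finset.range N, ∑ j ∈ Finset.range N, c i j ≤ A) :
    ∑ i ∈ Finset.range N, ∑ j ∈ Finset.range N, e i * e j * c i j
      ≤ A * ∑ i ∈ Finset.range N, e i ^ 2 := by
  have h1 : ∑ i ∈ Finset.range N, ∑ j ∈ Finset.range N, e i * e j * c i j
      ≤ ∑ i ∈ Finset.range N, ∑ j ∈ Finset.range N, (e i ^ 2 * c i j / 2 + e j ^ 2 * c i j / 2) :=
    Finset.sum_le_sum fun i _ => Finset.sum_le_sum fun j _ => by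
      nlinarith [mul_nonneg (hc i j) (sq_nonneg (e i - e j))]
  have h2 : ∑ i ∈ Finset.range N, ∑ j ∈ Finset.range N, (e i ^ 2 * c i j / 2 + e j ^ 2 * c i j / 2)
      = ∑ i ∈ Finset.range N, e i ^ 2 * ∑ j ∈ Finset.range N, c i j := by
    simp only [Finset.sum_add_distrib]
    rw [Finset.sum_comm (f := fun i j => e j ^ 2 * c i j / 2), ← Finset.sum_add_distrib]
    refine Finset.sum_congr rfl fun i _ => ?_
    rw [← Finset.sum_add_distrib, Finset.mul_sum]
    refine Finset.sum_congr rfl fun j _ => ?_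
    rw [hsymm j i]
    ring
  rw [h2] at h1
  refine h1.trans ?_
  rw [Finset.mul_sum]
  refine Finset.sum_le_sum fun i hi => ?_
  rw [mul_comm]
  exact mul_le_mul_of_nonneg_right (hA i hi) (sq_nonneg _)

/-- Hilbert's inequality (with a constant that is not optimal). -/
theorem hilbert_inequality (N : ℕ) (e : ℕ → ℝ) (P : Finset ℤ) :
    ∑ p ∈ P, (∑ i ∈ Finset.range N, e i * ((p - i : ℤ) : ℝ)⁻¹) ^ 2
      ≤ 12 * ∑ i ∈ Finset.range N, e i ^ 2 := by
  classical
  set c : ℕ → ℕ → ℕ → ℝ := fun R i j => if i = j then 4 else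
    (((j : ℤ) - i : ℤ) : ℝ)⁻¹ * (hilbertSum R j - hilbertSum R i)
        + 2 * (((j : ℤ) - i : ℤ) : ℝ)⁻¹ ^ 2 with hc
  set c' : ℕ → ℕ → ℝ := fun i j => if i = j then 4 else 2 * (((j : ℤ) - i : ℤ) : ℝ)⁻¹ ^ 2 with hc'
  -- In the limit of the symmetric window only the nonnegative kernel 2/(i-j)² and the diagonal
  -- bound remain.
  have hlim : Tendsto (fun R => ∑ i ∈ Finset.range N, ∑ j ∈ Finset.range N, e i * e j * c R i j) atTop
      (𝓝 (∑ i ∈ Finset.range N, ∑ j ∈ Finset.range N, e i * e j * c' i j)) := by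
    refine tendsto_finsetSum _ fun i _ => tendsto_finsetSum _ fun j _ => Tendsto.const_mul _ ?_
    by_cases h : i = j
    · simp only [hc, hc', if_pos h]
      exact tendsto_const_nhds
    · simp only [hc, hc', if_neg h]
      have := (((tendsto_hilbertSum j).sub (tendsto_hilbertSum i)).const_mul
        (((j : ℤ) - i : ℤ) : ℝ)⁻¹).add_const (2 * (((j : ℤ) - i : ℤ) : ℝ)⁻¹ ^ 2)
      simpa using this
  -- Once the window from -R to R contains the finite set P, the square is expanded and the sum over
  -- the window is computed by `sum_inv_mul_inv`.
  have hle : ∀ᶠ R in atTop, ∑ p ∈ P, (∑ i ∈ Finset.range N, e i * ((p - i : ℤ) : ℝ)⁻¹) ^ 2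
      ≤ ∑ i ∈ Finset.range N, ∑ j ∈ Finset.range N, e i * e j * c R i j := by
    filter_upwards [eventually_ge_atTop (N + ∑ p ∈ P, p.natAbs)] with R hR
    have hPR : ∀ p ∈ P, p.natAbs ≤ R := fun p hp => by
      have := Finset.single_le_sum (f := Int.natAbs) (fun _ _ => Nat.zero_le _) hp
      omega
    have h1 : ∑ p ∈ P, (∑ i ∈ Finset.range N, e i * ((p - i : ℤ) : ℝ)⁻¹) ^ 2
        ≤ ∑ p ∈ Finset.range (2 * R + 1),
          (∑ i ∈ Finset.range N, e i * (((p : ℤ) - R - i : ℤ) : ℝ)⁻¹) ^ 2 := by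
      have hinj : Set.InjOn (fun p : ℕ => (p : ℤ) - R) (Finset.range (2 * R + 1) : Set ℕ) :=
        fun p _ q _ h => by simp only at h; omega
      rw [← Finset.sum_image
        (f := fun p : ℤ => (∑ i ∈ Finset.range N, e i * ((p - i : ℤ) : ℝ)⁻¹) ^ 2) hinj]
      refine Finset.sum_le_sum_of_subset_of_nonneg (fun p hp => ?_) fun _ _ _ => sq_nonneg _
      have := hPR p hp
      exact Finset.mem_image.2 ⟨(p + R).toNat, Finset.mem_range.2 (by omega), by omega⟩
    refine h1.trans ?_
    have h2 : ∀ p : ℕ, (∑ i ∈ Finset.range N, e i * (((p : ℤ) - R - i : ℤ) : ℝ)⁻¹) ^ 2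
        = ∑ i ∈ Finset.range N, ∑ j ∈ Finset.range N, e i * e j *
          ((((p : ℤ) - R - i : ℤ) : ℝ)⁻¹ * (((p : ℤ) - R - j : ℤ) : ℝ)⁻¹) := fun p => by
      rw [sq, Finset.sum_mul_sum]
      exact Finset.sum_congr rfl fun i _ => Finset.sum_congr rfl fun j _ => by ring
    simp only [h2]
    rw [Finset.sum_comm]
    refine Finset.sum_le_sum fun i hi => ?_
    rw [Finset.sum_comm]
    refine Finset.sum_le_sum fun j hj => ?_
    rw [Finset.mem_range] at hi hj
    rw [← Finset.mul_sum]
    by_cases h : i = j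
    · subst h
      simp only [hc, if_true]
      simp only [← sq]
      exact mul_le_mul_of_nonneg_left (sum_inv_sq_int_le (φ := fun p : ℕ => (p : ℤ) - R - i)
        fun p _ q _ h => by simp only at h; omega) (sq_nonneg _)
    · simp only [hc, if_neg h]
      rw [sum_inv_mul_inv (by omega) (by omega) h]
  refine (ge_of_tendsto hlim hle).trans ?_
  refine quadratic_form_le e c' (fun i j => ?_) (fun i j => ?_) fun i hi => ?_
  · simp only [hc']
    split_ifs <;> positivity
  · simp only [hc']
    by_cases h : i = j
    · rw [if_pos h, if_pos h.symm]
    · rw [if_neg h, if_neg (Ne.symm h), show ((j : ℤ) - i) = -((i : ℤ) - j) by ring, Int.cast_neg,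
        inv_neg, neg_sq]
  · have h3 : ∀ j, c' i j = (if i = j then 4 else 0) + 2 * (((j : ℤ) - i : ℤ) : ℝ)⁻¹ ^ 2 := fun j => by
      simp only [hc']
      split_ifs with h
      · subst h; simp
      · ring
    simp only [h3]
    rw [Finset.sum_add_distrib, Finset.sum_ite_eq, if_pos hi, ← Finset.mul_sum]
    -- The row sums are at most 4 + 2·4 = 12.
    have := sum_inv_sq_int_le (s := Finset.range N) (φ := fun j : ℕ => (j : ℤ) - i)
      fun p _ q _ h => by simp only at h; omega
    linarith

end DivONS

end

noncomputable section

namespace DivONS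

open MeasureTheory Filter Topology

/-! ### Existence of the Menshov systems -/

/-- The values of the translates of the Menshov function, up to normalization. -/
def menshovVal (N q i : ℕ) : ℝ :=
  if q < i then (if q + 1 = i then 0 else (((q : ℤ) + N + 1 - i : ℤ) : ℝ)⁻¹)
  else if q + 1 = 2 * N ∧ i = 0 then 0 else (((q : ℤ) - N + 1 - i : ℤ) : ℝ)⁻¹

/-- Here q counts the cells of [-1,1] from the left end. For q < i the translated point lies below
-1 and is brought back by the period 2, which adds 2N to the index. -/
theorem menshov_of_cell {k i q : ℕ} (hi : i < 2 ^ k) (hq : q < 2 * 2 ^ k) {x : ℝ}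
    (h1 : (q : ℝ) < 2 ^ k * (x + 1)) (h2 : 2 ^ k * (x + 1) < q + 1) :
    menshov k (x - (i : ℝ) / 2 ^ k) = √(2 ^ k) / 8 * menshovVal (2 ^ k) q i := by
  have hNr : (2 : ℝ) ^ k = ((2 ^ k : ℕ) : ℝ) := by push_cast; rfl
  have hNz : (2 : ℤ) ^ k = ((2 ^ k : ℕ) : ℤ) := by push_cast; rfl
  have hN0 : (0 : ℝ) < 2 ^ k := by positivity
  rw [menshov_eq_floor, menshovVal, pow_succ (2 : ℤ), hNz]
  have hi' : (i : ℝ) + 1 ≤ 2 ^ k := by rw [hNr]; exact_mod_cast hi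
  have hq' : (q : ℝ) + 1 ≤ 2 * 2 ^ k := by rw [hNr]; exact_mod_cast hq
  have f1 : ⌊(2 : ℝ) ^ k * (x - (i : ℝ) / 2 ^ k)⌋ = (q : ℤ) - (2 ^ k : ℕ) - i := by
    rw [Int.floor_eq_iff, mul_sub, mul_div_cancel₀ _ hN0.ne']
    push_cast
    constructor <;> linarith
  have e : (x - (i : ℝ) / 2 ^ k + 1) / 2 = (2 ^ k * (x + 1) - i) / (2 * 2 ^ k) := by
    field_simp
    ring
  rw [f1, e]
  generalize 2 ^ k = N at *
  have hi0 : (0 : ℝ) ≤ i := by positivity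
  have hq0 : (0 : ℝ) ≤ q := by positivity
  by_cases hqi : q < i
  · have f2 : ⌊((2 : ℝ) ^ k * (x + 1) - i) / (2 * 2 ^ k)⌋ = -1 := by
      have : (q : ℝ) + 1 ≤ i := by exact_mod_cast hqi
      rw [Int.floor_eq_iff]
      push_cast
      constructor
      · rw [le_div_iff₀ (by positivity)]
        linarith
      · rw [div_lt_iff₀ (by positivity)]
        linarith
    rw [f2, if_pos hqi]
    by_cases h : q + 1 = i
    · rw [if_pos h, if_pos (Or.inr (by omega)), mul_zero]
    · rw [if_neg h, if_neg (by omega),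
        show ((q : ℤ) - N - i - N * 2 * -1 + 1) = (q : ℤ) + N + 1 - i by ring]
      rw [div_mul_eq_div_div, div_eq_mul_inv (_ / 8)]
  · have f2 : ⌊((2 : ℝ) ^ k * (x + 1) - i) / (2 * 2 ^ k)⌋ = 0 := by
      have : (i : ℝ) ≤ q := by exact_mod_cast not_lt.1 hqi
      rw [Int.floor_eq_iff]
      push_cast
      constructor
      · apply div_nonneg (by linarith) (by positivity)
      · rw [div_lt_iff₀ (by positivity)]
        linarith
    rw [f2, if_neg hqi, show ((q : ℤ) - N - i - N * 2 * 0 + 1) = (q : ℤ) - N + 1 - i by ring]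
    by_cases h : q + 1 = 2 * N ∧ i = 0
    · rw [if_pos h, if_pos (Or.inr (by omega)), mul_zero]
    · rw [if_neg h]
      by_cases h0 : (q : ℤ) - N + 1 - i = 0
      · rw [if_pos (Or.inl h0), h0]
        simp
      · rw [if_neg (by omega), div_mul_eq_div_div, div_eq_mul_inv (_ / 8)]

/-- Passing from i to i + 1 permutes the 2N values cyclically, so the sum does not depend on i; for
i = 0 it is a symmetric sum of reciprocals. -/
theorem sum_menshovVal {N : ℕ} (hN : 1 ≤ N) {i : ℕ} (hi : i < N) :
    ∑ q ∈ Finset.range (2 * N), menshovVal N q i = 0 := by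
  obtain ⟨n, rfl⟩ : ∃ n, N = n + 1 := ⟨N - 1, by omega⟩
  rw [show 2 * (n + 1) = 2 * n + 1 + 1 by ring]
  induction i with
  | zero =>
    rw [Finset.sum_range_succ]
    have h1 : menshovVal (n + 1) (2 * n + 1) 0 = 0 := by
      rw [menshovVal, if_neg (by omega), if_pos ⟨by omega, rfl⟩]
    rw [h1, add_zero, ← hilbertSum_zero n, hilbertSum]
    refine Finset.sum_congr rfl fun q hq => ?_
    rw [Finset.mem_range] at hq
    rw [menshovVal, if_neg (by omega), if_neg (by omega)]
    congr 2
    push_cast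
    ring
  | succ i ih =>
    rw [← ih (by omega), Finset.sum_range_succ', Finset.sum_range_succ (fun q => menshovVal _ q i)]
    congr 1
    · refine Finset.sum_congr rfl fun q hq => ?_
      rw [Finset.mem_range] at hq
      rw [menshovVal, menshovVal]
      by_cases h : q < i
      · rw [if_pos (by omega), if_pos h]
        by_cases h' : q + 1 = i
        · rw [if_pos (by omega), if_pos h']
        · rw [if_neg (by omega), if_neg h']
          congr 2
          push_cast
          ring
      · rw [if_neg (by omega), if_neg h, if_neg (by omega), if_neg (by omega)]
        congr 2
        push_cast
        ring
    · rw [menshovVal, menshovVal, if_pos (by omega), if_neg (show ¬ 2 * n + 1 < i by omega)]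
      by_cases h : i = 0
      · rw [if_pos (by omega), if_pos ⟨by omega, h⟩]
      · rw [if_neg (by omega), if_neg (by omega)]
        congr 2
        push_cast
        ring

theorem sq_sum_le_of_abs_le {N : ℕ} {e c u v : ℕ → ℝ} (h : ∀ i < N, |c i| ≤ u i + v i) :
    (∑ i ∈ Finset.range N, e i * c i) ^ 2
      ≤ 2 * (∑ i ∈ Finset.range N, |e i| * u i) ^ 2 + 2 * (∑ i ∈ Finset.range N, |e i| * v i) ^ 2 := by
  have h1 : |∑ i ∈ Finset.range N, e i * c i|
      ≤ ∑ i ∈ Finset.range N, |e i| * u i + ∑ i ∈ Finset.range N, |e i| * v i := by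
    refine (Finset.abs_sum_le_sum_abs _ _).trans ?_
    rw [← Finset.sum_add_distrib]
    refine Finset.sum_le_sum fun i hi => ?_
    rw [abs_mul, ← mul_add]
    exact mul_le_mul_of_nonneg_left (h i (Finset.mem_range.1 hi)) (abs_nonneg _)
  rw [← sq_abs]
  refine (pow_le_pow_left₀ (abs_nonneg _) h1 2).trans ?_
  nlinarith [sq_nonneg (∑ i ∈ Finset.range N, |e i| * u i - ∑ i ∈ Finset.range N, |e i| * v i)]

theorem sum_hilbert_shift (N : ℕ) (e : ℕ → ℝ) (c : ℤ) :
    ∑ r ∈ Finset.range N, (∑ i ∈ Finset.range N, e i * (((r : ℤ) + c - i : ℤ) : ℝ)⁻¹) ^ 2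
      ≤ 12 * ∑ i ∈ Finset.range N, e i ^ 2 := by
  classical
  rw [← Finset.sum_image (s := Finset.range N) (g := fun r : ℕ => (r : ℤ) + c)
    (f := fun p : ℤ => (∑ i ∈ Finset.range N, e i * ((p - i : ℤ) : ℝ)⁻¹) ^ 2)
    fun p _ q _ h => by simp only at h; omega]
  exact hilbert_inequality N e _

/-- On the N middle cells the values form an exact Hilbert kernel, costing 12. On the N outer cells
each value is bounded by the sum of two shifted Hilbert kernels of constant sign, costing 2·12 +
2·12. The total 60 is below 64, the square of the 8 in the definition of M_k. -/
theorem sum_menshovVal_sq_le {N : ℕ} (hN : 1 ≤ N) (e : ℕ → ℝ) :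
    ∑ q ∈ Finset.range (2 * N), (∑ i ∈ Finset.range N, e i * menshovVal N q i) ^ 2
      ≤ 60 * ∑ i ∈ Finset.range N, e i ^ 2 := by
  set E := ∑ i ∈ Finset.range N, e i ^ 2 with hE
  -- The outer cells after a cyclic shift: the last cell q = 2N - 1 becomes r = 0 and the cell q < N
  -- - 1 becomes r = q + 1.
  set c : ℕ → ℕ → ℝ := fun r i => if i < r then (((r : ℤ) - N - i : ℤ) : ℝ)⁻¹
    else if i = r then 0 else (((r : ℤ) + N - i : ℤ) : ℝ)⁻¹ with hc
  have houter : ∑ r ∈ Finset.range N, (∑ i ∈ Finset.range N, e i * c r i) ^ 2 ≤ 48 * E := by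
    have h1 : ∀ r ∈ Finset.range N, (∑ i ∈ Finset.range N, e i * c r i) ^ 2
        ≤ 2 * (∑ i ∈ Finset.range N, |e i| * (((r : ℤ) + -N - i : ℤ) : ℝ)⁻¹) ^ 2
          + 2 * (∑ i ∈ Finset.range N, |e i| * (((r : ℤ) + N - i : ℤ) : ℝ)⁻¹) ^ 2 := by
      intro r hr
      rw [Finset.mem_range] at hr
      have h2 := sq_sum_le_of_abs_le (N := N) (e := e) (c := c r)
        (u := fun i => -(((r : ℤ) + -N - i : ℤ) : ℝ)⁻¹) (v := fun i => (((r : ℤ) + N - i : ℤ) : ℝ)⁻¹)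
        fun i hi => by
          have n1 : (((r : ℤ) + -N - i : ℤ) : ℝ)⁻¹ ≤ 0 := by
            rw [inv_nonpos]
            exact_mod_cast (show ((r : ℤ) + -N - i : ℤ) ≤ 0 by omega)
          have n2 : 0 ≤ (((r : ℤ) + N - i : ℤ) : ℝ)⁻¹ := by
            rw [inv_nonneg]
            exact_mod_cast (show 0 ≤ ((r : ℤ) + N - i : ℤ) by omega)
          simp only [hc]
          split_ifs
          · rw [show ((r : ℤ) - N - i) = (r : ℤ) + -N - i by ring, abs_of_nonpos n1]
            linarith
          · rw [abs_zero]
            linarith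
          · rw [abs_of_nonneg n2]
            linarith
      simpa only [mul_neg, Finset.sum_neg_distrib, neg_sq] using h2
    refine (Finset.sum_le_sum h1).trans ?_
    rw [Finset.sum_add_distrib, ← Finset.mul_sum, ← Finset.mul_sum]
    have h3 := sum_hilbert_shift N (fun i => |e i|) (-N)
    have h4 := sum_hilbert_shift N (fun i => |e i|) N
    simp only [sq_abs] at h3 h4
    linarith
  have hmid := sum_hilbert_shift N e 0
  obtain ⟨n, rfl⟩ : ∃ n, N = n + 1 := ⟨N - 1, by omega⟩
  rw [show 2 * (n + 1) = n + (n + 1) + 1 by ring, Finset.sum_range_succ, Finset.sum_range_add]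
  have e1 : ∑ s ∈ Finset.range (n + 1), (∑ i ∈ Finset.range (n + 1),
      e i * menshovVal (n + 1) (n + s) i) ^ 2 = ∑ r ∈ Finset.range (n + 1),
        (∑ i ∈ Finset.range (n + 1), e i * (((r : ℤ) + 0 - i : ℤ) : ℝ)⁻¹) ^ 2 := by
    refine Finset.sum_congr rfl fun s hs => ?_
    congr 1
    refine Finset.sum_congr rfl fun i hi => ?_
    rw [Finset.mem_range] at hs hi
    congr 1
    rw [menshovVal, if_neg (by omega), if_neg (by omega)]
    congr 2
    push_cast
    ring
  have e2 : ∑ s ∈ Finset.range n, (∑ i ∈ Finset.range (n + 1),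
      e i * menshovVal (n + 1) s i) ^ 2 + (∑ i ∈ Finset.range (n + 1),
        e i * menshovVal (n + 1) (n + (n + 1)) i) ^ 2
      = ∑ r ∈ Finset.range (n + 1), (∑ i ∈ Finset.range (n + 1), e i * c r i) ^ 2 := by
    rw [Finset.sum_range_succ' (fun r => (∑ i ∈ Finset.range (n + 1), e i * c r i) ^ 2)]
    congr 1
    · refine Finset.sum_congr rfl fun s hs => ?_
      congr 1
      refine Finset.sum_congr rfl fun i hi => ?_
      rw [Finset.mem_range] at hs hi
      congr 1
      simp only [hc]
      rw [menshovVal]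
      by_cases h : s < i
      · rw [if_pos h, if_neg (show ¬ i < s + 1 by omega)]
        by_cases h' : s + 1 = i
        · rw [if_pos h', if_pos h'.symm]
        · rw [if_neg h', if_neg (Ne.symm h')]
          congr 2
          push_cast
          ring
      · rw [if_neg h, if_neg (show ¬ (s + 1 = 2 * (n + 1) ∧ i = 0) by omega),
          if_pos (show i < s + 1 by omega)]
        congr 2
        push_cast
        ring
    · congr 1
      refine Finset.sum_congr rfl fun i hi => ?_
      rw [Finset.mem_range] at hi
      congr 1
      simp only [hc]
      rw [menshovVal, if_neg (show ¬ n + (n + 1) < i by omega), if_neg (show ¬ i < 0 by omega)]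
      by_cases h : i = 0
      · rw [if_pos ⟨by omega, h⟩, if_pos h]
      · rw [if_neg (show ¬ (n + (n + 1) + 1 = 2 * (n + 1) ∧ i = 0) by omega), if_neg h]
        congr 2
        push_cast
        ring
  rw [e1]
  linarith

open scoped MatrixOrder ComplexOrder in
/-- Vectors of a contraction can be completed to an orthonormal system. -/
theorem exists_gram_complement {N Q : ℕ} (m : ℕ → ℕ → ℝ)
    (h : ∀ e : ℕ → ℝ, ∑ q ∈ Finset.range Q, (∑ i ∈ Finset.range N, e i * m q i) ^ 2
      ≤ ∑ i ∈ Finset.range N, e i ^ 2) :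
    ∃ B : ℕ → ℕ → ℝ, ∀ i < N, ∀ j < N, ∑ l ∈ Finset.range N, B l i * B l j
      = (if i = j then 1 else 0) - ∑ q ∈ Finset.range Q, m q i * m q j := by
  classical
  -- For a contraction M the defect 1 - MᵀM is positive semidefinite, hence of the form BᵀB; the
  -- columns of B supply the missing scalar products.
  set M : Matrix (Fin Q) (Fin N) ℝ := Matrix.of fun q i => m q i with hM
  have hpsd : (1 - M.transpose * M).PosSemidef := by
    refine Matrix.PosSemidef.of_dotProduct_mulVec_nonneg ?_ fun x => ?_
    · rw [Matrix.IsHermitian, Matrix.conjTranspose_eq_transpose_of_trivial]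
      simp [Matrix.transpose_sub, Matrix.transpose_mul]
    · have h1 : star x ⬝ᵥ (1 - M.transpose * M).mulVec x
          = x ⬝ᵥ x - M.mulVec x ⬝ᵥ M.mulVec x := by
        rw [star_trivial, Matrix.sub_mulVec, Matrix.one_mulVec, dotProduct_sub,
          ← Matrix.mulVec_mulVec, Matrix.dotProduct_mulVec, Matrix.vecMul_transpose]
      rw [h1, sub_nonneg]
      have h2 := h fun i => if hi : i < N then x ⟨i, hi⟩ else 0
      rw [← Fin.sum_univ_eq_sum_range (fun q => (∑ i ∈ Finset.range N,
        (if hi : i < N then x ⟨i, hi⟩ else 0) * m q i) ^ 2) Q] at h2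
      simp only [← Fin.sum_univ_eq_sum_range (fun i => (if hi : i < N then x ⟨i, hi⟩ else 0) * m _ i) N,
        ← Fin.sum_univ_eq_sum_range (fun i => (if hi : i < N then x ⟨i, hi⟩ else 0) ^ 2) N,
        Fin.is_lt, dif_pos, Fin.eta] at h2
      simp only [dotProduct, Matrix.mulVec, hM, Matrix.of_apply, ← sq]
      simpa only [mul_comm] using h2
  obtain ⟨B, hB⟩ := CStarAlgebra.nonneg_iff_eq_star_mul_self.mp hpsd.nonneg
  refine ⟨fun l i => if h : l < N ∧ i < N then B ⟨l, h.1⟩ ⟨i, h.2⟩ else 0, fun i hi j hj => ?_⟩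
  have h3 := congrFun (congrFun hB ⟨i, hi⟩) ⟨j, hj⟩
  simp only [Matrix.sub_apply, Matrix.one_apply, Matrix.mul_apply, Matrix.transpose_apply, hM,
    Matrix.of_apply, Matrix.star_apply, star_trivial, Fin.mk.injEq] at h3
  rw [← Fin.sum_univ_eq_sum_range (fun q => m q i * m q j) Q, h3, Finset.sum_range]
  refine Finset.sum_congr rfl fun l _ => ?_
  simp only [Fin.is_lt, hi, hj, and_self, dif_pos, Fin.eta]

end DivONS

end

/-! ### Extension of the Menshov translates to a full period. -/

noncomputable section

namespace DivONS

open MeasureTheory Filter Topology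

/-- The translates of the Menshov function, continued to `(1,2]` by the columns of `B` with
alternating signs and to the line with period `4`. -/
def menshovExt (k : ℕ) (B : ℕ → ℕ → ℝ) (i : ℕ) (x : ℝ) : ℝ :=
  let y : ℝ := 4 * Int.fract ((x + 2) / 4) - 2
  if y < -1 then 0
  else if y ≤ 1 then menshov k (y - (i : ℝ) / 2 ^ k)
  else √(2 ^ k) * ((-1) ^ ⌊2 ^ (k + 1) * (y - 1)⌋₊ * B (⌊2 ^ (k + 1) * (y - 1)⌋₊ / 2) i)

theorem menshovExt_eq {k : ℕ} {B : ℕ → ℕ → ℝ} {i : ℕ} {x : ℝ} (h1 : -2 ≤ x) (h2 : x < 2) :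
    menshovExt k B i x = if x < -1 then 0 else if x ≤ 1 then menshov k (x - (i : ℝ) / 2 ^ k)
      else √(2 ^ k) * ((-1) ^ ⌊2 ^ (k + 1) * (x - 1)⌋₊ * B (⌊2 ^ (k + 1) * (x - 1)⌋₊ / 2) i) := by
  have h : 4 * Int.fract ((x + 2) / 4) - 2 = x := by
    rw [Int.fract_eq_self.2 ⟨by linarith, by linarith⟩]
    ring
  simp only [menshovExt, h]

/-- The values of the functions `menshovExt` on the intervals of length `2^(-k-1)`. -/
def menshovExtVal (k : ℕ) (B : ℕ → ℕ → ℝ) (c i : ℕ) : ℝ :=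
  if c < 2 * 2 ^ k then 0
  else if c < 2 * 2 ^ k + 2 * (2 * 2 ^ k) then
    √(2 ^ k) / 8 * menshovVal (2 ^ k) ((c - 2 * 2 ^ k) / 2) i
  else √(2 ^ k) * ((-1) ^ (c - (2 * 2 ^ k + 2 * (2 * 2 ^ k))) *
    B ((c - (2 * 2 ^ k + 2 * (2 * 2 ^ k))) / 2) i)

theorem menshovExt_of_cell {k : ℕ} {B : ℕ → ℕ → ℝ} {i : ℕ} (hi : i < 2 ^ k) {c : ℕ}
    (hc : c < 2 ^ (k + 3)) {t : ℝ} (h1 : (c : ℝ) < 2 ^ (k + 3) * t)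
    (h2 : 2 ^ (k + 3) * t < c + 1) :
    menshovExt k B i (4 * t - 2) = menshovExtVal k B c i := by
  have hN : (2 : ℝ) ^ k = ((2 ^ k : ℕ) : ℝ) := by push_cast; rfl
  have hN0 : (0 : ℝ) < 2 ^ k := by positivity
  have hc' : c + 1 ≤ 8 * 2 ^ k := by rw [pow_add] at hc; omega
  have hcr : (c : ℝ) + 1 ≤ 8 * 2 ^ k := by rw [hN]; exact_mod_cast hc'
  rw [pow_add] at h1 h2
  have hc0 : (0 : ℝ) ≤ c := by positivity
  have t0 : 0 < t := by
    by_contra! h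
    nlinarith
  have t1 : t < 1 := by
    by_contra! h
    nlinarith
  rw [menshovExt_eq (by linarith) (by linarith), menshovExtVal]
  by_cases a1 : c < 2 * 2 ^ k
  · have : (c : ℝ) + 1 ≤ 2 * 2 ^ k := by rw [hN]; exact_mod_cast a1
    rw [if_pos a1, if_pos]
    by_contra! h
    nlinarith
  have a1' : (2 : ℝ) * 2 ^ k ≤ c := by rw [hN]; exact_mod_cast not_lt.1 a1
  rw [if_neg a1, if_neg (by intro h; nlinarith)]
  by_cases a2 : c < 2 * 2 ^ k + 2 * (2 * 2 ^ k)
  · have : (c : ℝ) + 1 ≤ 2 * 2 ^ k + 2 * (2 * 2 ^ k) := by rw [hN]; exact_mod_cast a2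
    rw [if_pos a2, if_pos (by by_contra! h; nlinarith)]
    obtain ⟨s, rfl⟩ : ∃ s, c = s + 2 * 2 ^ k := ⟨c - 2 * 2 ^ k, by omega⟩
    rw [Nat.add_sub_cancel]
    have b1 : 2 * (((s / 2 : ℕ)) : ℝ) ≤ s := by exact_mod_cast (show 2 * (s / 2) ≤ s by omega)
    have b2 : (s : ℝ) + 1 ≤ 2 * (((s / 2 : ℕ)) : ℝ) + 2 := by
      exact_mod_cast (show s + 1 ≤ 2 * (s / 2) + 2 by omega)
    push_cast at h1 h2
    refine menshov_of_cell hi (by omega) ?_ ?_ <;> linarith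
  · have a2' : (2 : ℝ) * 2 ^ k + 2 * (2 * 2 ^ k) ≤ c := by rw [hN]; exact_mod_cast not_lt.1 a2
    rw [if_neg a2, if_neg (by intro h; nlinarith)]
    have hfl : ⌊(2 : ℝ) ^ (k + 1) * (4 * t - 2 - 1)⌋₊ = c - (2 * 2 ^ k + 2 * (2 * 2 ^ k)) := by
      obtain ⟨s, rfl⟩ : ∃ s, c = s + (2 * 2 ^ k + 2 * (2 * 2 ^ k)) :=
        ⟨c - (2 * 2 ^ k + 2 * (2 * 2 ^ k)), by omega⟩
      push_cast at h1 h2 a2'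
      rw [Nat.add_sub_cancel, Nat.floor_eq_iff, pow_succ]
      · constructor <;> linarith
      · rw [pow_succ]
        linarith
    rw [hfl]

theorem step_menshovExt {k : ℕ} {B : ℕ → ℕ → ℝ} {i : ℕ} (hi : i < 2 ^ k) :
    (fun t => menshovExt k B i (4 * t - 2)) ∈ dyadicStep 0 1 (k + 3) := by
  rw [mem_dyadicStep_iff]
  rintro x y ⟨c, hc, h1, h2, h3, h4⟩
  simp only [menshovExt_of_cell hi hc h1 h2, menshovExt_of_cell hi hc h3 h4]

theorem sum_range_two_mul (F : ℕ → ℝ) (n : ℕ) :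
    ∑ c ∈ Finset.range (2 * n), F c = ∑ l ∈ Finset.range n, (F (2 * l) + F (2 * l + 1)) := by
  induction n with
  | zero => simp
  | succ n ih =>
    rw [show 2 * (n + 1) = 2 * n + 1 + 1 by ring, Finset.sum_range_succ, Finset.sum_range_succ,
      Finset.sum_range_succ, ih]
    ring

/-- A general G treats the mean value and the scalar products at once. The part [-2,-1) contributes
G 0 0 = 0, each Menshov cell consists of two cells of level k+1, and on (1,2] the values come in
pairs of opposite sign. -/
theorem integral_menshovExt {k : ℕ} {B : ℕ → ℕ → ℝ} {i j : ℕ} (hi : i < 2 ^ k) (hj : j < 2 ^ k)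
    {G : ℝ → ℝ → ℝ} (hG : G 0 0 = 0) :
    ∫ x in (-2 : ℝ)..2, G (menshovExt k B i x) (menshovExt k B j x)
      = (2 * 2 ^ k)⁻¹ * (∑ q ∈ Finset.range (2 * 2 ^ k),
          2 * G (√(2 ^ k) / 8 * menshovVal (2 ^ k) q i) (√(2 ^ k) / 8 * menshovVal (2 ^ k) q j)
        + ∑ l ∈ Finset.range (2 ^ k), (G (√(2 ^ k) * B l i) (√(2 ^ k) * B l j)
          + G (-(√(2 ^ k) * B l i)) (-(√(2 ^ k) * B l j)))) := by
  have h1 := intervalIntegral.integral_comp_mul_sub (a := 0) (b := 1)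
    (fun x => G (menshovExt k B i x) (menshovExt k B j x)) (c := 4) (by norm_num) 2
  norm_num at h1
  have h2 := integral_step (step_comp₂ G (step_menshovExt (B := B) hi) (step_menshovExt (B := B) hj))
  rw [h1] at h2
  have h3 : ∀ c ∈ Finset.range (2 ^ (k + 3)),
      G (menshovExt k B i (4 * mid (k + 3) c - 2)) (menshovExt k B j (4 * mid (k + 3) c - 2))
        * (1 / 2 ^ (k + 3)) = (1 / 2 ^ (k + 3)) *
          G (menshovExtVal k B c i) (menshovExtVal k B c j) := fun c hc => by
    rw [Finset.mem_range] at hc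
    rw [menshovExt_of_cell hi hc (mid_mem _ _).1 (mid_mem _ _).2,
      menshovExt_of_cell hj hc (mid_mem _ _).1 (mid_mem _ _).2, mul_comm]
  rw [Finset.sum_congr rfl h3, ← Finset.mul_sum,
    show 2 ^ (k + 3) = 2 * 2 ^ k + 2 * (2 * 2 ^ k) + 2 * 2 ^ k by rw [pow_add]; ring,
    Finset.sum_range_add, Finset.sum_range_add] at h2
  have s1 : ∑ c ∈ Finset.range (2 * 2 ^ k),
      G (menshovExtVal k B c i) (menshovExtVal k B c j) = 0 :=
    Finset.sum_eq_zero fun c hc => by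
      rw [Finset.mem_range] at hc
      simp only [menshovExtVal, if_pos hc, hG]
  have s2 : ∑ c ∈ Finset.range (2 * (2 * 2 ^ k)),
      G (menshovExtVal k B (2 * 2 ^ k + c) i) (menshovExtVal k B (2 * 2 ^ k + c) j)
        = ∑ q ∈ Finset.range (2 * 2 ^ k), 2 * G (√(2 ^ k) / 8 * menshovVal (2 ^ k) q i)
          (√(2 ^ k) / 8 * menshovVal (2 ^ k) q j) := by
    have h : ∀ c < 2 * (2 * 2 ^ k), ∀ i, menshovExtVal k B (2 * 2 ^ k + c) i
        = √(2 ^ k) / 8 * menshovVal (2 ^ k) (c / 2) i := fun c hc i => by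
      rw [menshovExtVal, if_neg (by omega), if_pos (by omega), Nat.add_sub_cancel_left]
    rw [sum_range_two_mul]
    refine Finset.sum_congr rfl fun q hq => ?_
    rw [Finset.mem_range] at hq
    rw [h _ (by omega), h _ (by omega), h _ (by omega), h _ (by omega),
      show 2 * q / 2 = q by omega, show (2 * q + 1) / 2 = q by omega]
    ring
  have s3 : ∑ c ∈ Finset.range (2 * 2 ^ k),
      G (menshovExtVal k B (2 * 2 ^ k + 2 * (2 * 2 ^ k) + c) i)
        (menshovExtVal k B (2 * 2 ^ k + 2 * (2 * 2 ^ k) + c) j)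
        = ∑ l ∈ Finset.range (2 ^ k), (G (√(2 ^ k) * B l i) (√(2 ^ k) * B l j)
          + G (-(√(2 ^ k) * B l i)) (-(√(2 ^ k) * B l j))) := by
    have h : ∀ c i, menshovExtVal k B (2 * 2 ^ k + 2 * (2 * 2 ^ k) + c) i
        = √(2 ^ k) * ((-1) ^ c * B (c / 2) i) := fun c i => by
      rw [menshovExtVal, if_neg (by omega), if_neg (by omega), Nat.add_sub_cancel_left]
    rw [sum_range_two_mul]
    refine Finset.sum_congr rfl fun l _ => ?_
    simp only [h, show 2 * l / 2 = l by omega, show (2 * l + 1) / 2 = l by omega, pow_succ,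
      pow_mul, mul_neg, mul_one]
    norm_num
  rw [s1, s2, s3, zero_add] at h2
  have h4 : (2 : ℝ) ^ k ≠ 0 := by positivity
  have h5 : (1 : ℝ) / 2 ^ (k + 3) = 4⁻¹ * (2 * 2 ^ k)⁻¹ := by
    rw [pow_add]
    field_simp
    norm_num
  rw [h5] at h2
  linarith

theorem exists_isMenshovSystem (k : ℕ) : ∃ f, IsMenshovSystem k f := by
  have hN1 : 1 ≤ 2 ^ k := Nat.one_le_two_pow
  have h4 : (2 : ℝ) ^ k ≠ 0 := by positivity
  have hs : √((2 : ℝ) ^ k) * √(2 ^ k) = 2 ^ k := Real.mul_self_sqrt (by positivity)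
  obtain ⟨B, hB⟩ := exists_gram_complement (N := 2 ^ k) (Q := 2 * 2 ^ k)
    (fun q i => menshovVal (2 ^ k) q i / 8) fun e => by
      have h := sum_menshovVal_sq_le hN1 e
      have h0 : 0 ≤ ∑ i ∈ Finset.range (2 ^ k), e i ^ 2 := Finset.sum_nonneg fun i _ => sq_nonneg _
      -- After division by 8² the bound 60 of `sum_menshovVal_sq_le` yields a contraction.
      simp only [← mul_div_assoc, ← Finset.sum_div, div_pow]
      linarith
  refine ⟨menshovExt k B, fun i _ x => ?_, fun i _ x hx => ?_, fun i _ x hx => ?_, fun i hi => ?_,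
    fun i hi => ?_, fun i hi j hj => ?_⟩
  · have : Int.fract ((x + 4 + 2) / 4) = Int.fract ((x + 2) / 4) := by
      rw [show (x + 4 + 2) / 4 = (x + 2) / 4 + 1 by ring, Int.fract_add_one]
    simp only [menshovExt, this]
  · rw [menshovExt_eq hx.1 (by linarith [hx.2]), if_pos hx.2]
  · rw [menshovExt_eq (by linarith [hx.1]) (by linarith [hx.2]), if_neg (by linarith [hx.1]),
      if_pos hx.2]
  · refine ⟨fun c => √(2 ^ k) * ((-1) ^ (c - 1) * B ((c - 1) / 2) i), fun c hc1 hc2 x hx => ?_⟩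
    have h0 : (0 : ℝ) < 2 ^ (k + 1) := by positivity
    obtain ⟨h1, h2⟩ := hx
    obtain ⟨d, rfl⟩ : ∃ d, c = d + 1 := ⟨c - 1, by omega⟩
    have hd : (d : ℝ) + 1 ≤ 2 ^ (k + 1) := by exact_mod_cast hc2
    push_cast at h1 h2
    rw [show (1 : ℝ) + ((d : ℝ) + 1 - 1) * ((2 - 1) / 2 ^ (k + 1)) = 1 + d / 2 ^ (k + 1) by ring,
      ← lt_sub_iff_add_lt', div_lt_iff₀' h0] at h1
    rw [show (1 : ℝ) + ((d : ℝ) + 1) * ((2 - 1) / 2 ^ (k + 1)) = 1 + (d + 1) / 2 ^ (k + 1) by ring,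
      ← sub_lt_iff_lt_add', lt_div_iff₀' h0] at h2
    have hd0 : (0 : ℝ) ≤ d := by positivity
    have x1 : 1 < x := by
      by_contra! h
      nlinarith
    have x2 : x < 2 := by
      by_contra! h
      nlinarith
    rw [menshovExt_eq (by linarith) x2, if_neg (by linarith), if_neg (by linarith),
      (Nat.floor_eq_iff (by nlinarith)).2 ⟨h1.le, h2⟩]
    simp
  · have := integral_menshovExt (B := B) hi hi (G := fun a _ => a) rfl
    rw [this]
    -- The opposite signs cancel the part on (1,2], and the Menshov values already have sum 0.
    simp only [add_neg_cancel, Finset.sum_const_zero, ← mul_assoc, ← Finset.mul_sum]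
    rw [sum_menshovVal hN1 hi]
    simp
  · have := integral_menshovExt (B := B) hi hj (G := fun a b => a * b) (by simp)
    rw [this]
    have e1 : ∀ a b : ℝ, 2 * (√(2 ^ k) / 8 * a * (√(2 ^ k) / 8 * b))
        = 2 * 2 ^ k * (a / 8 * (b / 8)) := fun a b => by
      linear_combination (2 * (a / 8) * (b / 8)) * hs
    have e2 : ∀ a b : ℝ, √(2 ^ k) * a * (√(2 ^ k) * b) + -(√(2 ^ k) * a) * -(√(2 ^ k) * b)
        = 2 * 2 ^ k * (a * b) := fun a b => by
      linear_combination (2 * a * b) * hs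
    simp only [e1, e2, ← Finset.mul_sum]
    rw [hB i hi j hj, ← mul_add, add_sub_cancel, ← mul_assoc, inv_mul_cancel₀ (by positivity),
      one_mul]

end DivONS

end

noncomputable section

namespace DivONS

open MeasureTheory Filter Topology

/-! ### Existence of the complementary functions -/

theorem ip_step_eq_zero_of_cellFn {K : ℕ} {v u : ℝ → ℝ} (hv : IntervalIntegrable v volume 0 1)
    (h : ∀ i, ip v (cellFn K i) = 0) (hu : u ∈ dyadicStep 0 1 K) : ip v u = 0 := by
  rw [ip_comm, ip, (integral_step_mul hu hv).2]
  refine Finset.sum_eq_zero fun i hi => ?_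
  rw [Finset.mem_range] at hi
  have h1 := h ⟨i, hi⟩
  have h0 : √((2 : ℝ) ^ K) ≠ 0 := by positivity
  rw [ip_comm, ip, cellFn, (integral_step_mul (step_ofVec _ _) hv).2,
    Finset.sum_eq_single_of_mem i (Finset.mem_range.2 hi) fun j hj hji => by
      rw [Finset.mem_range] at hj
      rw [ofVec_of_cell hj _ (mid_mem K j).1 (mid_mem K j).2]
      simp [hji],
    ofVec_of_cell hi _ (mid_mem K i).1 (mid_mem K i).2] at h1
  simp only [PiLp.single_apply, if_true, mul_one] at h1
  rw [(mul_eq_zero.1 h1).resolve_left h0, mul_zero]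

theorem ip_known_one {f : ℕ → ℕ → ℝ → ℝ} (hf : ∀ k ≥ 1, IsMenshovSystem k (f k))
    (a : Fin (prevDim (kSeq f) 1) ⊕ Fin (2 ^ (2 * 1)) ⊕ Fin 2) :
    ip (known f 1 a) (fun _ => 1) = 0 := by
  rcases a with i | i | i
  · have := prevDim_lt i
    omega
  · simpa [ip, known] using integral_gFun hf le_rfl i.2
  · rw [ip_comm]
    simp only [known]
    split_ifs
    · exact ip_rademacher_step (Nat.zero_le _) (step_const _ _)
    · exact ip_haarFirst_step (step_const _ _)

/-- The known functions, joined for n = 1 by the constant 1, are orthonormal and extend to a basis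
of E^{k_n+2}; by the dimension count the added vectors are exactly as many as the required ψ_ν. -/
theorem exists_generation {f : ℕ → ℕ → ℝ → ℝ} (hf : ∀ k ≥ 1, IsMenshovSystem k (f k)) {n : ℕ}
    (hn : 1 ≤ n) : ∃ w : ℕ → ℝ → ℝ, (n = 1 → w 0 = fun _ => 1) ∧
      ∀ j < mSeq (kSeq f) n - mSeq (kSeq f) (n - 1), w j ∈ dyadicStep 0 1 (kSeq f n + 2) ∧
        (∀ a, ip (w j) (known f n a) = 0) ∧
        ∀ j' < mSeq (kSeq f) n - mSeq (kSeq f) (n - 1),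
          ip (w j) (w j') = if j = j' then 1 else 0 := by
  set K := kSeq f n + 2 with hK
  set M := mSeq (kSeq f) n - mSeq (kSeq f) (n - 1) with hM
  let F : (Fin (prevDim (kSeq f) n) ⊕ Fin (2 ^ (2 * n)) ⊕ Fin 2) ⊕ Fin M → ℝ → ℝ :=
    Sum.elim (known f n) (fun _ _ => 1)
  have hFs : ∀ a, F a ∈ dyadicStep 0 1 K := by
    rintro (a | j)
    · exact step_known hf hn a
    · exact step_const _ _
  -- The indices at which the basis is prescribed: all known functions and, only for n = 1, the
  -- first new one, which must be the constant 1.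
  let s : Set ((Fin (prevDim (kSeq f) n) ⊕ Fin (2 ^ (2 * n)) ⊕ Fin 2) ⊕ Fin M) :=
    {a | ∀ j, a = .inr j → n = 1 ∧ (j : ℕ) = 0}
  have horth : Orthonormal ℝ (s.domRestrict fun a => toVec K (F a)) := by
    rw [orthonormal_iff_ite]
    rintro ⟨a, ha⟩ ⟨b, hb⟩
    simp only [Set.domRestrict_apply, Subtype.mk.injEq]
    rw [inner_toVec (hFs a) (hFs b)]
    rcases a with a | j <;> rcases b with b | j'
    · simpa [F] using ip_known hf hn a b
    · obtain ⟨rfl, -⟩ := hb j' rfl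
      simpa [F] using ip_known_one hf a
    · obtain ⟨rfl, -⟩ := ha j rfl
      rw [ip_comm]
      simpa [F] using ip_known_one hf b
    · have h1 := (ha j rfl).2
      have h2 := (hb j' rfl).2
      have : j = j' := Fin.ext (h1.trans h2.symm)
      simp [F, ip, this]
  obtain ⟨b, hb⟩ := Orthonormal.exists_orthonormalBasis_extension_of_card_eq (𝕜 := ℝ)
    (E := EuclideanSpace ℝ (Fin (2 ^ K)))
    (ι := (Fin (prevDim (kSeq f) n) ⊕ Fin (2 ^ (2 * n)) ⊕ Fin 2) ⊕ Fin M)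
    (by rw [finrank_euclideanSpace_fin, card_generation hf hn]) (v := fun a => toVec K (F a))
    (s := s) horth
  let w : ℕ → ℝ → ℝ := fun j => if n = 1 ∧ j = 0 then fun _ => 1
    else if h : j < M then ofVec K (b (.inr ⟨j, h⟩)) else 0
  have hw : ∀ j (h : j < M), w j ∈ dyadicStep 0 1 K ∧ toVec K (w j) = b (.inr ⟨j, h⟩) := by
    intro j h
    by_cases h' : n = 1 ∧ j = 0
    · simp only [w, if_pos h']
      refine ⟨step_const _ _, ?_⟩
      rw [hb]
      · rfl
      · intro i hi
        rw [Sum.inr.injEq] at hi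
        rw [← hi]
        exact h'
    · simp only [w, if_neg h', dif_pos h]
      exact ⟨step_ofVec _ _, toVec_ofVec _ _⟩
  have hbo := orthonormal_iff_ite.1 b.orthonormal
  refine ⟨w, fun h => if_pos ⟨h, rfl⟩, fun j hj => ⟨(hw j hj).1, fun a => ?_, fun j' hj' => ?_⟩⟩
  · rw [← inner_toVec (hw j hj).1 (step_known hf hn a), (hw j hj).2,
      show toVec (kSeq f n + 2) (known f n a) = b (.inl a) from
        (hb (.inl a) (fun i hi => by simp at hi)).symm, hbo]
    simp
  · rw [← inner_toVec (hw j hj).1 (hw j' hj').1, (hw j hj).2, (hw j' hj').2, hbo]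
    simp

theorem exists_isComplement {f : ℕ → ℕ → ℝ → ℝ} (hf : ∀ k ≥ 1, IsMenshovSystem k (f k)) :
    ∃ ψ, IsComplement (kSeq f) (gFun f) ψ := by
  choose w hw using fun n : ℕ => exists_generation hf (n := n + 1) (by omega)
  let ψ : ℕ → ℝ → ℝ := fun ν => w (blockOf (mSeq (kSeq f)) ν - 1)
    (ν - mSeq (kSeq f) (blockOf (mSeq (kSeq f)) ν - 1) - 1)
  have hb : ∀ n ≥ 1, ∀ ν ∈ Finset.Ioc (mSeq (kSeq f) (n - 1)) (mSeq (kSeq f) n),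
      ψ ν = w (n - 1) (ν - mSeq (kSeq f) (n - 1) - 1) := by
    intro n hn ν hν
    rw [Finset.mem_Ioc] at hν
    have : blockOf (mSeq (kSeq f)) ν = n := blockOf_eq (mSeq_strictMono hf).monotone hν.1 hν.2
    simp only [ψ, this]
  have key : ∀ n ≥ 1, ∀ ν ∈ Finset.Ioc (mSeq (kSeq f) (n - 1)) (mSeq (kSeq f) n),
      ψ ν ∈ dyadicStep 0 1 (kSeq f n + 2) ∧ (∀ a, ip (ψ ν) (known f n a) = 0) ∧
        ∀ ν' ∈ Finset.Ioc (mSeq (kSeq f) (n - 1)) (mSeq (kSeq f) n),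
          ip (ψ ν) (ψ ν') = if ν = ν' then 1 else 0 := by
    intro n hn ν hν
    have h := (hw (n - 1)).2 (ν - mSeq (kSeq f) (n - 1) - 1)
    rw [hb n hn ν hν]
    rw [Finset.mem_Ioc] at hν
    obtain ⟨n, rfl⟩ : ∃ m, n = m + 1 := ⟨n - 1, by omega⟩
    simp only [Nat.add_sub_cancel] at h hν ⊢
    obtain ⟨h1, h2, h3⟩ := h (by omega)
    refine ⟨h1, h2, fun ν' hν' => ?_⟩
    have h4 := hb (n + 1) hn ν' hν'
    rw [Nat.add_sub_cancel] at h4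
    rw [Finset.mem_Ioc] at hν'
    rw [h4, h3 _ (by omega)]
    congr 1
    rw [eq_iff_iff]
    omega
  refine ⟨ψ, ?_, fun n hn ν hν => (key n hn ν hν).1, fun n hn ν hν u hu => ?_,
    fun n hn ν hν i hi => (key n hn ν hν).2.1 (.inr (.inl ⟨i, hi⟩)),
    fun n hn ν hν => (key n hn ν hν).2.1 (.inr (.inr 0)),
    fun n hn ν hν => (key n hn ν hν).2.1 (.inr (.inr 1)),
    fun n hn ν hν => (key n hn ν hν).2.2⟩
  · intro t _
    have h1 := mSeq_strictMono hf zero_lt_one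
    have h0 : mSeq (kSeq f) 0 = 0 := rfl
    rw [hb 1 le_rfl 1 (by rw [Finset.mem_Ioc]; exact ⟨by simp [h0], by omega⟩)]
    simp only [Nat.sub_self, h0]
    rw [(hw 0).1 rfl]
  · obtain ⟨h1, h2, -⟩ := key n (by omega) ν hν
    refine ip_step_eq_zero_of_cellFn (intervalIntegrable_step h1) (fun i => ?_) hu
    have hi : (i : ℕ) < prevDim (kSeq f) n := by
      rw [prevDim, if_neg (by omega)]
      exact i.2
    have h3 := h2 (.inl ⟨i, hi⟩)
    obtain ⟨h, e⟩ := known_inl f ⟨i, hi⟩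
    rwa [e] at h3

end DivONS

end

noncomputable section

namespace DivONS

open MeasureTheory Filter Topology

/-! ### Existence of admissible choices -/

/-- The number of Rademacher functions in the blocks `0, …, j`, for blocks chosen so long that
this number is at least `R j`. -/
def nuRec (l₀ : ℕ) (k R : ℕ → ℕ) : ℕ → ℕ
  | 0 => R 0 + 1
  | j + 1 => nuRec l₀ k R j + (2 ^ (k (nuRec l₀ k R j) + l₀ + R (j + 1)) - 1)

theorem lt_nuRec (l₀ : ℕ) (k R : ℕ → ℕ) (j : ℕ) : R j < nuRec l₀ k R j := by
  have hpos : ∀ j, 1 ≤ nuRec l₀ k R j := fun j => by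
    induction j with
    | zero => simp [nuRec]
    | succ j ih => rw [nuRec]; omega
  cases j with
  | zero => simp [nuRec]
  | succ j =>
    rw [nuRec]
    have := hpos j
    have := Nat.lt_two_pow_self (n := k (nuRec l₀ k R j) + l₀ + R (j + 1))
    omega

/-- The functions Υ_l do not depend on ν, so each ν_j can be made larger than the levels of the
finitely many Υ_l that have to be steps of level k_{ν_j}. -/
theorem exists_isBlocking (l₀ : ℕ) {k : ℕ → ℕ} (hk : StrictMono k) {Y : ℕ → ℝ → ℝ}
    (hY : ∀ l ≥ 1, IsStep (Y l)) : ∃ ν N, IsBlocking l₀ k Y ν N := by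
  choose! c hc using hY
  set R : ℕ → ℕ := fun j => (Finset.range (muSeq (j + 1) + 1)).sup c
  set ν := nuRec l₀ k R with hν
  have hstep : ∀ j l, 1 ≤ l → l ≤ muSeq (j + 1) → Y l ∈ dyadicStep 0 1 (k (ν j)) := by
    intro j l h1 h2
    refine dyadicStep_mono ?_ (hc l h1)
    have h3 : c l ≤ R j := Finset.le_sup (f := c) (Finset.mem_range.2 (by omega))
    exact h3.trans ((lt_nuRec l₀ k R j).le.trans hk.le_apply)
  refine ⟨ν, fun j => k (ν (j - 1)) + l₀ + R j, ?_, ?_, ?_, ?_, ?_⟩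
  · rw [hν, nuRec]
    omega
  · intro j hj
    obtain ⟨j, rfl⟩ : ∃ i, j = i + 1 := ⟨j - 1, by omega⟩
    rw [Nat.add_sub_cancel, hν, nuRec]
  · intro j _
    omega
  · exact fun j => hstep j (j + 1) (by omega) muSeq_strictMono.le_apply
  · intro m hm l hl
    rw [Finset.mem_Ioc] at hl
    refine hstep _ l (by omega) (hl.2.trans (muSeq_strictMono.monotone ?_))
    -- R j takes all l up to μ_{j+1} into account, and for j = μ_{m-1} this includes the whole group
    -- m because m ≤ μ_{m-1} + 1.
    have : m - 1 ≤ muSeq (m - 1) := muSeq_strictMono.le_apply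
    omega

theorem exists_admissible (l₀ : ℕ) : ∃ D : Choices, D.Admissible l₀ := by
  choose f hf using exists_isMenshovSystem
  have hf' : ∀ k ≥ 1, IsMenshovSystem k (f k) := fun k _ => hf k
  obtain ⟨ψ, hψ⟩ := exists_isComplement hf'
  obtain ⟨ν, N, h⟩ := exists_isBlocking l₀ (kSeq_strictMono hf')
    (Y := upsilon (kSeq f) (gFun f) ψ) fun l hl => isStep_upsilon hf' hψ hl
  exact ⟨⟨f, ψ, ν, N⟩, hf', hψ, h⟩

end DivONS

end

theorem mainTheorem2 (l₀ : ℕ) :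
    (∃ D : DivONS.Choices, D.Admissible l₀) ∧
    ∀ D : DivONS.Choices, D.Admissible l₀ →
      DivONS.IsCompleteONS D.χ ∧
      ∀ a : ℕ → ℝ, ¬ Summable (fun l => a l ^ 2) →
        ∀ᵐ x ∂MeasureTheory.volume.restrict (Set.Icc (0 : ℝ) 1),
          ¬ ∃ L : ℝ, Filter.Tendsto (fun j : ℕ => D.blockSum a j x) Filter.atTop (nhds L) := by
  exact ⟨DivONS.exists_admissible l₀,
    fun D hD => ⟨DivONS.isCompleteONS_chi hD, DivONS.ae_diverges hD⟩⟩
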